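/- **Setting.** Let $X$ be a measurable space with measurable points and a $\sigma$-finite positive measure $dx$, let $x\mapsto t(x)\ge 0$ be measurable with $dx=\lambda(t,dx)\,dt$ (that is, $\int_\Delta f(t(x))\,dx=\int_0^\infty f(s)\lambda(s,\Delta)\,ds$ for a kernel $\lambda$ and all $\Delta$ of finite measure), let $\{\mathcal E(x)\}_{x\in X}$ be a measurable family of separable complex Hilbert spaces and $\mathcal H$ a complex Hilbert space. $\mathcal X$ is the set of finite chains $\varkappa=\{x_1,\dots,x_n\}\subset X$, $t(x_1)<\dots<t(x_n)$, with the measure $d\varkappa=\prod_{x\in\varkappa}dx$ (mass $1$ at $\emptyset$); $X^t=\{x: t(x)<t\}$, $\mathcal X^t=\{\varkappa\in\mathcal X:\varkappa\subset X^t\}$, $\varkappa^t=\varkappa\cap X^t$, $\mathcal E^\otimes(\varkappa)=\bigotimes_{x\in\varkappa}\mathcal E(x)$. For $\xi>0$, $\mathcal G(\xi)$ is the Hilbert space of functions $a(\varkappa)\in\mathcal H\otimes\mathcal E^\otimes(\varkappa)$ with $\|a\|^2(\xi)=\int\xi^{|\varkappa|}\|a(\varkappa)\|^2d\varkappa<\infty$;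 $\dot a(\vartheta)\colon\varkappa\mapsto a(\varkappa\sqcup\vartheta)$ is the point derivative, and $\|T\|_{\xi^+}^{\xi_-}=\sup\|Ta\|(\xi_-)/\|a\|(\xi^+)$. A table is $\boldsymbol\vartheta=(\vartheta^-_0,\vartheta^-_+,\vartheta^0_0,\vartheta^0_+)\in\mathcal X^4$, and $B$ is a measurable operator-valued function with $$B(\boldsymbol\vartheta):\ \mathcal G(\eta^+)\otimes\mathcal E^\otimes(\vartheta^-_0)\otimes\mathcal E^\otimes(\vartheta^0_0)\to\mathcal G(\eta_-)\otimes\mathcal E^\otimes(\vartheta^0_0)\otimes\mathcal E^\otimes(\vartheta^0_+).$$ $B$ is *locally QS-integrable* if for every $t\ge0$ there are positive numbers $\eta^\bullet=(\eta^-,\eta^0,\eta^+)$, $\eta_\bullet=(\eta_-,\eta_0,\eta_+)$ with $$\|B\|(t):=\int_{\mathcal X^t}\Big(\int_{\mathcal X^t}\!\int_{\mathcal X^t}\frac{(\eta_+)^{|\vartheta^0_+|}}{(\eta^-)^{|\vartheta^-_0|}}\operatorname*{ess\,sup}_{\vartheta^0_0\in\mathcal X^t}\frac{(\eta_0)^{|\vartheta^0_0|}}{(\eta^0)^{|\vartheta^0_0|}}\big(\|B(\boldsymbol\vartheta)\|_{\eta^+}^{\eta_-}\big)^2d\vartheta^0_+d\vartheta^-_0\Big)^{1/2}d\vartheta^-_+<\infty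 .$$ The multiple QS integral is $$[\Lambda_{[0,t)}(B)a](\varkappa)=\sum_{\vartheta^0_0\sqcup\vartheta^0_+\subseteq\varkappa^t}\int_{\mathcal X^t}\!\int_{\mathcal X^t}[B(\boldsymbol\vartheta)\,\dot a(\vartheta^-_0\sqcup\vartheta^0_0)](\varkappa\setminus(\vartheta^0_0\sqcup\vartheta^0_+))\,d\vartheta^-_0\,d\vartheta^-_+ ,$$ and for a table $\mathbf D=(D^\mu_\nu)^{\mu=-,0}_{\nu=0,+}$ of operator functions of a point the QS integral is $$[\Lambda^t(\mathbf D)a](\varkappa)=\sum_{x\in\varkappa^t}[D^0_0(x)\dot a(x)+D^0_+(x)a](\varkappa\setminus x)+\int_{X^t}[D^-_0(x)\dot a(x)+D^-_+(x)a](\varkappa)\,dx .$$ $\mathbf x^\mu_\nu$ is the elementary table whose only nonempty entry is $\{x\}$ at the place $(\mu,\nu)$; $\mathbf x\sqcup\boldsymbol\vartheta$ is the entrywise disjoint union and $\dot B(\mathbf x,\boldsymbol\vartheta)=B(\mathbf x\sqcup\boldsymbol\vartheta)$. The formal adjoint of an operator is its adjoint for the pairing $\int\langle c(\varkappa)|a(\varkappa)\rangle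 d\varkappa$. **Theorem 1.** Let $t\ge0$, let $\eta^\bullet,\eta_\bullet$ be such that $\|B\|(t)<\infty$, and let $\xi^+,\xi_->0$ satisfy $\xi^+\ge\eta^-+\eta^0+\eta^+$ and $\xi_-^{-1}\ge\eta_-^{-1}+\eta_0^{-1}+\eta_+^{-1}$. 1. $U^t=\Lambda_{[0,t)}(B)$ is well defined on $\mathcal G(\xi^+)$ and is a continuous operator $\mathcal G(\xi^+)\to\mathcal G(\xi_-)$ with $\|U^ta\|(\xi_-)\le\|B\|(t)\,\|a\|(\xi^+)$. 2. Let $B^*(\boldsymbol\vartheta)=B(\boldsymbol\vartheta^*)^*$, where $\boldsymbol\vartheta^*$ is $\boldsymbol\vartheta$ with $\vartheta^-_0$ and $\vartheta^0_+$ exchanged. The formal adjoint of $U^t$ is $\Lambda_{[0,t)}(B^*)$, a continuous operator $\mathcal G(1/\xi_-)\to\mathcal G(1/\xi^+)$ with $\|\Lambda_{[0,t)}(B^*)\|_{1/\xi_-}^{1/\xi^+}=\|\Lambda_{[0,t)}(B)\|_{\xi^+}^{\xi_-}$. 3. $U^t=B(\boldsymbol\emptyset)+\Lambda^t(\mathbf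 D)$ on $\mathcal G(\xi^+)$ with $D^\mu_\nu(x)=\Lambda_{[0,t(x))}(\dot B(\mathbf x^\mu_\nu))$, and the derivatives satisfy the QS-integrability conditions: the functions $x\mapsto\|D^\mu_\nu(x)\|_{\xi^+}^{\xi_-}$ on $X^t$ are essentially bounded for $D^0_0$, square integrable for $D^0_+$ and $D^-_0$, and integrable for $D^-_+$. 4. Suppose that $B(\boldsymbol\emptyset)=T^0\otimes\hat 1$ and $B(\mathbf x\sqcup\boldsymbol\vartheta)=L(\mathbf x)\odot B(\boldsymbol\vartheta)$ for the four elementary tables $\mathbf x=\mathbf x^\mu_\nu$, $x\in X^t$, and $\boldsymbol\vartheta\in(\mathcal X^{t(x)})^4$ (almost everywhere), with bounded operators $T^0$ in $\mathcal H$ and $L(\mathbf x^0_0)\colon\mathcal H\otimes\mathcal E(x)\to\mathcal H\otimes\mathcal E(x)$, $L(\mathbf x^0_+)\colon\mathcal H\to\mathcal H\otimes\mathcal E(x)$, $L(\mathbf x^-_0)\colon\mathcal H\otimes\mathcal E(x)\to\mathcal H$, $L(\mathbf x^-_+)\colon\mathcal H\to\mathcal H$. Here $L(\mathbf x)\odot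 T=(L(\mathbf x)\otimes\hat 1)(T\otimes I(x))$, the factor $I(x)$ on $\mathcal E(x)$ being present for $\mathbf x^0_0$ and $\mathbf x^-_0$ only, and $L(\mathbf x)$ acting as the identity on all other tensor factors. Then $U^0=T^0\otimes\hat 1$ and $U^t=U^0+\Lambda^t(\mathbf L\odot U)$ on $\mathcal G(\xi^+)$, where $(\mathbf L\odot U)^\mu_\nu(x)=L(\mathbf x^\mu_\nu)\odot U^{t(x)}$. -/

import Mathlib

open MeasureTheory Set
open scoped ENNReal

noncomputable section

namespace QS

/-! ### Finite chains -/

/-- A finite chain in `Z` with respect to the time function `τ`: finitely many points with pairwise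
different times, enumerated as `(z₁, …, zₙ)` with `τ z₁ < ⋯ < τ zₙ` (equivalently, a finite subset of
`Z` on which `τ` is injective). -/
def Chain {Z : Type*} (τ : Z → ℝ) : Type _ :=
  Σ n : ℕ, {z : Fin n → Z // StrictMono (τ ∘ z)}

instance {Z : Type*} [MeasurableSpace Z] (τ : Z → ℝ) : MeasurableSpace (Chain τ) :=
  inferInstanceAs (MeasurableSpace (Σ n : ℕ, {z : Fin n → Z // StrictMono (τ ∘ z)}))

namespace Chain

/-- The cardinality `|κ|`. -/
def len {Z : Type*} {τ : Z → ℝ} (κ : Chain τ) : ℕ := κ.1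

/-- The points of the chain, in chronological order. -/
def pt {Z : Type*} {τ : Z → ℝ} (κ : Chain τ) : Fin κ.len → Z := κ.2.1

/-- The chain as a subset of `Z`. -/
def support {Z : Type*} {τ : Z → ℝ} (κ : Chain τ) : Set Z := Set.range κ.pt

/-- The empty chain. -/
def empty {Z : Type*} (τ : Z → ℝ) : Chain τ := ⟨0, Fin.elim0, fun i => i.elim0⟩

/-- The one point chain. -/
def single {Z : Type*} (τ : Z → ℝ) (z : Z) : Chain τ := ⟨1, fun _ => z, Subsingleton.strictMono _⟩

/-- The subchain of the points whose index belongs to `s`. -/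
def sub {Z : Type*} {τ : Z → ℝ} (κ : Chain τ) (s : Finset (Fin κ.len)) : Chain τ :=
  ⟨s.card, κ.pt ∘ s.orderEmbOfFin rfl, κ.2.2.comp (s.orderEmbOfFin rfl).strictMono⟩

open Classical in
/-- The subchain of the points lying in `A`. -/
def inside {Z : Type*} {τ : Z → ℝ} (κ : Chain τ) (A : Set Z) : Chain τ :=
  κ.sub (Finset.univ.filter fun i => κ.pt i ∈ A)

/-- The subchain of the points lying outside `A`. -/
def outside {Z : Type*} {τ : Z → ℝ} (κ : Chain τ) (A : Set Z) : Chain τ := κ.inside Aᶜ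

open Classical in
/-- The disjoint union `κ ⊔ σ` of two chains. A chain is determined by its set of points, so there is
at most one candidate; there is none exactly when two points have the same time, and then the value
is by convention the empty chain (this happens on a null set only). -/
def union {Z : Type*} {τ : Z → ℝ} (κ σ : Chain τ) : Chain τ :=
  if h : ∃ ω : Chain τ, ω.support = κ.support ∪ σ.support ∧ ω.len = κ.len + σ.len then h.choose
  else empty τ

/-- The chains all of whose points have time `< t`. -/
def below {Z : Type*} (τ : Z → ℝ) (t : ℝ) : Set (Chain τ) := {κ | ∀ i, τ (κ.pt i) < t}

/-- The measure `dκ = ∏ dz` on chains: the sum over `n` of the restriction of the product measure to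
`{τ z₁ < ⋯ < τ zₙ}`; the empty chain has mass `1`. -/
def measure {Z : Type*} [MeasurableSpace Z] (τ : Z → ℝ) (μ : Measure Z) : Measure (Chain τ) :=
  Measure.sum fun n : ℕ =>
    ((Measure.pi fun _ : Fin n => μ).comap
      (Subtype.val : {z : Fin n → Z // StrictMono (τ ∘ z)} → Fin n → Z)).map (Sigma.mk n)

end Chain

/-! ### The noise space -/

/-- The space `X` with its positive measure `dx`, the time `x ↦ t(x) ≥ 0` with
`dx = λ(t, dx) dt`, and the measurable family of separable Hilbert spaces `E(x)`. The latter is given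
by a measurable orthonormal frame, indexed at the point `x` by the set `idx x ⊆ ℕ`, so that
`E(x) = ℓ²(idx x)` has an arbitrary dimension `≤ ℵ₀`, which may vary with `x`. -/
structure NoiseSpace (X : Type*) [MeasurableSpace X] where
  μ : Measure X
  sigmaFinite : SigmaFinite μ
  time : X → ℝ
  measurable_time : Measurable time
  time_nonneg : ∀ x, 0 ≤ time x
  lam : ProbabilityTheory.Kernel ℝ X
  disintegration : ∀ Δ : Set X, MeasurableSet Δ → μ Δ < ⊤ → ∀ f : ℝ → ℝ≥0∞, Measurable f →
    ∫⁻ x in Δ, f (time x) ∂μ = ∫⁻ s in Ici (0 : ℝ), f s * lam s Δ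
  idx : X → Set ℕ
  measurable_idx : ∀ i, MeasurableSet {x | i ∈ idx x}

attribute [instance] NoiseSpace.sigmaFinite

section
variable {X : Type*} [MeasurableSpace X] (S : NoiseSpace X)

/-- `X^t = {x | t(x) < t}`. -/
def NoiseSpace.before (t : ℝ) : Set X := {x | S.time x < t}

/-- The space of chains in `X`. -/
abbrev Ch := Chain S.time

/-- Marked points are pairs `(x, i)`, `i ∈ idx x`; a marked point `(x, i)` stands for the `i`-th frame
vector of `E(x)`. -/
def NoiseSpace.markedTime : X × ℕ → ℝ := fun p => S.time p.1

/-- The measure on marked points: `dx` times the counting measure of `idx x`. -/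
def NoiseSpace.markedMeasure : Measure (X × ℕ) :=
  (S.μ.prod Measure.count).restrict {p | p.2 ∈ S.idx p.1}

/-- Marked chains: chains `κ` with a mark `i(x) ∈ idx x` at every point `x ∈ κ`. A marked chain over
`κ` stands for a product frame vector of `E^⊗(κ) = ⊗_{x ∈ κ} E(x)`. -/
abbrev MCh := Chain S.markedTime

/-- The measure `dκ` on chains. -/
def chM : Measure (Ch S) := Chain.measure S.time S.μ

/-- The measure on marked chains: `dκ` times the counting measure of the marks. -/
def mchM : Measure (MCh S) := Chain.measure S.markedTime S.markedMeasure

/-- The chain underlying a marked chain. -/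
def base (y : MCh S) : Ch S := ⟨y.len, fun i => (y.pt i).1, y.2.2⟩

/-- The chain `σ` with the marks `m`. -/
def attach (σ : Ch S) (m : Fin σ.len → ℕ) : MCh S := ⟨σ.len, fun i => (σ.pt i, m i), σ.2.2⟩

/-- The counting measure on the marked chains over the chain `σ`, that is, on the product frame of
`E^⊗(σ)`. -/
def fibM (σ : Ch S) : Measure (MCh S) :=
  Measure.sum fun m : {m : Fin σ.len → ℕ // ∀ i, m i ∈ S.idx (σ.pt i)} =>
    Measure.dirac (attach S σ m.1)

/-- The points of a marked chain that lie in the chain `σ`. -/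
def inCh (y : MCh S) (σ : Ch S) : MCh S := y.inside {p | p.1 ∈ σ.support}

/-- The points of a marked chain that lie outside the chain `σ`. -/
def offCh (y : MCh S) (σ : Ch S) : MCh S := y.outside {p | p.1 ∈ σ.support}

/-! ### Tables of four chains -/

/-- A table of four chains `(ϑ₀⁻, ϑ₀⁰, ϑ₊⁰, ϑ₊⁻)`, listed in this order. -/
abbrev Table := Ch S × Ch S × Ch S × Ch S

/-- The four types of elementary tables: annihilation `₀⁻`, gauge `₀⁰`, creation `₊⁰`,
time `₊⁻`. -/
inductive Pos
  | ann
  | gau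
  | cre
  | tim

namespace Table
variable {S}

/-- `ϑ₀⁻` -/
abbrev ann (ϑ : Table S) : Ch S := ϑ.1
/-- `ϑ₀⁰` -/
abbrev gau (ϑ : Table S) : Ch S := ϑ.2.1
/-- `ϑ₊⁰` -/
abbrev cre (ϑ : Table S) : Ch S := ϑ.2.2.1
/-- `ϑ₊⁻` -/
abbrev tim (ϑ : Table S) : Ch S := ϑ.2.2.2

/-- The adjoint table `ϑ*`, in which `ϑ₀⁻` and `ϑ₊⁰` are exchanged. -/
abbrev star (ϑ : Table S) : Table S := (ϑ.cre, ϑ.gau, ϑ.ann, ϑ.tim)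

/-- The entrywise disjoint union `κ ⊔ ϑ`. -/
def union (κ ϑ : Table S) : Table S :=
  (κ.ann.union ϑ.ann, κ.gau.union ϑ.gau, κ.cre.union ϑ.cre, κ.tim.union ϑ.tim)

variable (S)

/-- The table of four empty chains. -/
abbrev empty : Table S :=
  (Chain.empty S.time, Chain.empty S.time, Chain.empty S.time, Chain.empty S.time)

/-- The elementary table with the single point `x` at the position `i`. -/
def elem : Pos → X → Table S
  | .ann, x => (Chain.single S.time x, Chain.empty S.time, Chain.empty S.time, Chain.empty S.time)
  | .gau, x => (Chain.empty S.time, Chain.single S.time x, Chain.empty S.time, Chain.empty S.time)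
  | .cre, x => (Chain.empty S.time, Chain.empty S.time, Chain.single S.time x, Chain.empty S.time)
  | .tim, x => (Chain.empty S.time, Chain.empty S.time, Chain.empty S.time, Chain.single S.time x)

/-- The tables of chains in `X^t`. -/
def below (t : ℝ) : Set (Table S) :=
  {ϑ | ϑ.ann ∈ Chain.below S.time t ∧ ϑ.gau ∈ Chain.below S.time t ∧
    ϑ.cre ∈ Chain.below S.time t ∧ ϑ.tim ∈ Chain.below S.time t}

/-- The product measure on tables. -/
def measure : Measure (Table S) := (chM S).prod ((chM S).prod ((chM S).prod (chM S)))

end Table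

/-! ### The scale of spaces `G(ξ) ⊗ E^⊗(σ) ⊗ E^⊗(ρ)` -/

/-- Vectors of `G(ξ) ⊗ E^⊗(σ) ⊗ E^⊗(ρ)` are functions of `(z₁, z₂, w)` with values in `H`; here `z₁`
and `z₂` are marked chains over `σ` and `ρ` (the components in `E^⊗(σ) ⊗ E^⊗(ρ)`), and `w = (κ, m)` is
the argument `κ` together with the component `m` in `E^⊗(κ)`. -/
abbrev Triple := MCh S × MCh S × MCh S

/-- The reference measure for `E^⊗(σ) ⊗ E^⊗(ρ) ⊗ F`. -/
def vecM (σ ρ : Ch S) : Measure (Triple S) := (fibM S σ).prod ((fibM S ρ).prod (mchM S))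

/-- The norm `‖f‖(ξ)` in `G(ξ) ⊗ E^⊗(σ) ⊗ E^⊗(ρ)`:
`‖f‖²(ξ) = ∫ ξ^|κ| ‖f(κ)‖² dκ`, possibly infinite. -/
def gnorm {H : Type*} [NormedAddCommGroup H] (ξ : ℝ) (σ ρ : Ch S) (f : Triple S → H) : ℝ≥0∞ :=
  (∫⁻ y, ENNReal.ofReal ξ ^ y.2.2.len * ‖f y‖ₑ ^ 2 ∂(vecM S σ ρ)) ^ (1 / 2 : ℝ)

variable (H : Type*) [NormedAddCommGroup H] [InnerProductSpace ℂ H]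

/-- All measurable vector functions, up to equality almost everywhere. Every
`G(ξ) ⊗ E^⊗(σ) ⊗ E^⊗(ρ)`, `ξ > 0`, is the subspace of those with `‖f‖(ξ) < ∞`. -/
abbrev L0 (σ ρ : Ch S) := Triple S →ₘ[vecM S σ ρ] H

/-- Linear operators (with a domain) in the scale with the source and the target of the value at the
table `ϑ`: from `G ⊗ E^⊗(ϑ₀⁻) ⊗ E^⊗(ϑ₀⁰)` to `G ⊗ E^⊗(ϑ₊⁰) ⊗ E^⊗(ϑ₀⁰)`. -/
abbrev Op (ϑ : Table S) := L0 S H ϑ.ann ϑ.gau →ₗ.[ℂ] L0 S H ϑ.cre ϑ.gau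

/-- Operator-valued functions of a table. -/
abbrev OpFun := ∀ ϑ : Table S, Op S H ϑ

variable {S H}

/-- The function `a` represents an element of `G(ξ) ⊗ E^⊗(σ) ⊗ E^⊗(ρ)`. -/
def InG (ξ : ℝ) {σ ρ : Ch S} (a : L0 S H σ ρ) : Prop := gnorm S ξ σ ρ a < ⊤

open Classical in
/-- `‖T‖ = sup ‖T a‖(ξ₋) / ‖a‖(ξ⁺)` over `a ∈ G(ξ⁺) ⊗ ⋯`; it is infinite if `T` is not defined on the
whole of `G(ξ⁺) ⊗ ⋯`. (Elements of the graph with `‖a‖(ξ⁺) = ∞` contribute `0`, as `c / ∞ = 0`; so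
does `a = 0`, as `0 / 0 = 0`.) -/
def opNorm (ξp ξm : ℝ) {σ ρ σ' ρ' : Ch S} (T : L0 S H σ ρ →ₗ.[ℂ] L0 S H σ' ρ') : ℝ≥0∞ :=
  if ∀ a : L0 S H σ ρ, InG ξp a → a ∈ T.domain then
    ⨆ p ∈ T.graph, gnorm S ξm σ' ρ' p.2 / gnorm S ξp σ ρ p.1
  else ⊤

/-- The operator whose graph is the linear relation `r`. (It is only used for relations which are
linear and single-valued, where the span below is the relation itself.) -/
def ofRel {E F : Type*} [AddCommGroup E] [Module ℂ E] [AddCommGroup F] [Module ℂ F]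
    (r : E → F → Prop) : E →ₗ.[ℂ] F :=
  (Submodule.span ℂ {p : E × F | r p.1 p.2}).toLinearPMap

/-- Two operators are both defined on `G(ξ) ⊗ ⋯` and coincide there. -/
def AgreeOn (ξ : ℝ) {σ ρ σ' ρ' : Ch S} (T T' : L0 S H σ ρ →ₗ.[ℂ] L0 S H σ' ρ') : Prop :=
  ∀ a, InG ξ a → ∃ u, (a, u) ∈ T.graph ∧ (a, u) ∈ T'.graph

/-- `T f = g` for functions `f`, `g` considered up to equality almost everywhere. -/
def Represents {σ ρ σ' ρ' : Ch S} (T : L0 S H σ ρ →ₗ.[ℂ] L0 S H σ' ρ') (f g : Triple S → H) : Prop :=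
  ∃ p ∈ T.graph, p.1 =ᵐ[vecM S σ ρ] f ∧ p.2 =ᵐ[vecM S σ' ρ'] g

/-- The pairing `⟨c | a⟩ = ∫ ⟨c(κ) | a(κ)⟩ dκ` is defined for `c`, `a`. -/
def Paired {σ ρ : Ch S} (c a : L0 S H σ ρ) : Prop :=
  Integrable (fun y => (inner ℂ (c y) (a y) : ℂ)) (vecM S σ ρ)

/-- The pairing `⟨c | a⟩ = ∫ ⟨c(κ) | a(κ)⟩ dκ`. -/
def pairing {σ ρ : Ch S} (c a : L0 S H σ ρ) : ℂ := ∫ y, inner ℂ (c y) (a y) ∂(vecM S σ ρ)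

/-- The formally conjugated operator in `G`: `T* c = d` if `⟨c | T a⟩ = ⟨d | a⟩` for all
`a ∈ ⋂_{ξ > 0} G(ξ) ⊗ ⋯`. -/
def formalAdjoint {σ ρ σ' ρ' : Ch S} (T : L0 S H σ ρ →ₗ.[ℂ] L0 S H σ' ρ') :
    L0 S H σ' ρ' →ₗ.[ℂ] L0 S H σ ρ :=
  ofRel fun c d => ∀ p ∈ T.graph, (∀ ξ : ℝ, 0 < ξ → InG ξ p.1) →
    Paired c p.2 ∧ Paired d p.1 ∧ pairing c p.2 = pairing d p.1

/-- `B*(ϑ) = B(ϑ*)*`. -/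
def OpFun.adj (B : OpFun S H) : OpFun S H := fun ϑ => formalAdjoint (B ϑ.star)

/-! ### Local QS integrability -/

/-- The pair of triples `(η^•, η_•)` of positive numbers. -/
structure Weights where
  upMinus : ℝ
  upZero : ℝ
  upPlus : ℝ
  loMinus : ℝ
  loZero : ℝ
  loPlus : ℝ
  upMinus_pos : 0 < upMinus
  upZero_pos : 0 < upZero
  upPlus_pos : 0 < upPlus
  loMinus_pos : 0 < loMinus
  loZero_pos : 0 < loZero
  loPlus_pos : 0 < loPlus

/-- The norm of local QS integrability
`∫ dϑ₊⁻ (∫∫ (η₊)^|ϑ₊⁰| / (η⁻)^|ϑ₀⁻| ess sup_{ϑ₀⁰} (η₀ / η⁰)^|ϑ₀⁰| ‖B(ϑ)‖² dϑ₊⁰ dϑ₀⁻)^{1/2}`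
over chains in `X^t`, where `‖B(ϑ)‖` is the norm of `B(ϑ) : G(η⁺) ⊗ ⋯ → G(η₋) ⊗ ⋯`. -/
def qsNorm (t : ℝ) (η : Weights) (B : OpFun S H) : ℝ≥0∞ :=
  ∫⁻ tim in Chain.below S.time t,
    (∫⁻ ann in Chain.below S.time t, ∫⁻ cre in Chain.below S.time t,
      ENNReal.ofReal η.loPlus ^ cre.len / ENNReal.ofReal η.upMinus ^ ann.len *
        essSup (fun gau : Ch S =>
          (ENNReal.ofReal η.loZero ^ gau.len / ENNReal.ofReal η.upZero ^ gau.len) *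
            opNorm η.upPlus η.loMinus (B (ann, gau, cre, tim)) ^ 2)
          ((chM S).restrict (Chain.below S.time t))
      ∂(chM S) ∂(chM S)) ^ (1 / 2 : ℝ) ∂(chM S)

/-- `B` is a measurable field of operators on `G(η) ⊗ ⋯` over the tables in `X^t`: for almost all
tables, it maps measurable fields of vectors to measurable fields of vectors. -/
def MapsFields (t η : ℝ) (B : OpFun S H) : Prop :=
  ∃ N : Set (Table S), (∀ᵐ ϑ ∂((Table.measure S).restrict (Table.below S t)), ϑ ∈ N) ∧
    ∀ b : Table S → Triple S → H, StronglyMeasurable (Function.uncurry b) →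
      (∀ ϑ ∈ N, gnorm S η ϑ.ann ϑ.gau (b ϑ) < ⊤) →
      ∃ c : Table S → Triple S → H, StronglyMeasurable (Function.uncurry c) ∧
        ∀ ϑ ∈ N, Represents (B ϑ) (b ϑ) (c ϑ)

/-- `B` is QS integrable up to the time `t` with the weights `η`: it is measurable, and its norm is
finite. Measurability means that the operators `B(ϑ)` and their adjoints form measurable fields
and that the function `‖B(ϑ)‖` is measurable; for separable `H` and standard Borel `X` the first of
these three properties implies the other two when the norms are finite. `B` is locally QS integrable
if for every `t ≥ 0` there exist weights `η` with this property. -/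
def QSIntegrableUpTo (t : ℝ) (η : Weights) (B : OpFun S H) : Prop :=
  MapsFields t η.upPlus B ∧ MapsFields t (1 / η.loMinus) B.adj ∧
    AEMeasurable (fun ϑ => opNorm η.upPlus η.loMinus (B ϑ))
      ((Table.measure S).restrict (Table.below S t)) ∧
    qsNorm t η B < ⊤

/-! ### Multiple QS integrals -/

/-- The point derivative: for a vector function `b` over the table `κ`, this is the function
`ḃ(ϑ₀⁻ ⊔ ϑ₀⁰)` over the table `κ ⊔ ϑ`, that is,
`(p₁ ⊔ y₁, p₂ ⊔ y₂, w) ↦ b(p₁, p₂, y₁ ⊔ y₂ ⊔ w)` for `p₁`, `p₂`, `y₁`, `y₂` over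
`κ₀⁻`, `κ₀⁰`, `ϑ₀⁻`, `ϑ₀⁰`. -/
def deriv (κ : Table S) (b : Triple S → H) : Triple S → H := fun z =>
  b (inCh S z.1 κ.ann, inCh S z.2.1 κ.gau,
    ((offCh S z.1 κ.ann).union (offCh S z.2.1 κ.gau)).union z.2.2)

open Classical in
/-- The pairs `(ϑ₀⁰, ϑ₊⁰)` of disjoint subsets of `κ^t = κ ∩ X^t`, as sets of indices of points of the
(marked) chain `κ`. -/
def parts (S : NoiseSpace X) (t : ℝ) (w : MCh S) : Finset (Finset (Fin w.len) × Finset (Fin w.len)) :=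
  Finset.univ.filter fun P => Disjoint P.1 P.2 ∧ ∀ i ∈ P.1 ∪ P.2, S.time (w.pt i).1 < t

/-- The function `(ϑ₀⁻, ϑ₊⁻) ↦ [B(κ ⊔ ϑ) ḃ(ϑ₀⁻ ⊔ ϑ₀⁰)](ϑ₋⁰)` under the multiple integral, at the point
`q = (q₁, q₂, w)`, for the parts `ϑ₀⁰ = P.1`, `ϑ₊⁰ = P.2` of `w` and `ϑ₋⁰ = w \ ϑ₀⁰ \ ϑ₊⁰`. The value
`f ϑ` stands for `B(κ ⊔ ϑ) ḃ(ϑ₀⁻ ⊔ ϑ₀⁰)`. -/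
def integrand (f : Table S → Triple S → H) (q : Triple S)
    (P : Finset (Fin q.2.2.len) × Finset (Fin q.2.2.len)) (r : Ch S × Ch S) : H :=
  f (r.1, base S (q.2.2.sub P.1), base S (q.2.2.sub P.2), r.2)
    (q.1.union (q.2.2.sub P.2), q.2.1.union (q.2.2.sub P.1), q.2.2.sub (P.1 ∪ P.2)ᶜ)

/-- The measure `dϑ₀⁻ dϑ₊⁻` on pairs of chains in `X^t`. -/
def pairM (S : NoiseSpace X) (t : ℝ) : Measure (Ch S × Ch S) :=
  ((chM S).restrict (Chain.below S.time t)).prod ((chM S).restrict (Chain.below S.time t))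

/-- The action of the multiple QS integral over `[0, t)` of the operator function
`Ḃ(κ, ϑ) = B(κ ⊔ ϑ)`; for `κ = ∅` this is the function `B` itself:
`u(w) = ∑_{ϑ₀⁰ ⊔ ϑ₊⁰ ⊆ w^t} ∫∫ [B(κ ⊔ ϑ) ḃ(ϑ₀⁻ ⊔ ϑ₀⁰)](ϑ₋⁰) dϑ₀⁻ dϑ₊⁻`
for almost all arguments. Here `f` is a jointly measurable version of
`ϑ ↦ B(κ ⊔ ϑ) ḃ(ϑ₀⁻ ⊔ ϑ₀⁰)`, and the result does not depend on its choice. -/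
def ActsAs (t : ℝ) (κ : Table S) (B : OpFun S H) (b : L0 S H κ.ann κ.gau)
    (u : L0 S H κ.cre κ.gau) : Prop :=
  ∃ f : Table S → Triple S → H, StronglyMeasurable (Function.uncurry f) ∧
    (∀ᵐ ϑ ∂((Table.measure S).restrict (Table.below S t)),
      Represents (B (κ.union ϑ)) (deriv κ b) (f ϑ)) ∧
    ∀ᵐ q : Triple S ∂(vecM S κ.cre κ.gau),
      (∀ P ∈ parts S t q.2.2, Integrable (integrand f q P) (pairM S t)) ∧
      u q = ∑ P ∈ parts S t q.2.2, ∫ r, integrand f q P r ∂(pairM S t)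

/-- The multiple QS integral `Λ_{[0,t)}(Ḃ(κ))` of `Ḃ(κ, ϑ) = B(κ ⊔ ϑ)`, with its maximal domain. -/
def multInt (t : ℝ) (κ : Table S) (B : OpFun S H) : Op S H κ := ofRel (ActsAs t κ B)

/-- The multiple QS integral `Λ_{[0,t)}(B)`. -/
def qsInt (t : ℝ) (B : OpFun S H) : Op S H (Table.empty S) := multInt t (Table.empty S) B

/-! ### Single QS integrals -/

/-- The action of the QS integral `Λ^t(D)` of a table `D` of operator-valued functions of a point:
`u(w) = ∑_{x ∈ w^t} ([D₀⁰(x) ȧ(x)](w \ x) + [D₊⁰(x) a](w \ x))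
  + ∫_{X^t} [D₀⁻(x) ȧ(x)](w) dx + ∫_{X^t} [D₊⁻(x) a](w) dx`.
Here `f i` is a jointly measurable version of `x ↦ D_i(x) ȧ(x)` or `x ↦ D_i(x) a`. -/
def SingleActsAs (t : ℝ) (D : ∀ (i : Pos) (x : X), Op S H (Table.elem S i x))
    (a u : L0 S H (Chain.empty S.time) (Chain.empty S.time)) : Prop :=
  ∃ f : Pos → X → Triple S → H, (∀ i, StronglyMeasurable (Function.uncurry (f i))) ∧
    (∀ i, ∀ᵐ x ∂(S.μ.restrict (S.before t)),
      Represents (D i x) (deriv (Table.empty S) a) (f i x)) ∧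
    ∀ᵐ q ∂(vecM S (Chain.empty S.time) (Chain.empty S.time)),
      IntegrableOn (fun x => f .ann x q) (S.before t) S.μ ∧
      IntegrableOn (fun x => f .tim x q) (S.before t) S.μ ∧
      u q =
        (∑ j : Fin q.2.2.len, (open Classical in
          if S.time (q.2.2.pt j).1 < t then
            f .gau (q.2.2.pt j).1
              (Chain.empty S.markedTime, Chain.single S.markedTime (q.2.2.pt j), q.2.2.sub {j}ᶜ) +
            f .cre (q.2.2.pt j).1
              (Chain.single S.markedTime (q.2.2.pt j), Chain.empty S.markedTime, q.2.2.sub {j}ᶜ)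
          else 0)) +
        (∫ x in S.before t, f .ann x q ∂S.μ) + ∫ x in S.before t, f .tim x q ∂S.μ

/-- The QS integral `Λ^t(D)`. -/
def singleInt (t : ℝ) (D : ∀ (i : Pos) (x : X), Op S H (Table.elem S i x)) :
    Op S H (Table.empty S) := ofRel (SingleActsAs t D)

/-- The exponents `p` in the conditions of QS integrability of `D`. -/
def Pos.exponent : Pos → ℝ≥0∞
  | .ann => 2
  | .gau => ⊤
  | .cre => 2
  | .tim => 1

/-- The QS integrability conditions for `D` with the scale parameters `ξ⁺`, `ξ₋` up to the time `t`:
the function `x ↦ ‖D_i(x)‖` has a finite norm in `L^p(X^t)`, where `p = ∞, 2, 2, 1` for gauge,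
creation, annihilation, time. (The norm is understood through a measurable majorant, which can be
the function itself if that is measurable.) -/
def SingleIntegrable (t ξp ξm : ℝ) (D : ∀ (i : Pos) (x : X), Op S H (Table.elem S i x)) : Prop :=
  ∀ i, ∃ g : X → ℝ≥0∞, Measurable g ∧
    (∀ᵐ x ∂(S.μ.restrict (S.before t)), opNorm ξp ξm (D i x) ≤ g x) ∧
    eLpNorm g i.exponent (S.μ.restrict (S.before t)) < ⊤

/-! ### The recurrence -/

variable (S H) in
/-- The Hilbert space `H ⊗ E^⊗(σ) ⊗ E^⊗(ρ)`. -/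
abbrev Fib (σ ρ : Ch S) := Lp H 2 ((fibM S σ).prod (fibM S ρ))

/-- The operator `A ⊗ 1̂` in `G` for a bounded operator `A` in `H`. -/
def ampliation (A : H →L[ℂ] H) : Op S H (Table.empty S) :=
  ofRel fun a u => ∀ᵐ y ∂(vecM S (Chain.empty S.time) (Chain.empty S.time)), u y = A (a y)

/-- The semitensor product `L ⊙ T = (L ⊗ 1̂ ⊗ I^⊗(ϑ₀⁰ ⊔ ϑ₊⁰)) (T ⊗ I^⊗(κ₀⁻ ⊔ κ₀⁰))` of
`L : H ⊗ E^⊗(κ₀⁻) ⊗ E^⊗(κ₀⁰) → H ⊗ E^⊗(κ₊⁰) ⊗ E^⊗(κ₀⁰)` and an operator `T` over the table `ϑ`; it is an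
operator over the table `χ`, which has to be `κ ⊔ ϑ` (`κ` itself for `ϑ = ∅`). In components:
first `T` is applied for all fixed components `p` in `E^⊗(κ₀⁻) ⊗ E^⊗(κ₀⁰)`, giving `u p`; then `L` is
applied to `p ↦ u p z` for all fixed arguments `z`. -/
def odot (κ ϑ χ : Table S) (L : Fib S H κ.ann κ.gau →L[ℂ] Fib S H κ.cre κ.gau) (T : Op S H ϑ) :
    Op S H χ :=
  ofRel fun v out => ∃ u : MCh S × MCh S → Triple S → H,
    (∀ᵐ p ∂((fibM S κ.ann).prod (fibM S κ.gau)),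
      Represents T (fun z => v (p.1.union z.1, p.2.union z.2.1, z.2.2)) (u p)) ∧
    ∀ᵐ z ∂(vecM S ϑ.cre ϑ.gau), ∃ α : Fib S H κ.ann κ.gau,
      (α =ᵐ[(fibM S κ.ann).prod (fibM S κ.gau)] fun p => u p z) ∧
      (L α =ᵐ[(fibM S κ.cre).prod (fibM S κ.gau)]
        fun q => out (q.1.union z.1, q.2.union z.2.1, z.2.2))

/-- `B` solves, over the tables in `X^t` and on `G(η) ⊗ ⋯`, the recurrence `B(x ⊔ ϑ) = L(x) ⊙ B(ϑ)`
for `ϑ` in `X^{t(x)}` and the four elementary tables `x`, with `B(∅) = T⁰ ⊗ 1̂`. -/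
def Recurrence (t η : ℝ) (B : OpFun S H) (T0 : H →L[ℂ] H)
    (L : ∀ (i : Pos) (x : X), Fib S H (Table.elem S i x).ann (Table.elem S i x).gau →L[ℂ]
      Fib S H (Table.elem S i x).cre (Table.elem S i x).gau) : Prop :=
  AgreeOn η (B (Table.empty S)) (ampliation T0) ∧
  ∀ i, ∀ᵐ x ∂(S.μ.restrict (S.before t)),
    ∀ᵐ ϑ ∂((Table.measure S).restrict (Table.below S (S.time x))),
      AgreeOn η (B ((Table.elem S i x).union ϑ))
        (odot (Table.elem S i x) ϑ ((Table.elem S i x).union ϑ) (L i x) (B ϑ))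

end

end QS

end

noncomputable section

namespace QS

/-! ### Chains as finite sets of points with pairwise different times. -/

namespace Chain

variable {Z : Type*} {τ : Z → ℝ}

/-! Everything rests on two facts about integration over finite configurations of points, whose
times are almost surely pairwise different. The first is the recursion over the latest point: a
nonempty chain is a point `z` together with a chain before `z` (`Chain.lintegral_measure_rec`). The
recursion passes to products, because the latest point of a pair of configurations lies in exactly
one factor (`Growth.Rec.prod`), so a table of four chains has its latest point at one of four places
(`lintegral_tabT_rec`). It also determines the measure, by induction on the number of points
(`Growth.Rec.eq_of_rec`). The second fact follows from this uniqueness: integration over three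
chains equals integration over one chain with a sum over its partitions into three parts
(`Chain.lintegral_prod_prod_eq`). With marks for the components in the spaces `E(x)`, it becomes
`lintegral_partM_vecM`: summing over the parts of an argument `q` and integrating over `ϑ₀⁻`, `ϑ₊⁻`
and `q` is the same as integrating over tables `ϑ` and over the arguments of the vector `B(κ ⊔ ϑ)ḃ`.

Norm bound. The multiple integral is paired with a test function `C`. After the change of variables,
Cauchy–Schwarz is applied over the argument, then over `ϑ₀⁰`, then over `(ϑ₀⁻, ϑ₊⁰)`; the essential
supremum and the square root in `‖B‖(t)` are what these three steps leave. The remaining factors are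
sums over partitions with three weights, and the multinomial theorem (`sum_parts_le`) bounds them by
norms whose weight is the sum of the three. Hence the conditions `ξ⁺ ≥ η⁻ + η⁰ + η⁺` and `1/ξ₋ ≥
1/η₋ + 1/η₀ + 1/η₊`. The result is `lintegral_mul_partM_le`, turned into a bound for the norm by
duality.

Adjoint. The same pairing is an absolutely convergent integral over tables. Exchanging `ϑ₀⁻` and
`ϑ₊⁰` preserves the measure and turns each `B(ϑ)` into its adjoint, which exists by the Riesz
theorem in the weighted `L²` spaces (`exists_adjoint`). Thus `Λ(B)` and `Λ(B*)` are adjoint to each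
other on the full weighted spaces, and each bounds the norm of the other.

Differential. Splitting the integral by the latest point of the table gives the value at the empty
table, which is `B(∅)`, and four terms, one for each place of the latest point `x`; what is left
before `x` is the multiple integral of the derivative of `B` up to `t(x)` (`multFun_rec`). The norm
of a derivative is bounded by the integrand of `‖B‖(t)` with `x` added: it is integrable in `x` for
the time place, square integrable by Minkowski's inequality for the two places under the square
root, and bounded for the gauge place.

Equation. The same splitting applies once `L(x) ⊙ U^{t(x)}` is known to reproduce the inner
integrals. On the frame of the fibre over `x` the integrands are square summable families, so their
integral is a Bochner integral in `L²`, with which the bounded operator `L(x)` commutes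
(`exists_integral_famLp`). The vector `ȧ(x)` need not lie in the space with parameter `ξ⁺`; since
all points of the remaining table precede `x`, the weaker norm `adaptedSq` at time `t(x)` suffices,
and it is finite for almost every `x`, again by the recursion over the latest point. -/

theorem strictMono_pt (κ : Chain τ) : StrictMono (τ ∘ κ.pt) := κ.2.2

theorem pt_injective (κ : Chain τ) : Function.Injective κ.pt :=
  κ.strictMono_pt.injective.of_comp

/-- Since `τ` is injective on a chain, the set of points has only one chronological enumeration.
Identities between chains thereby become identities between sets, and almost all of them are proved
in this way. -/
theorem ext_support {κ σ : Chain τ} (h : κ.support = σ.support) : κ = σ := by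
  have hl : κ.len = σ.len := by
    have h1 : κ.support.ncard = κ.len := by
      rw [support, ← image_univ, ncard_image_of_injective _ κ.pt_injective]; simp
    have h2 : σ.support.ncard = σ.len := by
      rw [support, ← image_univ, ncard_image_of_injective _ σ.pt_injective]; simp
    rw [← h1, ← h2, h]
  obtain ⟨n, z, hz⟩ := κ
  obtain ⟨m, y, hy⟩ := σ
  obtain rfl : n = m := hl
  have hzy : range z = range y := h
  have h2 : τ ∘ z = τ ∘ y := by
    rw [← StrictMono.range_inj hz hy, range_comp, range_comp, hzy]
  have : z = y := by
    funext i
    obtain ⟨j, hj⟩ : y i ∈ range z := hzy ▸ mem_range_self i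
    have h3 : (τ ∘ z) j = (τ ∘ z) i := by
      rw [congrFun h2 i]; simp [hj]
    rw [← hj, hz.injective h3]
  subst this
  rfl

theorem injOn_support (κ : Chain τ) : InjOn τ κ.support := by
  rintro _ ⟨i, rfl⟩ _ ⟨j, rfl⟩ h
  rw [κ.strictMono_pt.injective h]

theorem finite_support (κ : Chain τ) : κ.support.Finite := finite_range _

theorem ncard_support (κ : Chain τ) : κ.support.ncard = κ.len := by
  rw [support, ← image_univ, ncard_image_of_injective _ κ.pt_injective]; simp

@[simp] theorem support_empty : (empty τ).support = ∅ := by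
  simp only [support]
  exact range_eq_empty_iff.2 (inferInstanceAs (IsEmpty (Fin 0)))

@[simp] theorem support_single (z : Z) : (single τ z).support = {z} :=
  haveI : Nonempty (Fin (single τ z).len) := inferInstanceAs (Nonempty (Fin 1))
  range_const

@[simp] theorem len_single (z : Z) : (single τ z).len = 1 := rfl

theorem support_sub (κ : Chain τ) (s : Finset (Fin κ.len)) :
    (κ.sub s).support = κ.pt '' s := by
  have : (κ.sub s).support = range (κ.pt ∘ s.orderEmbOfFin rfl) := rfl
  rw [this, range_comp, Finset.range_orderEmbOfFin]

@[simp] theorem len_sub (κ : Chain τ) (s : Finset (Fin κ.len)) : (κ.sub s).len = s.card := rfl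

@[simp] theorem support_inside (κ : Chain τ) (A : Set Z) :
    (κ.inside A).support = κ.support ∩ A := by
  classical
  rw [inside, support_sub]
  ext z
  simp only [Finset.coe_filter, Finset.mem_univ, true_and, mem_image, mem_ofPred_eq, support,
    mem_inter_iff, mem_range]
  constructor
  · rintro ⟨i, h, rfl⟩; exact ⟨⟨i, rfl⟩, h⟩
  · rintro ⟨⟨i, rfl⟩, h⟩; exact ⟨i, h, rfl⟩

@[simp] theorem support_outside (κ : Chain τ) (A : Set Z) :
    (κ.outside A).support = κ.support \ A := by
  rw [outside, support_inside, sdiff_eq]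

theorem eq_empty_of_support {κ : Chain τ} (h : κ.support = ∅) : κ = empty τ :=
  ext_support (by simp [h])

theorem eq_empty_of_len {κ : Chain τ} (h : κ.len = 0) : κ = empty τ := by
  refine eq_empty_of_support ?_
  rw [← ncard_support, ncard_eq_zero κ.finite_support] at h
  exact h

/-- A finite set on which `τ` is injective is the support of a chain. -/
theorem exists_support_eq {A : Set Z} (hA : A.Finite) (hi : InjOn τ A) :
    ∃ ω : Chain τ, ω.support = A := by
  classical
  let B : Finset ℝ := hA.toFinset.image τ
  have hB : ∀ i : Fin B.card, ∃ z ∈ A, τ z = B.orderEmbOfFin rfl i := by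
    intro i
    have := B.orderEmbOfFin_mem rfl i
    simp only [B, Finset.mem_image, Finite.mem_toFinset] at this
    exact this
  choose z hzA hz using hB
  refine ⟨⟨B.card, z, ?_⟩, ?_⟩
  · have : τ ∘ z = B.orderEmbOfFin rfl := funext hz
    rw [this]
    exact (B.orderEmbOfFin rfl).strictMono
  · change range z = A
    apply Subset.antisymm
    · rintro _ ⟨i, rfl⟩; exact hzA i
    · intro a ha
      have : τ a ∈ range (B.orderEmbOfFin rfl) := by
        rw [Finset.range_orderEmbOfFin]
        simp only [B, Finset.coe_image, Finite.coe_toFinset]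
        exact mem_image_of_mem _ ha
      obtain ⟨i, hia⟩ := this
      exact ⟨i, hi (hzA i) ha (by rw [hz, hia])⟩

/-- The points of `κ` and `σ` have different times. -/
def Apart (κ σ : Chain τ) : Prop := ∀ a ∈ κ.support, ∀ b ∈ σ.support, τ a ≠ τ b

theorem Apart.symm {κ σ : Chain τ} (h : κ.Apart σ) : σ.Apart κ :=
  fun a ha b hb => (h b hb a ha).symm

theorem Apart.disjoint {κ σ : Chain τ} (h : κ.Apart σ) : Disjoint κ.support σ.support :=
  disjoint_left.2 fun a ha hb => h a ha a hb rfl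

theorem apart_empty (κ : Chain τ) : κ.Apart (empty τ) := by intro a _ b hb; simp at hb

theorem empty_apart (κ : Chain τ) : (empty τ).Apart κ := (apart_empty κ).symm

theorem Apart.mono {κ σ κ' σ' : Chain τ} (h : κ.Apart σ) (h1 : κ'.support ⊆ κ.support)
    (h2 : σ'.support ⊆ σ.support) : κ'.Apart σ' :=
  fun a ha b hb => h a (h1 ha) b (h2 hb)

/-- Two points of a chain with equal times coincide, so a union with a time in common would have a
common point and too few points. The default branch of `union` is thus controlled by `Apart`. -/
theorem exists_union_iff (κ σ : Chain τ) :
    (∃ ω : Chain τ, ω.support = κ.support ∪ σ.support ∧ ω.len = κ.len + σ.len) ↔ κ.Apart σ := by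
  constructor
  · rintro ⟨ω, h1, h2⟩ a ha b hb hab
    have hab' : a = b :=
      ω.injOn_support (h1 ▸ mem_union_left _ ha) (h1 ▸ mem_union_right _ hb) hab
    subst hab'
    have h3 := ncard_union_add_ncard_inter κ.support σ.support κ.finite_support σ.finite_support
    rw [← h1, ω.ncard_support, κ.ncard_support, σ.ncard_support, h2] at h3
    have h4 : (κ.support ∩ σ.support).ncard = 0 := by omega
    rw [ncard_eq_zero (κ.finite_support.inter_of_left _)] at h4
    exact (h4 ▸ (⟨ha, hb⟩ : a ∈ κ.support ∩ σ.support) : a ∈ (∅ : Set Z))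
  · intro h
    have hi : InjOn τ (κ.support ∪ σ.support) := by
      rintro a (ha | ha) b (hb | hb) hab
      · exact κ.injOn_support ha hb hab
      · exact (h a ha b hb hab).elim
      · exact (h b hb a ha hab.symm).elim
      · exact σ.injOn_support ha hb hab
    obtain ⟨ω, hω⟩ := exists_support_eq (κ.finite_support.union σ.finite_support) hi
    refine ⟨ω, hω, ?_⟩
    rw [← ω.ncard_support, hω, ncard_union_eq h.disjoint κ.finite_support σ.finite_support,
      ncard_support, ncard_support]

theorem support_union {κ σ : Chain τ} (h : κ.Apart σ) :
    (κ.union σ).support = κ.support ∪ σ.support := by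
  have h' := (exists_union_iff κ σ).2 h
  rw [union, dif_pos h']
  exact h'.choose_spec.1

theorem len_union {κ σ : Chain τ} (h : κ.Apart σ) : (κ.union σ).len = κ.len + σ.len := by
  have h' := (exists_union_iff κ σ).2 h
  rw [union, dif_pos h']
  exact h'.choose_spec.2

theorem union_of_not_apart {κ σ : Chain τ} (h : ¬ κ.Apart σ) : κ.union σ = empty τ := by
  rw [union, dif_neg (fun h' => h ((exists_union_iff κ σ).1 h'))]

theorem union_comm (κ σ : Chain τ) : κ.union σ = σ.union κ := by
  by_cases h : κ.Apart σ
  · exact ext_support (by rw [support_union h, support_union h.symm, Set.union_comm])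
  · rw [union_of_not_apart h, union_of_not_apart (fun h' => h h'.symm)]

@[simp] theorem empty_union (κ : Chain τ) : (empty τ).union κ = κ :=
  ext_support (by rw [support_union (empty_apart κ)]; simp)

@[simp] theorem union_empty (κ : Chain τ) : κ.union (empty τ) = κ := by
  rw [union_comm, empty_union]

theorem mem_below_iff {t : ℝ} {κ : Chain τ} : κ ∈ below τ t ↔ ∀ z ∈ κ.support, τ z < t := by
  simp [below, support]

@[simp] theorem empty_mem_below (t : ℝ) : empty τ ∈ below τ t := by
  simp [mem_below_iff]

theorem single_apart_of_below {z : Z} {κ : Chain τ} (h : κ ∈ below τ (τ z)) :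
    (single τ z).Apart κ := by
  intro a ha b hb
  rw [support_single, mem_singleton_iff] at ha
  subst ha
  exact (mem_below_iff.1 h b hb).ne'

theorem below_mono {s t : ℝ} (h : s ≤ t) : below τ s ⊆ below τ t :=
  fun κ hκ => mem_below_iff.2 fun z hz => (mem_below_iff.1 hκ z hz).trans_le h

theorem single_union_mem_below {z : Z} {κ : Chain τ} (h : κ ∈ below τ (τ z)) {t : ℝ} :
    (single τ z).union κ ∈ below τ t ↔ τ z < t := by
  rw [mem_below_iff, support_union (single_apart_of_below h)]
  constructor
  · intro h'; exact h' z (by simp)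
  · intro hz a ha
    rcases ha with ha | ha
    · rw [support_single, mem_singleton_iff] at ha; rwa [ha]
    · exact (mem_below_iff.1 h a ha).trans hz

theorem len_single_union {z : Z} {κ : Chain τ} (h : κ ∈ below τ (τ z)) :
    ((single τ z).union κ).len = κ.len + 1 := by
  rw [len_union (single_apart_of_below h), len_single, add_comm]

/-- The chain with the given enumeration. -/
def ofFn {n : ℕ} (y : Fin n → Z) (hy : StrictMono (τ ∘ y)) : Chain τ := ⟨n, y, hy⟩

theorem support_ofFn {n : ℕ} (y : Fin n → Z) (hy : StrictMono (τ ∘ y)) :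
    (ofFn y hy).support = range y := rfl

theorem strictMono_snoc {n : ℕ} {y : Fin n → Z} {z : Z} :
    StrictMono (τ ∘ Fin.snoc (α := fun _ => Z) y z) ↔
      StrictMono (τ ∘ y) ∧ ∀ i, τ (y i) < τ z := by
  constructor
  · intro h
    refine ⟨fun i j hij => ?_, fun i => ?_⟩
    · simpa using h (Fin.castSucc_lt_castSucc_iff.2 hij)
    · simpa using h (Fin.castSucc_lt_last i)
  · rintro ⟨hy, h⟩ i j hij
    induction j using Fin.lastCases with
    | last =>
      induction i using Fin.lastCases with
      | last => exact (lt_irrefl _ hij).elim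
      | cast i => simpa using h i
    | cast j =>
      induction i using Fin.lastCases with
      | last => exact (lt_asymm hij (Fin.castSucc_lt_last j)).elim
      | cast i => simpa using hy (by simpa using hij)

/-- In the chronological enumeration a later point is appended at the end. This links `Fin.snoc`,
where product measures split, with `union`. -/
theorem ofFn_snoc {n : ℕ} (y : Fin n → Z) (z : Z)
    (h : StrictMono (τ ∘ Fin.snoc (α := fun _ => Z) y z)) :
    ofFn _ h = (single τ z).union (ofFn y (strictMono_snoc.1 h).1) := by
  refine ext_support ?_
  rw [support_union (single_apart_of_below (mem_below_iff.2 ?_)), support_single, support_ofFn,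
    support_ofFn]
  · ext a
    simp only [mem_range, singleton_union, mem_insert_iff]
    constructor
    · rintro ⟨i, rfl⟩
      induction i using Fin.lastCases with
      | last => left; simp
      | cast i => right; exact ⟨i, by simp⟩
    · rintro (rfl | ⟨i, rfl⟩)
      · exact ⟨Fin.last n, by simp⟩
      · exact ⟨i.castSucc, by simp⟩
  · rintro _ ⟨i, rfl⟩; exact (strictMono_snoc.1 h).2 i

end Chain

/-- Serves maps such as `union` and `inside`, which have a measurable formula on each of countably
many sets according to the order or the position of the points. -/
theorem measurable_of_cover {α β ι : Type*} [MeasurableSpace α] [MeasurableSpace β] [Countable ι]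
    {f : α → β} (S : ι → Set α) (hS : ∀ i, MeasurableSet (S i)) (hc : ∀ a, ∃ i, a ∈ S i)
    (g : ι → α → β) (hg : ∀ i, Measurable (g i)) (h : ∀ i, ∀ a ∈ S i, f a = g i a) :
    Measurable f := by
  intro A hA
  have : f ⁻¹' A = ⋃ i, S i ∩ g i ⁻¹' A := by
    ext a
    simp only [mem_preimage, mem_iUnion, mem_inter_iff]
    constructor
    · intro ha
      obtain ⟨i, hi⟩ := hc a
      exact ⟨i, hi, by rwa [← h i a hi]⟩
    · rintro ⟨i, hi, ha⟩
      rwa [h i a hi]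
  rw [this]
  exact MeasurableSet.iUnion fun i => (hS i).inter (hg i hA)

/-! ### Measurability on the space of chains. -/

namespace Chain

variable {Z : Type*} [MeasurableSpace Z] {τ : Z → ℝ}

/-- The chains of length `n`, as tuples. -/
abbrev Piece (τ : Z → ℝ) (n : ℕ) := {z : Fin n → Z // StrictMono (τ ∘ z)}

/-- The inclusion of the chains of length `n`. -/
def ofPiece {n : ℕ} (z : Piece τ n) : Chain τ := ⟨n, z⟩

theorem measurable_ofPiece (n : ℕ) : Measurable (ofPiece : Piece τ n → Chain τ) := by
  intro A hA
  have := MeasurableSpace.measurableSet_iInf.1 hA n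
  exact this

theorem measurableSet_iff {A : Set (Chain τ)} :
    MeasurableSet A ↔ ∀ n, MeasurableSet ((ofPiece : Piece τ n → Chain τ) ⁻¹' A) :=
  MeasurableSpace.measurableSet_iInf

theorem exists_ofPiece (κ : Chain τ) : ∃ (n : ℕ) (z : Piece τ n), ofPiece z = κ := ⟨κ.1, κ.2, rfl⟩

theorem measurableEmbedding_ofPiece (n : ℕ) :
    MeasurableEmbedding (ofPiece : Piece τ n → Chain τ) where
  injective := sigma_mk_injective
  measurable := measurable_ofPiece n
  measurableSet_image' := by
    intro s hs
    rw [measurableSet_iff]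
    intro m
    by_cases h : m = n
    · subst h
      have : (ofPiece : Piece τ m → Chain τ) ⁻¹' (ofPiece '' s) = s :=
        preimage_image_eq _ sigma_mk_injective
      rwa [this]
    · have : (ofPiece : Piece τ m → Chain τ) ⁻¹' (ofPiece '' s) = ∅ := by
        ext y
        simp only [mem_preimage, mem_image, mem_empty_iff_false, iff_false, not_exists, not_and]
        intro x _ hxy
        exact h (congrArg Sigma.fst hxy).symm
      rw [this]; exact MeasurableSet.empty

theorem measurable_of_pieces {W : Type*} [MeasurableSpace W] {f : Chain τ → W}
    (h : ∀ n, Measurable fun z : Piece τ n => f (ofPiece z)) : Measurable f := fun _ hA =>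
  measurableSet_iff.2 fun n => h n hA

/-- With a parameter space `Ω` present the σ-algebra is a product and no longer an infimum over
lengths by definition; but the sets `Ω × Piece τ n` are measurably embedded and cover the product.
-/
theorem measurable_prod_pieces {Ω W : Type*} [MeasurableSpace Ω] [MeasurableSpace W]
    {f : Ω × Chain τ → W}
    (h : ∀ n, Measurable fun p : Ω × Piece τ n => f (p.1, ofPiece p.2)) : Measurable f := by
  intro A hA
  have : f ⁻¹' A = ⋃ n, (Prod.map id (ofPiece : Piece τ n → Chain τ)) ''
      ((fun p : Ω × Piece τ n => f (p.1, ofPiece p.2)) ⁻¹' A) := by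
    ext ⟨a, κ⟩
    simp only [mem_preimage, mem_iUnion, mem_image]
    constructor
    · intro ha
      obtain ⟨n, z, rfl⟩ := exists_ofPiece κ
      exact ⟨n, (a, z), ha, rfl⟩
    · rintro ⟨n, ⟨b, z⟩, hb, he⟩
      simp only [Prod.map_apply, id_eq, Prod.mk.injEq] at he
      obtain ⟨rfl, rfl⟩ := he
      exact hb
  rw [this]
  exact MeasurableSet.iUnion fun n =>
    (MeasurableEmbedding.id.prodMap (measurableEmbedding_ofPiece n)).measurableSet_image' (h n hA)

theorem measurable_len : Measurable (len : Chain τ → ℕ) :=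
  measurable_of_pieces fun _ => measurable_const

theorem measurableSet_len_eq (n : ℕ) : MeasurableSet {κ : Chain τ | κ.len = n} :=
  measurable_len (measurableSet_singleton n)

theorem measurable_piece_apply {n : ℕ} (i : Fin n) : Measurable fun z : Piece τ n => z.1 i :=
  (measurable_pi_apply i).comp measurable_subtype_coe

/-- The chain with the given enumeration, or the empty chain. -/
def mkOr (τ : Z → ℝ) (n : ℕ) (y : Fin n → Z) : Chain τ :=
  open Classical in if h : StrictMono (τ ∘ y) then ofFn y h else empty τ

theorem mkOr_of {n : ℕ} {y : Fin n → Z} (h : StrictMono (τ ∘ y)) : mkOr τ n y = ofFn y h :=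
  dif_pos h

theorem mkOr_coe {n : ℕ} (y : Piece τ n) : mkOr τ n y.1 = ofPiece y := dif_pos y.2

variable (hτ : Measurable τ)
include hτ

theorem measurableSet_strictMono (n : ℕ) : MeasurableSet {y : Fin n → Z | StrictMono (τ ∘ y)} := by
  have : {y : Fin n → Z | StrictMono (τ ∘ y)} =
      ⋂ (i : Fin n) (j : Fin n) (_ : i < j), {y | τ (y i) < τ (y j)} := by
    ext y; simp [StrictMono]
  rw [this]
  exact MeasurableSet.iInter fun i => MeasurableSet.iInter fun j => MeasurableSet.iInter fun _ =>
    measurableSet_lt (hτ.comp (measurable_pi_apply i)) (hτ.comp (measurable_pi_apply j))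

theorem measurable_mkOr (n : ℕ) : Measurable (mkOr τ n) := by
  classical
  have := Measurable.dite (s := {y : Fin n → Z | StrictMono (τ ∘ y)})
    (f := fun y => (ofPiece y : Chain τ))
    (g := fun _ => empty τ) (measurable_ofPiece n) measurable_const (measurableSet_strictMono hτ n)
  have h : mkOr τ n = fun y => if h : StrictMono (τ ∘ y) then ofPiece ⟨y, h⟩ else empty τ := by
    funext y; rw [mkOr]; congr
  rw [h]
  exact this

omit hτ in
theorem measurable_mkOr_piece {n m : ℕ} (φ : Fin m ↪o Fin n) :
    Measurable fun z : Piece τ n => (ofFn (z.1 ∘ φ) (z.2.comp φ.strictMono) : Chain τ) := by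
  have h : Measurable fun z : Piece τ n =>
      (⟨z.1 ∘ φ, z.2.comp φ.strictMono⟩ : Piece τ m) :=
    Measurable.subtype_mk (measurable_pi_lambda _ fun i => measurable_piece_apply (φ i))
  exact (measurable_ofPiece m).comp h

omit hτ in
theorem measurable_sub_piece {n : ℕ} (s : Finset (Fin n)) :
    Measurable fun z : Piece τ n => (ofPiece z).sub s :=
  measurable_mkOr_piece (s.orderEmbOfFin rfl)

theorem measurableSet_below_prod :
    MeasurableSet {p : ℝ × Chain τ | p.2 ∈ below τ p.1} := by
  have : Measurable fun p : ℝ × Chain τ => (p.2 ∈ below τ p.1 : Prop) := by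
    refine measurable_prod_pieces fun n => ?_
    have : MeasurableSet {p : ℝ × Piece τ n | ofPiece p.2 ∈ below τ p.1} := by
      have h : {p : ℝ × Piece τ n | ofPiece p.2 ∈ below τ p.1} =
          ⋂ i : Fin n, {p | τ (p.2.1 i) < p.1} := by
        ext p; simp only [mem_iInter]; rfl
      rw [h]
      exact MeasurableSet.iInter fun i => measurableSet_lt
        (hτ.comp ((measurable_piece_apply i).comp measurable_snd)) measurable_fst
    exact measurableSet_setOfPred.1 this
  exact measurableSet_setOfPred.2 this

theorem measurableSet_below (t : ℝ) : MeasurableSet (below τ t) :=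
  (measurableSet_below_prod hτ).preimage (measurable_const (a := t) |>.prodMk measurable_id)

theorem measurableSet_apart : MeasurableSet {p : Chain τ × Chain τ | p.1.Apart p.2} := by
  have : Measurable fun p : Chain τ × Chain τ => (p.1.Apart p.2 : Prop) := by
    refine measurable_prod_pieces fun n => ?_
    have := measurable_prod_pieces (τ := τ) (Ω := Piece τ n)
      (f := fun p : Piece τ n × Chain τ => (p.2.Apart (ofPiece p.1) : Prop)) ?_
    · exact this.comp measurable_swap
    intro m
    have : MeasurableSet {p : Piece τ n × Piece τ m | (ofPiece p.2).Apart (ofPiece p.1)} := by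
      have h : {p : Piece τ n × Piece τ m | (ofPiece p.2).Apart (ofPiece p.1)} =
          ⋂ (i : Fin n) (j : Fin m), {p | τ (p.2.1 j) ≠ τ (p.1.1 i)} := by
        ext p
        simp only [mem_iInter]
        constructor
        · intro h i j; exact h _ (mem_range_self j) _ (mem_range_self i)
        · rintro h _ ⟨j, rfl⟩ _ ⟨i, rfl⟩; exact h i j
      rw [h]
      refine MeasurableSet.iInter fun i => MeasurableSet.iInter fun j => ?_
      exact (measurableSet_eq_fun (hτ.comp ((measurable_piece_apply j).comp measurable_snd))
        (hτ.comp ((measurable_piece_apply i).comp measurable_fst))).compl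
    exact measurableSet_setOfPred.1 this
  exact measurableSet_setOfPred.2 this

/-- For lengths `n` and `m` the union is the concatenation of the two tuples, reordered by one of
finitely many permutations. Each reordering is a measurable formula, valid on the measurable set
where it is strictly increasing in time; one more piece consists of the pairs which are not apart.
-/
theorem measurable_union : Measurable fun p : Chain τ × Chain τ => p.1.union p.2 := by
  refine measurable_prod_pieces fun n => ?_
  have := measurable_prod_pieces (τ := τ) (Ω := Piece τ n)
    (f := fun p : Piece τ n × Chain τ => p.2.union (ofPiece p.1)) ?_
  · exact this.comp measurable_swap
  intro m
  let e : Fin (n + m) → Fin n ⊕ Fin m := finSumFinEquiv.symm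
  let g : Equiv.Perm (Fin (n + m)) → Piece τ n × Piece τ m → Fin (n + m) → Z :=
    fun π p => Sum.elim p.1.1 p.2.1 ∘ e ∘ π
  have hg : ∀ π, Measurable (g π) := fun π => measurable_pi_lambda _ fun i => by
    simp only [g, Function.comp]
    rcases e (π i) with j | j
    · exact (measurable_piece_apply j).comp measurable_fst
    · exact (measurable_piece_apply j).comp measurable_snd
  have hr : ∀ π p, range (g π p) = (ofPiece p.2 : Chain τ).support ∪ (ofPiece p.1).support := by
    intro π p
    have h1 : range (g π p) = range (Sum.elim p.1.1 p.2.1) := by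
      simp only [g]
      rw [← Function.comp_assoc, π.surjective.range_comp, (finSumFinEquiv.symm).surjective.range_comp]
    rw [h1, Sum.elim_range, Set.union_comm]
    rfl
  refine measurable_of_cover (ι := Option (Equiv.Perm (Fin (n + m))))
    (fun o => o.elim {p | ¬ (ofPiece p.2 : Chain τ).Apart (ofPiece p.1)}
      (fun π => {p | StrictMono (τ ∘ g π p)})) ?_ ?_
    (fun o => o.elim (fun _ => empty τ) (fun π p => mkOr τ (n + m) (g π p))) ?_ ?_
  · rintro (_ | π)
    · have := (measurableSet_apart hτ).preimage (((measurable_ofPiece (τ := τ) m).comp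
        (measurable_snd (α := Piece τ n))).prodMk ((measurable_ofPiece n).comp measurable_fst))
      exact this.compl
    · exact (measurableSet_strictMono hτ (n + m)).preimage (hg π)
  · intro p
    by_cases h : (ofPiece p.2 : Chain τ).Apart (ofPiece p.1)
    · let f : Fin (n + m) → ℝ := τ ∘ Sum.elim p.1.1 p.2.1 ∘ e
      have hf : Function.Injective f := by
        have h1 : Function.Injective (τ ∘ Sum.elim p.1.1 p.2.1) := by
          rintro (i | i) (j | j) hij
          · rw [p.1.2.injective hij]
          · exact (h _ (mem_range_self j) _ (mem_range_self i) hij.symm).elim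
          · exact (h _ (mem_range_self i) _ (mem_range_self j) hij).elim
          · rw [p.2.2.injective hij]
        exact h1.comp (finSumFinEquiv.symm).injective
      -- The sorting permutation gives monotone times, strictly so because the times are distinct.
      refine ⟨some (Tuple.sort f), ?_⟩
      exact (Tuple.monotone_sort f).strictMono_of_injective (hf.comp (Equiv.injective _))
    · exact ⟨none, h⟩
  · rintro (_ | π)
    · exact measurable_const
    · exact (measurable_mkOr hτ _).comp (hg π)
  · rintro (_ | π) p hp
    · exact union_of_not_apart hp
    · have hp' : StrictMono (τ ∘ g π p) := hp
      have ha : (ofPiece p.2 : Chain τ).Apart (ofPiece p.1) := by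
        rw [← exists_union_iff]
        exact ⟨ofFn _ hp', hr π p, add_comm _ _⟩
      simp only [Option.elim, mkOr_of hp']
      refine ext_support ?_
      rw [support_union ha, support_ofFn, hr]

omit hτ in
theorem measurable_inside {A : Set Z} (hA : MeasurableSet A) :
    Measurable fun κ : Chain τ => κ.inside A := by
  classical
  refine measurable_of_pieces fun n => ?_
  refine measurable_of_cover (ι := Finset (Fin n))
    (fun s => {z | ∀ i, i ∈ s ↔ z.1 i ∈ A}) ?_ ?_ (fun s z => (ofPiece z).sub s)
    (fun s => measurable_sub_piece s) ?_
  · intro s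
    have : {z : Piece τ n | ∀ i, i ∈ s ↔ z.1 i ∈ A} = ⋂ i, {z | i ∈ s ↔ z.1 i ∈ A} := by
      ext; simp
    rw [this]
    refine MeasurableSet.iInter fun i => ?_
    by_cases hi : i ∈ s
    · simp only [hi, true_iff]; exact (measurable_piece_apply i) hA
    · simp only [hi, false_iff]; exact ((measurable_piece_apply i) hA).compl
  · intro z
    exact ⟨Finset.univ.filter fun i => z.1 i ∈ A, by simp⟩
  · intro s z hz
    refine ext_support ?_
    rw [support_inside]
    refine Eq.trans ?_ (support_sub (ofPiece z) s).symm
    ext a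
    constructor
    · rintro ⟨⟨i, rfl⟩, h⟩
      exact ⟨i, (hz i).2 h, rfl⟩
    · rintro ⟨i, hi, rfl⟩
      exact ⟨⟨i, rfl⟩, (hz i).1 hi⟩

theorem measurable_single : Measurable fun z : Z => single τ z := by
  have : Measurable fun z : Z => mkOr τ 1 (fun _ => z) :=
    (measurable_mkOr hτ 1).comp (measurable_pi_lambda _ fun _ => measurable_id)
  convert this using 2 with z
  exact (mkOr_of (Subsingleton.strictMono _)).symm

omit hτ in
instance [MeasurableSingletonClass Z] : MeasurableSingletonClass (Chain τ) where
  measurableSet_singleton κ := by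
    rw [measurableSet_iff]
    intro n
    by_cases h : ∃ z : Piece τ n, ofPiece z = κ
    · obtain ⟨z, rfl⟩ := h
      have : (ofPiece : Piece τ n → Chain τ) ⁻¹' {ofPiece z} = {z} := by
        ext y
        simp only [mem_preimage, mem_singleton_iff]
        exact (sigma_mk_injective (i := n)).eq_iff
      rw [this]; exact measurableSet_singleton z
    · have : (ofPiece : Piece τ n → Chain τ) ⁻¹' {κ} = ∅ := by
        ext y; simp only [mem_preimage, mem_singleton_iff, mem_empty_iff_false, iff_false]
        exact fun hy => h ⟨y, hy⟩
      rw [this]; exact MeasurableSet.empty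

end Chain

/-! ### The measure on chains: latest point, σ-finiteness, coincidences. -/

namespace Chain

variable {Z : Type*} [MeasurableSpace Z] {τ : Z → ℝ} (hτ : Measurable τ)
include hτ

theorem lintegral_measure (μ : Measure Z) {F : Chain τ → ℝ≥0∞} (hF : Measurable F) :
    ∫⁻ κ, F κ ∂(measure τ μ) = ∑' n, ∫⁻ y in {y : Fin n → Z | StrictMono (τ ∘ y)},
      F (mkOr τ n y) ∂(Measure.pi fun _ => μ) := by
  rw [measure, lintegral_sum_measure]
  refine tsum_congr fun n => ?_
  rw [← lintegral_subtype_comap (measurableSet_strictMono hτ n)]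
  rw [show (Sigma.mk n : Piece τ n → Chain τ) = ofPiece from rfl]
  rw [lintegral_map hF (measurable_ofPiece n)]
  refine lintegral_congr fun y => ?_
  rw [← mkOr_coe y]

omit hτ in
theorem mkOr_snoc {n : ℕ} {y : Fin n → Z} {z : Z}
    (h : StrictMono (τ ∘ Fin.snoc (α := fun _ => Z) y z)) :
    mkOr τ (n + 1) (Fin.snoc (α := fun _ => Z) y z) = (single τ z).union (mkOr τ n y) := by
  rw [mkOr_of h, mkOr_of (strictMono_snoc.1 h).1, ofFn_snoc]

omit hτ in
theorem mkOr_mem_below {n : ℕ} {y : Fin n → Z} (h : StrictMono (τ ∘ y)) {t : ℝ} :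
    mkOr τ n y ∈ below τ t ↔ ∀ i, τ (y i) < t := by
  rw [mkOr_of h]; rfl

/-- Integration over chains, by the latest point. -/
theorem lintegral_measure_rec (μ : Measure Z) [SigmaFinite μ] {F : Chain τ → ℝ≥0∞}
    (hF : Measurable F) :
    ∫⁻ κ, F κ ∂(measure τ μ) = F (empty τ) +
      ∫⁻ z, ∫⁻ κ in below τ (τ z), F ((single τ z).union κ) ∂(measure τ μ) ∂μ := by
  have hU : Measurable fun p : Z × Chain τ => F ((single τ p.1).union p.2) :=
    hF.comp ((measurable_union hτ).comp
      (((measurable_single hτ).comp measurable_fst).prodMk measurable_snd))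
  have hb : MeasurableSet {p : Z × Chain τ | p.2 ∈ below τ (τ p.1)} :=
    (measurableSet_below_prod hτ).preimage ((hτ.comp measurable_fst).prodMk measurable_snd)
  let G : Z × Chain τ → ℝ≥0∞ := indicator {p | p.2 ∈ below τ (τ p.1)}
    fun p => F ((single τ p.1).union p.2)
  have hG : Measurable G := hU.indicator hb
  have h1 : ∀ z, ∫⁻ κ in below τ (τ z), F ((single τ z).union κ) ∂(measure τ μ) =
      ∑' n, ∫⁻ y in {y : Fin n → Z | StrictMono (τ ∘ y)}, G (z, mkOr τ n y)
        ∂(Measure.pi fun _ => μ) := by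
    intro z
    rw [← lintegral_indicator (measurableSet_below hτ _)]
    exact lintegral_measure hτ μ (F := fun κ => G (z, κ)) (hG.comp measurable_prodMk_left)
  have hc : ∀ n, Measurable fun y : Fin n → Z => F (mkOr τ n y) := fun n =>
    hF.comp (measurable_mkOr hτ n)
  rw [lintegral_measure hτ μ hF, tsum_eq_zero_add' ENNReal.summable]
  congr 1
  · have : {y : Fin 0 → Z | StrictMono (τ ∘ y)} = univ := by
      ext y; simp [Subsingleton.strictMono]
    rw [this, Measure.restrict_univ, Measure.pi_of_empty _ (Fin.elim0 : Fin 0 → Z)]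
    rw [lintegral_dirac' _ (hc 0)]
    exact congrArg F <| eq_empty_of_len (by rw [mkOr_of (Subsingleton.strictMono _)]; rfl)
  · simp_rw [h1]
    rw [lintegral_tsum]
    swap
    · intro n
      refine Measurable.aemeasurable ?_
      exact Measurable.lintegral_prod_right'
        (f := fun p : Z × (Fin n → Z) => G (p.1, mkOr τ n p.2))
        (hG.comp (measurable_fst.prodMk ((measurable_mkOr hτ n).comp measurable_snd)))
    refine tsum_congr fun n => ?_
    -- On the simplex the last coordinate is the latest point. Splitting it off from the product
    -- measure leaves a simplex of dimension `n`, subject to the condition that its points precede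
    -- `z`.
    have hmp := (measurePreserving_piFinSuccAbove (fun _ : Fin (n + 1) => μ) (Fin.last n)).symm
    rw [← lintegral_indicator (measurableSet_strictMono hτ (n + 1)), ← hmp.lintegral_comp
      ((hc (n + 1)).indicator (measurableSet_strictMono hτ (n + 1)))]
    rw [lintegral_prod]
    swap
    · exact (((hc (n + 1)).indicator
        (measurableSet_strictMono hτ (n + 1))).comp (MeasurableEquiv.measurable _)).aemeasurable
    refine lintegral_congr fun z => ?_
    rw [← lintegral_indicator (measurableSet_strictMono hτ n)]
    refine lintegral_congr fun y => ?_
    have he : (MeasurableEquiv.piFinSuccAbove (fun _ : Fin (n + 1) => Z) (Fin.last n)).symm (z, y) =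
        Fin.snoc (α := fun _ => Z) y z := Fin.insertNth_last' _ _
    rw [he]
    by_cases h : StrictMono (τ ∘ Fin.snoc (α := fun _ => Z) y z)
    · have h' := strictMono_snoc.1 h
      rw [indicator_of_mem (by exact h), indicator_of_mem (by exact h'.1)]
      simp only [G]
      rw [indicator_of_mem (by exact (mkOr_mem_below h'.1).2 h'.2), mkOr_snoc h]
    · rw [indicator_of_notMem (by exact h)]
      by_cases h1 : StrictMono (τ ∘ y)
      · rw [indicator_of_mem (by exact h1)]
        simp only [G]
        rw [indicator_of_notMem]
        exact fun h2 => h (strictMono_snoc.2 ⟨h1, (mkOr_mem_below h1).1 h2⟩)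
      · rw [indicator_of_notMem (by exact h1)]

omit hτ in
-- The exhausting sets consist of chains with at most `k` points, all in the `k`-th spanning set:
-- only finitely many lengths occur, and length `n` contributes at most `μ (S k) ^ n`.
theorem sigmaFinite_measure (hτ : Measurable τ) (μ : Measure Z) [SigmaFinite μ] :
    SigmaFinite (measure τ μ) := by
  let S := spanningSets μ
  let A : ℕ → Set (Chain τ) := fun k => {κ | κ.len ≤ k ∧ κ.support ⊆ S k}
  have hA : ∀ k, MeasurableSet (A k) := by
    intro k
    rw [measurableSet_iff]
    intro n
    have : (ofPiece : Piece τ n → Chain τ) ⁻¹' A k =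
        {_z | n ≤ k} ∩ ⋂ i, (fun z => z.1 i) ⁻¹' S k := by
      ext z
      simp only [A, mem_preimage, mem_inter_iff, mem_iInter]
      exact and_congr Iff.rfl (range_subset_iff)
    rw [this]
    exact (MeasurableSet.const _).inter (MeasurableSet.iInter fun i =>
      (measurable_piece_apply i) (measurableSet_spanningSets μ k))
  refine ⟨⟨⟨A, fun _ => trivial, fun k => ?_, ?_⟩⟩⟩
  · rw [← lintegral_indicator_one (hA k),
      lintegral_measure hτ μ (measurable_one.indicator (hA k))]
    rw [tsum_eq_sum (s := Finset.range (k + 1))]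
    · refine ENNReal.sum_lt_top.2 fun n _ => ?_
      rw [← lintegral_indicator (measurableSet_strictMono hτ n)]
      calc _ ≤ ∫⁻ y : Fin n → Z, (univ.pi fun _ => S k).indicator 1 y
            ∂(Measure.pi fun _ => μ) := by
            refine lintegral_mono fun y => ?_
            by_cases h : StrictMono (τ ∘ y)
            · rw [indicator_of_mem (by exact h)]
              by_cases h2 : mkOr τ n y ∈ A k
              · rw [indicator_of_mem h2, indicator_of_mem]; · exact le_rfl
                rw [mkOr_of h] at h2
                intro i _
                exact h2.2 (mem_range_self i)
              · rw [indicator_of_notMem h2]; exact zero_le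
            · rw [indicator_of_notMem (by exact h)]; exact zero_le
        _ = ∏ _i : Fin n, μ (S k) := by
            rw [lintegral_indicator_one (MeasurableSet.univ_pi fun _ =>
              measurableSet_spanningSets μ k), Measure.pi_pi]
        _ < ⊤ := ENNReal.prod_lt_top fun _ _ => measure_spanningSets_lt_top μ k
    · intro n hn
      rw [← lintegral_indicator (measurableSet_strictMono hτ n)]
      refine (lintegral_congr fun y => ?_).trans lintegral_zero
      by_cases h : StrictMono (τ ∘ y)
      · rw [indicator_of_mem (by exact h), indicator_of_notMem, ]
        rw [mkOr_of h]
        rintro ⟨h1, _⟩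
        exact hn (Finset.mem_range.2 (Nat.lt_succ_of_le h1))
      · rw [indicator_of_notMem (by exact h)]
  · refine eq_univ_of_forall fun κ => ?_
    have h1 : ∀ i, ∃ k, κ.pt i ∈ S k := fun i => by
      have := (iUnion_spanningSets μ).symm ▸ mem_univ (κ.pt i)
      exact mem_iUnion.1 this
    choose k hk using h1
    refine mem_iUnion.2 ⟨max κ.len (Finset.univ.sup k), le_max_left _ _, ?_⟩
    rintro _ ⟨i, rfl⟩
    exact monotone_spanningSets μ ((Finset.le_sup (Finset.mem_univ i)).trans (le_max_right _ _))
      (hk i)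

omit hτ in
theorem measurableSet_apart_right (hτ : Measurable τ) (σ : Chain τ) :
    MeasurableSet {κ : Chain τ | σ.Apart κ} := by
  rw [measurableSet_iff]
  intro n
  have : (ofPiece : Piece τ n → Chain τ) ⁻¹' {κ | σ.Apart κ} =
      ⋂ (i : Fin n) (j : Fin σ.len), {z | τ (σ.pt j) ≠ τ (z.1 i)} := by
    ext z
    simp only [mem_preimage, mem_iInter]
    constructor
    · intro h i j; exact h _ (mem_range_self j) _ (mem_range_self i)
    · rintro h _ ⟨j, rfl⟩ _ ⟨i, rfl⟩; exact h i j
  rw [this]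
  refine MeasurableSet.iInter fun i => MeasurableSet.iInter fun j => ?_
  exact (measurableSet_eq_fun measurable_const (hτ.comp (measurable_piece_apply i))).compl

/-- A chain which is not apart from `σ` has a coordinate in one of finitely many level sets of `τ`,
each of which is null by `h0`. -/
theorem ae_apart {μ : Measure Z} [SigmaFinite μ] (h0 : ∀ s, μ {z | τ z = s} = 0) (σ : Chain τ) :
    ∀ᵐ κ ∂(measure τ μ), σ.Apart κ := by
  have hm := (measurableSet_apart_right hτ σ).compl
  rw [ae_iff, ← lintegral_indicator_one (by exact hm)]
  rw [lintegral_measure hτ μ (measurable_one.indicator (by exact hm)), ENNReal.tsum_eq_zero]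
  intro n
  have hn : Measurable fun y : Fin n → Z => ({κ | ¬ σ.Apart κ} : Set (Chain τ)).indicator
      (1 : Chain τ → ℝ≥0∞) (mkOr τ n y) :=
    (measurable_one.indicator (by exact hm)).comp (measurable_mkOr hτ n)
  rw [lintegral_eq_zero_iff hn]
  have h1 : ∀ᵐ y ∂(Measure.pi fun _ : Fin n => μ), ∀ i : Fin n, ∀ j : Fin σ.len,
      τ (y i) ≠ τ (σ.pt j) := by
    rw [ae_all_iff]; intro i
    rw [ae_all_iff]; intro j
    have := Measure.pi_eval_preimage_null (fun _ : Fin n => μ) (i := i) (h0 (τ (σ.pt j)))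
    rw [ae_iff]
    simpa using this
  filter_upwards [ae_restrict_of_ae h1, ae_restrict_mem (measurableSet_strictMono hτ n)] with y hy hs
  rw [mkOr_of hs, indicator_of_notMem]
  · rfl
  · simp only [mem_ofPred_eq, not_not]
    rintro _ ⟨j, rfl⟩ _ ⟨i, rfl⟩
    exact (hy i j).symm

end Chain

/-- A space of finite configurations of points of `A`, built from an empty configuration `e` by
inserting latest points in finitely many ways. -/
structure Growth {A : Type*} [MeasurableSpace A] (τ : A → ℝ) (Y : Type*) [MeasurableSpace Y]
    (ι : Type*) where
  e : Y
  ins : ι → A × Y → Y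
  measurable_ins : ∀ i, Measurable (ins i)
  bel : ℝ → Set Y
  measurableSet_bel : MeasurableSet {p : ℝ × Y | p.2 ∈ bel p.1}
  e_mem : ∀ t, e ∈ bel t
  ins_mem : ∀ i a y t, y ∈ bel (τ a) → (ins i (a, y) ∈ bel t ↔ τ a < t)
  bel_mono : ∀ s t, s ≤ t → bel s ⊆ bel t
  len : Y → ℕ
  measurable_len : Measurable len
  len_e : len e = 0
  len_ins : ∀ i a y, y ∈ bel (τ a) → len (ins i (a, y)) = len y + 1

/-! ### Recursion over the latest point for general configurations. -/

namespace Growth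

variable {A : Type*} [MeasurableSpace A] {τ : A → ℝ} {Y : Type*} [MeasurableSpace Y]
  {ι : Type*} {Y' : Type*} [MeasurableSpace Y'] {ι' : Type*}

theorem measurableSet_bel_apply (g : Growth τ Y ι) (t : ℝ) : MeasurableSet (g.bel t) :=
  g.measurableSet_bel.preimage (measurable_const (a := t) |>.prodMk measurable_id)

/-- The pairs of a point and a configuration before it. -/
def before (g : Growth τ Y ι) : Set (A × Y) := {p | p.2 ∈ g.bel (τ p.1)}

theorem measurableSet_before (g : Growth τ Y ι) (hτ : Measurable τ) : MeasurableSet g.before :=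
  g.measurableSet_bel.preimage ((hτ.comp measurable_fst).prodMk measurable_snd)

/-- The measure `ν` satisfies the recursion over the latest point. -/
def Rec [Fintype ι] (g : Growth τ Y ι) (α : Measure A) (ν : Measure Y) : Prop :=
  ∀ F : Y → ℝ≥0∞, Measurable F → ∫⁻ y, F y ∂ν =
    F g.e + ∑ i, ∫⁻ p in g.before, F (g.ins i p) ∂(α.prod ν)

theorem setLIntegral_before (g : Growth τ Y ι) (hτ : Measurable τ) {α : Measure A} {ν : Measure Y}
    [SFinite ν] {F : A × Y → ℝ≥0∞} (hF : Measurable F) :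
    ∫⁻ p in g.before, F p ∂(α.prod ν) = ∫⁻ a, ∫⁻ y in g.bel (τ a), F (a, y) ∂ν ∂α := by
  rw [← lintegral_indicator (g.measurableSet_before hτ), lintegral_prod _
    (hF.indicator (g.measurableSet_before hτ)).aemeasurable]
  refine lintegral_congr fun a => ?_
  rw [← lintegral_indicator (g.measurableSet_bel_apply _)]
  rfl

variable [Fintype ι] [Fintype ι']

theorem Rec.restrict {g : Growth τ Y ι} {α : Measure A} {ν : Measure Y} (h : g.Rec α ν)
    (hτ : Measurable τ) {F : Y → ℝ≥0∞} (hF : Measurable F) (s : ℝ) :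
    ∫⁻ y in g.bel s, F y ∂ν = F g.e +
      ∑ i, ∫⁻ p in g.before, {p : A × Y | τ p.1 < s}.indicator (fun p => F (g.ins i p)) p
        ∂(α.prod ν) := by
  rw [← lintegral_indicator (g.measurableSet_bel_apply s),
    h _ (hF.indicator (g.measurableSet_bel_apply s)), indicator_of_mem (g.e_mem s)]
  congr 1
  refine Finset.sum_congr rfl fun i _ => ?_
  refine setLIntegral_congr_fun (g.measurableSet_before hτ) fun p hp => ?_
  have := g.ins_mem i p.1 p.2 s hp
  by_cases h1 : τ p.1 < s
  · rw [indicator_of_mem (this.2 h1), indicator_of_mem (by exact h1)]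
  · rw [indicator_of_notMem (fun h2 => h1 (this.1 h2)), indicator_of_notMem (by exact h1)]

/-- A configuration not before `s` has its latest point at or after `s`, and the time `s` itself is
null by `h0`. -/
theorem Rec.split {g : Growth τ Y ι} {α : Measure A} {ν : Measure Y} [SFinite α] [SFinite ν]
    (h : g.Rec α ν)
    (hτ : Measurable τ) (h0 : ∀ s, α {a | τ a = s} = 0) {F : Y → ℝ≥0∞} (hF : Measurable F) (s : ℝ) :
    ∫⁻ y, F y ∂ν = ∫⁻ y in g.bel s, F y ∂ν +
      ∑ i, ∫⁻ p in g.before, {p : A × Y | s < τ p.1}.indicator (fun p => F (g.ins i p)) p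
        ∂(α.prod ν) := by
  have hm : MeasurableSet {p : A × Y | τ p.1 < s} :=
    measurableSet_lt (hτ.comp measurable_fst) measurable_const
  have h1 : ∀ᵐ p ∂((α.prod ν).restrict g.before), τ p.1 ≠ s := by
    refine ae_restrict_of_ae ?_
    have : ∀ᵐ a ∂α, τ a ≠ s := by rw [ae_iff]; simpa using h0 s
    exact Measure.quasiMeasurePreserving_fst.ae this
  rw [h.restrict hτ hF s, h F hF, add_assoc, ← Finset.sum_add_distrib]
  congr 1
  refine Finset.sum_congr rfl fun i _ => ?_
  rw [← lintegral_add_left ((hF.fun_comp (g.measurable_ins i)).indicator hm)]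
  refine lintegral_congr_ae ?_
  filter_upwards [h1] with p hp
  rcases lt_or_gt_of_ne hp with h2 | h2
  · rw [indicator_of_mem (by exact h2), indicator_of_notMem (by exact h2.asymm), add_zero]
  · rw [indicator_of_notMem (by exact h2.asymm), indicator_of_mem (by exact h2), zero_add]

/-- Pairs of configurations. -/
def prod (g : Growth τ Y ι) (g' : Growth τ Y' ι') : Growth τ (Y × Y') (ι ⊕ ι') where
  e := (g.e, g'.e)
  ins := Sum.elim (fun i p => (g.ins i (p.1, p.2.1), p.2.2)) fun i p => (p.2.1, g'.ins i (p.1, p.2.2))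
  measurable_ins := by
    have := g.measurable_ins
    have := g'.measurable_ins
    rintro (i | i) <;> simp only [Sum.elim_inl, Sum.elim_inr] <;> fun_prop
  bel t := g.bel t ×ˢ g'.bel t
  measurableSet_bel := by
    have h1 := g.measurableSet_bel.preimage (f := fun p : ℝ × (Y × Y') => (p.1, p.2.1)) (by fun_prop)
    have h2 := g'.measurableSet_bel.preimage (f := fun p : ℝ × (Y × Y') => (p.1, p.2.2)) (by fun_prop)
    exact h1.inter h2
  e_mem t := ⟨g.e_mem t, g'.e_mem t⟩
  ins_mem := by
    rintro (i | i) a ⟨y, y'⟩ t ⟨h, h'⟩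
    · simp only [Sum.elim_inl, mem_prod]
      rw [g.ins_mem i a y t h]
      exact ⟨fun h => h.1, fun h1 => ⟨h1, g'.bel_mono _ _ h1.le h'⟩⟩
    · simp only [Sum.elim_inr, mem_prod]
      rw [g'.ins_mem i a y' t h']
      exact ⟨fun h => h.2, fun h1 => ⟨g.bel_mono _ _ h1.le h, h1⟩⟩
  bel_mono s t h := prod_mono (g.bel_mono s t h) (g'.bel_mono s t h)
  len p := g.len p.1 + g'.len p.2
  measurable_len := (g.measurable_len.comp measurable_fst).add (g'.measurable_len.comp measurable_snd)
  len_e := by simp [g.len_e, g'.len_e]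
  len_ins := by
    rintro (i | i) a ⟨y, y'⟩ ⟨h, h'⟩
    · simp [g.len_ins i a y h]; omega
    · simp [g'.len_ins i a y' h']; omega

/-- The latest point of a pair belongs to exactly one factor, up to a null set. For a latest point
`p` of the first configuration, `Rec.split` separates the second configurations before `p` from
those with a later point. The first kind gives the pairs whose latest point lies in the first
factor. The second kind, together with the pairs whose first member is empty, is reassembled by
`Rec.restrict` into the pairs whose latest point lies in the second factor. -/
theorem Rec.prod {g : Growth τ Y ι} {g' : Growth τ Y' ι'} {α : Measure A} {ν : Measure Y}
    {ν' : Measure Y'} [SFinite α] [SFinite ν] [SFinite ν'] (h : g.Rec α ν) (h' : g'.Rec α ν')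
    (hτ : Measurable τ) (h0 : ∀ s, α {a | τ a = s} = 0) :
    (g.prod g').Rec α (ν.prod ν') := by
  intro F hF
  have mi := g.measurable_ins
  have mi' := g'.measurable_ins
  have mb := g.measurableSet_before hτ
  have mb' := g'.measurableSet_before hτ
  rw [lintegral_prod _ hF.aemeasurable, h _ hF.lintegral_prod_right', h' _ (by fun_prop)]
  have hG : ∀ i, ∀ p : A × Y, ∫⁻ y', F (g.ins i p, y') ∂ν' =
      ∫⁻ y' in g'.bel (τ p.1), F (g.ins i p, y') ∂ν' +
      ∑ i', ∫⁻ p' in g'.before, {p' : A × Y' | τ p.1 < τ p'.1}.indicator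
        (fun p' => F (g.ins i p, g'.ins i' p')) p' ∂(α.prod ν') := by
    intro i p
    exact h'.split hτ h0 (F := fun y' => F (g.ins i p, y')) (by fun_prop) (τ p.1)
  let K : ι → ι' → (A × Y) × (A × Y') → ℝ≥0∞ := fun i i' =>
    {q : (A × Y) × (A × Y') | τ q.1.1 < τ q.2.1}.indicator
      fun q => F (g.ins i q.1, g'.ins i' q.2)
  have hK : ∀ i i', Measurable (K i i') := fun i i' => by
    refine Measurable.indicator (by fun_prop) (measurableSet_lt ?_ ?_) <;> fun_prop
  have hL : ∀ i, Measurable fun p : A × Y => ∫⁻ y' in g'.bel (τ p.1), F (g.ins i p, y') ∂ν' := by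
    intro i
    have : ∀ p : A × Y, ∫⁻ y' in g'.bel (τ p.1), F (g.ins i p, y') ∂ν' =
        ∫⁻ y', {q : (A × Y) × Y' | q.2 ∈ g'.bel (τ q.1.1)}.indicator
          (fun q => F (g.ins i q.1, q.2)) (p, y') ∂ν' := fun p => by
      rw [← lintegral_indicator (g'.measurableSet_bel_apply _)]; rfl
    simp_rw [this]
    refine Measurable.lintegral_prod_right' (Measurable.indicator (by fun_prop) ?_)
    exact g'.measurableSet_bel.preimage (f := fun q : (A × Y) × Y' => (τ q.1.1, q.2)) (by fun_prop)
  have hR : ∀ i, ∫⁻ p in g.before, ∫⁻ y', F (g.ins i p, y') ∂ν' ∂(α.prod ν) =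
      ∫⁻ p in g.before, ∫⁻ y' in g'.bel (τ p.1), F (g.ins i p, y') ∂ν' ∂(α.prod ν) +
      ∑ i', ∫⁻ p' in g'.before, ∫⁻ p in g.before, K i i' (p, p') ∂(α.prod ν) ∂(α.prod ν') := by
    intro i
    rw [lintegral_congr (hG i), lintegral_add_left (hL i), lintegral_finsetSum]
    · congr 1
      refine Finset.sum_congr rfl fun i' _ => ?_
      exact lintegral_lintegral_swap (hK i i').aemeasurable
    · intro i' _
      exact Measurable.lintegral_prod_right' (hK i i')
  rw [Finset.sum_congr rfl fun i _ => hR i, Finset.sum_add_distrib, Fintype.sum_sum_type]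
  have e1 : ∀ i, ∫⁻ p in (g.prod g').before, F ((g.prod g').ins (Sum.inl i) p) ∂(α.prod (ν.prod ν')) =
      ∫⁻ p in g.before, ∫⁻ y' in g'.bel (τ p.1), F (g.ins i p, y') ∂ν' ∂(α.prod ν) := by
    intro i
    rw [setLIntegral_before _ hτ (hF.fun_comp ((g.prod g').measurable_ins _)),
      setLIntegral_before _ hτ (hL i)]
    refine lintegral_congr fun a => ?_
    rw [show (g.prod g').bel (τ a) = g.bel (τ a) ×ˢ g'.bel (τ a) from rfl, ← Measure.prod_restrict,
      lintegral_prod]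
    · rfl
    · exact ((hF.fun_comp ((g.prod g').measurable_ins _)).comp measurable_prodMk_left).aemeasurable
  have mJ : ∀ i', Measurable fun p' : A × Y' =>
      ∫⁻ y in g.bel (τ p'.1), F (y, g'.ins i' p') ∂ν := by
    intro i'
    have : ∀ p : A × Y', ∫⁻ y in g.bel (τ p.1), F (y, g'.ins i' p) ∂ν =
        ∫⁻ y, {q : (A × Y') × Y | q.2 ∈ g.bel (τ q.1.1)}.indicator
          (fun q => F (q.2, g'.ins i' q.1)) (p, y) ∂ν := fun p => by
      rw [← lintegral_indicator (g.measurableSet_bel_apply _)]; rfl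
    simp_rw [this]
    refine Measurable.lintegral_prod_right' (Measurable.indicator (by fun_prop) ?_)
    exact g.measurableSet_bel.preimage (f := fun q : (A × Y') × Y => (τ q.1.1, q.2)) (by fun_prop)
  -- Latest point in the second factor: the first configuration is empty or has an earlier latest
  -- point `p`, which is the constraint encoded in `K`.
  have e2 : ∀ i', ∫⁻ p in (g.prod g').before, F ((g.prod g').ins (Sum.inr i') p)
      ∂(α.prod (ν.prod ν')) =
      ∫⁻ p' in g'.before, F (g.e, g'.ins i' p') ∂(α.prod ν') +
      ∑ i, ∫⁻ p' in g'.before, ∫⁻ p in g.before, K i i' (p, p') ∂(α.prod ν) ∂(α.prod ν') := by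
    intro i'
    rw [← lintegral_finsetSum _ (fun i _ => Measurable.lintegral_prod_left' (hK i i')),
      ← lintegral_add_left (by fun_prop)]
    have : ∀ p' : A × Y', F (g.e, g'.ins i' p') + ∑ i, ∫⁻ p in g.before, K i i' (p, p') ∂(α.prod ν) =
        ∫⁻ y in g.bel (τ p'.1), F (y, g'.ins i' p') ∂ν := fun p' =>
      (h.restrict hτ (F := fun y => F (y, g'.ins i' p')) (by fun_prop) (τ p'.1)).symm
    rw [lintegral_congr this, setLIntegral_before _ hτ (hF.fun_comp ((g.prod g').measurable_ins _)),
      setLIntegral_before _ hτ (mJ i')]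
    refine lintegral_congr fun a => ?_
    rw [show (g.prod g').bel (τ a) = g.bel (τ a) ×ˢ g'.bel (τ a) from rfl, ← Measure.prod_restrict,
      lintegral_prod_symm]
    · rfl
    · exact ((hF.fun_comp ((g.prod g').measurable_ins _)).comp measurable_prodMk_left).aemeasurable
  rw [Finset.sum_congr rfl fun i _ => e1 i, Finset.sum_congr rfl fun i _ => e2 i,
    Finset.sum_add_distrib, Finset.sum_comm]
  change F (g.e, g'.e) + _ + _ = F (g.e, g'.e) + _
  ring

/-- The recursion over the latest point determines a measure. -/
theorem Rec.eq_of_rec {g : Growth τ Y ι} {α : Measure A} {ν : Measure Y} [SFinite ν]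
    (h : g.Rec α ν) (hτ : Measurable τ) (Φ : (Y → ℝ≥0∞) → ℝ≥0∞) (hΦ0 : Φ (fun _ => 0) = 0)
    (hΦ : ∀ F, Measurable F → Φ F = F g.e +
      ∑ i, ∫⁻ a, Φ ((g.bel (τ a)).indicator fun y => F (g.ins i (a, y))) ∂α)
    (hadd : ∀ F, Measurable F → Φ F = ∑' n, Φ ({y | g.len y = n}.indicator F))
    {F : Y → ℝ≥0∞} (hF : Measurable F) : ∫⁻ y, F y ∂ν = Φ F := by
  have ml : ∀ n, MeasurableSet {y | g.len y = n} := fun n =>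
    g.measurable_len (measurableSet_singleton n)
  -- Induction on the number of points: inserting a point raises the length by one, so the recursion
  -- for length `n + 1` only uses functions supported by length `n`. For length `0` all the inserted
  -- terms vanish.
  have key : ∀ n, ∀ F : Y → ℝ≥0∞, Measurable F →
      ∫⁻ y, {y | g.len y = n}.indicator F y ∂ν = Φ ({y | g.len y = n}.indicator F) := by
    intro n
    induction n with
    | zero =>
      intro F hF
      rw [h _ (hF.indicator (ml 0)), hΦ _ (hF.indicator (ml 0))]
      congr 1
      refine Finset.sum_congr rfl fun i _ => ?_
      rw [setLIntegral_before _ hτ ((hF.indicator (ml 0)).fun_comp (g.measurable_ins i))]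
      refine lintegral_congr fun a => ?_
      have h2 : ∀ y, (g.bel (τ a)).indicator (fun y => {y | g.len y = 0}.indicator F
          (g.ins i (a, y))) y = 0 := by
        intro y
        by_cases hy : y ∈ g.bel (τ a)
        · rw [indicator_of_mem hy, indicator_of_notMem]
          simp [g.len_ins i a y hy]
        · rw [indicator_of_notMem hy]
      rw [← lintegral_indicator (g.measurableSet_bel_apply _), lintegral_congr h2, funext h2, hΦ0,
        lintegral_zero]
    | succ n ih =>
      intro F hF
      rw [h _ (hF.indicator (ml _)), hΦ _ (hF.indicator (ml _))]
      congr 1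
      refine Finset.sum_congr rfl fun i _ => ?_
      rw [setLIntegral_before _ hτ ((hF.indicator (ml _)).fun_comp (g.measurable_ins i))]
      refine lintegral_congr fun a => ?_
      have h2 : ∀ y, (g.bel (τ a)).indicator (fun y => {y | g.len y = n + 1}.indicator F
          (g.ins i (a, y))) y = {y | g.len y = n}.indicator
            ((g.bel (τ a)).indicator fun y => F (g.ins i (a, y))) y := by
        intro y
        by_cases hy : y ∈ g.bel (τ a)
        · rw [indicator_of_mem hy]
          by_cases hn : g.len y = n
          · rw [indicator_of_mem (by simp [g.len_ins i a y hy, hn]), indicator_of_mem (by exact hn),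
              indicator_of_mem hy]
          · rw [indicator_of_notMem (by simp [g.len_ins i a y hy, hn]),
              indicator_of_notMem (by exact hn)]
        · rw [indicator_of_notMem hy]
          by_cases hn : g.len y = n
          · rw [indicator_of_mem (by exact hn), indicator_of_notMem hy]
          · rw [indicator_of_notMem (by exact hn)]
      rw [← lintegral_indicator (g.measurableSet_bel_apply _), lintegral_congr h2, funext h2]
      refine ih _ (Measurable.indicator ?_ (g.measurableSet_bel_apply _))
      exact (hF.comp (g.measurable_ins i)).comp measurable_prodMk_left
  rw [hadd F hF]
  have h3 : ∀ y, F y = ∑' n, {y | g.len y = n}.indicator F y := by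
    intro y
    rw [tsum_eq_single (g.len y)]
    · rw [indicator_of_mem (by rfl)]
    · intro n hn
      rw [indicator_of_notMem (by exact fun h => hn h.symm)]
  rw [lintegral_congr h3, lintegral_tsum fun n => (hF.indicator (ml n)).aemeasurable]
  exact tsum_congr fun n => key n F hF

end Growth

/-! ### Partitions of a chain into three parts. -/

namespace Chain

variable {Z : Type*} [MeasurableSpace Z] {τ : Z → ℝ}

/-- Chains as configurations. -/
def growth (hτ : Measurable τ) : Growth τ (Chain τ) Unit where
  e := empty τ
  ins _ p := (single τ p.1).union p.2
  measurable_ins _ := (measurable_union hτ).comp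
      (((measurable_single hτ).comp measurable_fst).prodMk measurable_snd)
  bel := below τ
  measurableSet_bel := measurableSet_below_prod hτ
  e_mem := empty_mem_below
  ins_mem _ _ _ _ h := single_union_mem_below h
  bel_mono _ _ h := below_mono h
  len := len
  measurable_len := measurable_len
  len_e := rfl
  len_ins _ _ _ h := len_single_union h

theorem growth_rec (hτ : Measurable τ) (μ : Measure Z) [SigmaFinite μ] :
    (growth hτ).Rec μ (measure τ μ) := by
  have := sigmaFinite_measure hτ μ
  intro F hF
  rw [Finset.univ_unique, Finset.sum_singleton, (growth hτ).setLIntegral_before hτ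
    (hF.fun_comp ((growth hτ).measurable_ins _))]
  exact lintegral_measure_rec hτ μ hF

/-- The points of the chain `w` with the colour `k`. -/
def col {K : Type*} [DecidableEq K] (w : Chain τ) (c : Fin w.len → K) (k : K) : Chain τ :=
  w.sub (Finset.univ.filter fun i => c i = k)

section
omit [MeasurableSpace Z]

theorem support_col {K : Type*} [DecidableEq K] (w : Chain τ) (c : Fin w.len → K) (k : K) :
    (w.col c k).support = w.pt '' {i | c i = k} := by
  rw [col, support_sub]; simp

theorem support_col_subset {K : Type*} [DecidableEq K] (w : Chain τ) (c : Fin w.len → K) (k : K) :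
    (w.col c k).support ⊆ w.support := by
  rw [support_col]; exact image_subset_range _ _

theorem col_snoc {K : Type*} [DecidableEq K] {n : ℕ} (y : Fin n → Z) (z : Z)
    (h : StrictMono (τ ∘ Fin.snoc (α := fun _ => Z) y z)) (c : Fin n → K) (k k' : K) :
    (ofFn _ h).col (Fin.snoc (α := fun _ => K) c k) k' =
      if k = k' then (single τ z).union ((ofFn y (strictMono_snoc.1 h).1).col c k')
      else (ofFn y (strictMono_snoc.1 h).1).col c k' := by
  have hb : (ofFn y (strictMono_snoc.1 h).1).col c k' ∈ below τ (τ z) := by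
    refine mem_below_iff.2 fun a ha => ?_
    obtain ⟨i, rfl⟩ := support_col_subset _ _ _ ha
    exact (strictMono_snoc.1 h).2 i
  refine ext_support ?_
  have e1 : ((ofFn _ h).col (Fin.snoc (α := fun _ => K) c k) k').support =
      (Fin.snoc (α := fun _ => Z) y z) '' {i | Fin.snoc (α := fun _ => K) c k i = k'} :=
    support_col _ _ _
  have e2 : ((ofFn y (strictMono_snoc.1 h).1).col c k').support = y '' {i | c i = k'} :=
    support_col _ _ _
  rw [e1]
  split_ifs with hk
  · rw [support_union (single_apart_of_below hb), support_single, e2]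
    ext a
    simp only [mem_image, mem_ofPred_eq, singleton_union, mem_insert_iff]
    constructor
    · rintro ⟨i, hi, rfl⟩
      induction i using Fin.lastCases with
      | last => left; simp
      | cast i => right; exact ⟨i, by simpa using hi, by simp⟩
    · rintro (rfl | ⟨i, hi, rfl⟩)
      · exact ⟨Fin.last n, by simpa using hk, by simp⟩
      · exact ⟨i.castSucc, by simpa using hi, by simp⟩
  · rw [e2]
    ext a
    simp only [mem_image, mem_ofPred_eq]
    constructor
    · rintro ⟨i, hi, rfl⟩
      induction i using Fin.lastCases with
      | last => simp at hi; exact (hk hi).elim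
      | cast i => exact ⟨i, by simpa using hi, by simp⟩
    · rintro ⟨i, hi, rfl⟩
      exact ⟨i.castSucc, by simpa using hi, by simp⟩

end

theorem measurable_col_piece {n : ℕ} {K : Type*} [DecidableEq K] (c : Fin n → K) (k : K) :
    Measurable fun z : Piece τ n => (ofPiece z).col c k :=
  measurable_sub_piece (τ := τ) (Finset.univ.filter fun i => c i = k)

/-- Summation over all partitions of a chain into three parts. -/
def sumParts (F : Chain τ × Chain τ × Chain τ → ℝ≥0∞) (w : Chain τ) : ℝ≥0∞ :=
  ∑ c : Fin w.len → Fin 3, F (w.col c 0, w.col c 1, w.col c 2)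

theorem measurable_sumParts {F : Chain τ × Chain τ × Chain τ → ℝ≥0∞} (hF : Measurable F) :
    Measurable (sumParts F) := by
  refine measurable_of_pieces fun n => ?_
  change Measurable fun z : Piece τ n => ∑ c : Fin n → Fin 3,
    F ((ofPiece z).col c 0, (ofPiece z).col c 1, (ofPiece z).col c 2)
  refine Finset.measurable_fun_sum _ fun c _ => hF.fun_comp (?_ : Measurable fun z : Piece τ n =>
    ((ofPiece z).col c 0, (ofPiece z).col c 1, (ofPiece z).col c 2))
  exact (measurable_col_piece c _).prodMk ((measurable_col_piece c _).prodMk (measurable_col_piece c _))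

omit [MeasurableSpace Z] in
theorem sumParts_empty (F : Chain τ × Chain τ × Chain τ → ℝ≥0∞) :
    sumParts F (empty τ) = F (empty τ, empty τ, empty τ) := by
  have h : ∀ c : Fin (empty τ).len → Fin 3, ∀ k, (empty τ).col c k = empty τ := fun c k =>
    eq_empty_of_support (subset_empty_iff.1 ((support_col_subset _ c k).trans (by simp)))
  simp only [sumParts, h]
  change ∑ c : Fin 0 → Fin 3, _ = _
  simp

omit [MeasurableSpace Z] in
-- A colouring of the enlarged chain is a colouring of `w` together with one of three colours for
-- the new point, and that point joins the part of its colour.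
theorem sumParts_single_union (F : Chain τ × Chain τ × Chain τ → ℝ≥0∞) (z : Z) (w : Chain τ)
    (hw : w ∈ below τ (τ z)) :
    sumParts F ((single τ z).union w) =
      sumParts (fun p => F ((single τ z).union p.1, p.2.1, p.2.2)) w +
      (sumParts (fun p => F (p.1, (single τ z).union p.2.1, p.2.2)) w +
        sumParts (fun p => F (p.1, p.2.1, (single τ z).union p.2.2)) w) := by
  obtain ⟨n, y, hy⟩ := w
  have h : StrictMono (τ ∘ Fin.snoc (α := fun _ => Z) y z) := strictMono_snoc.2 ⟨hy, hw⟩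
  have e : (single τ z).union (ofFn y hy) = ofFn _ h := (ofFn_snoc y z h).symm
  change sumParts F ((single τ z).union (ofFn y hy)) = sumParts _ (ofFn y hy) +
    (sumParts _ (ofFn y hy) + sumParts _ (ofFn y hy))
  rw [e]
  simp only [sumParts]
  change ∑ c : Fin (n + 1) → Fin 3, F ((ofFn _ h).col c 0, (ofFn _ h).col c 1, (ofFn _ h).col c 2) =
    ∑ c : Fin n → Fin 3, F ((single τ z).union ((ofFn y hy).col c 0),
      (ofFn y hy).col c 1, (ofFn y hy).col c 2) +
    (∑ c : Fin n → Fin 3, F ((ofFn y hy).col c 0, (single τ z).union ((ofFn y hy).col c 1),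
      (ofFn y hy).col c 2) +
    ∑ c : Fin n → Fin 3, F ((ofFn y hy).col c 0, (ofFn y hy).col c 1,
      (single τ z).union ((ofFn y hy).col c 2)))
  rw [← (Fin.snocEquiv (fun _ : Fin (n + 1) => Fin 3)).sum_comp, Fintype.sum_prod_type_right,
    ← Finset.sum_add_distrib, ← Finset.sum_add_distrib]
  refine Finset.sum_congr rfl fun c _ => ?_
  have hs : ∀ k, Fin.snocEquiv (fun _ : Fin (n + 1) => Fin 3) (k, c) =
    Fin.snoc (α := fun _ => Fin 3) c k := fun k => rfl
  simp only [hs, col_snoc, Fin.sum_univ_three]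
  simp [add_assoc]

/-- Integration over triples of chains is integration over chains partitioned into three parts. -/
theorem lintegral_prod_prod_eq (hτ : Measurable τ) (μ : Measure Z) [SigmaFinite μ]
    (h0 : ∀ s, μ {z | τ z = s} = 0) {F : Chain τ × Chain τ × Chain τ → ℝ≥0∞} (hF : Measurable F) :
    ∫⁻ p, F p ∂((measure τ μ).prod ((measure τ μ).prod (measure τ μ))) =
      ∫⁻ w, sumParts F w ∂(measure τ μ) := by
  have := sigmaFinite_measure hτ μ
  let g := growth hτ
  have hr := (growth_rec hτ μ).prod ((growth_rec hτ μ).prod (growth_rec hτ μ) hτ h0) hτ h0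
  -- Both sides satisfy the same recursion. The latest point of a triple lies in one of three
  -- chains; the latest point of `w` has one of three colours.
  refine hr.eq_of_rec hτ (fun F => ∫⁻ w, sumParts F w ∂(measure τ μ)) ?_ ?_ ?_ hF
  · simp [sumParts]
  · intro F hF
    have hU := measurable_union hτ
    have hS := measurable_single hτ
    have m1 : ∀ i, Measurable ((g.prod (g.prod g)).ins i) := (g.prod (g.prod g)).measurable_ins
    rw [lintegral_measure_rec hτ μ (measurable_sumParts hF), sumParts_empty]
    congr 1
    have h1 : ∀ i z w, sumParts (((g.prod (g.prod g)).bel (τ z)).indicator fun y =>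
        F ((g.prod (g.prod g)).ins i (z, y))) w = (below τ (τ z)).indicator
          (sumParts fun y => F ((g.prod (g.prod g)).ins i (z, y))) w := by
      intro i z w
      by_cases hw : w ∈ below τ (τ z)
      · rw [indicator_of_mem hw]
        refine Finset.sum_congr rfl fun c _ => ?_
        have hb : ∀ k, w.col c k ∈ below τ (τ z) := fun k =>
          mem_below_iff.2 fun a ha => mem_below_iff.1 hw a (support_col_subset _ _ _ ha)
        rw [indicator_of_mem]
        exact ⟨hb 0, hb 1, hb 2⟩
      · rw [indicator_of_notMem hw]
        -- Every point of `w` has a colour, so three parts before `z` would force `w` itself to lie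
        -- before `z`.
        refine Finset.sum_eq_zero fun c _ => ?_
        rw [indicator_of_notMem]
        rintro ⟨h0, h1, h2⟩
        refine hw fun i => ?_
        have hk : w.pt i ∈ (w.col c (c i)).support := by
          rw [support_col]; exact mem_image_of_mem _ rfl
        have : ∀ k, w.col c k ∈ below τ (τ z) := fun k => by fin_cases k <;> assumption
        exact mem_below_iff.1 (this (c i)) _ hk
    have h2 : ∀ i z, ∫⁻ w, sumParts (((g.prod (g.prod g)).bel (τ z)).indicator fun y =>
        F ((g.prod (g.prod g)).ins i (z, y))) w ∂(measure τ μ) = ∫⁻ w in below τ (τ z),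
          sumParts (fun y => F ((g.prod (g.prod g)).ins i (z, y))) w ∂(measure τ μ) := by
      intro i z
      rw [← lintegral_indicator (measurableSet_below hτ _)]
      exact lintegral_congr (h1 i z)
    have h3 : ∀ i, Measurable fun z => ∫⁻ w in below τ (τ z),
        sumParts (fun y => F ((g.prod (g.prod g)).ins i (z, y))) w ∂(measure τ μ) := by
      intro i
      have : ∀ z, ∫⁻ w in below τ (τ z),
          sumParts (fun y => F ((g.prod (g.prod g)).ins i (z, y))) w ∂(measure τ μ) =
          ∫⁻ w, {q : Z × Chain τ | q.2 ∈ below τ (τ q.1)}.indicator (fun q =>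
            sumParts (fun y => F ((g.prod (g.prod g)).ins i (q.1, y))) q.2) (z, w)
            ∂(measure τ μ) := fun z => by
        rw [← lintegral_indicator (measurableSet_below hτ _)]; rfl
      simp_rw [this]
      refine Measurable.lintegral_prod_right' (Measurable.indicator ?_ ?_)
      · refine measurable_prod_pieces fun n => ?_
        change Measurable fun z : Z × Piece τ n => ∑ c : Fin n → Fin 3,
          F ((g.prod (g.prod g)).ins i (z.1, ((ofPiece z.2).col c 0, (ofPiece z.2).col c 1,
            (ofPiece z.2).col c 2)))
        refine Finset.measurable_fun_sum _ fun c _ => (hF.fun_comp (m1 i)).fun_comp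
          (measurable_fst.prodMk (?_ : Measurable fun z : Z × Piece τ n =>
            ((ofPiece z.2).col c 0, (ofPiece z.2).col c 1, (ofPiece z.2).col c 2)))
        exact ((measurable_col_piece c _).comp measurable_snd).prodMk
          (((measurable_col_piece c _).comp measurable_snd).prodMk
            ((measurable_col_piece c _).comp measurable_snd))
      · exact (measurableSet_below_prod hτ).preimage (f := fun q : Z × Chain τ => (τ q.1, q.2))
          (by fun_prop)
    have h4 : ∀ i z, Measurable (sumParts fun y => F ((g.prod (g.prod g)).ins i (z, y))) :=
      fun i z => measurable_sumParts ((hF.comp (m1 i)).comp measurable_prodMk_left)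
    refine Eq.trans ?_ (Finset.sum_congr rfl fun i _ => lintegral_congr fun z => (h2 i z).symm)
    rw [← lintegral_finsetSum _ fun i _ => h3 i]
    refine lintegral_congr fun z => ?_
    rw [← lintegral_finsetSum _ fun i _ => h4 i z]
    refine setLIntegral_congr_fun (measurableSet_below hτ _) fun w hw => ?_
    simp only [Fintype.sum_sum_type, Finset.univ_unique, Finset.sum_singleton]
    exact sumParts_single_union F z w hw
  · intro F hF
    have ml := fun n => (g.prod (g.prod g)).measurable_len (measurableSet_singleton n)
    rw [← lintegral_tsum]
    · refine lintegral_congr fun w => ?_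
      simp only [sumParts]
      rw [Summable.tsum_finsetSum fun _ _ => ENNReal.summable]
      refine Finset.sum_congr rfl fun c _ => ?_
      rw [tsum_eq_single ((g.prod (g.prod g)).len (w.col c 0, w.col c 1, w.col c 2))]
      · rw [indicator_of_mem (by rfl)]
      · intro n hn
        rw [indicator_of_notMem (by exact fun h => hn h.symm)]
    · exact fun n => (measurable_sumParts (hF.indicator (ml n))).aemeasurable

end Chain

/-! ### Marked chains over the noise space. -/

variable {X : Type*} [MeasurableSpace X] (S : NoiseSpace X)

/-- On sets of finite measure the disintegration, tested on the indicator of `{s}`, yields a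
Lebesgue integral over one point. This is the source of every statement that chains are almost
surely apart. -/
theorem NoiseSpace.measure_time_eq (s : ℝ) : S.μ {x | S.time x = s} = 0 := by
  have hs : MeasurableSet {x | S.time x = s} := S.measurable_time (measurableSet_singleton s)
  have h : ∀ n, S.μ (spanningSets S.μ n ∩ {x | S.time x = s}) = 0 := by
    intro n
    have h1 := S.disintegration (spanningSets S.μ n) (measurableSet_spanningSets _ _)
      (measure_spanningSets_lt_top _ _) (indicator {s} 1)
      (measurable_one.indicator (measurableSet_singleton s))
    have h2 : ∀ x, indicator {s} (1 : ℝ → ℝ≥0∞) (S.time x) = indicator {x | S.time x = s} 1 x :=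
      fun x => rfl
    have h3 : ∀ᵐ r ∂(volume.restrict (Ici (0 : ℝ))), r ≠ s :=
      ae_restrict_of_ae (by simp [ae_iff])
    rw [lintegral_congr h2, lintegral_indicator_one hs, Measure.restrict_apply hs, inter_comm] at h1
    rw [h1]
    refine (lintegral_congr_ae ?_).trans lintegral_zero
    filter_upwards [h3] with r hr
    rw [indicator_of_notMem (by exact hr), zero_mul]
  have : {x | S.time x = s} = ⋃ n, spanningSets S.μ n ∩ {x | S.time x = s} := by
    rw [← iUnion_inter, iUnion_spanningSets, univ_inter]
  rw [this]
  exact measure_iUnion_null h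

theorem NoiseSpace.measurable_markedTime : Measurable S.markedTime :=
  S.measurable_time.comp measurable_fst

theorem NoiseSpace.measurableSet_marked : MeasurableSet {p : X × ℕ | p.2 ∈ S.idx p.1} := by
  have : {p : X × ℕ | p.2 ∈ S.idx p.1} = ⋃ i : ℕ, {x | i ∈ S.idx x} ×ˢ {i} := by
    ext ⟨x, i⟩; simp
  rw [this]
  exact MeasurableSet.iUnion fun i => (S.measurable_idx i).prod (measurableSet_singleton i)

instance : SigmaFinite S.markedMeasure := by
  unfold NoiseSpace.markedMeasure; infer_instance

theorem NoiseSpace.markedMeasure_time_eq (s : ℝ) :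
    S.markedMeasure {p | S.markedTime p = s} = 0 := by
  refine le_antisymm ((Measure.restrict_apply_le _ _).trans ?_) zero_le
  have : {p : X × ℕ | S.markedTime p = s} = {x | S.time x = s} ×ˢ univ := by
    ext p; simp [NoiseSpace.markedTime]
  rw [this, Measure.prod_prod, S.measure_time_eq, zero_mul]

theorem lintegral_markedMeasure {F : X × ℕ → ℝ≥0∞} (hF : Measurable F) :
    ∫⁻ p, F p ∂S.markedMeasure = ∫⁻ x, ∑' m : S.idx x, F (x, m) ∂S.μ := by
  rw [NoiseSpace.markedMeasure, ← lintegral_indicator S.measurableSet_marked,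
    lintegral_prod _ (hF.indicator S.measurableSet_marked).aemeasurable]
  refine lintegral_congr fun x => ?_
  rw [lintegral_count, tsum_subtype (S.idx x) (fun m => F (x, m))]
  rfl

instance : SigmaFinite (chM S) := Chain.sigmaFinite_measure S.measurable_time S.μ
instance : SigmaFinite (mchM S) := Chain.sigmaFinite_measure S.measurable_markedTime S.markedMeasure

@[simp] theorem support_base (y : MCh S) : (base S y).support = Prod.fst '' y.support := by
  change range (fun i => (y.pt i).1) = _
  rw [Chain.support, ← range_comp]; rfl

@[simp] theorem len_base (y : MCh S) : (base S y).len = y.len := rfl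

@[simp] theorem support_inCh (y : MCh S) (σ : Ch S) :
    (inCh S y σ).support = y.support ∩ {p | p.1 ∈ σ.support} := Chain.support_inside _ _

@[simp] theorem support_offCh (y : MCh S) (σ : Ch S) :
    (offCh S y σ).support = y.support \ {p | p.1 ∈ σ.support} := Chain.support_outside _ _

theorem base_mem_below {t : ℝ} {y : MCh S} :
    base S y ∈ Chain.below S.time t ↔ y ∈ Chain.below S.markedTime t := Iff.rfl

theorem base_apart {y z : MCh S} : (base S y).Apart (base S z) ↔ y.Apart z := by
  simp only [Chain.Apart, support_base, forall_mem_image]; rfl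

@[simp] theorem base_empty : base S (Chain.empty S.markedTime) = Chain.empty S.time :=
  Chain.eq_empty_of_support (by simp)

@[simp] theorem base_single (p : X × ℕ) :
    base S (Chain.single S.markedTime p) = Chain.single S.time p.1 :=
  Chain.ext_support (by simp)

theorem base_union {y z : MCh S} (h : y.Apart z) :
    base S (y.union z) = (base S y).union (base S z) := by
  refine Chain.ext_support ?_
  rw [Chain.support_union ((base_apart S).2 h), support_base, Chain.support_union h, image_union,
    support_base, support_base]

theorem measurable_base : Measurable (base S) := by
  refine Chain.measurable_of_pieces fun n => (Chain.measurable_ofPiece n).comp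
    (Measurable.subtype_mk (measurable_pi_lambda _ fun i => ?_))
  exact measurable_fst.comp (Chain.measurable_piece_apply i)

/-- The marked chains over `σ`. -/
def fiber (σ : Ch S) : Set (MCh S) := {y | base S y = σ ∧ ∀ p ∈ y.support, p.2 ∈ S.idx p.1}

theorem len_eq_of_mem_fiber {σ : Ch S} {y : MCh S} (hy : y ∈ fiber S σ) :
    Chain.len σ = Chain.len y := by
  rw [← hy.1, len_base]

/-- The marked chains over `σ` as marks. -/
def fiberEquiv (σ : Ch S) : {m : Fin σ.len → ℕ // ∀ i, m i ∈ S.idx (σ.pt i)} ≃ fiber S σ where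
  toFun m := ⟨attach S σ m.1, rfl, by rintro _ ⟨i, rfl⟩; exact m.2 i⟩
  invFun y := ⟨fun i => (y.1.pt (i.cast (len_eq_of_mem_fiber S y.2))).2, fun i => by
    obtain ⟨y, rfl, hy⟩ := y
    exact hy (Chain.pt y i) (mem_range_self (f := Chain.pt y) i)⟩
  left_inv m := rfl
  right_inv y := by
    obtain ⟨y, rfl, hy⟩ := y
    rfl

theorem lintegral_fibM (σ : Ch S) {F : MCh S → ℝ≥0∞} (hF : Measurable F) :
    ∫⁻ y, F y ∂(fibM S σ) = ∑' y : fiber S σ, F y := by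
  rw [fibM, lintegral_sum_measure, ← (fiberEquiv S σ).tsum_eq]
  exact tsum_congr fun m => lintegral_dirac' _ hF

theorem lintegral_fibM_marks (σ : Ch S) {F : MCh S → ℝ≥0∞} (hF : Measurable F) :
    ∫⁻ y, F y ∂(fibM S σ) = ∑' m : Fin σ.len → ℕ,
      {m : Fin σ.len → ℕ | ∀ i, m i ∈ S.idx (σ.pt i)}.indicator (fun m => F (attach S σ m)) m := by
  rw [fibM, lintegral_sum_measure, ← tsum_subtype]
  exact tsum_congr fun m => lintegral_dirac' _ hF

theorem measurable_attach_piece (n : ℕ) (m : Fin n → ℕ) :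
    Measurable fun z : Chain.Piece S.time n => attach S (Chain.ofPiece z) m := by
  have h : Measurable fun z : Chain.Piece S.time n =>
      (⟨fun i => (z.1 i, m i), z.2⟩ : Chain.Piece S.markedTime n) :=
    Measurable.subtype_mk (measurable_pi_lambda _ fun i =>
      (Chain.measurable_piece_apply i).prodMk measurable_const)
  exact (Chain.measurable_ofPiece n).comp h

/-- For fixed length the admissible marks depend on the chain, but they range over the fixed
countable set `Fin n → ℕ`; admissibility becomes a measurable indicator in a countable sum. -/
theorem measurable_lintegral_fibM_prod {Ω : Type*} [MeasurableSpace Ω] {G : Ω × MCh S → ℝ≥0∞}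
    (hG : Measurable G) : Measurable fun p : Ω × Ch S => ∫⁻ y, G (p.1, y) ∂(fibM S p.2) := by
  refine Chain.measurable_prod_pieces fun n => ?_
  have h : ∀ p : Ω × Chain.Piece S.time n, ∫⁻ y, G (p.1, y) ∂(fibM S (Chain.ofPiece p.2)) =
      ∑' m : Fin n → ℕ, {p : Ω × Chain.Piece S.time n | ∀ i, m i ∈ S.idx (p.2.1 i)}.indicator
        (fun p => G (p.1, attach S (Chain.ofPiece p.2) m)) p := by
    intro p
    refine (lintegral_fibM_marks S (Chain.ofPiece p.2) (F := fun y => G (p.1, y))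
      (hG.comp measurable_prodMk_left)).trans ?_
    refine tsum_congr fun m => ?_
    rfl
  simp_rw [h]
  refine Measurable.tsum fun m => Measurable.indicator ?_ ?_
  · exact hG.comp (measurable_fst.prodMk ((measurable_attach_piece S n m).comp measurable_snd))
  · have : {p : Ω × Chain.Piece S.time n | ∀ i, m i ∈ S.idx (p.2.1 i)} =
        ⋂ i, (fun p : Ω × Chain.Piece S.time n => p.2.1 i) ⁻¹' {x | m i ∈ S.idx x} := by
      ext; simp
    rw [this]
    exact MeasurableSet.iInter fun i =>
      ((Chain.measurable_piece_apply i).comp measurable_snd) (S.measurable_idx (m i))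

theorem measurable_lintegral_fibM {Ω : Type*} [MeasurableSpace Ω] {G : Ω × MCh S → ℝ≥0∞}
    (hG : Measurable G) {s : Ω → Ch S} (hs : Measurable s) :
    Measurable fun ω => ∫⁻ y, G (ω, y) ∂(fibM S (s ω)) := by
  have h2 : Measurable fun ω => (ω, s ω) := measurable_id.prodMk hs
  have h3 := (measurable_lintegral_fibM_prod S hG).comp h2
  simp only [Function.comp_def] at h3
  exact h3

section
variable [MeasurableSingletonClass X]

/-- The measure is the image of a counting measure on a countable set under an injective map. Since
singletons are measurable, this map is a measurable embedding. -/
instance (σ : Ch S) : SigmaFinite (fibM S σ) := by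
  let f : {m : Fin σ.len → ℕ // ∀ i, m i ∈ S.idx (σ.pt i)} → MCh S := fun m => attach S σ m.1
  have hf : MeasurableEmbedding f := by
    refine ⟨?_, measurable_of_countable _, fun {s} _ => (s.to_countable.image f).measurableSet⟩
    intro m m' h
    have h2 : ∀ y : fiber S σ, f ((fiberEquiv S σ).symm y) = y := fun y =>
      congrArg Subtype.val ((fiberEquiv S σ).apply_symm_apply y)
    have h3 : fiberEquiv S σ m = fiberEquiv S σ m' := Subtype.ext h
    exact (fiberEquiv S σ).injective h3
  have h : fibM S σ = (Measure.count).map f := by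
    rw [fibM, Measure.count, Measure.map_sum hf.measurable.aemeasurable]
    congr 1
    funext m
    rw [Measure.map_dirac' hf.measurable]
  rw [h]
  exact hf.sigmaFinite_map

theorem ae_fibM_iff {σ : Ch S} {p : MCh S → Prop} :
    (∀ᵐ y ∂(fibM S σ), p y) ↔ ∀ y ∈ fiber S σ, p y := by
  rw [fibM, Measure.ae_sum_iff]
  simp only [ae_dirac_eq, Filter.eventually_pure]
  constructor
  · intro h y hy
    have := h ((fiberEquiv S σ).symm ⟨y, hy⟩)
    have h2 : attach S σ ((fiberEquiv S σ).symm ⟨y, hy⟩).1 = y :=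
      congrArg Subtype.val ((fiberEquiv S σ).apply_symm_apply ⟨y, hy⟩)
    rwa [h2] at this
  · intro h m
    exact h _ (fiberEquiv S σ m).2

theorem ae_mem_fiber (σ : Ch S) : ∀ᵐ y ∂(fibM S σ), y ∈ fiber S σ :=
  (ae_fibM_iff S).2 fun _ h => h

instance (σ ρ : Ch S) : SigmaFinite (vecM S σ ρ) := by unfold vecM; infer_instance

end

theorem fiber_empty : fiber S (Chain.empty S.time) = {Chain.empty S.markedTime} := by
  ext y
  simp only [fiber, mem_ofPred_eq, mem_singleton_iff]
  constructor
  · rintro ⟨h, -⟩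
    exact Chain.eq_empty_of_len (by rw [← len_base, h]; rfl)
  · rintro rfl; simp

theorem fiber_single (x : X) :
    fiber S (Chain.single S.time x) = (fun m => Chain.single S.markedTime (x, m)) '' S.idx x := by
  ext y
  simp only [fiber, mem_ofPred_eq, mem_image]
  constructor
  · rintro ⟨h, h2⟩
    have hl : y.len = 1 := by rw [← len_base, h]; rfl
    obtain ⟨n, y, hy⟩ := y
    obtain rfl : n = 1 := hl
    have hx : (y 0).1 = x := by
      have : (y 0).1 ∈ (base S ⟨1, y, hy⟩).support := mem_range_self (0 : Fin 1)
      rw [h] at this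
      simpa using this
    refine ⟨(y 0).2, hx ▸ h2 _ (mem_range_self (0 : Fin 1)), ?_⟩
    refine Chain.ext_support ?_
    rw [Chain.support_single]
    change _ = range y
    rw [range_unique]
    congr 1
    exact Prod.ext hx.symm rfl
  · rintro ⟨m, hm, rfl⟩
    simpa using hm

theorem fibM_empty : fibM S (Chain.empty S.time) = Measure.dirac (Chain.empty S.markedTime) := by
  refine Measure.ext_of_lintegral _ fun F hF => ?_
  rw [lintegral_fibM S _ hF, lintegral_dirac' _ hF, fiber_empty]
  exact tsum_singleton _ F

theorem lintegral_fibM_single (x : X) {F : MCh S → ℝ≥0∞} (hF : Measurable F) :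
    ∫⁻ y, F y ∂(fibM S (Chain.single S.time x)) =
      ∑' m : S.idx x, F (Chain.single S.markedTime (x, m)) := by
  rw [lintegral_fibM S _ hF, fiber_single]
  refine tsum_image F ?_
  intro m _ m' _ h
  have := congrArg Chain.support h
  simpa using this

theorem fiber_apart {κ σ : Ch S} (h : κ.Apart σ) {y z : MCh S} (hy : y ∈ fiber S κ)
    (hz : z ∈ fiber S σ) : y.Apart z := by
  rw [← base_apart, hy.1, hz.1]; exact h

theorem inCh_union {κ σ : Ch S} (h : κ.Apart σ) {y z : MCh S} (hy : y ∈ fiber S κ)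
    (hz : z ∈ fiber S σ) : inCh S (y.union z) κ = y ∧ offCh S (y.union z) κ = z := by
  have ha := fiber_apart S h hy hz
  have h1 : ∀ p ∈ y.support, p.1 ∈ κ.support := fun p hp => by
    rw [← hy.1, support_base]; exact mem_image_of_mem _ hp
  have h2 : ∀ p ∈ z.support, p.1 ∉ κ.support := fun p hp hk => by
    have : p.1 ∈ σ.support := by rw [← hz.1, support_base]; exact mem_image_of_mem _ hp
    exact disjoint_left.1 h.disjoint hk this
  constructor
  · refine Chain.ext_support ?_
    rw [support_inCh, Chain.support_union ha]
    ext p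
    constructor
    · rintro ⟨hp | hp, hk⟩
      · exact hp
      · exact (h2 p hp hk).elim
    · exact fun hp => ⟨Or.inl hp, h1 p hp⟩
  · refine Chain.ext_support ?_
    rw [support_offCh, Chain.support_union ha]
    ext p
    constructor
    · rintro ⟨hp | hp, hk⟩
      · exact (hk (h1 p hp)).elim
      · exact hp
    · exact fun hp => ⟨Or.inr hp, h2 p hp⟩

theorem union_mem_fiber {κ σ : Ch S} (h : κ.Apart σ) {y z : MCh S} (hy : y ∈ fiber S κ)
    (hz : z ∈ fiber S σ) : y.union z ∈ fiber S (κ.union σ) := by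
  have ha := fiber_apart S h hy hz
  refine ⟨by rw [base_union S ha, hy.1, hz.1], ?_⟩
  rw [Chain.support_union ha]
  rintro p (hp | hp)
  · exact hy.2 p hp
  · exact hz.2 p hp

theorem inCh_apart_offCh (y : MCh S) (κ : Ch S) : (inCh S y κ).Apart (offCh S y κ) := by
  intro a ha b hb hab
  rw [support_inCh] at ha
  rw [support_offCh] at hb
  obtain rfl := y.injOn_support ha.1 hb.1 hab
  exact hb.2 ha.2

theorem inCh_union_offCh (y : MCh S) (κ : Ch S) : (inCh S y κ).union (offCh S y κ) = y := by
  refine Chain.ext_support ?_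
  rw [Chain.support_union (inCh_apart_offCh S y κ)]
  simp [inter_union_sdiff]

theorem inCh_mem_fiber {κ σ : Ch S} (h : κ.Apart σ) {y : MCh S} (hy : y ∈ fiber S (κ.union σ)) :
    inCh S y κ ∈ fiber S κ ∧ offCh S y κ ∈ fiber S σ := by
  have hs : Prod.fst '' y.support = κ.support ∪ σ.support := by
    rw [← support_base, hy.1, Chain.support_union h]
  refine ⟨⟨Chain.ext_support ?_, fun p hp => hy.2 p (by rw [support_inCh] at hp; exact hp.1)⟩,
    ⟨Chain.ext_support ?_, fun p hp => hy.2 p (by rw [support_offCh] at hp; exact hp.1)⟩⟩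
  · rw [support_base, support_inCh]
    ext x
    constructor
    · rintro ⟨p, ⟨_, hk⟩, rfl⟩; exact hk
    · intro hx
      have : x ∈ Prod.fst '' y.support := hs ▸ Or.inl hx
      obtain ⟨p, hp, rfl⟩ := this
      exact ⟨p, ⟨hp, hx⟩, rfl⟩
  · rw [support_base, support_offCh]
    ext x
    constructor
    · rintro ⟨p, ⟨hp, hk⟩, rfl⟩
      have : p.1 ∈ κ.support ∪ σ.support := hs ▸ mem_image_of_mem _ hp
      exact this.resolve_left hk
    · intro hx
      have : x ∈ Prod.fst '' y.support := hs ▸ Or.inr hx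
      obtain ⟨p, hp, rfl⟩ := this
      exact ⟨p, ⟨hp, fun hk => disjoint_left.1 h.disjoint hk hx⟩, rfl⟩

/-- Marked chains over a disjoint union. -/
def fiberUnionEquiv {κ σ : Ch S} (h : κ.Apart σ) :
    fiber S κ × fiber S σ ≃ fiber S (κ.union σ) where
  toFun p := ⟨p.1.1.union p.2.1, union_mem_fiber S h p.1.2 p.2.2⟩
  invFun y := (⟨_, (inCh_mem_fiber S h y.2).1⟩, ⟨_, (inCh_mem_fiber S h y.2).2⟩)
  left_inv p := by
    have := inCh_union S h p.1.2 p.2.2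
    exact Prod.ext (Subtype.ext this.1) (Subtype.ext this.2)
  right_inv y := Subtype.ext (inCh_union_offCh S y.1 κ)

theorem measurable_munion : Measurable fun p : MCh S × MCh S => p.1.union p.2 :=
  Chain.measurable_union S.measurable_markedTime

/-- The product frame over a disjoint union consists of the products of frame vectors over the two
chains. -/
theorem lintegral_fibM_union {κ σ : Ch S} (h : κ.Apart σ) {F : MCh S → ℝ≥0∞} (hF : Measurable F) :
    ∫⁻ y, F y ∂(fibM S (κ.union σ)) =
      ∫⁻ y, ∫⁻ z, F (y.union z) ∂(fibM S σ) ∂(fibM S κ) := by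
  have hU := measurable_munion S
  have h1 : ∀ y : MCh S, ∫⁻ z, F (y.union z) ∂(fibM S σ) = ∑' z : fiber S σ, F (y.union z) := fun y =>
    lintegral_fibM S σ (hF.comp (hU.comp measurable_prodMk_left))
  rw [lintegral_fibM S κ (measurable_lintegral_fibM S
    (G := fun p : MCh S × MCh S => F (p.1.union p.2)) (hF.comp hU) measurable_const), lintegral_fibM S _ hF, ← (fiberUnionEquiv S h).tsum_eq,
    ENNReal.tsum_prod']
  exact tsum_congr fun y => (h1 y).symm

/-- Integration over marked chains is integration over chains and over marks. -/
theorem lintegral_mchM {F : MCh S → ℝ≥0∞} (hF : Measurable F) :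
    ∫⁻ y, F y ∂(mchM S) = ∫⁻ σ, ∫⁻ y, F y ∂(fibM S σ) ∂(chM S) := by
  have hU := measurable_munion S
  have hS := Chain.measurable_single S.measurable_markedTime
  have hr := Chain.growth_rec S.measurable_markedTime S.markedMeasure
  have : SFinite (Chain.measure S.markedTime S.markedMeasure) := inferInstanceAs (SFinite (mchM S))
  -- Uniqueness of the recursion on marked chains. The latest marked point is `(x, m)` with `m` in
  -- `idx x`; summing over `m` and over the marks of the earlier chain `σ` gives the sum over all
  -- marks of the chain `x ⊔ σ`.
  refine hr.eq_of_rec S.measurable_markedTime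
    (fun F => ∫⁻ σ, ∫⁻ y, F y ∂(fibM S σ) ∂(chM S)) (by simp) ?_ ?_ hF
  · intro F hF
    have hm : Measurable fun σ : Ch S => ∫⁻ y, F y ∂(fibM S σ) := measurable_lintegral_fibM S
      (G := fun p : Ch S × MCh S => F p.2) (hF.comp measurable_snd) measurable_id
    rw [chM, Chain.lintegral_measure_rec S.measurable_time S.μ hm, fibM_empty,
      lintegral_dirac' _ hF]
    congr 1
    rw [Finset.univ_unique, Finset.sum_singleton]
    let G : (X × ℕ) × MCh S → ℝ≥0∞ := {q | q.2 ∈ Chain.below S.markedTime (S.markedTime q.1)}.indicator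
      fun q => F ((Chain.single S.markedTime q.1).union q.2)
    have hG : Measurable G := by
      refine Measurable.indicator (by fun_prop) ?_
      exact (Chain.measurableSet_below_prod S.measurable_markedTime).preimage
        (f := fun q : (X × ℕ) × MCh S => (S.markedTime q.1, q.2))
        ((S.measurable_markedTime.comp measurable_fst).prodMk measurable_snd)
    have hG2 : Measurable fun p => ∫⁻ σ, ∫⁻ y, G (p, y) ∂(fibM S σ) ∂(chM S) := by
      refine Measurable.lintegral_prod_right' (f := fun q : (X × ℕ) × Ch S =>
        ∫⁻ y, G (q.1, y) ∂(fibM S q.2)) ?_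
      exact measurable_lintegral_fibM S (Ω := (X × ℕ) × Ch S)
        (G := fun q => G (q.1.1, q.2)) (by fun_prop) measurable_snd
    change _ = ∫⁻ p, ∫⁻ σ, ∫⁻ y, G (p, y) ∂(fibM S σ) ∂(chM S) ∂S.markedMeasure
    rw [lintegral_markedMeasure S hG2]
    refine lintegral_congr fun x => ?_
    rw [← lintegral_tsum]
    swap
    · intro m
      exact (measurable_lintegral_fibM S (Ω := Ch S) (G := fun q => G ((x, m), q.2)) (by fun_prop)
        measurable_id).aemeasurable
    rw [← lintegral_indicator (Chain.measurableSet_below S.measurable_time _)]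
    refine lintegral_congr fun σ => ?_
    have hfib : ∀ m : ℕ, ∫⁻ y, G ((x, m), y) ∂(fibM S σ) =
        (Chain.below S.time (S.time x)).indicator (fun σ => ∫⁻ y,
          F ((Chain.single S.markedTime (x, m)).union y) ∂(fibM S σ)) σ := by
      intro m
      rw [lintegral_fibM S σ (F := fun y => G ((x, m), y)) (hG.comp measurable_prodMk_left)]
      by_cases hσ : σ ∈ Chain.below S.time (S.time x)
      · rw [indicator_of_mem hσ, lintegral_fibM S σ (F := fun y =>
          F ((Chain.single S.markedTime (x, m)).union y)) (hF.comp (hU.comp measurable_prodMk_left))]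
        refine tsum_congr fun y => indicator_of_mem ?_ _
        have : base S y.1 ∈ Chain.below S.time (S.time x) := by rw [y.2.1]; exact hσ
        exact this
      · rw [indicator_of_notMem hσ]
        refine ENNReal.tsum_eq_zero.2 fun y => indicator_of_notMem ?_ _
        intro h
        have : base S y.1 ∈ Chain.below S.time (S.time x) := h
        rw [y.2.1] at this
        exact hσ this
    simp_rw [hfib]
    by_cases hσ : σ ∈ Chain.below S.time (S.time x)
    · simp_rw [indicator_of_mem hσ]
      rw [lintegral_fibM_union S (Chain.single_apart_of_below hσ) hF,
        lintegral_fibM_single S x]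
      exact measurable_lintegral_fibM S (G := fun p : MCh S × MCh S => F (p.1.union p.2))
        (hF.comp hU) measurable_const
    · simp_rw [indicator_of_notMem hσ]
      simp
  · intro F hF
    have ml : ∀ n, MeasurableSet {y | (Chain.growth S.measurable_markedTime).len y = n} :=
      fun n => (Chain.growth S.measurable_markedTime).measurable_len (measurableSet_singleton n)
    have m2 : ∀ n, Measurable fun σ => ∫⁻ y, {y | (Chain.growth S.measurable_markedTime).len y =
        n}.indicator F y ∂(fibM S σ) := fun n =>
      measurable_lintegral_fibM S (Ω := Ch S) (G := fun q => {y |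
        (Chain.growth S.measurable_markedTime).len y = n}.indicator F q.2)
        ((hF.indicator (ml n)).comp measurable_snd) measurable_id
    rw [← lintegral_tsum fun n => (m2 n).aemeasurable]
    refine lintegral_congr fun σ => ?_
    rw [← lintegral_tsum fun n => (hF.indicator (ml n)).aemeasurable]
    refine lintegral_congr fun y => ?_
    rw [tsum_eq_single ((Chain.growth S.measurable_markedTime).len y)]
    · rw [indicator_of_mem (by rfl)]
    · intro n hn
      rw [indicator_of_notMem (by exact fun h => hn h.symm)]

variable {X : Type*} [MeasurableSpace X] (S : NoiseSpace X)

/-! ### Measurability -/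

@[fun_prop]
theorem measurable_union_ch {Ω : Type*} [MeasurableSpace Ω] {f g : Ω → Ch S} (hf : Measurable f)
    (hg : Measurable g) : Measurable fun ω => (f ω).union (g ω) := by
  have h := (Chain.measurable_union S.measurable_time).comp (hf.prodMk hg)
  exact h

@[fun_prop]
theorem measurable_union_mch {Ω : Type*} [MeasurableSpace Ω] {f g : Ω → MCh S} (hf : Measurable f)
    (hg : Measurable g) : Measurable fun ω => (f ω).union (g ω) := by
  have h := (Chain.measurable_union S.measurable_markedTime).comp (hf.prodMk hg)
  exact h

@[fun_prop]
theorem measurable_base_comp {Ω : Type*} [MeasurableSpace Ω] {f : Ω → MCh S} (hf : Measurable f) :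
    Measurable fun ω => base S (f ω) := (measurable_base S).comp hf

@[fun_prop]
theorem measurable_single_ch {Ω : Type*} [MeasurableSpace Ω] {f : Ω → X} (hf : Measurable f) :
    Measurable fun ω => Chain.single S.time (f ω) :=
  (Chain.measurable_single S.measurable_time).comp hf

@[fun_prop]
theorem measurable_single_mch {Ω : Type*} [MeasurableSpace Ω] {f : Ω → X × ℕ} (hf : Measurable f) :
    Measurable fun ω => Chain.single S.markedTime (f ω) :=
  (Chain.measurable_single S.measurable_markedTime).comp hf

@[fun_prop]
theorem measurable_len_comp {Z : Type*} [MeasurableSpace Z] {τ : Z → ℝ} {Ω : Type*}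
    [MeasurableSpace Ω] {f : Ω → Chain τ} (hf : Measurable f) :
    Measurable fun ω => (f ω).len := Chain.measurable_len.comp hf

@[fun_prop]
theorem measurable_table_union {Ω : Type*} [MeasurableSpace Ω] {f g : Ω → Table S}
    (hf : Measurable f) (hg : Measurable g) : Measurable fun ω => (f ω).union (g ω) := by
  unfold Table.union; fun_prop

@[fun_prop]
theorem measurable_elem (i : Pos) {Ω : Type*} [MeasurableSpace Ω] {f : Ω → X} (hf : Measurable f) :
    Measurable fun ω => Table.elem S i (f ω) := by
  cases i <;> · simp only [Table.elem]; fun_prop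

theorem measurableSet_below_ch (t : ℝ) : MeasurableSet (Chain.below S.time t) :=
  Chain.measurableSet_below S.measurable_time t

theorem measurableSet_below_mch (t : ℝ) : MeasurableSet (Chain.below S.markedTime t) :=
  Chain.measurableSet_below S.measurable_markedTime t

theorem measurableSet_before (t : ℝ) : MeasurableSet (S.before t) :=
  measurableSet_lt S.measurable_time measurable_const

theorem below_table_eq (t : ℝ) : Table.below S t = Chain.below S.time t ×ˢ (Chain.below S.time t ×ˢ
    (Chain.below S.time t ×ˢ Chain.below S.time t)) := rfl

theorem measurableSet_below_table (t : ℝ) : MeasurableSet (Table.below S t) := by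
  have h := measurableSet_below_ch S t
  exact h.prod (h.prod (h.prod h))

/-- The measure on chains in `X^t`. -/
abbrev chT (t : ℝ) : Measure (Ch S) := (chM S).restrict (Chain.below S.time t)

/-- The measure on tables in `X^t`. -/
abbrev tabT (t : ℝ) : Measure (Table S) := (Table.measure S).restrict (Table.below S t)

theorem tabT_eq (t : ℝ) :
    tabT S t = (chT S t).prod ((chT S t).prod ((chT S t).prod (chT S t))) := by
  rw [tabT, Table.measure, below_table_eq, ← Measure.prod_restrict, ← Measure.prod_restrict,
    ← Measure.prod_restrict]

instance : SFinite (Table.measure S) := by unfold Table.measure; infer_instance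

theorem ae_apart_ch (σ : Ch S) : ∀ᵐ κ ∂(chM S), σ.Apart κ :=
  Chain.ae_apart S.measurable_time S.measure_time_eq σ

theorem ae_apart_mch (σ : MCh S) : ∀ᵐ κ ∂(mchM S), σ.Apart κ :=
  Chain.ae_apart S.measurable_markedTime S.markedMeasure_time_eq σ

/-! ### Sums over parts -/

/-- A pair of disjoint index sets is a colouring: colour `0` on the first, `1` on the second, `2`
elsewhere. Only the parts with colours `0` and `1` are required to lie before `t`, which becomes the
indicator. -/
theorem sum_parts_eq (t : ℝ) (H : MCh S × MCh S × MCh S → ℝ≥0∞) (w : MCh S) :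
    ∑ P ∈ parts S t w, H (w.sub P.1, w.sub P.2, w.sub (P.1 ∪ P.2)ᶜ) =
      Chain.sumParts ({p | p.1 ∈ Chain.below S.markedTime t ∧
        p.2.1 ∈ Chain.below S.markedTime t}.indicator H) w := by
  classical
  have hbel : ∀ s : Finset (Fin w.len), w.sub s ∈ Chain.below S.markedTime t ↔
      ∀ i ∈ s, S.time (w.pt i).1 < t := by
    intro s
    rw [Chain.mem_below_iff, Chain.support_sub]
    simp [NoiseSpace.markedTime]
  let col : (Fin w.len → Fin 3) → Fin 3 → Finset (Fin w.len) := fun c k =>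
    Finset.univ.filter fun i => c i = k
  have e : Chain.sumParts ({p | p.1 ∈ Chain.below S.markedTime t ∧
      p.2.1 ∈ Chain.below S.markedTime t}.indicator H) w =
      ∑ c ∈ Finset.univ.filter (fun c : Fin w.len → Fin 3 =>
        w.sub (col c 0) ∈ Chain.below S.markedTime t ∧
        w.sub (col c 1) ∈ Chain.below S.markedTime t),
        H (w.sub (col c 0), w.sub (col c 1), w.sub (col c 2)) := by
    rw [Finset.sum_filter]
    refine Finset.sum_congr rfl fun c _ => ?_
    by_cases h : w.sub (col c 0) ∈ Chain.below S.markedTime t ∧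
        w.sub (col c 1) ∈ Chain.below S.markedTime t
    · rw [if_pos h]; exact indicator_of_mem (by exact h) _
    · rw [if_neg h]; exact indicator_of_notMem (by exact h) _
  rw [e]
  refine Finset.sum_nbij'
    (fun P i => if i ∈ P.1 then 0 else if i ∈ P.2 then 1 else 2)
    (fun c => (col c 0, col c 1)) ?_ ?_ ?_ ?_ ?_
  · intro P hP
    simp only [parts, Finset.mem_filter, Finset.mem_univ, true_and] at hP ⊢
    constructor
    · rw [hbel]
      intro i hi
      refine hP.2 i (Finset.mem_union_left _ ?_)
      by_contra h
      simp only [col, Finset.mem_filter, Finset.mem_univ, true_and, h, if_false] at hi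
      split_ifs at hi <;> simp at hi
    · rw [hbel]
      intro i hi
      refine hP.2 i ?_
      simp only [col, Finset.mem_filter, Finset.mem_univ, true_and] at hi
      split_ifs at hi with h1 h2
      · exact Finset.mem_union_left _ h1
      · exact Finset.mem_union_right _ h2
      · simp at hi
  · intro c hc
    simp only [parts, Finset.mem_filter, Finset.mem_univ, true_and] at hc ⊢
    rw [hbel, hbel] at hc
    refine ⟨?_, ?_⟩
    · rw [Finset.disjoint_left]
      intro i h0 h1
      simp only [col, Finset.mem_filter, Finset.mem_univ, true_and] at h0 h1
      rw [h0] at h1; simp at h1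
    · intro i hi
      rcases Finset.mem_union.1 hi with h | h
      · exact hc.1 i h
      · exact hc.2 i h
  · intro P hP
    simp only [parts, Finset.mem_filter, Finset.mem_univ, true_and] at hP
    ext i
    · simp only [col, Finset.mem_filter, Finset.mem_univ, true_and]
      split_ifs <;> simp_all
    · simp only [col, Finset.mem_filter, Finset.mem_univ, true_and]
      have hd : i ∈ P.1 → i ∉ P.2 := fun h => Finset.disjoint_left.1 hP.1 h
      split_ifs <;> simp_all
  · intro c _
    funext i
    simp only [col, Finset.mem_filter, Finset.mem_univ, true_and]
    generalize c i = k
    fin_cases k <;> simp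
  · intro P hP
    simp only [parts, Finset.mem_filter, Finset.mem_univ, true_and] at hP
    have h0 : col (fun i => if i ∈ P.1 then 0 else if i ∈ P.2 then 1 else 2) 0 = P.1 := by
      ext i
      simp only [col, Finset.mem_filter, Finset.mem_univ, true_and]
      split_ifs <;> simp_all
    have h1 : col (fun i => if i ∈ P.1 then 0 else if i ∈ P.2 then 1 else 2) 1 = P.2 := by
      ext i
      simp only [col, Finset.mem_filter, Finset.mem_univ, true_and]
      have hd : i ∈ P.1 → i ∉ P.2 := fun h => Finset.disjoint_left.1 hP.1 h
      split_ifs <;> simp_all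
    have h2 : col (fun i => if i ∈ P.1 then 0 else if i ∈ P.2 then 1 else 2) 2 = (P.1 ∪ P.2)ᶜ := by
      ext i
      simp only [col, Finset.mem_filter, Finset.mem_univ, true_and, Finset.mem_compl,
        Finset.mem_union]
      split_ifs <;> simp_all
    rw [h0, h1, h2]

theorem measurable_sum_parts (t : ℝ) {H : MCh S × MCh S × MCh S → ℝ≥0∞} (hH : Measurable H) :
    Measurable fun w => ∑ P ∈ parts S t w, H (w.sub P.1, w.sub P.2, w.sub (P.1 ∪ P.2)ᶜ) := by
  have hm : MeasurableSet {p : MCh S × MCh S × MCh S | p.1 ∈ Chain.below S.markedTime t ∧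
      p.2.1 ∈ Chain.below S.markedTime t} :=
    ((measurableSet_below_mch S t).preimage measurable_fst).inter
      ((measurableSet_below_mch S t).preimage (measurable_fst.comp measurable_snd))
  simp_rw [sum_parts_eq]
  exact Chain.measurable_sumParts (hH.indicator hm)

theorem lintegral_sum_parts (t : ℝ) {H : MCh S × MCh S × MCh S → ℝ≥0∞} (hH : Measurable H) :
    ∫⁻ w, ∑ P ∈ parts S t w, H (w.sub P.1, w.sub P.2, w.sub (P.1 ∪ P.2)ᶜ) ∂(mchM S) =
      ∫⁻ y in Chain.below S.markedTime t, ∫⁻ z in Chain.below S.markedTime t, ∫⁻ w,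
        H (y, z, w) ∂(mchM S) ∂(mchM S) ∂(mchM S) := by
  have hm : MeasurableSet {p : MCh S × MCh S × MCh S | p.1 ∈ Chain.below S.markedTime t ∧
      p.2.1 ∈ Chain.below S.markedTime t} :=
    ((measurableSet_below_mch S t).preimage measurable_fst).inter
      ((measurableSet_below_mch S t).preimage (measurable_fst.comp measurable_snd))
  have hset : {p : MCh S × MCh S × MCh S | p.1 ∈ Chain.below S.markedTime t ∧
      p.2.1 ∈ Chain.below S.markedTime t} = Chain.below S.markedTime t ×ˢ
        (Chain.below S.markedTime t ×ˢ univ) := by ext; simp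
  simp_rw [sum_parts_eq]
  have := Chain.lintegral_prod_prod_eq S.measurable_markedTime S.markedMeasure
    S.markedMeasure_time_eq (hH.indicator hm)
  refine this.symm.trans ?_
  rw [lintegral_indicator hm, hset]
  change ∫⁻ p in _, H p ∂((mchM S).prod ((mchM S).prod (mchM S))) = _
  rw [← Measure.prod_restrict, ← Measure.prod_restrict, Measure.restrict_univ,
    lintegral_prod _ hH.aemeasurable]
  refine lintegral_congr fun y => ?_
  exact lintegral_prod (fun p => H (y, p)) (hH.comp measurable_prodMk_left).aemeasurable

/-- Integration over marked chains in `X^t`. -/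
theorem lintegral_chT_fibM (t : ℝ) {F : MCh S → ℝ≥0∞} (hF : Measurable F) :
    ∫⁻ σ, ∫⁻ y, F y ∂(fibM S σ) ∂(chT S t) =
      ∫⁻ y in Chain.below S.markedTime t, F y ∂(mchM S) := by
  rw [← lintegral_indicator (measurableSet_below_mch S t),
    lintegral_mchM S (hF.indicator (measurableSet_below_mch S t)),
    ← lintegral_indicator (measurableSet_below_ch S t)]
  refine lintegral_congr fun σ => ?_
  rw [lintegral_fibM S σ (hF.indicator (measurableSet_below_mch S t))]
  by_cases hσ : σ ∈ Chain.below S.time t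
  · rw [indicator_of_mem hσ, lintegral_fibM S σ hF]
    refine tsum_congr fun y => (indicator_of_mem ?_ _).symm
    rw [← base_mem_below, y.2.1]; exact hσ
  · rw [indicator_of_notMem hσ]
    refine (ENNReal.tsum_eq_zero.2 fun y => indicator_of_notMem ?_ _).symm
    rw [← base_mem_below, y.2.1]; exact hσ

/-! ### The last point of a table -/

theorem empty_table_union (ϑ : Table S) : (Table.empty S).union ϑ = ϑ := by
  change ((Chain.empty S.time).union ϑ.1, (Chain.empty S.time).union ϑ.2.1,
    (Chain.empty S.time).union ϑ.2.2.1, (Chain.empty S.time).union ϑ.2.2.2) = ϑ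
  simp only [Chain.empty_union]

theorem elem_ann_union (x : X) (ϑ : Table S) : (Table.elem S .ann x).union ϑ =
    ((Chain.single S.time x).union ϑ.1, ϑ.2.1, ϑ.2.2.1, ϑ.2.2.2) := by
  change ((Chain.single S.time x).union ϑ.1, (Chain.empty S.time).union ϑ.2.1,
    (Chain.empty S.time).union ϑ.2.2.1, (Chain.empty S.time).union ϑ.2.2.2) = _
  simp only [Chain.empty_union]

theorem elem_gau_union (x : X) (ϑ : Table S) : (Table.elem S .gau x).union ϑ =
    (ϑ.1, (Chain.single S.time x).union ϑ.2.1, ϑ.2.2.1, ϑ.2.2.2) := by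
  change ((Chain.empty S.time).union ϑ.1, (Chain.single S.time x).union ϑ.2.1,
    (Chain.empty S.time).union ϑ.2.2.1, (Chain.empty S.time).union ϑ.2.2.2) = _
  simp only [Chain.empty_union]

theorem elem_cre_union (x : X) (ϑ : Table S) : (Table.elem S .cre x).union ϑ =
    (ϑ.1, ϑ.2.1, (Chain.single S.time x).union ϑ.2.2.1, ϑ.2.2.2) := by
  change ((Chain.empty S.time).union ϑ.1, (Chain.empty S.time).union ϑ.2.1,
    (Chain.single S.time x).union ϑ.2.2.1, (Chain.empty S.time).union ϑ.2.2.2) = _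
  simp only [Chain.empty_union]

theorem elem_tim_union (x : X) (ϑ : Table S) : (Table.elem S .tim x).union ϑ =
    (ϑ.1, ϑ.2.1, ϑ.2.2.1, (Chain.single S.time x).union ϑ.2.2.2) := by
  change ((Chain.empty S.time).union ϑ.1, (Chain.empty S.time).union ϑ.2.1,
    (Chain.empty S.time).union ϑ.2.2.1, (Chain.single S.time x).union ϑ.2.2.2) = _
  simp only [Chain.empty_union]

/-- The recursion for the fourfold product of the measure on chains. It is the origin of the four
terms of the QS differential. -/
theorem lintegral_tabT_rec (t : ℝ) {F : Table S → ℝ≥0∞} (hF : Measurable F) :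
    ∫⁻ ϑ, F ϑ ∂(tabT S t) = F (Table.empty S) +
      (∫⁻ x in S.before t, ∫⁻ ϑ, F ((Table.elem S .ann x).union ϑ) ∂(tabT S (S.time x)) ∂S.μ +
      (∫⁻ x in S.before t, ∫⁻ ϑ, F ((Table.elem S .gau x).union ϑ) ∂(tabT S (S.time x)) ∂S.μ +
      (∫⁻ x in S.before t, ∫⁻ ϑ, F ((Table.elem S .cre x).union ϑ) ∂(tabT S (S.time x)) ∂S.μ +
      ∫⁻ x in S.before t, ∫⁻ ϑ, F ((Table.elem S .tim x).union ϑ) ∂(tabT S (S.time x)) ∂S.μ))) := by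
  let g := Chain.growth S.measurable_time
  have : SFinite (Chain.measure S.time S.μ) := inferInstanceAs (SFinite (chM S))
  have hr1 := Chain.growth_rec S.measurable_time S.μ
  have hr2 := hr1.prod hr1 S.measurable_time S.measure_time_eq
  have hr3 := hr1.prod hr2 S.measurable_time S.measure_time_eq
  have hr := hr1.prod hr3 S.measurable_time S.measure_time_eq
  have h := hr.restrict S.measurable_time hF t
  let G := g.prod (g.prod (g.prod g))
  have key : ∀ i, ∀ f : X × Table S → ℝ≥0∞, Measurable f → (∀ p, F (G.ins i p) = f p) →
      ∫⁻ p in G.before, {p : X × Table S | S.time p.1 < t}.indicator (fun p => F (G.ins i p)) p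
        ∂(S.μ.prod (Table.measure S)) =
      ∫⁻ x in S.before t, ∫⁻ ϑ, f (x, ϑ) ∂(tabT S (S.time x)) ∂S.μ := by
    intro i f hf hfi
    have hm : MeasurableSet {p : X × Table S | S.time p.1 < t} :=
      measurableSet_lt (S.measurable_time.comp measurable_fst) measurable_const
    simp_rw [hfi]
    rw [G.setLIntegral_before S.measurable_time (hf.indicator hm),
      ← lintegral_indicator (measurableSet_before S t)]
    refine lintegral_congr fun x => ?_
    by_cases hx : S.time x < t
    · rw [indicator_of_mem (by exact hx)]
      refine lintegral_congr fun ϑ => ?_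
      rw [indicator_of_mem (by exact hx)]
    · rw [indicator_of_notMem (by exact hx)]
      refine (lintegral_congr fun ϑ => ?_).trans lintegral_zero
      rw [indicator_of_notMem (by exact hx)]
  refine h.trans ?_
  rw [Fintype.sum_sum_type, Fintype.sum_sum_type, Fintype.sum_sum_type]
  simp only [Finset.univ_unique, Finset.sum_singleton]
  congr 1
  congr 1
  · refine key (Sum.inl ()) (fun p => F ((Table.elem S .ann p.1).union p.2)) (by fun_prop) ?_
    rintro ⟨x, ϑ⟩
    simp only [elem_ann_union]
    rfl
  congr 1
  · refine key (Sum.inr (Sum.inl ())) (fun p => F ((Table.elem S .gau p.1).union p.2))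
      (by fun_prop) ?_
    rintro ⟨x, ϑ⟩
    simp only [elem_gau_union]
    rfl
  congr 1
  · refine key (Sum.inr (Sum.inr (Sum.inl ()))) (fun p => F ((Table.elem S .cre p.1).union p.2))
      (by fun_prop) ?_
    rintro ⟨x, ϑ⟩
    simp only [elem_cre_union]
    rfl
  · refine key (Sum.inr (Sum.inr (Sum.inr ()))) (fun p => F ((Table.elem S .tim p.1).union p.2))
      (by fun_prop) ?_
    rintro ⟨x, ϑ⟩
    simp only [elem_tim_union]
    rfl

namespace Chain
variable {Z : Type*} [MeasurableSpace Z] {τ : Z → ℝ}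

theorem measurable_sumParts_prod {Ω : Type*} [MeasurableSpace Ω]
    {F : Ω × (Chain τ × Chain τ × Chain τ) → ℝ≥0∞} (hF : Measurable F) :
    Measurable fun p : Ω × Chain τ => sumParts (fun c => F (p.1, c)) p.2 := by
  refine measurable_prod_pieces fun n => ?_
  change Measurable fun z : Ω × Piece τ n => ∑ c : Fin n → Fin 3,
    F (z.1, ((ofPiece z.2).col c 0, (ofPiece z.2).col c 1, (ofPiece z.2).col c 2))
  refine Finset.measurable_fun_sum _ fun c _ => hF.fun_comp (?_ : Measurable fun z : Ω × Piece τ n =>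
    (z.1, ((ofPiece z.2).col c 0, (ofPiece z.2).col c 1, (ofPiece z.2).col c 2)))
  have h : ∀ k, Measurable fun z : Ω × Piece τ n => (ofPiece z.2).col c k := fun k =>
    (measurable_col_piece c k).comp measurable_snd
  exact measurable_fst.prodMk ((h 0).prodMk ((h 1).prodMk (h 2)))

end Chain

variable {X : Type*} [MeasurableSpace X] (S : NoiseSpace X)

/-! ### The split points of a triple -/

instance (t : ℝ) : SFinite (pairM S t) := by unfold pairM; infer_instance

variable {S} in
/-- The table and the argument belonging to the parts `P` of a triple. -/
def splitPt (q : Triple S) (P : Finset (Fin q.2.2.len) × Finset (Fin q.2.2.len))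
    (r : Ch S × Ch S) : Table S × Triple S :=
  ((r.1, base S (q.2.2.sub P.1), base S (q.2.2.sub P.2), r.2),
    (q.1.union (q.2.2.sub P.2), q.2.1.union (q.2.2.sub P.1), q.2.2.sub (P.1 ∪ P.2)ᶜ))

/-- The table and the argument belonging to a triple, split into three pieces. -/
def joinPt (p : (MCh S × MCh S) × (MCh S × MCh S × MCh S)) (r : Ch S × Ch S) : Table S × Triple S :=
  ((r.1, base S p.2.1, base S p.2.2.1, r.2), (p.1.1.union p.2.2.1, p.1.2.union p.2.1, p.2.2.2))

@[fun_prop]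
theorem measurable_joinPt {Ω : Type*} [MeasurableSpace Ω]
    {f : Ω → (MCh S × MCh S) × (MCh S × MCh S × MCh S)} {g : Ω → Ch S × Ch S}
    (hf : Measurable f) (hg : Measurable g) : Measurable fun ω => joinPt S (f ω) (g ω) := by
  unfold joinPt; fun_prop

theorem splitPt_eq (q : Triple S) (P) (r) : splitPt q P r = joinPt S ((q.1, q.2.1),
    (q.2.2.sub P.1, q.2.2.sub P.2, q.2.2.sub (P.1 ∪ P.2)ᶜ)) r := rfl

theorem measurable_splitPt (q : Triple S) (P) : Measurable fun r => splitPt q P r := by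
  simp_rw [splitPt_eq]; fun_prop

/-- The measure `∑ ∫∫` over the parts and the pairs of chains for a given triple. -/
def partM (t : ℝ) (q : Triple S) : Measure (Table S × Triple S) :=
  ∑ P ∈ parts S t q.2.2, (pairM S t).map (splitPt q P)

theorem lintegral_partM (t : ℝ) (q : Triple S) {G : Table S × Triple S → ℝ≥0∞}
    (hG : Measurable G) :
    ∫⁻ p, G p ∂(partM S t q) = ∑ P ∈ parts S t q.2.2, ∫⁻ r, G (splitPt q P r) ∂(pairM S t) := by
  rw [partM, lintegral_finsetSum_measure]
  exact Finset.sum_congr rfl fun P _ => lintegral_map hG (measurable_splitPt S q P)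

theorem lintegral_pairM (t : ℝ) {G : Ch S × Ch S → ℝ≥0∞} (hG : Measurable G) :
    ∫⁻ r, G r ∂(pairM S t) = ∫⁻ ann, ∫⁻ tim, G (ann, tim) ∂(chT S t) ∂(chT S t) :=
  lintegral_prod _ hG.aemeasurable

theorem measurable_lintegral_pairM {Ω : Type*} [MeasurableSpace Ω]
    {G : (ℝ × Ω) × (Ch S × Ch S) → ℝ≥0∞} (hG : Measurable G) :
    Measurable fun p : ℝ × Ω => ∫⁻ r, G (p, r) ∂(pairM S p.1) := by
  have hm : MeasurableSet {p : (ℝ × Ω) × (Ch S × Ch S) |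
      p.2.1 ∈ Chain.below S.time p.1.1 ∧ p.2.2 ∈ Chain.below S.time p.1.1} := by
    have h := Chain.measurableSet_below_prod S.measurable_time
    have h1 : Measurable fun p : (ℝ × Ω) × (Ch S × Ch S) => (p.1.1, p.2.1) := by fun_prop
    have h2 : Measurable fun p : (ℝ × Ω) × (Ch S × Ch S) => (p.1.1, p.2.2) := by fun_prop
    exact (h.preimage h1).inter (h.preimage h2)
  have h : ∀ p : ℝ × Ω, ∫⁻ r, G (p, r) ∂(pairM S p.1) = ∫⁻ r, {p : (ℝ × Ω) × (Ch S × Ch S) |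
      p.2.1 ∈ Chain.below S.time p.1.1 ∧ p.2.2 ∈ Chain.below S.time p.1.1}.indicator G (p, r)
      ∂((chM S).prod (chM S)) := by
    intro p
    have hb := measurableSet_below_ch S p.1
    rw [pairM, Measure.prod_restrict, ← lintegral_indicator (hb.prod hb)]
    refine lintegral_congr fun r => ?_
    rfl
  simp_rw [h]
  exact (hG.indicator hm).lintegral_prod_right'

/-- The index set of the sum depends on the argument. Rewritten as `sumParts` of a function which
contains the time constraint, the sum is jointly measurable in the parameter, the time and the
argument. -/
theorem measurable_lintegral_partM_prod {Ω : Type*} [MeasurableSpace Ω]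
    {G : Ω × (Table S × Triple S) → ℝ≥0∞} (hG : Measurable G) :
    Measurable fun p : Ω × (ℝ × Triple S) => ∫⁻ x, G (p.1, x) ∂(partM S p.2.1 p.2.2) := by
  let F : (ℝ × (Ω × (MCh S × MCh S))) × (MCh S × MCh S × MCh S) → ℝ≥0∞ := fun p =>
    {p : (ℝ × (Ω × (MCh S × MCh S))) × (MCh S × MCh S × MCh S) |
      p.2.1 ∈ Chain.below S.markedTime p.1.1 ∧ p.2.2.1 ∈ Chain.below S.markedTime p.1.1}.indicator
      (fun p => ∫⁻ r, G (p.1.2.1, joinPt S (p.1.2.2, p.2) r) ∂(pairM S p.1.1)) p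
  have hF : Measurable F := by
    refine Measurable.indicator ?_ ?_
    · have h := measurable_lintegral_pairM S (Ω := (Ω × (MCh S × MCh S)) × (MCh S × MCh S × MCh S))
        (G := fun p => G (p.1.2.1.1, joinPt S (p.1.2.1.2, p.1.2.2) p.2)) (by fun_prop)
      have h2 : Measurable fun p : (ℝ × (Ω × (MCh S × MCh S))) × (MCh S × MCh S × MCh S) =>
        (p.1.1, (p.1.2, p.2)) := by fun_prop
      have h3 := h.comp h2
      simp only [Function.comp_def] at h3
      exact h3
    · have h := Chain.measurableSet_below_prod S.measurable_markedTime
      have h1 : Measurable fun p : (ℝ × (Ω × (MCh S × MCh S))) × (MCh S × MCh S × MCh S) =>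
        (p.1.1, p.2.1) := by fun_prop
      have h2 : Measurable fun p : (ℝ × (Ω × (MCh S × MCh S))) × (MCh S × MCh S × MCh S) =>
        (p.1.1, p.2.2.1) := by fun_prop
      exact (h.preimage h1).inter (h.preimage h2)
  have h1 : ∀ p : Ω × (ℝ × Triple S), ∫⁻ x, G (p.1, x) ∂(partM S p.2.1 p.2.2) =
      Chain.sumParts (fun c => F ((p.2.1, (p.1, (p.2.2.1, p.2.2.2.1))), c)) p.2.2.2.2 := by
    intro p
    rw [lintegral_partM S _ _ (G := fun x => G (p.1, x)) (by fun_prop)]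
    simp_rw [splitPt_eq]
    rw [sum_parts_eq S p.2.1 (fun c => ∫⁻ r, G (p.1, joinPt S ((p.2.2.1, p.2.2.2.1), c) r)
      ∂(pairM S p.2.1))]
    rfl
  simp_rw [h1]
  have h2 := (Chain.measurable_sumParts_prod hF).comp
    (f := fun p : Ω × (ℝ × Triple S) => ((p.2.1, (p.1, (p.2.2.1, p.2.2.2.1))), p.2.2.2.2))
    (by fun_prop)
  simp only [Function.comp_def] at h2
  exact h2

theorem measurable_lintegral_partM {G : Table S × Triple S → ℝ≥0∞} (hG : Measurable G) :
    Measurable fun p : ℝ × Triple S => ∫⁻ x, G x ∂(partM S p.1 p.2) := by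
  have h := (measurable_lintegral_partM_prod S (Ω := Unit) (G := fun p => G p.2) (by fun_prop)).comp
    (f := fun p : ℝ × Triple S => ((), p)) (by fun_prop)
  simp only [Function.comp_def] at h
  exact h

theorem measurable_partM : Measurable fun p : ℝ × Triple S => partM S p.1 p.2 := by
  refine Measure.measurable_of_measurable_coe _ fun s hs => ?_
  have h := measurable_lintegral_partM S (G := s.indicator 1) (measurable_one.indicator hs)
  simp_rw [lintegral_indicator_one hs] at h
  exact h

/-- `partM` as a kernel, for a fixed time. -/
def partKerAt (t : ℝ) : ProbabilityTheory.Kernel (Triple S) (Table S × Triple S) where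
  toFun q := partM S t q
  measurable' := by
    have h := (measurable_partM S).comp (measurable_prodMk_left (x := t))
    simp only [Function.comp_def] at h
    exact h

@[simp] theorem partKerAt_apply (t : ℝ) (q : Triple S) : partKerAt S t q = partM S t q := rfl

section
variable {H : Type*} [NormedAddCommGroup H]
variable {S}

theorem ae_partM_iff {t : ℝ} {q : Triple S} {p : Table S × Triple S → Prop}
    (h : ∀ᵐ x ∂(partM S t q), p x) : ∀ P ∈ parts S t q.2.2, ∀ᵐ r ∂(pairM S t), p (splitPt q P r) := by
  intro P hP
  refine ae_of_ae_map (measurable_splitPt S q P).aemeasurable ?_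
  rw [ae_iff, partM, Measure.finsetSum_apply, Finset.sum_eq_zero_iff] at h
  exact ae_iff.2 (h P hP)

theorem integrable_partM {t : ℝ} {q : Triple S} {f : Table S → Triple S → H}
    (hf : StronglyMeasurable (Function.uncurry f)) :
    Integrable (Function.uncurry f) (partM S t q) ↔
      ∀ P ∈ parts S t q.2.2, Integrable (integrand f q P) (pairM S t) := by
  rw [partM, integrable_finsetSum_measure]
  refine forall₂_congr fun P _ => ?_
  rw [integrable_map_measure hf.aestronglyMeasurable (measurable_splitPt S q P).aemeasurable]
  rfl

theorem integral_partM [InnerProductSpace ℂ H] {t : ℝ} {q : Triple S} {f : Table S → Triple S → H}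
    (hf : StronglyMeasurable (Function.uncurry f))
    (h : Integrable (Function.uncurry f) (partM S t q)) :
    ∫ p, Function.uncurry f p ∂(partM S t q) =
      ∑ P ∈ parts S t q.2.2, ∫ r, integrand f q P r ∂(pairM S t) := by
  rw [partM, integrable_finsetSum_measure] at h
  rw [partM, integral_finsetSum_measure h]
  refine Finset.sum_congr rfl fun P _ => ?_
  rw [integral_map (measurable_splitPt S q P).aemeasurable hf.aestronglyMeasurable]
  rfl

end

/-! ### Integration over triples -/

variable [MeasurableSingletonClass X]

theorem lintegral_vecM (σ ρ : Ch S) {F : Triple S → ℝ≥0∞} (hF : Measurable F) :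
    ∫⁻ z, F z ∂(vecM S σ ρ) =
      ∫⁻ y, ∫⁻ z, ∫⁻ w, F (y, z, w) ∂(mchM S) ∂(fibM S ρ) ∂(fibM S σ) := by
  rw [vecM, lintegral_prod _ hF.aemeasurable]
  refine lintegral_congr fun y => ?_
  exact lintegral_prod (fun p => F (y, p)) (hF.comp measurable_prodMk_left).aemeasurable

theorem measurable_lintegral_vecM {Ω : Type*} [MeasurableSpace Ω] {G : Ω × Triple S → ℝ≥0∞}
    (hG : Measurable G) {s r : Ω → Ch S} (hs : Measurable s) (hr : Measurable r) :
    Measurable fun ω => ∫⁻ z, G (ω, z) ∂(vecM S (s ω) (r ω)) := by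
  have h : ∀ ω, ∫⁻ z, G (ω, z) ∂(vecM S (s ω) (r ω)) = ∫⁻ y, ∫⁻ z, ∫⁻ w, G (ω, (y, z, w)) ∂(mchM S)
      ∂(fibM S (r ω)) ∂(fibM S (s ω)) := fun ω =>
    lintegral_vecM S _ _ (F := fun z => G (ω, z)) (hG.comp measurable_prodMk_left)
  simp_rw [h]
  refine measurable_lintegral_fibM S (G := fun p : Ω × MCh S => ∫⁻ z, ∫⁻ w, G (p.1, (p.2, z, w))
    ∂(mchM S) ∂(fibM S (r p.1))) ?_ hs
  refine measurable_lintegral_fibM S (Ω := Ω × MCh S) (G := fun p : (Ω × MCh S) × MCh S =>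
    ∫⁻ w, G (p.1.1, (p.1.2, p.2, w)) ∂(mchM S)) ?_ (by fun_prop)
  exact Measurable.lintegral_prod_right' (f := fun p : ((Ω × MCh S) × MCh S) × MCh S =>
    G (p.1.1.1, (p.1.1.2, p.1.2, p.2))) (by fun_prop)

/-- Integration over slices. -/
theorem lintegral_vecM_union {κ σ κ' σ' : Ch S} (h : κ.Apart σ) (h' : κ'.Apart σ')
    {F : Triple S → ℝ≥0∞} (hF : Measurable F) :
    ∫⁻ z, F z ∂(vecM S (κ.union σ) (κ'.union σ')) =
      ∫⁻ p, ∫⁻ p', ∫⁻ z, F (p.union z.1, p'.union z.2.1, z.2.2) ∂(vecM S σ σ') ∂(fibM S κ')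
        ∂(fibM S κ) := by
  rw [lintegral_vecM S _ _ hF]
  rw [lintegral_fibM_union S h (F := fun y => ∫⁻ z, ∫⁻ w, F (y, z, w) ∂(mchM S)
    ∂(fibM S (κ'.union σ'))) (measurable_lintegral_fibM S (G := fun p : MCh S × MCh S =>
      ∫⁻ w, F (p.1, p.2, w) ∂(mchM S)) (Measurable.lintegral_prod_right' (f := fun p :
        (MCh S × MCh S) × MCh S => F (p.1.1, p.1.2, p.2)) (by fun_prop)) measurable_const)]
  refine lintegral_congr fun p => ?_
  have e1 : ∀ z, ∫⁻ y, ∫⁻ w, F (p.union z, y, w) ∂(mchM S) ∂(fibM S (κ'.union σ')) =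
      ∫⁻ p', ∫⁻ y, ∫⁻ w, F (p.union z, p'.union y, w) ∂(mchM S) ∂(fibM S σ') ∂(fibM S κ') := fun z =>
    lintegral_fibM_union S h' (F := fun y => ∫⁻ w, F (p.union z, y, w) ∂(mchM S))
      (Measurable.lintegral_prod_right' (f := fun q : MCh S × MCh S => F (p.union z, q.1, q.2))
        (by fun_prop))
  simp_rw [e1]
  rw [lintegral_lintegral_swap]
  · refine lintegral_congr fun p' => ?_
    rw [lintegral_vecM S _ _ (F := fun z : Triple S => F (p.union z.1, p'.union z.2.1, z.2.2))
      (by fun_prop)]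
  · refine Measurable.aemeasurable ?_
    exact measurable_lintegral_fibM S (Ω := MCh S × MCh S) (G := fun q : (MCh S × MCh S) × MCh S =>
      ∫⁻ w, F (p.union q.1.1, q.1.2.union q.2, w) ∂(mchM S))
      (Measurable.lintegral_prod_right' (f := fun q : ((MCh S × MCh S) × MCh S) × MCh S =>
        F (p.union q.1.1.1, q.1.1.2.union q.1.2, q.2)) (by fun_prop)) measurable_const

variable {X : Type*} [MeasurableSpace X] (S : NoiseSpace X)

theorem measurable_sum_parts_prod (t : ℝ) {Ω : Type*} [MeasurableSpace Ω]
    {H : Ω × (MCh S × MCh S × MCh S) → ℝ≥0∞} (hH : Measurable H) :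
    Measurable fun p : Ω × MCh S => ∑ P ∈ parts S t p.2,
      H (p.1, (p.2.sub P.1, p.2.sub P.2, p.2.sub (P.1 ∪ P.2)ᶜ)) := by
  have hm : MeasurableSet {p : Ω × (MCh S × MCh S × MCh S) |
      p.2.1 ∈ Chain.below S.markedTime t ∧ p.2.2.1 ∈ Chain.below S.markedTime t} :=
    ((measurableSet_below_mch S t).preimage (measurable_fst.comp measurable_snd)).inter
      ((measurableSet_below_mch S t).preimage
        (measurable_fst.comp (measurable_snd.comp measurable_snd)))
  have h : ∀ p : Ω × MCh S, ∑ P ∈ parts S t p.2,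
      H (p.1, (p.2.sub P.1, p.2.sub P.2, p.2.sub (P.1 ∪ P.2)ᶜ)) = _ := fun p =>
    sum_parts_eq S t (fun c => H (p.1, c)) p.2
  simp_rw [h]
  exact Chain.measurable_sumParts_prod (hH.indicator hm)

/-! ### Reordering of integrals over tables -/

theorem lintegral_tabT (t : ℝ) {F : Table S → ℝ≥0∞} (hF : Measurable F) :
    ∫⁻ ϑ, F ϑ ∂(tabT S t) = ∫⁻ ann, ∫⁻ gau, ∫⁻ cre, ∫⁻ tim, F (ann, gau, cre, tim)
      ∂(chT S t) ∂(chT S t) ∂(chT S t) ∂(chT S t) := by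
  rw [tabT_eq, lintegral_prod _ hF.aemeasurable]
  refine lintegral_congr fun ann => ?_
  rw [lintegral_prod _ (by fun_prop)]
  refine lintegral_congr fun gau => ?_
  rw [lintegral_prod _ (by fun_prop)]

theorem lintegral_tabT_tim (t : ℝ) {F : Table S → ℝ≥0∞} (hF : Measurable F) :
    ∫⁻ ϑ, F ϑ ∂(tabT S t) = ∫⁻ tim, ∫⁻ ann, ∫⁻ cre, ∫⁻ gau, F (ann, gau, cre, tim)
      ∂(chT S t) ∂(chT S t) ∂(chT S t) ∂(chT S t) := by
  rw [lintegral_tabT S t hF]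
  have e1 : ∀ ann, ∫⁻ gau, ∫⁻ cre, ∫⁻ tim, F (ann, gau, cre, tim)
      ∂(chT S t) ∂(chT S t) ∂(chT S t) = ∫⁻ tim, ∫⁻ cre, ∫⁻ gau, F (ann, gau, cre, tim)
      ∂(chT S t) ∂(chT S t) ∂(chT S t) := by
    intro ann
    have e2 : ∀ gau, ∫⁻ cre, ∫⁻ tim, F (ann, gau, cre, tim) ∂(chT S t) ∂(chT S t) =
        ∫⁻ tim, ∫⁻ cre, F (ann, gau, cre, tim) ∂(chT S t) ∂(chT S t) := fun gau =>
      lintegral_lintegral_swap (by fun_prop)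
    simp_rw [e2]
    rw [lintegral_lintegral_swap (by fun_prop)]
    refine lintegral_congr fun tim => ?_
    rw [lintegral_lintegral_swap (by fun_prop)]
  simp_rw [e1]
  rw [lintegral_lintegral_swap (by fun_prop)]

theorem lintegral_tabT_pair (t : ℝ) {F : Table S → ℝ≥0∞} (hF : Measurable F) :
    ∫⁻ ϑ, F ϑ ∂(tabT S t) = ∫⁻ r, ∫⁻ cre, ∫⁻ gau, F (r.1, gau, cre, r.2)
      ∂(chT S t) ∂(chT S t) ∂(pairM S t) := by
  rw [lintegral_tabT_tim S t hF, lintegral_pairM S t (by fun_prop),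
    lintegral_lintegral_swap (by fun_prop)]

theorem lintegral_tabT_star (t : ℝ) {F : Table S → ℝ≥0∞} (hF : Measurable F) :
    ∫⁻ ϑ, F ϑ.star ∂(tabT S t) = ∫⁻ ϑ, F ϑ ∂(tabT S t) := by
  rw [lintegral_tabT_tim S t hF, lintegral_tabT_tim S t (F := fun ϑ => F ϑ.star)
    (by fun_prop)]
  refine lintegral_congr fun tim => ?_
  rw [lintegral_lintegral_swap (by fun_prop)]

theorem measurePreserving_star (t : ℝ) :
    MeasurePreserving (Table.star : Table S → Table S) (tabT S t) (tabT S t) := by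
  have hm : Measurable (Table.star : Table S → Table S) := by fun_prop
  refine ⟨hm, Measure.ext_of_lintegral _ fun F hF => ?_⟩
  rw [lintegral_map hF hm, lintegral_tabT_star S t hF]

theorem ae_tabT_star {t : ℝ} {p : Table S → Prop} (h : ∀ᵐ ϑ ∂(tabT S t), p ϑ) :
    ∀ᵐ ϑ ∂(tabT S t), p ϑ.star :=
  (measurePreserving_star S t).quasiMeasurePreserving.ae h

variable [MeasurableSingletonClass X]

/-! ### The combinatorial formula -/

/-- Almost surely `cre` and `gau` are apart from `κc` and `κg`, so the marks over the unions split.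
The marks over `κc`, `κg` are spectators, while a chain integrated together with its marks is a
marked chain. The two resulting marked chains and the argument `w` form three marked chains, which
are recombined into one chain with a sum over its parts. -/
theorem lintegral_union_parts (t : ℝ) (κc κg : Ch S) {G : (Ch S × Ch S) × Triple S → ℝ≥0∞}
    (hG : Measurable G) :
    ∫⁻ cre, ∫⁻ gau, ∫⁻ z, G ((cre, gau), z) ∂(vecM S (κc.union cre) (κg.union gau))
      ∂(chT S t) ∂(chT S t) =
    ∫⁻ q, ∑ P ∈ parts S t q.2.2, G ((base S (q.2.2.sub P.2), base S (q.2.2.sub P.1)),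
      (q.1.union (q.2.2.sub P.2), q.2.1.union (q.2.2.sub P.1), q.2.2.sub (P.1 ∪ P.2)ᶜ))
      ∂(vecM S κc κg) := by
  let Q := (fibM S κc).prod (fibM S κg)
  let J : (MCh S × MCh S) × (MCh S × MCh S) → ℝ≥0∞ := fun x =>
    ∫⁻ w, G ((base S x.2.1, base S x.2.2), (x.1.1.union x.2.1, x.1.2.union x.2.2, w)) ∂(mchM S)
  have hJ : Measurable J := Measurable.lintegral_prod_right'
    (f := fun x : ((MCh S × MCh S) × (MCh S × MCh S)) × MCh S =>
      G ((base S x.1.2.1, base S x.1.2.2), (x.1.1.1.union x.1.2.1, x.1.1.2.union x.1.2.2, x.2)))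
      (by fun_prop)
  let L : MCh S × MCh S → ℝ≥0∞ := fun y => ∫⁻ p, J (p, y) ∂Q
  have hL : Measurable L := hJ.lintegral_prod_left'
  let mT := (mchM S).restrict (Chain.below S.markedTime t)
  have hl : ∫⁻ cre, ∫⁻ gau, ∫⁻ z, G ((cre, gau), z) ∂(vecM S (κc.union cre) (κg.union gau))
      ∂(chT S t) ∂(chT S t) = ∫⁻ yc, ∫⁻ yg, L (yc, yg) ∂mT ∂mT := by
    have e1 : ∀ᵐ cre ∂(chT S t), ∀ᵐ gau ∂(chT S t),
        ∫⁻ z, G ((cre, gau), z) ∂(vecM S (κc.union cre) (κg.union gau)) =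
        ∫⁻ yc, ∫⁻ yg, L (yc, yg) ∂(fibM S gau) ∂(fibM S cre) := by
      filter_upwards [ae_restrict_of_ae (ae_apart_ch S κc)] with cre hcre
      filter_upwards [ae_restrict_of_ae (ae_apart_ch S κg)] with gau hgau
      rw [lintegral_vecM_union S hcre hgau (F := fun z => G ((cre, gau), z)) (by fun_prop)]
      let V : (MCh S × MCh S) × (MCh S × MCh S) → ℝ≥0∞ := fun x =>
        ∫⁻ w, G ((cre, gau), (x.1.1.union x.2.1, x.1.2.union x.2.2, w)) ∂(mchM S)
      have hV : Measurable V := Measurable.lintegral_prod_right'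
        (f := fun x : ((MCh S × MCh S) × (MCh S × MCh S)) × MCh S =>
        G ((cre, gau), (x.1.1.1.union x.1.2.1, x.1.1.2.union x.1.2.2, x.2))) (by fun_prop)
      have e2 : ∀ p p', ∫⁻ z, G ((cre, gau), (p.union z.1, p'.union z.2.1, z.2.2))
          ∂(vecM S cre gau) = ∫⁻ y, V ((p, p'), y) ∂((fibM S cre).prod (fibM S gau)) := by
        intro p p'
        rw [lintegral_vecM S _ _ (F := fun z : Triple S =>
          G ((cre, gau), (p.union z.1, p'.union z.2.1, z.2.2))) (by fun_prop),
          lintegral_prod (fun y => V ((p, p'), y)) (hV.fun_comp measurable_prodMk_left).aemeasurable]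
      simp_rw [e2]
      rw [← lintegral_prod (μ := fibM S κc) (ν := fibM S κg) (fun p : MCh S × MCh S =>
        ∫⁻ y, V (p, y) ∂((fibM S cre).prod (fibM S gau))) hV.lintegral_prod_right'.aemeasurable,
        lintegral_lintegral_swap hV.aemeasurable,
        lintegral_prod _ hV.lintegral_prod_left'.aemeasurable]
      refine lintegral_congr_ae ?_
      filter_upwards [ae_mem_fiber S cre] with yc hyc
      refine lintegral_congr_ae ?_
      filter_upwards [ae_mem_fiber S gau] with yg hyg
      -- Almost everywhere for the fibre measure, `cre` and `gau` are the base chains of the marked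
      -- variables and can be eliminated from the integrand.
      simp only [V, L, J, hyc.1, hyg.1, Q]
    rw [lintegral_congr_ae (e1.mono fun cre h => lintegral_congr_ae h)]
    have e3 : ∀ cre, ∫⁻ gau, ∫⁻ yc, ∫⁻ yg, L (yc, yg) ∂(fibM S gau) ∂(fibM S cre) ∂(chT S t) =
        ∫⁻ yc, ∫⁻ yg, L (yc, yg) ∂mT ∂(fibM S cre) := by
      intro cre
      rw [lintegral_lintegral_swap]
      · refine lintegral_congr fun yc => lintegral_chT_fibM S t (F := fun yg => L (yc, yg)) (by fun_prop)
      · exact (measurable_lintegral_fibM S (Ω := Ch S × MCh S) (G := fun x => L (x.1.2, x.2))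
          (by fun_prop) measurable_fst).aemeasurable
    simp_rw [e3]
    exact lintegral_chT_fibM S t (F := fun yc => ∫⁻ yg, L (yc, yg) ∂mT) hL.lintegral_prod_right'
  rw [hl]
  let H : (MCh S × MCh S) × (MCh S × MCh S × MCh S) → ℝ≥0∞ := fun x =>
    G ((base S x.2.2.1, base S x.2.1), (x.1.1.union x.2.2.1, x.1.2.union x.2.1, x.2.2.2))
  have hH : Measurable H := by fun_prop
  have hS : Measurable fun q : Triple S => ∑ P ∈ parts S t q.2.2,
      H ((q.1, q.2.1), (q.2.2.sub P.1, q.2.2.sub P.2, q.2.2.sub (P.1 ∪ P.2)ᶜ)) := by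
    have h2 := (measurable_sum_parts_prod S t hH).comp
      (f := fun q : Triple S => ((q.1, q.2.1), q.2.2)) (by fun_prop)
    simp only [Function.comp_def] at h2
    exact h2
  refine Eq.symm ?_
  refine (lintegral_vecM S κc κg hS).trans ?_
  have e4 : ∀ q1 q2, ∫⁻ w, ∑ P ∈ parts S t w,
      H ((q1, q2), (w.sub P.1, w.sub P.2, w.sub (P.1 ∪ P.2)ᶜ)) ∂(mchM S) =
      ∫⁻ y, J ((q1, q2), y) ∂(mT.prod mT) := by
    intro q1 q2
    rw [lintegral_sum_parts S t (H := fun c => H ((q1, q2), c)) (by fun_prop),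
      lintegral_prod_symm _ (by fun_prop)]
  simp_rw [e4]
  rw [← lintegral_prod (μ := fibM S κc) (ν := fibM S κg) (fun p : MCh S × MCh S =>
        ∫⁻ y, J (p, y) ∂(mT.prod mT)) hJ.lintegral_prod_right'.aemeasurable,
    lintegral_lintegral_swap hJ.aemeasurable, lintegral_prod _ hL.aemeasurable]

omit [MeasurableSingletonClass X] in
theorem measurable_sum_splitPt (t : ℝ) {G : Table S × Triple S → ℝ≥0∞} (hG : Measurable G) :
    Measurable fun p : (Ch S × Ch S) × Triple S => ∑ P ∈ parts S t p.2.2.2,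
      G (splitPt p.2 P p.1) := by
  have hH : Measurable fun x : ((Ch S × Ch S) × (MCh S × MCh S)) × (MCh S × MCh S × MCh S) =>
    G (joinPt S (x.1.2, x.2) x.1.1) := by fun_prop
  have h2 := (measurable_sum_parts_prod S t hH).comp
    (f := fun p : (Ch S × Ch S) × Triple S => ((p.1, (p.2.1, p.2.2.1)), p.2.2.2)) (by fun_prop)
  simp only [Function.comp_def] at h2
  simp_rw [splitPt_eq]
  exact h2

/-- The chains `ϑ₀⁻` and `ϑ₊⁻` do not touch the argument on the target side. They are parameters in
`lintegral_union_parts`, and Tonelli's theorem supplies the rest. -/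
theorem lintegral_partM_vecM (t : ℝ) (κc κg : Ch S) {G : Table S × Triple S → ℝ≥0∞}
    (hG : Measurable G) :
    ∫⁻ q, ∫⁻ x, G x ∂(partM S t q) ∂(vecM S κc κg) =
    ∫⁻ ϑ, ∫⁻ z, G (ϑ, z) ∂(vecM S (κc.union ϑ.cre) (κg.union ϑ.gau)) ∂(tabT S t) := by
  have hm : Measurable fun ϑ : Table S => ∫⁻ z, G (ϑ, z)
      ∂(vecM S (κc.union ϑ.cre) (κg.union ϑ.gau)) :=
    measurable_lintegral_vecM S hG (by fun_prop) (by fun_prop)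
  refine Eq.symm ((lintegral_tabT_pair S t hm).trans ?_)
  have e : ∀ r : Ch S × Ch S, ∫⁻ cre, ∫⁻ gau, ∫⁻ z, G ((r.1, gau, cre, r.2), z)
      ∂(vecM S (κc.union cre) (κg.union gau)) ∂(chT S t) ∂(chT S t) =
      ∫⁻ q, ∑ P ∈ parts S t q.2.2, G (splitPt q P r) ∂(vecM S κc κg) := fun r =>
    lintegral_union_parts S t κc κg (G := fun x => G ((r.1, x.1.2, x.1.1, r.2), x.2)) (by fun_prop)
  have hS := measurable_sum_splitPt S t hG
  refine (lintegral_congr e).trans ?_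
  refine (lintegral_lintegral_swap (μ := pairM S t) hS.aemeasurable).trans ?_
  refine lintegral_congr fun q => ?_
  rw [lintegral_partM S t q hG, lintegral_finsetSum _ fun P _ => hG.fun_comp (measurable_splitPt S q P)]

variable {X : Type*} [MeasurableSpace X] (S : NoiseSpace X)

/-! ### Absorbing the points outside a table -/

/-- The change of variables in the point derivative. -/
def pull (κ κ' : Ch S) (z : Triple S) : Triple S :=
  (inCh S z.1 κ, inCh S z.2.1 κ', ((offCh S z.1 κ).union (offCh S z.2.1 κ')).union z.2.2)

theorem deriv_eq {H : Type*} (κ : Table S) (b : Triple S → H) :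
    deriv κ b = fun z => b (pull S κ.ann κ.gau z) := rfl

theorem base_attach (κ : Ch S) (m : Fin κ.len → ℕ) : base S (attach S κ m) = κ := rfl

theorem ae_apart_base (κ : Ch S) : ∀ᵐ w ∂(mchM S), κ.Apart (base S w) := by
  filter_upwards [ae_apart_mch S (attach S κ 0)] with w hw
  rw [← base_apart, base_attach] at hw
  exact hw

theorem inCh_union_base {κ : Ch S} {y z : MCh S} (h : κ.Apart (base S z)) (hy : base S y = κ) :
    inCh S (y.union z) κ = y ∧ offCh S (y.union z) κ = z := by
  have ha : y.Apart z := by rw [← base_apart, hy]; exact h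
  have h1 : ∀ p ∈ y.support, p.1 ∈ κ.support := fun p hp => by
    rw [← hy, support_base]; exact mem_image_of_mem _ hp
  have h2 : ∀ p ∈ z.support, p.1 ∉ κ.support := fun p hp hk =>
    disjoint_left.1 h.disjoint hk (by rw [support_base]; exact mem_image_of_mem _ hp)
  constructor
  · refine Chain.ext_support ?_
    rw [support_inCh, Chain.support_union ha]
    ext p
    constructor
    · rintro ⟨hp | hp, hk⟩
      · exact hp
      · exact (h2 p hp hk).elim
    · exact fun hp => ⟨Or.inl hp, h1 p hp⟩
  · refine Chain.ext_support ?_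
    rw [support_offCh, Chain.support_union ha]
    ext p
    constructor
    · rintro ⟨hp | hp, hk⟩
      · exact (hk (h1 p hp)).elim
      · exact hp
    · exact fun hp => ⟨Or.inr hp, h2 p hp⟩

theorem support_sub_subset {Z : Type*} {τ : Z → ℝ} (w : Chain τ) (s : Finset (Fin w.len)) :
    (w.sub s).support ⊆ w.support := by
  rw [Chain.support_sub]; exact image_subset_range _ _

theorem sub_apart {Z : Type*} {τ : Z → ℝ} (w : Chain τ) {s s' : Finset (Fin w.len)}
    (h : Disjoint s s') : (w.sub s).Apart (w.sub s') := by
  intro a ha b hb hab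
  rw [Chain.support_sub] at ha hb
  obtain ⟨i, hi, rfl⟩ := ha
  obtain ⟨j, hj, rfl⟩ := hb
  have : i = j := w.strictMono_pt.injective hab
  subst this
  exact Finset.disjoint_left.1 h hi hj

theorem sub_union_sub {Z : Type*} {τ : Z → ℝ} (w : Chain τ) {s s' : Finset (Fin w.len)}
    (h : Disjoint s s') : ((w.sub s).union (w.sub s')).union (w.sub (s ∪ s')ᶜ) = w := by
  classical
  have h1 := sub_apart w h
  have h2 : ((w.sub s).union (w.sub s')).Apart (w.sub (s ∪ s')ᶜ) := by
    intro a ha b hb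
    rw [Chain.support_union h1] at ha
    rcases ha with ha | ha
    · exact sub_apart w (s := s) (s' := (s ∪ s')ᶜ)
        (disjoint_compl_right.mono_left (Finset.subset_union_left)) a ha b hb
    · exact sub_apart w (s := s') (s' := (s ∪ s')ᶜ)
        (disjoint_compl_right.mono_left (Finset.subset_union_right)) a ha b hb
  refine Chain.ext_support ?_
  rw [Chain.support_union h2, Chain.support_union h1, Chain.support_sub, Chain.support_sub,
    Chain.support_sub, ← image_union, ← image_union, Chain.support, ← image_univ]
  congr 1
  ext i
  simp
  tauto

/-- The marks over `κ`, `κ'` are separated from the points taken out of the argument, and the three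
pieces of the argument are put together again. A function of `q` can therefore be written as a
function of the variables under the multiple integral. -/
theorem pull_splitPt {κ κ' : Ch S} {t : ℝ} {q : Triple S} (h1 : base S q.1 = κ)
    (h2 : base S q.2.1 = κ') (h3 : κ.Apart (base S q.2.2)) (h4 : κ'.Apart (base S q.2.2))
    {P} (hP : P ∈ parts S t q.2.2) (r) : pull S κ κ' (splitPt q P r).2 = q := by
  have hd : Disjoint P.1 P.2 := by
    simp only [parts, Finset.mem_filter] at hP
    exact hP.2.1
  have hb : ∀ s, (base S (q.2.2.sub s)).support ⊆ (base S q.2.2).support := fun s => by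
    rw [support_base, support_base]; exact image_mono (support_sub_subset _ _)
  have e1 := inCh_union_base S (h3.mono Subset.rfl (hb P.2)) h1
  have e2 := inCh_union_base S (h4.mono Subset.rfl (hb P.1)) h2
  change (inCh S (q.1.union (q.2.2.sub P.2)) κ, inCh S (q.2.1.union (q.2.2.sub P.1)) κ',
    ((offCh S (q.1.union (q.2.2.sub P.2)) κ).union
      (offCh S (q.2.1.union (q.2.2.sub P.1)) κ')).union (q.2.2.sub (P.1 ∪ P.2)ᶜ)) = q
  rw [e1.1, e1.2, e2.1, e2.2, Chain.union_comm (q.2.2.sub P.2), sub_union_sub _ hd]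

theorem inCh_empty (y : MCh S) : inCh S y (Chain.empty S.time) = Chain.empty S.markedTime :=
  Chain.eq_empty_of_support (by simp)

theorem offCh_empty (y : MCh S) : offCh S y (Chain.empty S.time) = y :=
  Chain.ext_support (by simp)

theorem pull_empty (z : Triple S) : pull S (Chain.empty S.time) (Chain.empty S.time) z =
    (Chain.empty S.markedTime, Chain.empty S.markedTime, (z.1.union z.2.1).union z.2.2) := by
  simp only [pull, inCh_empty, offCh_empty]

/-- Absorption in two steps. -/
theorem pull_empty_pull {κ κ' : Ch S} {z : Triple S} (h1 : z.1.Apart z.2.1)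
    (h2 : (z.1.union z.2.1).Apart z.2.2) :
    pull S (Chain.empty S.time) (Chain.empty S.time) (pull S κ κ' z) =
      pull S (Chain.empty S.time) (Chain.empty S.time) z := by
  rw [pull_empty, pull_empty]
  congr 2
  have ss : ∀ (y : MCh S) (σ : Ch S), (inCh S y σ).support ⊆ y.support ∧
      (offCh S y σ).support ⊆ y.support := fun y σ => by simp
  have hs := Chain.support_union h1
  have a1 : (inCh S z.1 κ).Apart (inCh S z.2.1 κ') := h1.mono (ss _ _).1 (ss _ _).1
  have a2 : (offCh S z.1 κ).Apart (offCh S z.2.1 κ') := h1.mono (ss _ _).2 (ss _ _).2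
  have a3 : ((offCh S z.1 κ).union (offCh S z.2.1 κ')).Apart z.2.2 := by
    refine h2.mono ?_ Subset.rfl
    rw [Chain.support_union a2, hs]
    exact union_subset_union (ss _ _).2 (ss _ _).2
  have a4 : ((inCh S z.1 κ).union (inCh S z.2.1 κ')).Apart
      (((offCh S z.1 κ).union (offCh S z.2.1 κ')).union z.2.2) := by
    intro a ha b hb
    rw [Chain.support_union a1] at ha
    rw [Chain.support_union a3, Chain.support_union a2] at hb
    rcases hb with (hb | hb) | hb
    · rcases ha with ha | ha
      · exact inCh_apart_offCh S _ _ a ha b hb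
      · exact h1.symm a ((ss _ _).1 ha) b ((ss _ _).2 hb)
    · rcases ha with ha | ha
      · exact h1 a ((ss _ _).1 ha) b ((ss _ _).2 hb)
      · exact inCh_apart_offCh S _ _ a ha b hb
    · refine h2 a ?_ b hb
      rw [hs]
      exact ha.imp (fun h => (ss _ _).1 h) (fun h => (ss _ _).1 h)
  refine Chain.ext_support ?_
  simp only [pull]
  rw [Chain.support_union a4, Chain.support_union a1, Chain.support_union a3,
    Chain.support_union a2, Chain.support_union h2, hs]
  simp only [support_inCh, support_offCh]
  ext p
  simp only [mem_union, mem_inter_iff, mem_sdiff]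
  tauto

/-! ### The multinomial formula -/

/-- The multinomial theorem: the sum over all colourings of the points is the power of `a + b + c`,
and the time constraint only removes terms. -/
theorem sum_parts_le (t : ℝ) (w : MCh S) (a b c : ℝ≥0∞) :
    ∑ P ∈ parts S t w, a ^ (w.sub P.1).len * b ^ (w.sub P.2).len * c ^ (w.sub (P.1 ∪ P.2)ᶜ).len ≤
      (a + b + c) ^ w.len := by
  rw [sum_parts_eq S t (fun p => a ^ p.1.len * b ^ p.2.1.len * c ^ p.2.2.len)]
  let F : MCh S × MCh S × MCh S → ℝ≥0∞ := fun p => a ^ p.1.len * b ^ p.2.1.len * c ^ p.2.2.len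
  refine (Finset.sum_le_sum (g := fun c => F (w.col c 0, w.col c 1, w.col c 2)) fun c _ => by
    exact indicator_le_self _ F _).trans ?_
  let v : Fin 3 → ℝ≥0∞ := ![a, b, c]
  have hv : a + b + c = ∑ k, v k := by simp [v, Fin.sum_univ_three]
  rw [hv, Fintype.sum_pow]
  refine le_of_eq (Finset.sum_congr rfl fun f _ => ?_)
  have h : ∏ i, v (f i) = ∏ k : Fin 3, v k ^ (Finset.univ.filter fun i => f i = k).card := by
    rw [← Finset.prod_fiberwise_of_maps_to (s := Finset.univ) (t := Finset.univ) (g := f)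
      (fun _ _ => Finset.mem_univ _)]
    refine Finset.prod_congr rfl fun k _ => ?_
    rw [Finset.prod_congr rfl (g := fun _ => v k) (fun i hi => by
      rw [(Finset.mem_filter.1 hi).2])]
    exact Finset.prod_const _
  rw [h, Fin.prod_univ_three]
  rfl

variable [MeasurableSingletonClass X]

@[fun_prop]
theorem measurable_inCh (κ : Ch S) {Ω : Type*} [MeasurableSpace Ω] {f : Ω → MCh S}
    (hf : Measurable f) : Measurable fun ω => inCh S (f ω) κ := by
  have h : MeasurableSet {p : X × ℕ | p.1 ∈ κ.support} :=
    κ.finite_support.measurableSet.preimage measurable_fst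
  exact (Chain.measurable_inside h).comp hf

@[fun_prop]
theorem measurable_offCh (κ : Ch S) {Ω : Type*} [MeasurableSpace Ω] {f : Ω → MCh S}
    (hf : Measurable f) : Measurable fun ω => offCh S (f ω) κ := by
  have h : MeasurableSet {p : X × ℕ | p.1 ∈ κ.support} :=
    κ.finite_support.measurableSet.preimage measurable_fst
  exact (Chain.measurable_inside h.compl).comp hf

@[fun_prop]
theorem measurable_pull (κ κ' : Ch S) {Ω : Type*} [MeasurableSpace Ω] {f : Ω → Triple S}
    (hf : Measurable f) : Measurable fun ω => pull S κ κ' (f ω) := by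
  unfold pull; fun_prop

theorem ae_vecM {κ κ' : Ch S} : ∀ᵐ q ∂(vecM S κ κ'), q.1 ∈ fiber S κ ∧ q.2.1 ∈ fiber S κ' ∧
    κ.Apart (base S q.2.2) ∧ κ'.Apart (base S q.2.2) := by
  have h1 : ∀ᵐ q ∂(vecM S κ κ'), q.1 ∈ fiber S κ :=
    Measure.quasiMeasurePreserving_fst.ae (ae_mem_fiber S κ)
  have h2 : ∀ᵐ q ∂(vecM S κ κ'), q.2.1 ∈ fiber S κ' ∧ κ.Apart (base S q.2.2) ∧
      κ'.Apart (base S q.2.2) := by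
    refine Measure.quasiMeasurePreserving_snd.ae (p := fun p : MCh S × MCh S =>
      p.1 ∈ fiber S κ' ∧ κ.Apart (base S p.2) ∧ κ'.Apart (base S p.2)) ?_
    have a1 : ∀ᵐ p ∂((fibM S κ').prod (mchM S)), p.1 ∈ fiber S κ' :=
      Measure.quasiMeasurePreserving_fst.ae (ae_mem_fiber S κ')
    have a2 : ∀ᵐ p ∂((fibM S κ').prod (mchM S)), κ.Apart (base S p.2) ∧ κ'.Apart (base S p.2) :=
      Measure.quasiMeasurePreserving_snd.ae ((ae_apart_base S κ).and (ae_apart_base S κ'))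
    exact a1.and a2
  exact h1.and h2

theorem ae_partM_pull (t : ℝ) (κ κ' : Ch S) : ∀ᵐ q ∂(vecM S κ κ'),
    ∀ᵐ x ∂(partM S t q), pull S κ κ' x.2 = q := by
  filter_upwards [ae_vecM S] with q hq
  have hm : MeasurableSet {x : Table S × Triple S | ¬ pull S κ κ' x.2 = q} :=
    
    ((measurableSet_singleton q).preimage (by fun_prop : Measurable fun x : Table S × Triple S =>
      pull S κ κ' x.2)).compl
  rw [ae_iff, partM, Measure.finsetSum_apply, Finset.sum_eq_zero_iff]
  intro P hP
  rw [Measure.map_apply (measurable_splitPt S q P) hm]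
  refine (measure_mono_null (t := ∅) ?_ measure_empty)
  intro r hr
  exact hr (pull_splitPt S hq.1.1 hq.2.1.1 hq.2.2.1 hq.2.2.2 hP r)

/-- By `pull_splitPt` the factor `A` takes the value `A q` on every split of `q`, so only a sum of
weights over parts remains, and `sum_parts_le` applies. This is how three weights combine into their
sum. -/
theorem lintegral_pull_le (t : ℝ) (κc κg : Ch S) {A : Triple S → ℝ≥0∞} (hA : Measurable A)
    (a b c : ℝ≥0∞) :
    ∫⁻ cre, a ^ cre.len * ∫⁻ gau, b ^ gau.len * ∫⁻ z, c ^ z.2.2.len * A (pull S κc κg z)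
      ∂(vecM S (κc.union cre) (κg.union gau)) ∂(chT S t) ∂(chT S t) ≤
    ∫⁻ q, (a + b + c) ^ q.2.2.len * A q ∂(vecM S κc κg) := by
  have hm : Measurable fun x : (Ch S × Ch S) × Triple S => c ^ x.2.2.2.len * A (pull S κc κg x.2) := by
    fun_prop
  let W : Ch S × Ch S → ℝ≥0∞ := fun x => ∫⁻ z, c ^ z.2.2.len * A (pull S κc κg z)
      ∂(vecM S (κc.union x.1) (κg.union x.2))
  have hW : Measurable W := measurable_lintegral_vecM S hm (by fun_prop) (by fun_prop)
  change ∫⁻ cre, a ^ cre.len * ∫⁻ gau, b ^ gau.len * W (cre, gau) ∂(chT S t) ∂(chT S t) ≤ _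
  have e : ∀ cre, a ^ cre.len * ∫⁻ gau, b ^ gau.len * W (cre, gau) ∂(chT S t) =
      ∫⁻ gau, ∫⁻ z, (a ^ cre.len * b ^ gau.len) * (c ^ z.2.2.len * A (pull S κc κg z))
        ∂(vecM S (κc.union cre) (κg.union gau)) ∂(chT S t) := by
    intro cre
    rw [← lintegral_const_mul _ (by fun_prop)]
    refine lintegral_congr fun gau => ?_
    rw [← mul_assoc]
    exact (lintegral_const_mul _ (by fun_prop)).symm
  refine (lintegral_congr e).trans_le ?_
  refine (lintegral_union_parts S t κc κg (G := fun x => (a ^ x.1.1.len * b ^ x.1.2.len) *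
        (c ^ x.2.2.2.len * A (pull S κc κg x.2))) (by fun_prop)).trans_le ?_
  refine lintegral_mono_ae ?_
  filter_upwards [ae_vecM S] with q hq
  have h : ∀ P ∈ parts S t q.2.2, (a ^ (base S (q.2.2.sub P.2)).len * b ^ (base S (q.2.2.sub P.1)).len) *
      (c ^ (q.2.2.sub (P.1 ∪ P.2)ᶜ).len * A (pull S κc κg (q.1.union (q.2.2.sub P.2),
        q.2.1.union (q.2.2.sub P.1), q.2.2.sub (P.1 ∪ P.2)ᶜ))) =
      (b ^ (q.2.2.sub P.1).len * a ^ (q.2.2.sub P.2).len * c ^ (q.2.2.sub (P.1 ∪ P.2)ᶜ).len) * A q := by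
    intro P hP
    have := pull_splitPt S hq.1.1 hq.2.1.1 hq.2.2.1 hq.2.2.2 hP (Chain.empty S.time, Chain.empty S.time)
    simp only [splitPt] at this
    rw [this, len_base, len_base]
    ring
  rw [Finset.sum_congr rfl h, ← Finset.sum_mul, add_comm a b]
  gcongr
  exact sum_parts_le S t _ _ _ _

/-! ### The measure on tables and arguments -/

/-- The vector measures as a kernel. -/
def vecKer (κc κg : Ch S) : ProbabilityTheory.Kernel (Table S) (Table S × Triple S) where
  toFun ϑ := (vecM S (κc.union ϑ.cre) (κg.union ϑ.gau)).map (Prod.mk ϑ)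
  measurable' := by
    refine Measure.measurable_of_measurable_coe _ fun s hs => ?_
    have h : ∀ ϑ : Table S, (vecM S (κc.union ϑ.cre) (κg.union ϑ.gau)).map (Prod.mk ϑ) s =
        ∫⁻ z, s.indicator 1 (ϑ, z) ∂(vecM S (κc.union ϑ.cre) (κg.union ϑ.gau)) := by
      intro ϑ
      rw [← lintegral_indicator_one hs, lintegral_map (measurable_one.indicator hs)
        measurable_prodMk_left]
    simp_rw [h]
    exact measurable_lintegral_vecM S (measurable_one.indicator hs) (by fun_prop) (by fun_prop)

theorem vecKer_apply (κc κg : Ch S) (ϑ : Table S) :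
    vecKer S κc κg ϑ = (vecM S (κc.union ϑ.cre) (κg.union ϑ.gau)).map (Prod.mk ϑ) := rfl

/-- The measure on tables and arguments. -/
def thetaM (κc κg : Ch S) (t : ℝ) : Measure (Table S × Triple S) :=
  (vecM S κc κg).bind (partKerAt S t)

theorem lintegral_thetaM (κc κg : Ch S) (t : ℝ) {G : Table S × Triple S → ℝ≥0∞}
    (hG : Measurable G) : ∫⁻ x, G x ∂(thetaM S κc κg t) =
      ∫⁻ ϑ, ∫⁻ z, G (ϑ, z) ∂(vecM S (κc.union ϑ.cre) (κg.union ϑ.gau)) ∂(tabT S t) := by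
  rw [thetaM, Measure.lintegral_bind (partKerAt S t).measurable.aemeasurable hG.aemeasurable]
  exact lintegral_partM_vecM S t κc κg hG

/-- One measure with two disintegrations, over arguments and over tables. Null sets and Bochner
integrals are carried from one description to the other through it. -/
theorem thetaM_eq (κc κg : Ch S) (t : ℝ) :
    thetaM S κc κg t = (tabT S t).bind (vecKer S κc κg) := by
  refine Measure.ext_of_lintegral _ fun G hG => ?_
  rw [lintegral_thetaM S κc κg t hG,
    Measure.lintegral_bind (vecKer S κc κg).measurable.aemeasurable hG.aemeasurable]
  refine lintegral_congr fun ϑ => ?_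
  rw [vecKer_apply, lintegral_map hG measurable_prodMk_left]

theorem ae_thetaM_vecM {κc κg : Ch S} {t : ℝ} {p : Table S × Triple S → Prop}
    (h : ∀ᵐ x ∂(thetaM S κc κg t), p x) :
    ∀ᵐ ϑ ∂(tabT S t), ∀ᵐ z ∂(vecM S (κc.union ϑ.cre) (κg.union ϑ.gau)), p (ϑ, z) := by
  rw [thetaM_eq] at h
  filter_upwards [Measure.ae_ae_of_ae_bind (vecKer S κc κg).measurable.aemeasurable h] with ϑ hϑ
  exact ae_of_ae_map measurable_prodMk_left.aemeasurable hϑ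

omit [MeasurableSingletonClass X] in
theorem ae_thetaM_partM {κc κg : Ch S} {t : ℝ} {p : Table S × Triple S → Prop}
    (h : ∀ᵐ x ∂(thetaM S κc κg t), p x) :
    ∀ᵐ q ∂(vecM S κc κg), ∀ᵐ x ∂(partM S t q), p x :=
  Measure.ae_ae_of_ae_bind (partKerAt S t).measurable.aemeasurable h

theorem ae_thetaM_of_vecM {κc κg : Ch S} {t : ℝ} {p : Table S × Triple S → Prop}
    (hp : MeasurableSet {x | p x})
    (h : ∀ᵐ ϑ ∂(tabT S t), ∀ᵐ z ∂(vecM S (κc.union ϑ.cre) (κg.union ϑ.gau)), p (ϑ, z)) :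
    ∀ᵐ x ∂(thetaM S κc κg t), p x := by
  rw [ae_iff]
  change thetaM S κc κg t {x | p x}ᶜ = 0
  rw [← lintegral_indicator_one hp.compl, lintegral_thetaM S _ _ _
    (measurable_one.indicator hp.compl)]
  refine (lintegral_congr_ae ?_).trans lintegral_zero
  filter_upwards [h] with ϑ hϑ
  refine (lintegral_congr_ae ?_).trans lintegral_zero
  filter_upwards [hϑ] with z hz
  exact indicator_of_notMem (not_not_intro hz) _

omit [MeasurableSingletonClass X] in
theorem ae_thetaM_of_partM {κc κg : Ch S} {t : ℝ} {p : Table S × Triple S → Prop}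
    (hp : MeasurableSet {x | p x})
    (h : ∀ᵐ q ∂(vecM S κc κg), ∀ᵐ x ∂(partM S t q), p x) :
    ∀ᵐ x ∂(thetaM S κc κg t), p x := by
  rw [ae_iff]
  change thetaM S κc κg t {x | p x}ᶜ = 0
  rw [← lintegral_indicator_one hp.compl, thetaM, Measure.lintegral_bind
    (partKerAt S t).measurable.aemeasurable (measurable_one.indicator hp.compl).aemeasurable]
  refine (lintegral_congr_ae ?_).trans lintegral_zero
  filter_upwards [h] with q hq
  refine (lintegral_congr_ae ?_).trans lintegral_zero
  filter_upwards [hq] with z hz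
  exact indicator_of_notMem (not_not_intro hz) _

/-- For almost every `q`, `pull` takes the value `q` on almost all of its splits, so a null set of
arguments pulls back to a null set of `thetaM`, which has null sections over almost all tables. -/
theorem ae_pull {κc κg : Ch S} {t : ℝ} {p : Triple S → Prop} (h : ∀ᵐ q ∂(vecM S κc κg), p q) :
    ∀ᵐ ϑ ∂(tabT S t), ∀ᵐ z ∂(vecM S (κc.union ϑ.cre) (κg.union ϑ.gau)), p (pull S κc κg z) := by
  obtain ⟨N, hN, hNm, hN0⟩ := exists_measurable_superset_of_null (ae_iff.1 h)
  have h1 : ∀ᵐ x ∂(thetaM S κc κg t), pull S κc κg x.2 ∉ N := by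
    refine ae_thetaM_of_partM S ?_ ?_
    · exact (hNm.preimage (by fun_prop : Measurable fun x : Table S × Triple S =>
        pull S κc κg x.2)).compl
    · filter_upwards [measure_eq_zero_iff_ae_notMem.1 hN0, ae_partM_pull S t κc κg] with q hq hq2
      filter_upwards [hq2] with x hx
      rw [hx]; exact hq
  filter_upwards [ae_thetaM_vecM S h1] with ϑ hϑ
  filter_upwards [hϑ] with z hz
  by_contra hc
  exact hz (hN hc)

/-! ### Cauchy–Schwarz and duality with weights -/

section
variable {α : Type*} [MeasurableSpace α] {ν : Measure α}

theorem rpow_half_sq (a : ℝ≥0∞) : (a ^ (1 / 2 : ℝ)) ^ 2 = a := by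
  rw [← ENNReal.rpow_natCast, ← ENNReal.rpow_mul]; norm_num

theorem sq_rpow_half (a : ℝ≥0∞) : (a ^ 2) ^ (1 / 2 : ℝ) = a := by
  rw [← ENNReal.rpow_natCast, ← ENNReal.rpow_mul]; norm_num

theorem lintegral_mul_le_weighted {f g v w : α → ℝ≥0∞} (hf : AEMeasurable f ν)
    (hg : AEMeasurable g ν) (hv : AEMeasurable v ν) (hw : AEMeasurable w ν)
    (h : ∀ x, v x * w x = 1) :
    ∫⁻ x, f x * g x ∂ν ≤
      (∫⁻ x, v x * f x ^ 2 ∂ν) ^ (1 / 2 : ℝ) * (∫⁻ x, w x * g x ^ 2 ∂ν) ^ (1 / 2 : ℝ) := by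
  have h1 := ENNReal.lintegral_mul_le_Lp_mul_Lq ν Real.HolderConjugate.two_two
    (f := fun x => v x ^ (1 / 2 : ℝ) * f x) (g := fun x => w x ^ (1 / 2 : ℝ) * g x)
    ((hv.pow_const _).mul hf) ((hw.pow_const _).mul hg)
  have e : ∀ a b : ℝ≥0∞, (a ^ (1 / 2 : ℝ) * b) ^ (2 : ℝ) = a * b ^ 2 := by
    intro a b
    rw [ENNReal.rpow_two, mul_pow, rpow_half_sq]
  simp only [e] at h1
  refine le_trans (le_of_eq (lintegral_congr fun x => ?_)) h1
  simp only [Pi.mul_apply]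
  have : (v x ^ (1 / 2 : ℝ)) * (w x ^ (1 / 2 : ℝ)) = 1 := by
    rw [← ENNReal.mul_rpow_of_nonneg _ _ (by norm_num), h, ENNReal.one_rpow]
  calc f x * g x = (v x ^ (1 / 2 : ℝ)) * (w x ^ (1 / 2 : ℝ)) * (f x * g x) := by rw [this, one_mul]
    _ = _ := by ring

theorem le_of_sq_le_mul {a K : ℝ≥0∞} (ha : a ≠ ⊤) (h : a ^ 2 ≤ K * a) : a ≤ K := by
  rcases eq_or_ne a 0 with rfl | h0
  · exact zero_le
  · rw [sq] at h
    exact (ENNReal.mul_le_mul_iff_left h0 ha).1 h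

/-- The norm of a weighted `L²` space is attained by duality. -/
theorem rpow_lintegral_le_of_dual [SigmaFinite ν] {V v w : α → ℝ≥0∞} (hV : Measurable V)
    (hw : Measurable w) (hvw : ∀ x, v x * w x = 1) {K : ℝ≥0∞}
    (h : ∀ C : α → ℝ≥0∞, Measurable C →
      ∫⁻ x, C x * V x ∂ν ≤ K * (∫⁻ x, v x * C x ^ 2 ∂ν) ^ (1 / 2 : ℝ)) :
    (∫⁻ x, w x * V x ^ 2 ∂ν) ^ (1 / 2 : ℝ) ≤ K := by
  have hwt : ∀ x, w x ≠ ⊤ := fun x hx => by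
    have := hvw x
    rw [hx] at this
    rcases eq_or_ne (v x) 0 with h0 | h0
    · rw [h0, zero_mul] at this; exact zero_ne_one this
    · rw [ENNReal.mul_top h0] at this; exact ENNReal.top_ne_one this
  -- Truncation in the space, in the weight and in the value makes the norm finite, so that it can
  -- be cancelled. The test function is `w · min V n` on `D n`: its pairing with `V` dominates `∫ T
  -- n`, and its dual norm is the square root of `∫ T n`.
  let D : ℕ → Set α := fun n => spanningSets ν n ∩ {x | w x ≤ n}
  have hD : ∀ n, MeasurableSet (D n) := fun n =>
    (measurableSet_spanningSets ν n).inter (measurableSet_le hw measurable_const)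
  let T : ℕ → α → ℝ≥0∞ := fun n => (D n).indicator fun x => w x * min (V x) n ^ 2
  have hT : ∀ n, Measurable (T n) := fun n =>
    (hw.mul ((hV.min measurable_const).pow_const 2)).indicator (hD n)
  have hfin : ∀ n, ∫⁻ x, T n x ∂ν ≠ ⊤ := by
    intro n
    rw [lintegral_indicator (hD n)]
    refine ne_top_of_le_ne_top (b := ∫⁻ x in D n, n * (n : ℝ≥0∞) ^ 2 ∂ν) ?_
      (setLIntegral_mono' (hD n) fun x hx => ?_)
    · rw [setLIntegral_const]
      refine ENNReal.mul_ne_top (by finiteness) ?_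
      exact ((measure_mono inter_subset_left).trans_lt (measure_spanningSets_lt_top ν n)).ne
    · have h1 : w x ≤ n := hx.2
      gcongr
      exact min_le_right _ _
  have hle : ∀ n, (∫⁻ x, T n x ∂ν) ^ (1 / 2 : ℝ) ≤ K := by
    intro n
    refine le_of_sq_le_mul (ENNReal.rpow_ne_top_of_nonneg (by norm_num) (hfin n)) ?_
    rw [rpow_half_sq]
    have hC : Measurable ((D n).indicator fun x => w x * min (V x) n) :=
      (hw.mul (hV.min measurable_const)).indicator (hD n)
    refine le_trans (lintegral_mono fun x => ?_) ((h _ hC).trans_eq ?_)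
    · by_cases hx : x ∈ D n
      · simp only [T, indicator_of_mem hx, sq, mul_assoc]
        gcongr
        exact min_le_left _ _
      · simp only [T, indicator_of_notMem hx, zero_mul]; exact le_rfl
    · congr 2
      refine lintegral_congr fun x => ?_
      by_cases hx : x ∈ D n
      · simp only [T, indicator_of_mem hx]
        rw [mul_pow, ← mul_assoc, sq (w x), ← mul_assoc, hvw, one_mul]
      · simp only [T, indicator_of_notMem hx]; simp
  have hlim : ∀ x, Filter.Tendsto (fun n => T n x) Filter.atTop (nhds (w x * V x ^ 2)) := by
    intro x
    have h1 : Filter.Tendsto (fun n : ℕ => w x * min (V x) n ^ 2) Filter.atTop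
        (nhds (w x * V x ^ 2)) := by
      have h2 : Filter.Tendsto (fun n : ℕ => min (V x) (n : ℝ≥0∞)) Filter.atTop (nhds (V x)) := by
        have := (tendsto_const_nhds (x := V x)).min ENNReal.tendsto_nat_nhds_top
        simpa using this
      exact ENNReal.Tendsto.const_mul (ENNReal.Tendsto.pow h2) (Or.inr (hwt x))
    refine h1.congr' ?_
    obtain ⟨m, hm⟩ : ∃ m, x ∈ spanningSets ν m := by
      have : x ∈ ⋃ n, spanningSets ν n := by rw [iUnion_spanningSets]; trivial
      exact mem_iUnion.1 this
    obtain ⟨k, hk⟩ := ENNReal.exists_nat_gt (hwt x)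
    filter_upwards [Filter.eventually_ge_atTop (max m k)] with n hn
    have hx : x ∈ D n := ⟨monotone_spanningSets ν ((le_max_left _ _).trans hn) hm,
      hk.le.trans (by exact_mod_cast (le_max_right _ _).trans hn)⟩
    simp only [T, indicator_of_mem hx]
  -- Fatou's lemma removes the truncation.
  have hsq : ∫⁻ x, w x * V x ^ 2 ∂ν ≤ K ^ 2 := by
    calc ∫⁻ x, w x * V x ^ 2 ∂ν = ∫⁻ x, Filter.liminf (fun n => T n x) Filter.atTop ∂ν :=
          lintegral_congr fun x => (hlim x).liminf_eq.symm
      _ ≤ Filter.liminf (fun n => ∫⁻ x, T n x ∂ν) Filter.atTop := lintegral_liminf_le hT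
      _ ≤ K ^ 2 := by
          refine (Filter.liminf_le_liminf (v := fun _ : ℕ => K ^ 2)
            (Filter.Eventually.of_forall fun n => ?_)).trans_eq (Filter.liminf_const _)
          have := pow_le_pow_left₀ zero_le (hle n) 2
          rwa [rpow_half_sq] at this
  calc _ ≤ (K ^ 2) ^ (1 / 2 : ℝ) := ENNReal.rpow_le_rpow hsq (by norm_num)
    _ = K := sq_rpow_half K

end

/-! ### The basic estimate for multiple integrals. -/

variable {X : Type*} [MeasurableSpace X] (S : NoiseSpace X)

/-- The squared norm in the scale, of a non-negative function. -/
def wsq (ξ : ℝ) (σ ρ : Ch S) (A : Triple S → ℝ≥0∞) : ℝ≥0∞ :=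
  ∫⁻ y, ENNReal.ofReal ξ ^ y.2.2.len * A y ^ 2 ∂(vecM S σ ρ)

/-- The norm of local QS integrability, for a bound `E` of the essential supremum. -/
def bnd (t : ℝ) (η : Weights) (E : Ch S × Ch S × Ch S → ℝ≥0∞) : ℝ≥0∞ :=
  ∫⁻ tim, (∫⁻ ann, ∫⁻ cre, ENNReal.ofReal η.loPlus ^ cre.len / ENNReal.ofReal η.upMinus ^ ann.len *
    E (ann, cre, tim) ∂(chT S t) ∂(chT S t)) ^ (1 / 2 : ℝ) ∂(chT S t)

theorem ofReal_pow_mul_inv {ξ : ℝ} (h : 0 < ξ) (n : ℕ) :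
    ENNReal.ofReal (1 / ξ) ^ n * ENNReal.ofReal ξ ^ n = 1 := by
  rw [← mul_pow, ← ENNReal.ofReal_mul (by positivity), one_div, inv_mul_cancel₀ h.ne',
    ENNReal.ofReal_one, one_pow]

theorem pow_mul_div {ξ : ℝ} (h : 0 < ξ) (n : ℕ) (a : ℝ≥0∞) :
    ENNReal.ofReal ξ ^ n * (a / ENNReal.ofReal ξ ^ n) = a := by
  have h0 : ENNReal.ofReal ξ ^ n ≠ 0 := pow_ne_zero _ (by simpa using h)
  exact ENNReal.mul_div_cancel h0 (by finiteness)

theorem inv_pow_eq {ξ : ℝ} (h : 0 < ξ) (n : ℕ) :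
    ENNReal.ofReal (1 / ξ) ^ n = (ENNReal.ofReal ξ ^ n)⁻¹ :=
  ENNReal.eq_inv_of_mul_eq_one_left (ofReal_pow_mul_inv h n)

theorem measurable_lintegral_partM_at (t : ℝ) {F : Table S × Triple S → ℝ≥0∞} (hF : Measurable F) :
    Measurable fun q => ∫⁻ x, F x ∂(partM S t q) := by
  have h := (measurable_lintegral_partM S hF).comp (measurable_prodMk_left (x := t))
  simp only [Function.comp_def] at h
  exact h

variable [MeasurableSingletonClass X]

variable {S} in
/-- The squared norm which controls the multiple integral over `[0, t)`: only the points before `t` carry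
the full weight. -/
def adaptedSq (t : ℝ) (κ : Table S) (η : Weights) (A : Triple S → ℝ≥0∞) : ℝ≥0∞ :=
  ∫⁻ ann, ENNReal.ofReal η.upMinus ^ ann.len * ∫⁻ gau, ENNReal.ofReal η.upZero ^ gau.len *
    wsq S η.upPlus (κ.ann.union ann) (κ.gau.union gau) (fun z => A (pull S κ.ann κ.gau z))
      ∂(chT S t) ∂(chT S t)

/-- The three weights refer to the points absorbed from `ϑ₀⁻`, from `ϑ₀⁰` and to the remaining ones,
so the multinomial bound gives their sum as weight of every point. The inequality loses something,
since points after `t` are never absorbed. -/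
theorem adaptedSq_le {t : ℝ} {κ : Table S} {η : Weights} {ξp : ℝ}
    (hp : η.upMinus + η.upZero + η.upPlus ≤ ξp) {A : Triple S → ℝ≥0∞} (hA : Measurable A) :
    adaptedSq t κ η A ≤ wsq S ξp κ.ann κ.gau A := by
  refine (lintegral_pull_le S t κ.ann κ.gau (A := fun z => A z ^ 2) (by fun_prop) _ _ _).trans ?_
  refine lintegral_mono fun q => ?_
  gcongr
  have := η.upPlus_pos; have := η.upZero_pos; have := η.upMinus_pos
  rw [← ENNReal.ofReal_add (by positivity) (by positivity),
    ← ENNReal.ofReal_add (by positivity) (by positivity)]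
  exact ENNReal.ofReal_le_ofReal hp

/-- Three applications of Cauchy–Schwarz: over the argument for a fixed table with the weight `η₋`,
over `ϑ₀⁰` with the weight `η₀`, and over `(ϑ₀⁻, ϑ₊⁰)` with the weight in the definition of `bnd`.
The bound `E` leaves the second integral because it does not depend on `ϑ₀⁰`; this is the role of
the essential supremum. The factor containing `A` is then independent of `ϑ₊⁰`, the one containing
`C` of `ϑ₀⁻`, and neither depends on `ϑ₊⁻`, so they come out as a product. -/
theorem lintegral_mul_partM_le {t : ℝ} {κ : Table S} {η : Weights} {ξm : ℝ}
    (hm : η.loMinus⁻¹ + η.loZero⁻¹ + η.loPlus⁻¹ ≤ ξm⁻¹)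
    {E : Ch S × Ch S × Ch S → ℝ≥0∞} (hE : Measurable E)
    {A C : Triple S → ℝ≥0∞} (hA : Measurable A) (hC : Measurable C)
    {F : Table S × Triple S → ℝ≥0∞} (hF : Measurable F)
    (h : ∀ᵐ ϑ ∂(tabT S t), wsq S η.loMinus (κ.cre.union ϑ.cre) (κ.gau.union ϑ.gau)
      (fun z => F (ϑ, z)) ≤ ENNReal.ofReal η.upZero ^ ϑ.gau.len / ENNReal.ofReal η.loZero ^ ϑ.gau.len *
        E (ϑ.ann, ϑ.cre, ϑ.tim) * wsq S η.upPlus (κ.ann.union ϑ.ann) (κ.gau.union ϑ.gau)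
          (fun z => A (pull S κ.ann κ.gau z))) :
    ∫⁻ q, C q * ∫⁻ x, F x ∂(partM S t q) ∂(vecM S κ.cre κ.gau) ≤
      bnd S t η E * adaptedSq t κ η A ^ (1 / 2 : ℝ) *
        wsq S (1 / ξm) κ.cre κ.gau C ^ (1 / 2 : ℝ) := by
  let a : Ch S × Ch S → ℝ≥0∞ := fun x => wsq S η.upPlus (κ.ann.union x.1) (κ.gau.union x.2)
          (fun z => A (pull S κ.ann κ.gau z))
  have ha : Measurable a := measurable_lintegral_vecM S (Ω := Ch S × Ch S)
    (G := fun x => ENNReal.ofReal η.upPlus ^ x.2.2.2.len * A (pull S κ.ann κ.gau x.2) ^ 2)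
    (by fun_prop) (by fun_prop) (by fun_prop)
  let c : Ch S × Ch S → ℝ≥0∞ := fun x => wsq S (1 / η.loMinus) (κ.cre.union x.1) (κ.gau.union x.2)
          (fun z => C (pull S κ.cre κ.gau z))
  have hc : Measurable c := measurable_lintegral_vecM S (Ω := Ch S × Ch S)
    (G := fun x => ENNReal.ofReal (1 / η.loMinus) ^ x.2.2.2.len * C (pull S κ.cre κ.gau x.2) ^ 2)
    (by fun_prop) (by fun_prop) (by fun_prop)
  let R : Ch S → ℝ≥0∞ := fun gau => ENNReal.ofReal η.upZero ^ gau.len / ENNReal.ofReal η.loZero ^ gau.len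
  have hR : Measurable R := by fun_prop
  let a' : Ch S → ℝ≥0∞ := fun ann => ∫⁻ gau, ENNReal.ofReal η.upZero ^ gau.len * a (ann, gau) ∂(chT S t)
  have ha' : Measurable a' := by fun_prop
  let c' : Ch S → ℝ≥0∞ := fun cre =>
    ∫⁻ gau, ENNReal.ofReal (1 / η.loZero) ^ gau.len * c (cre, gau) ∂(chT S t)
  have hc' : Measurable c' := by fun_prop
  -- On every split of `q` the function `C` may be evaluated at the pulled argument, which moves it
  -- under the sum over parts.
  have step1 : ∫⁻ q, C q * ∫⁻ x, F x ∂(partM S t q) ∂(vecM S κ.cre κ.gau) =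
      ∫⁻ ϑ, ∫⁻ z, C (pull S κ.cre κ.gau z) * F (ϑ, z)
        ∂(vecM S (κ.cre.union ϑ.cre) (κ.gau.union ϑ.gau)) ∂(tabT S t) := by
    rw [← lintegral_partM_vecM S t κ.cre κ.gau
      (G := fun x => C (pull S κ.cre κ.gau x.2) * F x) (by fun_prop)]
    refine lintegral_congr_ae ?_
    filter_upwards [ae_partM_pull S t κ.cre κ.gau] with q hq
    rw [← lintegral_const_mul _ hF]
    refine lintegral_congr_ae ?_
    filter_upwards [hq] with x hx
    rw [hx]
  have step2 : ∀ᵐ ϑ ∂(tabT S t), ∫⁻ z, C (pull S κ.cre κ.gau z) * F (ϑ, z)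
        ∂(vecM S (κ.cre.union ϑ.cre) (κ.gau.union ϑ.gau)) ≤
      E (ϑ.ann, ϑ.cre, ϑ.tim) ^ (1 / 2 : ℝ) *
        (c (ϑ.cre, ϑ.gau) ^ (1 / 2 : ℝ) * (R ϑ.gau * a (ϑ.ann, ϑ.gau)) ^ (1 / 2 : ℝ)) := by
    filter_upwards [h] with ϑ hϑ
    refine (lintegral_mul_le_weighted (v := fun z => ENNReal.ofReal (1 / η.loMinus) ^ z.2.2.len)
      (w := fun z => ENNReal.ofReal η.loMinus ^ z.2.2.len) (by fun_prop) (by fun_prop) (by fun_prop)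
      (by fun_prop) fun z => ofReal_pow_mul_inv η.loMinus_pos _).trans ?_
    have h1 : (∫⁻ z, ENNReal.ofReal η.loMinus ^ z.2.2.len * F (ϑ, z) ^ 2
        ∂(vecM S (κ.cre.union ϑ.cre) (κ.gau.union ϑ.gau))) ^ (1 / 2 : ℝ) ≤
        (R ϑ.gau * E (ϑ.ann, ϑ.cre, ϑ.tim) * a (ϑ.ann, ϑ.gau)) ^ (1 / 2 : ℝ) :=
      ENNReal.rpow_le_rpow hϑ (by norm_num)
    refine (mul_le_mul_right h1 _).trans (le_of_eq ?_)
    have h2 : R ϑ.gau * E (ϑ.ann, ϑ.cre, ϑ.tim) * a (ϑ.ann, ϑ.gau) =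
      E (ϑ.ann, ϑ.cre, ϑ.tim) * (R ϑ.gau * a (ϑ.ann, ϑ.gau)) := by ring
    rw [h2, ENNReal.mul_rpow_of_nonneg _ _ (by norm_num)]
    change c (ϑ.cre, ϑ.gau) ^ (1 / 2 : ℝ) * _ = _
    ring
  rw [step1]
  refine (lintegral_mono_ae step2).trans ?_
  rw [lintegral_tabT_tim S t (by fun_prop)]
  -- The ratio `R` converts the weight `η₀`, needed opposite to `1/η₀` on the side of `C`, into the
  -- weight `η⁰` on the side of `A`.
  have step3 : ∀ ann cre tim, ∫⁻ gau, E (ann, cre, tim) ^ (1 / 2 : ℝ) *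
        (c (cre, gau) ^ (1 / 2 : ℝ) * (R gau * a (ann, gau)) ^ (1 / 2 : ℝ)) ∂(chT S t) ≤
      E (ann, cre, tim) ^ (1 / 2 : ℝ) * (c' cre * a' ann) ^ (1 / 2 : ℝ) := by
    intro ann cre tim
    rw [lintegral_const_mul _ (by fun_prop)]
    gcongr
    refine (lintegral_mul_le_weighted (v := fun z => ENNReal.ofReal (1 / η.loZero) ^ z.len)
      (w := fun z => ENNReal.ofReal η.loZero ^ z.len) (by fun_prop) (by fun_prop) (by fun_prop)
      (by fun_prop) fun z => ofReal_pow_mul_inv η.loZero_pos _).trans ?_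
    simp only [rpow_half_sq]
    rw [ENNReal.mul_rpow_of_nonneg _ _ (by norm_num)]
    refine le_of_eq ?_
    congr 2
    refine lintegral_congr fun gau => ?_
    rw [← mul_assoc, pow_mul_div η.loZero_pos]
  refine (lintegral_mono fun tim => lintegral_mono fun ann => lintegral_mono fun cre =>
    step3 ann cre tim).trans ?_
  -- The weights on the side of `C` are the reciprocals of the `η_•`; their sum is at most `1/ξ₋` by
  -- `hm`.
  have hcle : ∫⁻ cre, ENNReal.ofReal (1 / η.loPlus) ^ cre.len * c' cre ∂(chT S t) ≤
      wsq S (1 / ξm) κ.cre κ.gau C := by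
    refine (lintegral_pull_le S t κ.cre κ.gau (A := fun z => C z ^ 2) (by fun_prop) _ _ _).trans ?_
    refine lintegral_mono fun q => ?_
    gcongr
    have := η.loPlus_pos; have := η.loZero_pos; have := η.loMinus_pos
    rw [← ENNReal.ofReal_add (by positivity) (by positivity),
      ← ENNReal.ofReal_add (by positivity) (by positivity)]
    refine ENNReal.ofReal_le_ofReal ?_
    simp only [one_div]
    linarith
  have step4 : ∀ tim, ∫⁻ ann, ∫⁻ cre, E (ann, cre, tim) ^ (1 / 2 : ℝ) *
      (c' cre * a' ann) ^ (1 / 2 : ℝ) ∂(chT S t) ∂(chT S t) ≤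
      (∫⁻ ann, ∫⁻ cre, ENNReal.ofReal η.loPlus ^ cre.len / ENNReal.ofReal η.upMinus ^ ann.len *
        E (ann, cre, tim) ∂(chT S t) ∂(chT S t)) ^ (1 / 2 : ℝ) *
      (adaptedSq t κ η A ^ (1 / 2 : ℝ) * wsq S (1 / ξm) κ.cre κ.gau C ^ (1 / 2 : ℝ)) := by
    intro tim
    rw [← lintegral_prod (fun x : Ch S × Ch S => E (x.1, x.2, tim) ^ (1 / 2 : ℝ) *
      (c' x.2 * a' x.1) ^ (1 / 2 : ℝ)) (by fun_prop)]
    refine (lintegral_mul_le_weighted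
      (v := fun x => ENNReal.ofReal η.loPlus ^ x.2.len / ENNReal.ofReal η.upMinus ^ x.1.len)
      (w := fun x => ENNReal.ofReal (1 / η.loPlus) ^ x.2.len * ENNReal.ofReal η.upMinus ^ x.1.len)
      (by fun_prop) (by fun_prop) (by fun_prop) (by fun_prop) fun x => ?_).trans ?_
    · rw [mul_comm (ENNReal.ofReal (1 / η.loPlus) ^ x.2.len), ← mul_assoc, mul_comm (_ / _),
        pow_mul_div η.upMinus_pos, mul_comm, ofReal_pow_mul_inv η.loPlus_pos]
    simp only [rpow_half_sq]
    rw [lintegral_prod _ (by fun_prop)]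
    refine mul_le_mul_right ?_ _
    rw [← ENNReal.mul_rpow_of_nonneg _ _ (by norm_num)]
    refine ENNReal.rpow_le_rpow ?_ (by norm_num)
    have e : ∀ x : Ch S × Ch S, ENNReal.ofReal (1 / η.loPlus) ^ x.2.len *
        ENNReal.ofReal η.upMinus ^ x.1.len * (c' x.2 * a' x.1) =
        (ENNReal.ofReal η.upMinus ^ x.1.len * a' x.1) *
          (ENNReal.ofReal (1 / η.loPlus) ^ x.2.len * c' x.2) := fun x => by ring
    simp_rw [e]
    rw [lintegral_prod_mul (f := fun ann : Ch S => ENNReal.ofReal η.upMinus ^ ann.len * a' ann)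
      (g := fun cre : Ch S => ENNReal.ofReal (1 / η.loPlus) ^ cre.len * c' cre)
      (by fun_prop) (by fun_prop)]
    gcongr
    exact le_rfl
  refine (lintegral_mono step4).trans ?_
  rw [lintegral_mul_const _ (by fun_prop), mul_assoc]
  rfl

/-- The function `F` is nonnegative. Applied to the norm of the integrand, the estimate gives both
the absolute convergence of the multiple integral for almost every argument and the bound for its
norm. -/
theorem wsq_partM_le_adaptedSq {t : ℝ} {κ : Table S} {η : Weights} {ξm : ℝ}
    (hξm : 0 < ξm)
    (hm : η.loMinus⁻¹ + η.loZero⁻¹ + η.loPlus⁻¹ ≤ ξm⁻¹)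
    {E : Ch S × Ch S × Ch S → ℝ≥0∞} (hE : Measurable E)
    {A : Triple S → ℝ≥0∞} (hA : Measurable A)
    {F : Table S × Triple S → ℝ≥0∞} (hF : Measurable F)
    (h : ∀ᵐ ϑ ∂(tabT S t), wsq S η.loMinus (κ.cre.union ϑ.cre) (κ.gau.union ϑ.gau)
      (fun z => F (ϑ, z)) ≤ ENNReal.ofReal η.upZero ^ ϑ.gau.len / ENNReal.ofReal η.loZero ^ ϑ.gau.len *
        E (ϑ.ann, ϑ.cre, ϑ.tim) * wsq S η.upPlus (κ.ann.union ϑ.ann) (κ.gau.union ϑ.gau)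
          (fun z => A (pull S κ.ann κ.gau z))) :
    wsq S ξm κ.cre κ.gau (fun q => ∫⁻ x, F x ∂(partM S t q)) ^ (1 / 2 : ℝ) ≤
      bnd S t η E * adaptedSq t κ η A ^ (1 / 2 : ℝ) := by
  have hV : Measurable fun q => ∫⁻ x, F x ∂(partM S t q) :=
    measurable_lintegral_partM_at S t hF
  exact rpow_lintegral_le_of_dual hV (v := fun z => ENNReal.ofReal (1 / ξm) ^ z.2.2.len)
    (w := fun z => ENNReal.ofReal ξm ^ z.2.2.len) (by fun_prop)
    (fun z => ofReal_pow_mul_inv hξm _) fun C hC =>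
      lintegral_mul_partM_le S hm hE hA hC hF h

theorem wsq_partM_le {t : ℝ} {κ : Table S} {η : Weights} {ξp ξm : ℝ}
    (hξm : 0 < ξm)
    (hp : η.upMinus + η.upZero + η.upPlus ≤ ξp)
    (hm : η.loMinus⁻¹ + η.loZero⁻¹ + η.loPlus⁻¹ ≤ ξm⁻¹)
    {E : Ch S × Ch S × Ch S → ℝ≥0∞} (hE : Measurable E)
    {A : Triple S → ℝ≥0∞} (hA : Measurable A)
    {F : Table S × Triple S → ℝ≥0∞} (hF : Measurable F)
    (h : ∀ᵐ ϑ ∂(tabT S t), wsq S η.loMinus (κ.cre.union ϑ.cre) (κ.gau.union ϑ.gau)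
      (fun z => F (ϑ, z)) ≤ ENNReal.ofReal η.upZero ^ ϑ.gau.len / ENNReal.ofReal η.loZero ^ ϑ.gau.len *
        E (ϑ.ann, ϑ.cre, ϑ.tim) * wsq S η.upPlus (κ.ann.union ϑ.ann) (κ.gau.union ϑ.gau)
          (fun z => A (pull S κ.ann κ.gau z))) :
    wsq S ξm κ.cre κ.gau (fun q => ∫⁻ x, F x ∂(partM S t q)) ^ (1 / 2 : ℝ) ≤
      bnd S t η E * wsq S ξp κ.ann κ.gau A ^ (1 / 2 : ℝ) :=
  (wsq_partM_le_adaptedSq S hξm hm hE hA hF h).trans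
    (mul_le_mul_right (ENNReal.rpow_le_rpow (adaptedSq_le S hp hA) (by norm_num)) _)

omit [MeasurableSingletonClass X] in
theorem lintegral_partM_lt_top {t : ℝ} {κ : Table S} {ξm : ℝ} (hξm : 0 < ξm)
    {F : Table S × Triple S → ℝ≥0∞} (hF : Measurable F)
    (h : wsq S ξm κ.cre κ.gau (fun q => ∫⁻ x, F x ∂(partM S t q)) < ⊤) :
    ∀ᵐ q ∂(vecM S κ.cre κ.gau), ∫⁻ x, F x ∂(partM S t q) < ⊤ := by
  have hV : Measurable fun q => ∫⁻ x, F x ∂(partM S t q) :=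
    measurable_lintegral_partM_at S t hF
  filter_upwards [ae_lt_top (by fun_prop) h.ne] with q hq
  by_contra hc
  rw [not_lt, top_le_iff] at hc
  rw [hc, ENNReal.top_pow two_ne_zero, ENNReal.mul_top (pow_ne_zero _ (by simpa using hξm))] at hq
  exact lt_irrefl _ hq

/-! ### Operators given by linear relations -/

/-- The span of a linear relation is the relation itself, and for a single-valued one `toLinearPMap`
has it as its graph. Each use therefore amounts to checking linearity and uniqueness of the value at
zero. -/
theorem mem_graph_ofRel {E F : Type*} [AddCommGroup E] [Module ℂ E] [AddCommGroup F] [Module ℂ F]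
    {r : E → F → Prop} (h0 : r 0 0)
    (hadd : ∀ a u b v, r a u → r b v → r (a + b) (u + v))
    (hsmul : ∀ (k : ℂ) a u, r a u → r (k • a) (k • u))
    (huniq : ∀ u, r 0 u → u = 0) {a : E} {u : F} : (a, u) ∈ (ofRel r).graph ↔ r a u := by
  let M : Submodule ℂ (E × F) :=
    { carrier := {p | r p.1 p.2}
      add_mem' := fun {p q} hp hq => hadd _ _ _ _ hp hq
      zero_mem' := h0
      smul_mem' := fun k p hp => hsmul k _ _ hp }
  have hM : Submodule.span ℂ {p : E × F | r p.1 p.2} = M := Submodule.span_eq M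
  rw [ofRel, hM, Submodule.toLinearPMap_graph_eq]
  · rfl
  · rintro ⟨x, y⟩ hx hx'
    simp only at hx'
    subst hx'
    exact huniq y hx

variable {X : Type*} [MeasurableSpace X] {S : NoiseSpace X}
variable {H : Type*} [NormedAddCommGroup H]

/-! ### Norms -/

theorem gnorm_eq (ξ : ℝ) (σ ρ : Ch S) (f : Triple S → H) :
    gnorm S ξ σ ρ f = wsq S ξ σ ρ (fun z => ‖f z‖ₑ) ^ (1 / 2 : ℝ) := rfl

theorem gnorm_sq (ξ : ℝ) (σ ρ : Ch S) (f : Triple S → H) :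
    gnorm S ξ σ ρ f ^ 2 = wsq S ξ σ ρ (fun z => ‖f z‖ₑ) := by
  rw [gnorm_eq, rpow_half_sq]

theorem gnorm_lt_top_iff {ξ : ℝ} {σ ρ : Ch S} {f : Triple S → H} :
    gnorm S ξ σ ρ f < ⊤ ↔ wsq S ξ σ ρ (fun z => ‖f z‖ₑ) < ⊤ := by
  rw [gnorm_eq, ENNReal.rpow_lt_top_iff_of_pos (by norm_num)]

theorem wsq_congr {ξ : ℝ} {σ ρ : Ch S} {A B : Triple S → ℝ≥0∞} (h : A =ᵐ[vecM S σ ρ] B) :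
    wsq S ξ σ ρ A = wsq S ξ σ ρ B :=
  lintegral_congr_ae (h.mono fun z hz => by simp only [hz])

theorem gnorm_congr {ξ : ℝ} {σ ρ : Ch S} {f g : Triple S → H} (h : f =ᵐ[vecM S σ ρ] g) :
    gnorm S ξ σ ρ f = gnorm S ξ σ ρ g := by
  rw [gnorm_eq, gnorm_eq, wsq_congr (B := fun z => ‖g z‖ₑ) (h.mono fun z hz => by simp only [hz])]

theorem wsq_mono {ξ ξ' : ℝ} {σ ρ : Ch S} {A B : Triple S → ℝ≥0∞} (hξ : ξ ≤ ξ') (h : ∀ z, A z ≤ B z) :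
    wsq S ξ σ ρ A ≤ wsq S ξ' σ ρ B :=
  lintegral_mono fun z => by
    have := h z
    gcongr

theorem gnorm_mono {ξ ξ' : ℝ} {σ ρ : Ch S} {f g : Triple S → H} (hξ : ξ ≤ ξ')
    (h : ∀ z, ‖f z‖ ≤ ‖g z‖) : gnorm S ξ σ ρ f ≤ gnorm S ξ' σ ρ g := by
  rw [gnorm_eq, gnorm_eq]
  refine ENNReal.rpow_le_rpow (wsq_mono hξ fun z => ?_) (by norm_num)
  exact enorm_le_iff_norm_le.2 (h z)

theorem gnorm_zero (ξ : ℝ) (σ ρ : Ch S) : gnorm S ξ σ ρ (0 : Triple S → H) = 0 := by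
  simp [gnorm]

@[fun_prop]
theorem measurable_weight {Ω : Type*} [MeasurableSpace Ω] (ξ : ℝ) {f : Ω → Triple S}
    (hf : Measurable f) : Measurable fun ω => ENNReal.ofReal ξ ^ (f ω).2.2.len := by fun_prop

theorem ae_zero_of_gnorm_eq_zero {ξ : ℝ} (hξ : 0 < ξ) {σ ρ : Ch S} {f : Triple S → H}
    (hf : AEStronglyMeasurable f (vecM S σ ρ)) (h : gnorm S ξ σ ρ f = 0) : f =ᵐ[vecM S σ ρ] 0 := by
  rw [gnorm, ENNReal.rpow_eq_zero_iff_of_pos (by norm_num), lintegral_eq_zero_iff' (by fun_prop)] at h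
  filter_upwards [h] with z hz
  have h0 : ENNReal.ofReal ξ ^ z.2.2.len ≠ 0 := pow_ne_zero _ (by simpa using hξ)
  simpa [h0] using hz

variable [InnerProductSpace ℂ H]

theorem InG.mono {ξ ξ' : ℝ} {σ ρ : Ch S} {a : L0 S H σ ρ} (h : ξ ≤ ξ') (ha : InG ξ' a) : InG ξ a :=
  (gnorm_mono h fun _ => le_rfl).trans_lt ha

/-! ### Representation by functions -/

section
variable {σ ρ σ' ρ' : Ch S} {T : L0 S H σ ρ →ₗ.[ℂ] L0 S H σ' ρ'} {f f' g g' : Triple S → H}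

theorem Represents.congr (h : Represents T f g) (hf : f =ᵐ[vecM S σ ρ] f')
    (hg : g =ᵐ[vecM S σ' ρ'] g') : Represents T f' g' := by
  obtain ⟨p, hp, h1, h2⟩ := h
  exact ⟨p, hp, h1.trans hf, h2.trans hg⟩

theorem represents_coe {a : L0 S H σ ρ} {u : L0 S H σ' ρ'} :
    Represents T a u ↔ (a, u) ∈ T.graph := by
  constructor
  · rintro ⟨⟨a', u'⟩, hp, h1, h2⟩
    rwa [← AEEqFun.ext h1, ← AEEqFun.ext h2]
  · exact fun h => ⟨_, h, Filter.EventuallyEq.rfl, Filter.EventuallyEq.rfl⟩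

theorem Represents.aesm_left (h : Represents T f g) : AEStronglyMeasurable f (vecM S σ ρ) := by
  obtain ⟨p, hp, h1, h2⟩ := h
  exact p.1.aestronglyMeasurable.congr h1

theorem Represents.unique (h : Represents T f g) (h' : Represents T f' g')
    (hf : f =ᵐ[vecM S σ ρ] f') : g =ᵐ[vecM S σ' ρ'] g' := by
  obtain ⟨p, hp, h1, h2⟩ := h
  obtain ⟨p', hp', h1', h2'⟩ := h'
  have : p.1 = p'.1 := AEEqFun.ext (h1.trans (hf.trans h1'.symm))
  have e := T.mem_graph_snd_inj' hp hp' this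
  exact h2.symm.trans ((Filter.EventuallyEq.of_eq (by rw [e])).trans h2')

theorem represents_zero : Represents T 0 0 :=
  ⟨0, zero_mem _, AEEqFun.coeFn_zero, AEEqFun.coeFn_zero⟩

theorem Represents.add (h : Represents T f g) (h' : Represents T f' g') :
    Represents T (f + f') (g + g') := by
  obtain ⟨p, hp, h1, h2⟩ := h
  obtain ⟨p', hp', h1', h2'⟩ := h'
  exact ⟨p + p', add_mem hp hp', (AEEqFun.coeFn_add _ _).trans (h1.add h1'),
    (AEEqFun.coeFn_add _ _).trans (h2.add h2')⟩

theorem Represents.smul (k : ℂ) (h : Represents T f g) : Represents T (k • f) (k • g) := by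
  obtain ⟨p, hp, h1, h2⟩ := h
  exact ⟨k • p, Submodule.smul_mem _ k hp, (AEEqFun.coeFn_smul _ _).trans (h1.const_smul k),
    (AEEqFun.coeFn_smul _ _).trans (h2.const_smul k)⟩

theorem Represents.eq_zero (h : Represents T f g) (hf : f =ᵐ[vecM S σ ρ] 0) : g =ᵐ[vecM S σ' ρ'] 0 :=
  h.unique represents_zero hf

theorem Represents.gnorm_le {ξp ξm : ℝ} (hξp : 0 < ξp) (h : Represents T f g)
    (hf : gnorm S ξp σ ρ f < ⊤) : gnorm S ξm σ' ρ' g ≤ opNorm ξp ξm T * gnorm S ξp σ ρ f := by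
  -- The quotient in `opNorm` says nothing for `‖f‖ = 0`; in that case `f` vanishes almost
  -- everywhere and so does its image.
  rcases eq_or_ne (gnorm S ξp σ ρ f) 0 with h0 | h0
  · rw [gnorm_congr (h.eq_zero (ae_zero_of_gnorm_eq_zero hξp h.aesm_left h0)), gnorm_zero]
    exact zero_le
  by_cases hd : ∀ a : L0 S H σ ρ, InG ξp a → a ∈ T.domain
  · rw [opNorm, if_pos hd]
    obtain ⟨p, hp, h1, h2⟩ := h
    have := le_iSup₂ (f := fun p (_ : p ∈ T.graph) => gnorm S ξm σ' ρ' p.2 / gnorm S ξp σ ρ p.1) p hp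
    simp only [gnorm_congr h1, gnorm_congr h2] at this
    exact (ENNReal.div_le_iff h0 hf.ne).1 this
  · rw [opNorm, if_neg hd, ENNReal.top_mul h0]
    exact le_top

theorem opNorm_le {ξp ξm : ℝ} {K : ℝ≥0∞} (hd : ∀ a : L0 S H σ ρ, InG ξp a → ∃ u, (a, u) ∈ T.graph)
    (hK : ∀ a u, (a, u) ∈ T.graph → InG ξp a → gnorm S ξm σ' ρ' u ≤ K * gnorm S ξp σ ρ a) :
    opNorm ξp ξm T ≤ K := by
  rw [opNorm, if_pos fun a ha => LinearPMap.mem_domain_iff.2 (hd a ha)]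
  refine iSup₂_le fun p hp => ?_
  by_cases h : InG ξp p.1
  · exact ENNReal.div_le_of_le_mul (hK _ _ hp h)
  · rw [InG, not_lt, top_le_iff] at h
    rw [h, ENNReal.div_top]; exact zero_le

end

/-! ### The point derivative -/

section
variable [MeasurableSingletonClass X]

/-- `ae_pull` concerns the chain `ϑ₊⁰`. The measure on tables is invariant under the exchange with
`ϑ₀⁻`, which gives the version on the source side. -/
theorem ae_pull_ann {κ : Table S} {t : ℝ} {p : Triple S → Prop}
    (h : ∀ᵐ q ∂(vecM S κ.ann κ.gau), p q) :
    ∀ᵐ ϑ ∂(tabT S t), ∀ᵐ z ∂(vecM S (κ.union ϑ).ann (κ.union ϑ).gau), p (pull S κ.ann κ.gau z) :=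
  ae_tabT_star S (ae_pull S h)

omit [InnerProductSpace ℂ H] in
theorem deriv_congr {κ : Table S} {t : ℝ} {a b : Triple S → H} (h : a =ᵐ[vecM S κ.ann κ.gau] b) :
    ∀ᵐ ϑ ∂(tabT S t), deriv κ a =ᵐ[vecM S (κ.union ϑ).ann (κ.union ϑ).gau] deriv κ b :=
  ae_pull_ann h

/-! ### The multiple integral as an operator -/

theorem actsAs_zero (t : ℝ) (κ : Table S) (B : OpFun S H) : ActsAs t κ B 0 0 := by
  refine ⟨fun _ _ => 0, stronglyMeasurable_const, ?_, ?_⟩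
  · filter_upwards [deriv_congr (t := t) (AEEqFun.coeFn_zero (μ := vecM S κ.ann κ.gau) (β := H))]
      with ϑ hϑ
    exact (represents_zero (T := B (κ.union ϑ))).congr (Filter.EventuallyEq.symm hϑ) Filter.EventuallyEq.rfl
  · filter_upwards [AEEqFun.coeFn_zero (μ := vecM S κ.cre κ.gau) (β := H)] with q hq
    refine ⟨fun P _ => integrable_zero _ _ _, ?_⟩
    rw [hq]
    exact (Finset.sum_eq_zero fun P _ => integral_zero _ _).symm

theorem actsAs_add {t : ℝ} {κ : Table S} {B : OpFun S H} {a b u v} (h : ActsAs t κ B a u)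
    (h' : ActsAs t κ B b v) : ActsAs t κ B (a + b) (u + v) := by
  obtain ⟨f, hf, h1, h2⟩ := h
  obtain ⟨g, hg, h1', h2'⟩ := h'
  refine ⟨fun ϑ z => f ϑ z + g ϑ z, hf.add hg, ?_, ?_⟩
  · filter_upwards [h1, h1', deriv_congr (t := t) (AEEqFun.coeFn_add a b)] with ϑ hϑ hϑ' e
    exact (hϑ.add hϑ').congr (Filter.EventuallyEq.symm e) Filter.EventuallyEq.rfl
  · filter_upwards [h2, h2', AEEqFun.coeFn_add u v] with q hq hq' e
    refine ⟨fun P hP => (hq.1 P hP).add (hq'.1 P hP), ?_⟩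
    rw [e, Pi.add_apply, hq.2, hq'.2, ← Finset.sum_add_distrib]
    exact Finset.sum_congr rfl fun P hP => (integral_add (hq.1 P hP) (hq'.1 P hP)).symm

theorem actsAs_smul {t : ℝ} {κ : Table S} {B : OpFun S H} {a u} (k : ℂ) (h : ActsAs t κ B a u) :
    ActsAs t κ B (k • a) (k • u) := by
  obtain ⟨f, hf, h1, h2⟩ := h
  refine ⟨fun ϑ z => k • f ϑ z, hf.const_smul k, ?_, ?_⟩
  · filter_upwards [h1, deriv_congr (t := t) (AEEqFun.coeFn_smul k a)] with ϑ hϑ e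
    exact (hϑ.smul k).congr (Filter.EventuallyEq.symm e) Filter.EventuallyEq.rfl
  · filter_upwards [h2, AEEqFun.coeFn_smul k u] with q hq e
    refine ⟨fun P hP => (hq.1 P hP).smul k, ?_⟩
    rw [e, Pi.smul_apply, hq.2, Finset.smul_sum]
    exact Finset.sum_congr rfl fun P hP => (integral_smul k _).symm

/-- The versions `f ϑ` vanish for almost every table, hence `f` vanishes almost everywhere for
`thetaM`, and so under the sum over the parts of almost every `q`. Together with additivity this
shows that the choice of the version is immaterial. -/
theorem actsAs_unique {t : ℝ} {κ : Table S} {B : OpFun S H} {u} (h : ActsAs t κ B 0 u) : u = 0 := by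
  obtain ⟨f, hf, h1, h2⟩ := h
  have h3 : ∀ᵐ x ∂(thetaM S κ.cre κ.gau t), Function.uncurry f x = 0 := by
    refine ae_thetaM_of_vecM S (hf.measurableSet_eq_fun stronglyMeasurable_const) ?_
    filter_upwards [h1, deriv_congr (t := t) (AEEqFun.coeFn_zero (μ := vecM S κ.ann κ.gau) (β := H))]
      with ϑ hϑ e
    exact hϑ.eq_zero e
  refine AEEqFun.ext (Filter.EventuallyEq.trans ?_ AEEqFun.coeFn_zero.symm)
  filter_upwards [h2, ae_thetaM_partM S h3] with q hq hq3
  rw [hq.2]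
  refine Finset.sum_eq_zero fun P hP => integral_eq_zero_of_ae ?_
  exact ae_partM_iff hq3 P hP

theorem mem_graph_multInt {t : ℝ} {κ : Table S} {B : OpFun S H} {a u} :
    (a, u) ∈ (multInt t κ B).graph ↔ ActsAs t κ B a u :=
  mem_graph_ofRel (actsAs_zero t κ B) (fun _ _ _ _ => actsAs_add) (fun k _ _ => actsAs_smul k)
    fun _ => actsAs_unique

end

variable {X : Type*} [MeasurableSpace X] {S : NoiseSpace X}
variable {H : Type*} [NormedAddCommGroup H] [InnerProductSpace ℂ H]

/-! ### Iterated almost everywhere statements over tables -/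

theorem ae_tabT_iterated {t : ℝ} {p : Table S → Prop} (h : ∀ᵐ ϑ ∂(tabT S t), p ϑ) :
    ∀ᵐ tim ∂(chT S t), ∀ᵐ ann ∂(chT S t), ∀ᵐ cre ∂(chT S t), ∀ᵐ gau ∂(chT S t),
      p (ann, gau, cre, tim) := by
  obtain ⟨N, hN, hNm, hN0⟩ := exists_measurable_superset_of_null (ae_iff.1 h)
  have hm : Measurable (N.indicator (1 : Table S → ℝ≥0∞)) := measurable_one.indicator hNm
  rw [← lintegral_indicator_one hNm, lintegral_tabT_tim S t hm,
    lintegral_eq_zero_iff (by fun_prop)] at hN0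
  filter_upwards [hN0] with tim h1
  simp only [Pi.zero_apply] at h1
  rw [lintegral_eq_zero_iff (by fun_prop)] at h1
  filter_upwards [h1] with ann h2
  simp only [Pi.zero_apply] at h2
  rw [lintegral_eq_zero_iff (by fun_prop)] at h2
  filter_upwards [h2] with cre h3
  simp only [Pi.zero_apply] at h3
  rw [lintegral_eq_zero_iff (by fun_prop)] at h3
  filter_upwards [h3] with gau h4
  by_contra hc
  have : (ann, gau, cre, tim) ∈ N := hN hc
  simp [this] at h4

/-- In contrast to `ae_tabT_iterated`, this direction requires the set to be measurable, because it
is recovered from its sections by Tonelli's theorem. -/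
theorem ae_tabT_of_iterated {t : ℝ} {p : Table S → Prop} (hp : MeasurableSet {ϑ | p ϑ})
    (h : ∀ᵐ tim ∂(chT S t), ∀ᵐ ann ∂(chT S t), ∀ᵐ cre ∂(chT S t), ∀ᵐ gau ∂(chT S t),
      p (ann, gau, cre, tim)) : ∀ᵐ ϑ ∂(tabT S t), p ϑ := by
  have hm : Measurable ({ϑ | p ϑ}ᶜ.indicator (1 : Table S → ℝ≥0∞)) :=
    measurable_one.indicator hp.compl
  rw [ae_iff]
  change tabT S t {ϑ | p ϑ}ᶜ = 0
  rw [← lintegral_indicator_one hp.compl, lintegral_tabT_tim S t hm]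
  refine (lintegral_congr_ae (h.mono fun tim h1 => ?_)).trans lintegral_zero
  refine (lintegral_congr_ae (h1.mono fun ann h2 => ?_)).trans lintegral_zero
  refine (lintegral_congr_ae (h2.mono fun cre h3 => ?_)).trans lintegral_zero
  refine (lintegral_congr_ae (h3.mono fun gau h4 => ?_)).trans lintegral_zero
  exact indicator_of_notMem (not_not_intro h4) _

theorem ae_tabT_ann_gau {t : ℝ} {p : Ch S × Ch S → Prop} (hp : MeasurableSet {x | p x})
    (h : ∀ᵐ ann ∂(chT S t), ∀ᵐ gau ∂(chT S t), p (ann, gau)) :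
    ∀ᵐ ϑ ∂(tabT S t), p (ϑ.ann, ϑ.gau) := by
  refine ae_tabT_of_iterated (hp.preimage (by fun_prop : Measurable fun ϑ : Table S =>
    (ϑ.ann, ϑ.gau))) ?_
  refine Filter.Eventually.of_forall fun tim => ?_
  filter_upwards [h] with ann h1
  exact Filter.Eventually.of_forall fun cre => h1

variable [MeasurableSingletonClass X]

omit [NormedAddCommGroup H] [InnerProductSpace ℂ H] in
theorem ae_wsq_pull_lt_top {t : ℝ} {κ : Table S} {η : Weights} {A : Triple S → ℝ≥0∞}
    (hA : Measurable A) (h : adaptedSq t κ η A < ⊤) :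
    ∀ᵐ ϑ ∂(tabT S t), wsq S η.upPlus (κ.union ϑ).ann (κ.union ϑ).gau
      (fun z => A (pull S κ.ann κ.gau z)) < ⊤ := by
  let a : Ch S × Ch S → ℝ≥0∞ := fun x => wsq S η.upPlus (κ.ann.union x.1) (κ.gau.union x.2)
    (fun z => A (pull S κ.ann κ.gau z))
  have ha : Measurable a := measurable_lintegral_vecM S (Ω := Ch S × Ch S)
    (G := fun x => ENNReal.ofReal η.upPlus ^ x.2.2.2.len * A (pull S κ.ann κ.gau x.2) ^ 2)
    (by fun_prop) (by fun_prop) (by fun_prop)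
  have hle : ∫⁻ ann, ENNReal.ofReal η.upMinus ^ ann.len * ∫⁻ gau, ENNReal.ofReal η.upZero ^ gau.len *
      a (ann, gau) ∂(chT S t) ∂(chT S t) < ⊤ := h
  have key : ∀ {ξ : ℝ} (_ : 0 < ξ) (n : ℕ) {b : ℝ≥0∞}, ENNReal.ofReal ξ ^ n * b < ⊤ → b < ⊤ := by
    intro ξ hξ n b hb
    by_contra hc
    rw [not_lt, top_le_iff] at hc
    rw [hc, ENNReal.mul_top (pow_ne_zero _ (by simpa using hξ))] at hb
    exact lt_irrefl _ hb
  have h1 : ∀ᵐ ann ∂(chT S t), ∀ᵐ gau ∂(chT S t), a (ann, gau) < ⊤ := by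
    filter_upwards [ae_lt_top (by fun_prop) hle.ne] with ann h1
    filter_upwards [ae_lt_top (by fun_prop) (key η.upMinus_pos _ h1).ne] with gau h2
    exact key η.upZero_pos _ h2
  exact ae_tabT_ann_gau (measurableSet_lt ha measurable_const) h1

theorem ae_gnorm_deriv_lt_top {t : ℝ} {κ : Table S} {η : Weights} {ξp : ℝ}
    (hp : η.upMinus + η.upZero + η.upPlus ≤ ξp) {v : Triple S → H} (hv : StronglyMeasurable v)
    (h : gnorm S ξp κ.ann κ.gau v < ⊤) :
    ∀ᵐ ϑ ∂(tabT S t), gnorm S η.upPlus (κ.union ϑ).ann (κ.union ϑ).gau (deriv κ v) < ⊤ := by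
  filter_upwards [ae_wsq_pull_lt_top (t := t) hv.enorm
    ((adaptedSq_le S hp hv.enorm).trans_lt (gnorm_lt_top_iff.1 h))] with ϑ hϑ
  exact gnorm_lt_top_iff.2 hϑ

/-! ### Fields of operators with a bound -/

/-- The operators `B(κ ⊔ ϑ)` form a measurable field over the tables in `X^t`, and the norms are
bounded in terms of `E`. -/
structure Good (t : ℝ) (κ : Table S) (B : OpFun S H) (η : Weights)
    (E : Ch S × Ch S × Ch S → ℝ≥0∞) : Prop where
  measurable : Measurable E
  field : ∀ v : Triple S → H, StronglyMeasurable v →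
    (∀ᵐ ϑ ∂(tabT S t), gnorm S η.upPlus (κ.union ϑ).ann (κ.union ϑ).gau (deriv κ v) < ⊤) →
    ∃ f : Table S → Triple S → H, StronglyMeasurable (Function.uncurry f) ∧
      ∀ᵐ ϑ ∂(tabT S t), Represents (B (κ.union ϑ)) (deriv κ v) (f ϑ)
  bound : ∀ᵐ ϑ ∂(tabT S t), opNorm η.upPlus η.loMinus (B (κ.union ϑ)) ^ 2 ≤
    ENNReal.ofReal η.upZero ^ ϑ.gau.len / ENNReal.ofReal η.loZero ^ ϑ.gau.len *
      E (ϑ.ann, ϑ.cre, ϑ.tim)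
  finite : bnd S t η E < ⊤

/-- The inequalities between the weights and the scale parameters. -/
structure Admissible (η : Weights) (ξp ξm : ℝ) : Prop where
  pos : 0 < ξm
  up : η.upMinus + η.upZero + η.upPlus ≤ ξp
  lo : η.loMinus⁻¹ + η.loZero⁻¹ + η.loPlus⁻¹ ≤ ξm⁻¹

theorem Admissible.up_pos {η : Weights} {ξp ξm : ℝ} (h : Admissible η ξp ξm) : 0 < ξp := by
  have := h.up; have := η.upMinus_pos; have := η.upZero_pos; have := η.upPlus_pos
  linarith

theorem Admissible.upPlus_le {η : Weights} {ξp ξm : ℝ} (h : Admissible η ξp ξm) :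
    η.upPlus ≤ ξp := by
  have := h.up; have := η.upMinus_pos; have := η.upZero_pos
  linarith

variable {t : ℝ} {κ : Table S} {B : OpFun S H} {η : Weights} {E : Ch S × Ch S × Ch S → ℝ≥0∞}
  {ξp ξm : ℝ}

/-- Squaring the operator bound of `B(κ ⊔ ϑ)` for almost every table yields exactly the hypothesis
of the basic estimate, with `A` the norm of `v` and `F` the norm of the field. -/
theorem Good.wsq_le (hG : Good t κ B η E) (hA : Admissible η ξp ξm) {v : Triple S → H}
    (hv : StronglyMeasurable v) (h : gnorm S ξp κ.ann κ.gau v < ⊤)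
    {f : Table S → Triple S → H} (hf : StronglyMeasurable (Function.uncurry f))
    (hr : ∀ᵐ ϑ ∂(tabT S t), Represents (B (κ.union ϑ)) (deriv κ v) (f ϑ)) :
    wsq S ξm κ.cre κ.gau (fun q => ∫⁻ x, ‖Function.uncurry f x‖ₑ ∂(partM S t q)) ^ (1 / 2 : ℝ) ≤
      bnd S t η E * gnorm S ξp κ.ann κ.gau v := by
  refine wsq_partM_le S hA.pos hA.up hA.lo hG.measurable (A := fun z => ‖v z‖ₑ) hv.enorm hf.enorm ?_
  filter_upwards [hr, hG.bound, ae_gnorm_deriv_lt_top hA.up hv h] with ϑ h1 h2 h3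
  have h4 := pow_le_pow_left₀ zero_le (h1.gnorm_le (ξm := η.loMinus) η.upPlus_pos h3) 2
  rw [mul_pow, gnorm_sq, gnorm_sq] at h4
  exact h4.trans (mul_le_mul_left h2 _)

theorem Good.integrable (hG : Good t κ B η E) (hA : Admissible η ξp ξm) {v : Triple S → H}
    (hv : StronglyMeasurable v) (h : gnorm S ξp κ.ann κ.gau v < ⊤)
    {f : Table S → Triple S → H} (hf : StronglyMeasurable (Function.uncurry f))
    (hr : ∀ᵐ ϑ ∂(tabT S t), Represents (B (κ.union ϑ)) (deriv κ v) (f ϑ)) :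
    ∀ᵐ q ∂(vecM S κ.cre κ.gau), Integrable (Function.uncurry f) (partM S t q) := by
  have h1 := (hG.wsq_le hA hv h hf hr).trans_lt (ENNReal.mul_lt_top hG.finite h)
  rw [ENNReal.rpow_lt_top_iff_of_pos (by norm_num)] at h1
  filter_upwards [lintegral_partM_lt_top S (κ := κ) hA.pos hf.enorm h1] with q hq
  exact ⟨hf.aestronglyMeasurable, hq⟩

/-- The multiple integral as a function, for a given field of vectors. -/
def multFun (t : ℝ) (f : Table S → Triple S → H) (q : Triple S) : H :=
  ∫ x, Function.uncurry f x ∂(partM S t q)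

omit [MeasurableSingletonClass X] in
theorem stronglyMeasurable_multFun (t : ℝ) {f : Table S → Triple S → H}
    (hf : StronglyMeasurable (Function.uncurry f)) : StronglyMeasurable (multFun t f) :=
  hf.integral_kernel (κ := partKerAt S t)

theorem Good.gnorm_multFun_le (hG : Good t κ B η E) (hA : Admissible η ξp ξm) {v : Triple S → H}
    (hv : StronglyMeasurable v) (h : gnorm S ξp κ.ann κ.gau v < ⊤)
    {f : Table S → Triple S → H} (hf : StronglyMeasurable (Function.uncurry f))
    (hr : ∀ᵐ ϑ ∂(tabT S t), Represents (B (κ.union ϑ)) (deriv κ v) (f ϑ)) :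
    gnorm S ξm κ.cre κ.gau (multFun t f) ≤ bnd S t η E * gnorm S ξp κ.ann κ.gau v := by
  refine le_trans ?_ (hG.wsq_le hA hv h hf hr)
  rw [gnorm_eq]
  exact ENNReal.rpow_le_rpow (wsq_mono le_rfl fun z => enorm_integral_le_lintegral_enorm _)
    (by norm_num)

theorem Good.actsAs (hG : Good t κ B η E) (hA : Admissible η ξp ξm) {v : L0 S H κ.ann κ.gau}
    {u : L0 S H κ.cre κ.gau} (h : InG ξp v)
    {f : Table S → Triple S → H} (hf : StronglyMeasurable (Function.uncurry f))
    (hr : ∀ᵐ ϑ ∂(tabT S t), Represents (B (κ.union ϑ)) (deriv κ v) (f ϑ))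
    (hu : u =ᵐ[vecM S κ.cre κ.gau] multFun t f) : ActsAs t κ B v u := by
  refine ⟨f, hf, hr, ?_⟩
  filter_upwards [hG.integrable hA v.stronglyMeasurable h hf hr, hu] with q hq hq2
  exact ⟨(integrable_partM hf).1 hq, by rw [hq2, multFun, integral_partM hf hq]⟩

theorem Good.exists_field (hG : Good t κ B η E) (hA : Admissible η ξp ξm) {v : Triple S → H}
    (hv : StronglyMeasurable v) (h : gnorm S ξp κ.ann κ.gau v < ⊤) :
    ∃ f : Table S → Triple S → H, StronglyMeasurable (Function.uncurry f) ∧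
      ∀ᵐ ϑ ∂(tabT S t), Represents (B (κ.union ϑ)) (deriv κ v) (f ϑ) :=
  hG.field v hv (ae_gnorm_deriv_lt_top hA.up hv h)

theorem Good.exists_actsAs (hG : Good t κ B η E) (hA : Admissible η ξp ξm)
    {v : L0 S H κ.ann κ.gau} (h : InG ξp v) : ∃ u, ActsAs t κ B v u := by
  obtain ⟨f, hf, hr⟩ := hG.exists_field hA v.stronglyMeasurable h
  exact ⟨AEEqFun.mk _ (stronglyMeasurable_multFun t hf).aestronglyMeasurable,
    hG.actsAs hA h hf hr (AEEqFun.coeFn_mk _ _)⟩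

theorem ActsAs.exists_multFun {v : L0 S H κ.ann κ.gau} {u : L0 S H κ.cre κ.gau}
    (h : ActsAs t κ B v u) : ∃ f : Table S → Triple S → H, StronglyMeasurable (Function.uncurry f) ∧
      (∀ᵐ ϑ ∂(tabT S t), Represents (B (κ.union ϑ)) (deriv κ v) (f ϑ)) ∧
      u =ᵐ[vecM S κ.cre κ.gau] multFun t f := by
  obtain ⟨f, hf, h1, h2⟩ := h
  refine ⟨f, hf, h1, ?_⟩
  filter_upwards [h2] with q hq
  rw [hq.2, multFun, integral_partM hf ((integrable_partM hf).2 hq.1)]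

theorem Good.gnorm_le (hG : Good t κ B η E) (hA : Admissible η ξp ξm)
    {v : L0 S H κ.ann κ.gau} {u : L0 S H κ.cre κ.gau} (h : InG ξp v) (hu : ActsAs t κ B v u) :
    gnorm S ξm κ.cre κ.gau u ≤ bnd S t η E * gnorm S ξp κ.ann κ.gau v := by
  obtain ⟨f, hf, hr, e⟩ := hu.exists_multFun
  rw [gnorm_congr e]
  exact hG.gnorm_multFun_le hA v.stronglyMeasurable h hf hr

theorem Good.opNorm_le (hG : Good t κ B η E) (hA : Admissible η ξp ξm) :
    opNorm ξp ξm (multInt t κ B) ≤ bnd S t η E := by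
  refine QS.opNorm_le (fun a ha => ?_) fun a u h ha => hG.gnorm_le hA ha (mem_graph_multInt.1 h)
  obtain ⟨u, hu⟩ := hG.exists_actsAs hA ha
  exact ⟨u, mem_graph_multInt.2 hu⟩

/-! ### Measurable fields -/

/-- The hypothesis on `B` accepts only fields with finite norm at every table of `N`, while the norm
of `ḃ` is finite for almost every table only. The field is replaced by zero on the measurable set of
tables where the norm is infinite. -/
theorem exists_field_of_maps {N : Set (Table S)}
    (hN : ∀ b : Table S → Triple S → H, StronglyMeasurable (Function.uncurry b) →
      (∀ ϑ ∈ N, gnorm S η.upPlus ϑ.ann ϑ.gau (b ϑ) < ⊤) →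
      ∃ c : Table S → Triple S → H, StronglyMeasurable (Function.uncurry c) ∧
        ∀ ϑ ∈ N, Represents (B ϑ) (b ϑ) (c ϑ))
    (h : ∀ᵐ ϑ ∂(tabT S t), κ.union ϑ ∈ N) {v : Triple S → H} (hv : StronglyMeasurable v)
    (hv2 : ∀ᵐ ϑ ∂(tabT S t), gnorm S η.upPlus (κ.union ϑ).ann (κ.union ϑ).gau (deriv κ v) < ⊤) :
    ∃ f : Table S → Triple S → H, StronglyMeasurable (Function.uncurry f) ∧
      ∀ᵐ ϑ ∂(tabT S t), Represents (B (κ.union ϑ)) (deriv κ v) (f ϑ) := by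
  have hd : StronglyMeasurable (deriv κ v) := by
    rw [deriv_eq]
    exact hv.comp_measurable (measurable_pull S κ.ann κ.gau measurable_id)
  have hD : MeasurableSet {ϑ : Table S | gnorm S η.upPlus ϑ.ann ϑ.gau (deriv κ v) < ⊤} := by
    refine measurableSet_lt (Measurable.pow_const ?_ _) measurable_const
    exact measurable_lintegral_vecM S (Ω := Table S)
      (G := fun x => ENNReal.ofReal η.upPlus ^ x.2.2.2.len * ‖deriv κ v x.2‖ₑ ^ 2)
      (by have := hd.enorm; fun_prop) (by fun_prop) (by fun_prop)
  classical
  let b : Table S → Triple S → H := fun ϑ z =>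
    if ϑ ∈ {ϑ : Table S | gnorm S η.upPlus ϑ.ann ϑ.gau (deriv κ v) < ⊤} then deriv κ v z else 0
  have hb : StronglyMeasurable (Function.uncurry b) :=
    StronglyMeasurable.ite (hD.preimage measurable_fst) (hd.comp_measurable measurable_snd)
      stronglyMeasurable_const
  obtain ⟨c, hc, hc2⟩ := hN b hb fun ϑ _ => by
    by_cases hϑ : ϑ ∈ {ϑ : Table S | gnorm S η.upPlus ϑ.ann ϑ.gau (deriv κ v) < ⊤}
    · simp only [b, if_pos hϑ]; exact hϑ
    · simp only [b, if_neg hϑ]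
      exact (gnorm_zero (H := H) _ _ _).trans_lt ENNReal.zero_lt_top
  refine ⟨fun ϑ => c (κ.union ϑ), ?_, ?_⟩
  · exact hc.comp_measurable (g := fun p : Table S × Triple S => (κ.union p.1, p.2)) (by fun_prop)
  · filter_upwards [h, hv2] with ϑ h1 h2
    have h3 := hc2 _ h1
    have h4 : b (κ.union ϑ) = deriv κ v := by
      funext z; simp only [b]; exact if_pos h2
    rwa [h4] at h3

/-! ### The essential supremum -/

omit [MeasurableSingletonClass X] in
-- The essential supremum is at most `c` exactly when the section of `{c < f}` is null, which is a
-- measurable condition on the parameter.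
theorem measurable_essSup {Ω α : Type*} [MeasurableSpace Ω] [MeasurableSpace α] {ν : Measure α}
    [SFinite ν] {f : Ω × α → ℝ≥0∞} (hf : Measurable f) :
    Measurable fun ω => essSup (fun y => f (ω, y)) ν := by
  refine measurable_of_Iic fun c => ?_
  have h : (fun ω => essSup (fun y => f (ω, y)) ν) ⁻¹' Iic c =
      (fun ω => ν (Prod.mk ω ⁻¹' {p | c < f p})) ⁻¹' {0} := by
    ext ω
    simp only [mem_preimage, mem_Iic, mem_singleton_iff]
    constructor
    · intro h
      refine measure_mono_null (fun y hy => ?_) (meas_essSup_lt (f := fun y => f (ω, y)) (μ := ν))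
      exact lt_of_le_of_lt h hy
    · intro h
      refine essSup_le_of_ae_le c ?_
      rw [Filter.EventuallyLE, ae_iff]
      simp only [not_le]
      exact h
  rw [h]
  exact measurable_measure_prodMk_left (measurableSet_lt measurable_const hf) (measurableSet_singleton 0)

omit [MeasurableSingletonClass X] in
-- The norms are only almost everywhere measurable. The essential supremum is taken for a measurable
-- version, which gives a jointly measurable `E`; by Fubini the version does not change the iterated
-- integral.
theorem exists_bound (t : ℝ) (η : Weights) {o : Table S → ℝ≥0∞} (ho : AEMeasurable o (tabT S t)) :
    ∃ E : Ch S × Ch S × Ch S → ℝ≥0∞, Measurable E ∧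
      (∀ᵐ ϑ ∂(tabT S t), o ϑ ^ 2 ≤ ENNReal.ofReal η.upZero ^ ϑ.gau.len /
        ENNReal.ofReal η.loZero ^ ϑ.gau.len * E (ϑ.ann, ϑ.cre, ϑ.tim)) ∧
      bnd S t η E = ∫⁻ tim, (∫⁻ ann, ∫⁻ cre,
        ENNReal.ofReal η.loPlus ^ cre.len / ENNReal.ofReal η.upMinus ^ ann.len *
        essSup (fun gau : Ch S =>
          (ENNReal.ofReal η.loZero ^ gau.len / ENNReal.ofReal η.upZero ^ gau.len) *
            o (ann, gau, cre, tim) ^ 2) (chT S t) ∂(chT S t) ∂(chT S t)) ^ (1 / 2 : ℝ) ∂(chT S t) := by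
  let g : (Ch S × Ch S × Ch S) × Ch S → ℝ≥0∞ := fun x =>
    (ENNReal.ofReal η.loZero ^ x.2.len / ENNReal.ofReal η.upZero ^ x.2.len) *
      ho.mk o (x.1.1, x.2, x.1.2.1, x.1.2.2) ^ 2
  have hg : Measurable g := by have := ho.measurable_mk; fun_prop
  have hae := ae_tabT_iterated ho.ae_eq_mk
  have hE : Measurable fun p => essSup (fun gau => g (p, gau)) (chT S t) := measurable_essSup hg
  refine ⟨fun p => essSup (fun gau => g (p, gau)) (chT S t), hE, ?_, ?_⟩
  · have h1 : ∀ᵐ ϑ ∂(tabT S t), g ((ϑ.ann, ϑ.cre, ϑ.tim), ϑ.gau) ≤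
        essSup (fun gau => g ((ϑ.ann, ϑ.cre, ϑ.tim), gau)) (chT S t) := by
      refine ae_tabT_of_iterated (measurableSet_le (by fun_prop) ?_) ?_
      · exact hE.fun_comp (by fun_prop : Measurable fun ϑ : Table S => (ϑ.ann, ϑ.cre, ϑ.tim))
      · exact Filter.Eventually.of_forall fun tim => Filter.Eventually.of_forall fun ann =>
          Filter.Eventually.of_forall fun cre => ENNReal.ae_le_essSup _
    filter_upwards [h1, ho.ae_eq_mk] with ϑ h1 h2
    refine le_trans (le_of_eq ?_) (mul_le_mul_right h1 _)
    simp only [g]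
    rw [h2, ← mul_assoc, div_eq_mul_inv, div_eq_mul_inv, ← inv_pow_eq η.loZero_pos,
      ← inv_pow_eq η.upZero_pos]
    have e : ∀ a b c d : ℝ≥0∞, a * b * (c * d) = (d * a) * (b * c) := fun a b c d => by ring
    rw [e, ofReal_pow_mul_inv η.upZero_pos, ofReal_pow_mul_inv η.loZero_pos, one_mul, one_mul]
  · refine lintegral_congr_ae (hae.mono fun tim h1 => ?_)
    simp only
    congr 1
    refine lintegral_congr_ae (h1.mono fun ann h2 => ?_)
    refine lintegral_congr_ae (h2.mono fun cre h3 => ?_)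
    simp only
    congr 1
    refine essSup_congr_ae (h3.mono fun gau h4 => ?_)
    simp only [g]
    rw [h4]

/-- The bound for a QS integrable function. -/
theorem QSIntegrableUpTo.exists_good {T : ℝ} (hB : QSIntegrableUpTo T η B) :
    ∃ E, Good T (Table.empty S) B η E ∧ bnd S T η E = qsNorm T η B := by
  obtain ⟨E, hE, h1, h2⟩ := exists_bound T η hB.2.2.1
  refine ⟨E, ⟨hE, ?_, ?_, ?_⟩, h2⟩
  · obtain ⟨N, hN, hN2⟩ := id hB.1
    intro v hv hv2
    refine exists_field_of_maps hN2 ?_ hv hv2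
    filter_upwards [hN] with ϑ hϑ
    rwa [empty_table_union]
  · filter_upwards [h1] with ϑ hϑ
    rwa [empty_table_union]
  · rw [h2]; exact hB.2.2.2

theorem integral_bind_kernel {α β F : Type*} [MeasurableSpace α] [MeasurableSpace β]
    [NormedAddCommGroup F] [NormedSpace ℝ F] {μ : Measure α} {κ : ProbabilityTheory.Kernel α β}
    {f : β → F} (hf : Integrable f (μ.bind κ)) :
    ∫ y, f y ∂(μ.bind κ) = ∫ x, ∫ y, f y ∂(κ x) ∂μ := by
  rw [Measure.comp_eq_comp_const_apply] at hf ⊢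
  rw [ProbabilityTheory.Kernel.integral_comp hf]
  simp

theorem eLpNorm_two_eq {α F : Type*} [MeasurableSpace α] [NormedAddCommGroup F] (f : α → F)
    (ν : Measure α) : eLpNorm f 2 ν = (∫⁻ x, ‖f x‖ₑ ^ 2 ∂ν) ^ (1 / 2 : ℝ) := by
  rw [eLpNorm_eq_lintegral_rpow_enorm_toReal (by norm_num) (by norm_num)]
  simp

variable {X : Type*} [MeasurableSpace X] {S : NoiseSpace X} [MeasurableSingletonClass X]
variable {H : Type*} [NormedAddCommGroup H] [InnerProductSpace ℂ H]

/-! ### The pairing -/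

section
variable {σ ρ : Ch S} {ξ : ℝ}

/-- Cauchy–Schwarz with reciprocal weights: the unweighted pairing puts the spaces with parameters
`1/ξ` and `ξ` in duality. -/
theorem lintegral_inner_le (hξ : 0 < ξ) {c a : Triple S → H}
    (hc : AEStronglyMeasurable c (vecM S σ ρ)) (ha : AEStronglyMeasurable a (vecM S σ ρ)) :
    ∫⁻ y, ‖(inner ℂ (c y) (a y) : ℂ)‖ₑ ∂(vecM S σ ρ) ≤
      gnorm S (1 / ξ) σ ρ c * gnorm S ξ σ ρ a := by
  refine le_trans (lintegral_mono fun y => ?_) (lintegral_mul_le_weighted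
    (f := fun y => ‖c y‖ₑ) (g := fun y => ‖a y‖ₑ)
    (v := fun z => ENNReal.ofReal (1 / ξ) ^ z.2.2.len)
    (w := fun z => ENNReal.ofReal ξ ^ z.2.2.len) hc.enorm ha.enorm (by fun_prop)
      (by fun_prop) fun z => ofReal_pow_mul_inv hξ _)
  rw [← enorm_norm (c y), ← enorm_norm (a y), ← enorm_mul]
  exact enorm_le_iff_norm_le.2 (by
    rw [norm_mul, norm_norm, norm_norm]; exact norm_inner_le_norm _ _)

theorem integrable_inner_of_gnorm (hξ : 0 < ξ) {c a : Triple S → H}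
    (hc : AEStronglyMeasurable c (vecM S σ ρ)) (ha : AEStronglyMeasurable a (vecM S σ ρ))
    (h1 : gnorm S (1 / ξ) σ ρ c < ⊤) (h2 : gnorm S ξ σ ρ a < ⊤) :
    Integrable (fun y => (inner ℂ (c y) (a y) : ℂ)) (vecM S σ ρ) :=
  ⟨hc.inner ha, (lintegral_inner_le hξ hc ha).trans_lt (ENNReal.mul_lt_top h1 h2)⟩

theorem pairing_congr {c a : L0 S H σ ρ} {c' a' : Triple S → H} (hc : c =ᵐ[vecM S σ ρ] c')
    (ha : a =ᵐ[vecM S σ ρ] a') : pairing c a = ∫ y, inner ℂ (c' y) (a' y) ∂(vecM S σ ρ) :=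
  integral_congr_ae (by filter_upwards [hc, ha] with y h1 h2; rw [h1, h2])

theorem paired_congr {c a : L0 S H σ ρ} {c' a' : Triple S → H} (hc : c =ᵐ[vecM S σ ρ] c')
    (ha : a =ᵐ[vecM S σ ρ] a') :
    Paired c a ↔ Integrable (fun y => (inner ℂ (c' y) (a' y) : ℂ)) (vecM S σ ρ) :=
  integrable_congr (by filter_upwards [hc, ha] with y h1 h2; rw [h1, h2])

theorem InG.paired (hξ : 0 < ξ) {c a : L0 S H σ ρ} (hc : InG (1 / ξ) c) (ha : InG ξ a) :
    Paired c a :=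
  integrable_inner_of_gnorm hξ c.aestronglyMeasurable a.aestronglyMeasurable hc ha

theorem paired_symm {c a : L0 S H σ ρ} (h : Paired c a) : Paired a c := by
  have := (Complex.conjCLE.toContinuousLinearMap.integrable_comp h)
  refine this.congr (Filter.Eventually.of_forall fun y => ?_)
  simp [inner_conj_symm]

theorem pairing_symm (c a : L0 S H σ ρ) : pairing a c = (starRingEnd ℂ) (pairing c a) := by
  rw [pairing, pairing, ← integral_conj]
  refine integral_congr_ae (Filter.Eventually.of_forall fun y => ?_)
  simp [inner_conj_symm]

theorem Paired.add_right {c a b : L0 S H σ ρ} (h : Paired c a) (h' : Paired c b) :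
    Paired c (a + b) ∧ pairing c (a + b) = pairing c a + pairing c b := by
  have e : ∀ᵐ y ∂(vecM S σ ρ), (inner ℂ (c y) ((a + b : L0 S H σ ρ) y) : ℂ) =
      inner ℂ (c y) (a y) + inner ℂ (c y) (b y) := by
    filter_upwards [AEEqFun.coeFn_add a b] with y hy
    rw [hy, Pi.add_apply, inner_add_right]
  exact ⟨(Integrable.add h h').congr (Filter.EventuallyEq.symm e),
    (integral_congr_ae e).trans (integral_add h h')⟩

theorem Paired.smul_right {c a : L0 S H σ ρ} (k : ℂ) (h : Paired c a) :
    Paired c (k • a) ∧ pairing c (k • a) = k * pairing c a := by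
  have e : ∀ᵐ y ∂(vecM S σ ρ), (inner ℂ (c y) ((k • a : L0 S H σ ρ) y) : ℂ) =
      k * inner ℂ (c y) (a y) := by
    filter_upwards [AEEqFun.coeFn_smul k a] with y hy
    rw [hy, Pi.smul_apply, inner_smul_right]
  exact ⟨(Integrable.const_mul h k).congr (Filter.EventuallyEq.symm e),
    (integral_congr_ae e).trans (integral_const_mul k _)⟩

theorem Paired.add_left {c a b : L0 S H σ ρ} (h : Paired a c) (h' : Paired b c) :
    Paired (a + b) c ∧ pairing (a + b) c = pairing a c + pairing b c := by
  have h1 := (paired_symm h).add_right (paired_symm h')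
  refine ⟨paired_symm h1.1, ?_⟩
  rw [pairing_symm, h1.2, map_add, ← pairing_symm, ← pairing_symm]

theorem Paired.smul_left {c a : L0 S H σ ρ} (k : ℂ) (h : Paired a c) :
    Paired (k • a) c ∧ pairing (k • a) c = (starRingEnd ℂ) k * pairing a c := by
  have h1 := (paired_symm h).smul_right k
  refine ⟨paired_symm h1.1, ?_⟩
  rw [pairing_symm, h1.2, map_mul, ← pairing_symm]

theorem paired_zero_left (a : L0 S H σ ρ) : Paired 0 a ∧ pairing 0 a = 0 := by
  have e : ∀ᵐ y ∂(vecM S σ ρ), (inner ℂ ((0 : L0 S H σ ρ) y) (a y) : ℂ) = 0 := by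
    filter_upwards [AEEqFun.coeFn_zero (μ := vecM S σ ρ) (β := H)] with y hy
    rw [hy, Pi.zero_apply, inner_zero_left]
  exact ⟨(integrable_zero _ _ _).congr (Filter.EventuallyEq.symm e),
    (integral_congr_ae e).trans (integral_zero _ _)⟩

/-- The test vectors separate functions. -/
theorem ae_zero_of_test {d : Triple S → H} (hd : StronglyMeasurable d)
    (h : ∀ a : Triple S → H, StronglyMeasurable a → (∀ ξ : ℝ, 0 < ξ → gnorm S ξ σ ρ a < ⊤) →
      Integrable (fun y => (inner ℂ (d y) (a y) : ℂ)) (vecM S σ ρ) →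
        ∫ y, (inner ℂ (d y) (a y) : ℂ) ∂(vecM S σ ρ) = 0) : d =ᵐ[vecM S σ ρ] 0 := by
  -- On `P k` the measure is finite, `‖d‖` is bounded and so is the number of points. The
  -- restriction of `d` to `P k` therefore has finite norm for every `ξ`, and its pairing with `d`
  -- is the integral of `‖d‖²` over `P k`.
  let P : ℕ → Set (Triple S) := fun k => spanningSets (vecM S σ ρ) k ∩ ({z | ‖d z‖ ≤ k} ∩ {z | z.2.2.len ≤ k})
  have hP : ∀ k, MeasurableSet (P k) := fun k => (measurableSet_spanningSets _ k).inter
    ((measurableSet_le hd.norm.measurable measurable_const).inter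
      (measurableSet_le (by fun_prop) measurable_const))
  have hfin : ∀ k, vecM S σ ρ (P k) < ⊤ := fun k =>
    (measure_mono inter_subset_left).trans_lt (measure_spanningSets_lt_top _ k)
  have key : ∀ k, ∀ᵐ z ∂(vecM S σ ρ), z ∈ P k → d z = 0 := by
    intro k
    have e : ∀ y, (inner ℂ (d y) ((P k).indicator d y) : ℂ) =
        ((P k).indicator (fun y => (‖d y‖ : ℝ) ^ 2) y : ℝ) := by
      intro y
      by_cases hy : y ∈ P k
      · rw [indicator_of_mem hy, indicator_of_mem hy, inner_self_eq_norm_sq_to_K]; simp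
      · rw [indicator_of_notMem hy, indicator_of_notMem hy, inner_zero_right]; simp
    have hi : Integrable ((P k).indicator (fun y => (‖d y‖ : ℝ) ^ 2)) (vecM S σ ρ) := by
      rw [integrable_indicator_iff (hP k)]
      refine Integrable.mono' (g := fun _ => (k : ℝ) ^ 2) (integrableOn_const (hfin k).ne)
        (hd.norm.pow 2).aestronglyMeasurable ?_
      filter_upwards [ae_restrict_mem (hP k)] with y hy
      rw [Real.norm_of_nonneg (by positivity)]
      exact pow_le_pow_left₀ (norm_nonneg _) hy.2.1 2
    have h1 := h ((P k).indicator d) (hd.indicator (hP k)) (fun ξ hξ => ?_) (by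
      simp_rw [e]; exact hi.ofReal)
    · simp_rw [e] at h1
      rw [integral_complex_ofReal] at h1
      have h2 : ∫ y, (P k).indicator (fun y => (‖d y‖ : ℝ) ^ 2) y ∂(vecM S σ ρ) = 0 := by
        exact_mod_cast h1
      rw [integral_eq_zero_iff_of_nonneg (fun y => indicator_nonneg (fun _ _ => by positivity) _) hi] at h2
      filter_upwards [h2] with z hz hzP
      rw [indicator_of_mem hzP] at hz
      simpa using hz
    · rw [gnorm_lt_top_iff]
      refine lt_of_le_of_lt (lintegral_mono fun z => ?_) (b := ∫⁻ z, (P k).indicator (fun _ =>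
        (1 + ENNReal.ofReal ξ) ^ k * (k : ℝ≥0∞) ^ 2) z ∂(vecM S σ ρ)) ?_
      · by_cases hz : z ∈ P k
        · simp only [indicator_of_mem hz]
          have h3 : ‖d z‖ₑ ≤ k := by
            rw [← ofReal_norm, ← ENNReal.ofReal_natCast]
            exact ENNReal.ofReal_le_ofReal hz.2.1
          have h4 : ENNReal.ofReal ξ ^ z.2.2.len ≤ (1 + ENNReal.ofReal ξ) ^ k :=
            (pow_le_pow_left₀ zero_le (le_add_self : ENNReal.ofReal ξ ≤ 1 + ENNReal.ofReal ξ)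
              _).trans (pow_le_pow_right₀ le_self_add hz.2.2)
          gcongr
        · simp only [indicator_of_notMem hz]; simp
      · rw [lintegral_indicator (hP k), setLIntegral_const]
        exact ENNReal.mul_lt_top (by finiteness) (hfin k)
  filter_upwards [ae_all_iff.2 key] with z hz
  obtain ⟨m, hm⟩ : ∃ m, z ∈ spanningSets (vecM S σ ρ) m := by
    have : z ∈ ⋃ n, spanningSets (vecM S σ ρ) n := by rw [iUnion_spanningSets]; trivial
    exact mem_iUnion.1 this
  obtain ⟨k, hk⟩ := exists_nat_ge ‖d z‖
  have hle : ((k : ℕ) : ℝ) ≤ ((max m (max k z.2.2.len) : ℕ) : ℝ) := by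
    exact_mod_cast (le_max_left k z.2.2.len).trans (le_max_right m _)
  refine hz (max m (max k z.2.2.len)) ⟨monotone_spanningSets _ (le_max_left _ _) hm, ?_, ?_⟩
  · exact hk.trans hle
  · exact (le_max_right k _).trans (le_max_right m _)

theorem eq_zero_of_pairing {d : L0 S H σ ρ}
    (h : ∀ a : L0 S H σ ρ, (∀ ξ : ℝ, 0 < ξ → InG ξ a) → Paired d a → pairing d a = 0) : d = 0 := by
  refine AEEqFun.ext (Filter.EventuallyEq.trans ?_ AEEqFun.coeFn_zero.symm)
  refine ae_zero_of_test d.stronglyMeasurable fun a ha h1 h2 => ?_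
  have e := AEEqFun.coeFn_mk a (ha.aestronglyMeasurable (μ := vecM S σ ρ))
  have h3 := h (AEEqFun.mk a ha.aestronglyMeasurable)
    (fun ξ hξ => by rw [InG, gnorm_congr e]; exact h1 ξ hξ)
    ((paired_congr Filter.EventuallyEq.rfl e).2 h2)
  rwa [pairing_congr Filter.EventuallyEq.rfl e] at h3

/-! ### The weighted spaces as `L²` spaces -/

/-- The square root of the weight. -/
def rootWeight (S : NoiseSpace X) (ξ : ℝ) (z : Triple S) : ℝ := Real.sqrt ξ ^ z.2.2.len

omit [MeasurableSingletonClass X] in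
theorem measurable_rootWeight (ξ : ℝ) : Measurable (rootWeight S ξ) := by
  have h : Measurable fun n : ℕ => Real.sqrt ξ ^ n := measurable_of_countable _
  exact h.comp (by fun_prop : Measurable fun z : Triple S => z.2.2.len)

omit [MeasurableSingletonClass X] in
theorem rootWeight_pos (hξ : 0 < ξ) (z : Triple S) : 0 < rootWeight S ξ z :=
  pow_pos (Real.sqrt_pos.2 hξ) _

omit [MeasurableSingletonClass X] in
theorem rootWeight_mul (hξ : 0 < ξ) (z : Triple S) :
    rootWeight S (1 / ξ) z * rootWeight S ξ z = 1 := by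
  rw [rootWeight, rootWeight, ← mul_pow, ← Real.sqrt_mul (by positivity), one_div,
    inv_mul_cancel₀ hξ.ne', Real.sqrt_one, one_pow]

omit [MeasurableSingletonClass X] in
-- Multiplication by the square root of the weight is an isometry into an ordinary `L²` space, where
-- the Riesz theorem is available.
theorem gnorm_eq_eLpNorm (hξ : 0 < ξ) (f : Triple S → H) :
    gnorm S ξ σ ρ f = eLpNorm (fun z => (rootWeight S ξ z : ℂ) • f z) 2 (vecM S σ ρ) := by
  rw [eLpNorm_two_eq, gnorm]
  congr 1
  refine lintegral_congr fun z => ?_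
  rw [enorm_smul, mul_pow]
  congr 1
  have : ‖(rootWeight S ξ z : ℂ)‖ₑ = ENNReal.ofReal (rootWeight S ξ z) := by
    rw [← ofReal_norm, Complex.norm_real, Real.norm_of_nonneg (rootWeight_pos hξ z).le]
  rw [this, rootWeight, ← ENNReal.ofReal_pow hξ.le, ← ENNReal.ofReal_pow (by positivity), ← pow_mul,
    mul_comm _ 2, pow_mul, Real.sq_sqrt hξ.le]

end

variable {X : Type*} [MeasurableSpace X] {S : NoiseSpace X} [MeasurableSingletonClass X]
variable {H : Type*} [NormedAddCommGroup H] [InnerProductSpace ℂ H]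

/-! ### Adjoints of bounded operators in the scale -/

section
variable {σ ρ σ' ρ' : Ch S} {T : L0 S H σ ρ →ₗ.[ℂ] L0 S H σ' ρ'} {ηp ηm : ℝ}

omit [MeasurableSingletonClass X] in
theorem exists_mem_graph (hT : opNorm ηp ηm T ≠ ⊤) {a : L0 S H σ ρ} (ha : InG ηp a) :
    ∃ u, (a, u) ∈ T.graph := by
  have hd : ∀ a : L0 S H σ ρ, InG ηp a → a ∈ T.domain := by
    by_contra hd
    exact hT (by rw [opNorm, if_neg hd])
  exact LinearPMap.mem_domain_iff.1 (hd a ha)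

omit [MeasurableSingletonClass X] in
theorem gnorm_le_of_mem_graph (hp : 0 < ηp) {a : L0 S H σ ρ} {u : L0 S H σ' ρ'}
    (h : (a, u) ∈ T.graph) (ha : InG ηp a) :
    gnorm S ηm σ' ρ' u ≤ opNorm ηp ηm T * gnorm S ηp σ ρ a :=
  (represents_coe.2 h).gnorm_le hp ha

omit [MeasurableSingletonClass X] in
theorem inG_of_mem_graph (hp : 0 < ηp) (hT : opNorm ηp ηm T ≠ ⊤) {a : L0 S H σ ρ}
    {u : L0 S H σ' ρ'} (h : (a, u) ∈ T.graph) (ha : InG ηp a) : InG ηm u :=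
  (gnorm_le_of_mem_graph hp h ha).trans_lt (ENNReal.mul_lt_top hT.lt_top ha)

/-- A finite norm puts every vector of `G(ηp) ⊗ ⋯` into the domain of `T`, in particular all the
test vectors. These separate points, so the adjoint relation is single-valued. -/
theorem formalAdjoint_graph (hp : 0 < ηp) (hT : opNorm ηp ηm T ≠ ⊤) {c : L0 S H σ' ρ'}
    {d : L0 S H σ ρ} : (c, d) ∈ (formalAdjoint T).graph ↔
      ∀ p ∈ T.graph, (∀ ξ : ℝ, 0 < ξ → InG ξ p.1) →
        Paired c p.2 ∧ Paired d p.1 ∧ pairing c p.2 = pairing d p.1 := by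
  refine mem_graph_ofRel ?_ ?_ ?_ ?_
  · intro p _ _
    refine ⟨(paired_zero_left _).1, (paired_zero_left _).1, ?_⟩
    rw [(paired_zero_left _).2, (paired_zero_left _).2]
  · intro a u b v h h' p hp hp2
    obtain ⟨h1, h2, h3⟩ := h p hp hp2
    obtain ⟨h1', h2', h3'⟩ := h' p hp hp2
    refine ⟨(h1.add_left h1').1, (h2.add_left h2').1, ?_⟩
    rw [(h1.add_left h1').2, (h2.add_left h2').2, h3, h3']
  · intro k a u h p hp hp2
    obtain ⟨h1, h2, h3⟩ := h p hp hp2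
    refine ⟨(h1.smul_left k).1, (h2.smul_left k).1, ?_⟩
    rw [(h1.smul_left k).2, (h2.smul_left k).2, h3]
  · intro u hu
    refine eq_zero_of_pairing fun a ha _ => ?_
    obtain ⟨b, hb⟩ := exists_mem_graph hT (ha _ hp)
    obtain ⟨-, -, h3⟩ := hu (a, b) hb ha
    rw [← h3, (paired_zero_left _).2]

variable [CompleteSpace H]

/-- The adjoint vector. -/
theorem exists_adjoint (hp : 0 < ηp) (hm : 0 < ηm) (hT : opNorm ηp ηm T ≠ ⊤) {c : L0 S H σ' ρ'}
    (hc : InG (1 / ηm) c) : ∃ d : L0 S H σ ρ,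
      gnorm S (1 / ηp) σ ρ d ≤ opNorm ηp ηm T * gnorm S (1 / ηm) σ' ρ' c ∧
      ∀ p ∈ T.graph, InG ηp p.1 → Paired c p.2 ∧ Paired d p.1 ∧ pairing c p.2 = pairing d p.1 := by
  let ν := vecM S σ ρ
  have hw : Measurable fun z => (rootWeight S ηp z : ℂ) :=
    Complex.measurable_ofReal.comp (measurable_rootWeight ηp)
  have hw' : Measurable fun z => (rootWeight S (1 / ηp) z : ℂ) :=
    Complex.measurable_ofReal.comp (measurable_rootWeight (1 / ηp))
  have hww : ∀ z, (rootWeight S (1 / ηp) z : ℂ) * rootWeight S ηp z = 1 := fun z => by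
    rw [← Complex.ofReal_mul, rootWeight_mul hp, Complex.ofReal_one]
  have hm1 : ∀ f : Lp H 2 ν, AEStronglyMeasurable (fun z => (rootWeight S (1 / ηp) z : ℂ) • f z) ν :=
    fun f => hw'.aestronglyMeasurable.smul (Lp.stronglyMeasurable f).aestronglyMeasurable
  -- `V` divides by the square root of the weight and identifies `L²` isometrically with the space
  -- with parameter `ηp`.
  let V : Lp H 2 ν → L0 S H σ ρ := fun f => AEEqFun.mk _ (hm1 f)
  have hV : ∀ f, V f =ᵐ[ν] fun z => (rootWeight S (1 / ηp) z : ℂ) • f z := fun f =>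
    AEEqFun.coeFn_mk _ (hm1 f)
  have hVn : ∀ f, gnorm S ηp σ ρ (V f) = ‖f‖ₑ := by
    intro f
    rw [gnorm_congr (hV f), gnorm_eq_eLpNorm hp, Lp.enorm_def]
    congr 1
    funext z
    rw [smul_smul, mul_comm, hww, one_smul]
  have hVG : ∀ f, InG ηp (V f) := fun f => by
    rw [InG, hVn]; exact enorm_lt_top
  have hVadd : ∀ f g, V (f + g) = V f + V g := by
    intro f g
    refine AEEqFun.ext ?_
    filter_upwards [hV f, hV g, hV (f + g), Lp.coeFn_add f g, AEEqFun.coeFn_add (V f) (V g)] with z h1 h2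
      h3 h4 h5
    rw [h3, h5, h4, Pi.add_apply, Pi.add_apply, h1, h2, smul_add]
  have hVsmul : ∀ (k : ℂ) f, V (k • f) = k • V f := by
    intro k f
    refine AEEqFun.ext ?_
    filter_upwards [hV f, hV (k • f), Lp.coeFn_smul k f, AEEqFun.coeFn_smul k (V f)] with z h1 h3 h4 h5
    rw [h3, h5, h4, Pi.smul_apply, Pi.smul_apply, h1, smul_comm]
  choose U hU using fun f => exists_mem_graph hT (hVG f)
  have hUG : ∀ f, InG ηm (U f) := fun f => inG_of_mem_graph hp hT (hU f) (hVG f)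
  have hUadd : ∀ f g, U (f + g) = U f + U g := fun f g =>
    T.mem_graph_snd_inj (hU (f + g)) (add_mem (hU f) (hU g)) (hVadd f g)
  have hUsmul : ∀ (k : ℂ) f, U (k • f) = k • U f := fun k f =>
    T.mem_graph_snd_inj (hU (k • f)) (Submodule.smul_mem _ k (hU f)) (hVsmul k f)
  have hcU : ∀ f, Paired c (U f) := fun f => hc.paired hm (hUG f)
  -- The functional `f ↦ ⟨c | T V f⟩` is bounded by the duality of the parameters `1/ηm` and `ηm`;
  -- the Riesz theorem represents it by a vector `e` of `L²`.
  let ℓ : Lp H 2 ν →ₗ[ℂ] ℂ :=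
    { toFun := fun f => pairing c (U f)
      map_add' := fun f g => by rw [hUadd, ((hcU f).add_right (hcU g)).2]
      map_smul' := fun k f => by rw [hUsmul, ((hcU f).smul_right k).2]; rfl }
  let K := (opNorm ηp ηm T * gnorm S (1 / ηm) σ' ρ' c).toReal
  have hKt : opNorm ηp ηm T * gnorm S (1 / ηm) σ' ρ' c ≠ ⊤ := (ENNReal.mul_lt_top hT.lt_top hc).ne
  have hℓ : ∀ f, ‖ℓ f‖ ≤ K * ‖f‖ := by
    intro f
    rw [← toReal_enorm f, ← toReal_enorm (ℓ f), ← ENNReal.toReal_mul]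
    refine ENNReal.toReal_mono (ENNReal.mul_ne_top hKt enorm_ne_top) ?_
    refine (enorm_integral_le_lintegral_enorm _).trans ?_
    refine (lintegral_inner_le hm c.aestronglyMeasurable (U f).aestronglyMeasurable).trans ?_
    have := gnorm_le_of_mem_graph (ηm := ηm) hp (hU f) (hVG f)
    rw [hVn] at this
    calc _ ≤ gnorm S (1 / ηm) σ' ρ' c * (opNorm ηp ηm T * ‖f‖ₑ) := by gcongr
      _ = _ := by ring
  let L : StrongDual ℂ (Lp H 2 ν) := ℓ.mkContinuous K hℓ
  let e : Lp H 2 ν := (InnerProductSpace.toDual ℂ (Lp H 2 ν)).symm L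
  have he : ∀ f, (inner ℂ e f : ℂ) = pairing c (U f) := fun f =>
    InnerProductSpace.toDual_symm_apply
  have hen : ‖e‖ₑ ≤ opNorm ηp ηm T * gnorm S (1 / ηm) σ' ρ' c := by
    have h1 : ‖e‖ ≤ K := by
      rw [LinearIsometryEquiv.norm_map]
      exact ℓ.mkContinuous_norm_le ENNReal.toReal_nonneg hℓ
    rw [← ofReal_norm, ← ENNReal.ofReal_toReal hKt]
    exact ENNReal.ofReal_le_ofReal h1
  -- The adjoint vector carries the square root of the weight as a factor, so that `⟨d | a⟩ = ⟨e |
  -- √w a⟩`; its norm with the parameter `1/ηp` is that of `e`.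
  have hdm : AEStronglyMeasurable (fun z => (rootWeight S ηp z : ℂ) • e z) ν :=
    hw.aestronglyMeasurable.smul (Lp.stronglyMeasurable e).aestronglyMeasurable
  have hd := AEEqFun.coeFn_mk _ hdm
  have hdn : gnorm S (1 / ηp) σ ρ (AEEqFun.mk _ hdm) = ‖e‖ₑ := by
    rw [gnorm_congr hd, gnorm_eq_eLpNorm (by positivity), Lp.enorm_def]
    congr 1
    funext z
    rw [smul_smul, hww, one_smul]
  refine ⟨AEEqFun.mk _ hdm, hdn.trans_le hen, ?_⟩
  rintro ⟨a, u⟩ hau ha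
  have hdG : InG (1 / ηp) (AEEqFun.mk _ hdm) := by rw [InG, hdn]; exact enorm_lt_top
  refine ⟨hc.paired hm (inG_of_mem_graph hp hT hau ha), hdG.paired hp ha, ?_⟩
  have ham : MemLp (fun z => (rootWeight S ηp z : ℂ) • a z) 2 ν := by
    refine ⟨hw.aestronglyMeasurable.smul a.aestronglyMeasurable, ?_⟩
    rw [← gnorm_eq_eLpNorm hp]; exact ha
  have hVa : V (ham.toLp _) = a := by
    refine AEEqFun.ext ?_
    filter_upwards [hV (ham.toLp _), ham.coeFn_toLp] with z h1 h2
    rw [h1, h2, smul_smul, hww, one_smul]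
  have hUa : U (ham.toLp _) = u := T.mem_graph_snd_inj (hU _) hau hVa
  have h1 := he (ham.toLp _)
  rw [hUa] at h1
  rw [← h1, L2.inner_def, pairing_congr hd Filter.EventuallyEq.rfl]
  refine integral_congr_ae ?_
  filter_upwards [ham.coeFn_toLp] with z hz
  rw [hz, inner_smul_left, inner_smul_right, Complex.conj_ofReal]

/-- The formal adjoint is tested only on vectors lying in all the spaces of the scale. By uniqueness
its value is the vector of `exists_adjoint`, so the adjoint identity extends to the whole source
space and the norm bound is inherited. -/
theorem formalAdjoint_of_mem_graph (hp : 0 < ηp) (hm : 0 < ηm) (hT : opNorm ηp ηm T ≠ ⊤)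
    {c : L0 S H σ' ρ'} {d : L0 S H σ ρ} (h : (c, d) ∈ (formalAdjoint T).graph)
    (hc : InG (1 / ηm) c) :
    gnorm S (1 / ηp) σ ρ d ≤ opNorm ηp ηm T * gnorm S (1 / ηm) σ' ρ' c ∧
      ∀ p ∈ T.graph, InG ηp p.1 → Paired c p.2 ∧ Paired d p.1 ∧ pairing c p.2 = pairing d p.1 := by
  obtain ⟨d', h1, h2⟩ := exists_adjoint hp hm hT hc
  have h3 : (c, d') ∈ (formalAdjoint T).graph :=
    (formalAdjoint_graph hp hT).2 fun p hp1 hp2 => h2 p hp1 (hp2 _ hp)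
  rw [(formalAdjoint T).mem_graph_snd_inj h h3 rfl]
  exact ⟨h1, h2⟩

theorem opNorm_formalAdjoint_le (hp : 0 < ηp) (hm : 0 < ηm) :
    opNorm (1 / ηm) (1 / ηp) (formalAdjoint T) ≤ opNorm ηp ηm T := by
  by_cases hT : opNorm ηp ηm T = ⊤
  · rw [hT]; exact le_top
  refine opNorm_le (fun c hc => ?_) fun c d h hc => (formalAdjoint_of_mem_graph hp hm hT h hc).1
  obtain ⟨d, -, h2⟩ := exists_adjoint hp hm hT hc
  exact ⟨d, (formalAdjoint_graph hp hT).2 fun p hp1 hp2 => h2 p hp1 (hp2 _ hp)⟩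

/-- Operators which are adjoint to each other. -/
theorem opNorm_le_of_pairing (hp : 0 < ηp) (hm : 0 < ηm) (hT : opNorm ηp ηm T ≠ ⊤)
    {T' : L0 S H σ' ρ' →ₗ.[ℂ] L0 S H σ ρ} (hd : ∀ c, InG (1 / ηm) c → ∃ d, (c, d) ∈ T'.graph)
    (h : ∀ p ∈ T.graph, ∀ q ∈ T'.graph, InG ηp p.1 → InG (1 / ηm) q.1 →
      Paired q.1 p.2 ∧ Paired q.2 p.1 ∧ pairing q.1 p.2 = pairing q.2 p.1) :
    opNorm (1 / ηm) (1 / ηp) T' ≤ opNorm ηp ηm T := by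
  refine opNorm_le hd fun c d hcd hc => ?_
  refine (formalAdjoint_of_mem_graph hp hm hT ((formalAdjoint_graph hp hT).2 ?_) hc).1
  exact fun p hp1 hp2 => h p hp1 (c, d) hcd (hp2 _ hp) hc

end

/-! ### The adjoint field -/

/-- The weights for the adjoint. -/
def Weights.adj (η : Weights) : Weights where
  upMinus := 1 / η.loPlus
  upZero := 1 / η.loZero
  upPlus := 1 / η.loMinus
  loMinus := 1 / η.upPlus
  loZero := 1 / η.upZero
  loPlus := 1 / η.upMinus
  upMinus_pos := one_div_pos.2 η.loPlus_pos
  upZero_pos := one_div_pos.2 η.loZero_pos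
  upPlus_pos := one_div_pos.2 η.loMinus_pos
  loMinus_pos := one_div_pos.2 η.upPlus_pos
  loZero_pos := one_div_pos.2 η.upZero_pos
  loPlus_pos := one_div_pos.2 η.upMinus_pos

/-- Passing to reciprocals exchanges the two inequalities for the weights. -/
theorem Admissible.adj {η : Weights} {ξp ξm : ℝ} (h : Admissible η ξp ξm) :
    Admissible η.adj (1 / ξm) (1 / ξp) where
  pos := one_div_pos.2 h.up_pos
  up := by
    have := h.lo
    simp only [Weights.adj, one_div]
    linarith
  lo := by
    have := h.up
    simp only [Weights.adj, one_div, inv_inv]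
    linarith

omit [MeasurableSingletonClass X] in
theorem bnd_adj (t : ℝ) (η : Weights) {E : Ch S × Ch S × Ch S → ℝ≥0∞} (hE : Measurable E) :
    bnd S t η.adj (fun p => E (p.2.1, p.1, p.2.2)) = bnd S t η E := by
  refine lintegral_congr fun tim => ?_
  congr 1
  rw [lintegral_lintegral_swap (by fun_prop)]
  refine lintegral_congr fun ann => lintegral_congr fun cre => ?_
  congr 1
  simp only [Weights.adj]
  rw [inv_pow_eq η.upMinus_pos, inv_pow_eq η.loPlus_pos, div_eq_mul_inv, div_eq_mul_inv, inv_inv,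
    mul_comm]

variable [CompleteSpace H]

/-- The bound at `ϑ` is that of `B` at `ϑ*`. The exchange of `ϑ₀⁻` and `ϑ₊⁰` is compensated by
exchanging the two arguments of `E`; the ratio of the gauge weights is unchanged, since both are
inverted and exchanged. -/
theorem Good.adj {t : ℝ} {B : OpFun S H} {η : Weights} {E : Ch S × Ch S × Ch S → ℝ≥0∞}
    (hG : Good t (Table.empty S) B η E) (hB : MapsFields t (1 / η.loMinus) B.adj) :
    Good t (Table.empty S) B.adj η.adj (fun p => E (p.2.1, p.1, p.2.2)) where
  measurable := hG.measurable.fun_comp (by fun_prop)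
  field := by
    obtain ⟨N, hN, hN2⟩ := hB
    intro v hv hv2
    refine exists_field_of_maps hN2 ?_ hv hv2
    filter_upwards [hN] with ϑ hϑ
    rwa [empty_table_union]
  bound := by
    filter_upwards [ae_tabT_star S hG.bound] with ϑ hϑ
    rw [empty_table_union] at hϑ ⊢
    have h1 : opNorm η.adj.upPlus η.adj.loMinus (B.adj ϑ) ≤ opNorm η.upPlus η.loMinus (B ϑ.star) :=
      opNorm_formalAdjoint_le η.upPlus_pos η.loMinus_pos
    refine ((pow_le_pow_left₀ zero_le h1 2).trans hϑ).trans_eq ?_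
    congr 1
    simp only [Weights.adj]
    rw [inv_pow_eq η.upZero_pos, inv_pow_eq η.loZero_pos, div_eq_mul_inv, div_eq_mul_inv, inv_inv,
      mul_comm]
  finite := by rw [bnd_adj t η hG.measurable]; exact hG.finite

/-! ### The pairing with the multiple integral -/

section
variable {t : ℝ} {κ : Table S} {B : OpFun S H} {η : Weights} {E : Ch S × Ch S × Ch S → ℝ≥0∞}
  {ξp ξm : ℝ}

omit [CompleteSpace H] in
theorem Good.opNorm_lt_top (hG : Good t κ B η E) :
    ∀ᵐ ϑ ∂(tabT S t), opNorm η.upPlus η.loMinus (B (κ.union ϑ)) < ⊤ := by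
  have hE := hG.measurable
  have h1 : ∀ᵐ ϑ ∂(tabT S t), ENNReal.ofReal η.loPlus ^ ϑ.cre.len / ENNReal.ofReal η.upMinus ^ ϑ.ann.len *
      E (ϑ.ann, ϑ.cre, ϑ.tim) < ⊤ := by
    refine ae_tabT_of_iterated (measurableSet_lt (by fun_prop) measurable_const) ?_
    filter_upwards [ae_lt_top (by fun_prop) hG.finite.ne] with tim h1
    rw [ENNReal.rpow_lt_top_iff_of_pos (by norm_num)] at h1
    filter_upwards [ae_lt_top (by fun_prop) h1.ne] with ann h2
    filter_upwards [ae_lt_top (by fun_prop) h2.ne] with cre h3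
    exact Filter.Eventually.of_forall fun gau => h3
  filter_upwards [h1, hG.bound] with ϑ h1 h2
  have h3 : E (ϑ.ann, ϑ.cre, ϑ.tim) ≠ ⊤ := by
    intro hc
    rw [hc, ENNReal.mul_top] at h1
    · exact lt_irrefl _ h1
    · refine (ENNReal.div_pos (pow_ne_zero _ ?_) (by finiteness)).ne'
      simpa using η.loPlus_pos
  have h4 : opNorm η.upPlus η.loMinus (B (κ.union ϑ)) ^ 2 < ⊤ := by
    refine h2.trans_lt (ENNReal.mul_lt_top (ENNReal.div_lt_top (by finiteness) ?_) h3.lt_top)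
    exact pow_ne_zero _ (by simpa using η.loZero_pos)
  exact (ENNReal.pow_lt_top_iff.1 h4).resolve_right (by norm_num)

/-- The pairing of a function with the integrand of a multiple integral. -/
def pairFun (κ : Table S) (c : Triple S → H) (f : Table S → Triple S → H)
    (x : Table S × Triple S) : ℂ :=
  inner ℂ (c (pull S κ.cre κ.gau x.2)) (Function.uncurry f x)

omit [CompleteSpace H] in
theorem stronglyMeasurable_pairFun {c : Triple S → H} (hc : StronglyMeasurable c)
    {f : Table S → Triple S → H} (hf : StronglyMeasurable (Function.uncurry f)) :
    StronglyMeasurable (pairFun κ c f) :=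
  (hc.comp_measurable (by fun_prop : Measurable fun x : Table S × Triple S =>
    pull S κ.cre κ.gau x.2)).inner hf

omit [CompleteSpace H] in
-- The basic estimate is stated with the norms inside the integral. It therefore gives absolute
-- integrability over tables and arguments jointly, which justifies Fubini's theorem for the
-- pairing.
theorem Good.integrable_pairFun (hG : Good t κ B η E) (hA : Admissible η ξp ξm) {v : Triple S → H}
    (hv : StronglyMeasurable v) (h : gnorm S ξp κ.ann κ.gau v < ⊤)
    {f : Table S → Triple S → H} (hf : StronglyMeasurable (Function.uncurry f))
    (hr : ∀ᵐ ϑ ∂(tabT S t), Represents (B (κ.union ϑ)) (deriv κ v) (f ϑ))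
    {c : Triple S → H} (hc : StronglyMeasurable c) (hc2 : gnorm S (1 / ξm) κ.cre κ.gau c < ⊤) :
    Integrable (pairFun κ c f) (thetaM S κ.cre κ.gau t) := by
  refine ⟨(stronglyMeasurable_pairFun hc hf).aestronglyMeasurable, ?_⟩
  rw [HasFiniteIntegral, thetaM, Measure.lintegral_bind (partKerAt S t).measurable.aemeasurable
    (stronglyMeasurable_pairFun hc hf).enorm.aemeasurable]
  have hV := measurable_lintegral_partM_at S t hf.enorm
  have h1 : ∀ᵐ q ∂(vecM S κ.cre κ.gau), ∫⁻ x, ‖pairFun κ c f x‖ₑ ∂(partKerAt S t q) ≤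
      ‖c q‖ₑ * ∫⁻ x, ‖Function.uncurry f x‖ₑ ∂(partM S t q) := by
    filter_upwards [ae_partM_pull S t κ.cre κ.gau] with q hq
    rw [← lintegral_const_mul _ hf.enorm]
    refine lintegral_mono_ae ?_
    filter_upwards [hq] with x hx
    rw [pairFun, hx, ← enorm_norm (c q), ← enorm_norm (Function.uncurry f x), ← enorm_mul]
    exact enorm_le_iff_norm_le.2 (by
      rw [norm_mul, norm_norm, norm_norm]; exact norm_inner_le_norm _ _)
  refine (lintegral_mono_ae h1).trans_lt ?_
  refine (lintegral_mul_le_weighted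
    (v := fun z => ENNReal.ofReal (1 / ξm) ^ z.2.2.len)
    (w := fun z => ENNReal.ofReal ξm ^ z.2.2.len) hc.enorm.aemeasurable hV.aemeasurable (by fun_prop)
      (by fun_prop) fun z => ofReal_pow_mul_inv hA.pos _).trans_lt ?_
  exact ENNReal.mul_lt_top hc2 ((hG.wsq_le hA hv h hf hr).trans_lt (ENNReal.mul_lt_top hG.finite h))

theorem Good.integral_inner_multFun (hG : Good t κ B η E) (hA : Admissible η ξp ξm)
    {v : Triple S → H} (hv : StronglyMeasurable v) (h : gnorm S ξp κ.ann κ.gau v < ⊤)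
    {f : Table S → Triple S → H} (hf : StronglyMeasurable (Function.uncurry f))
    (hr : ∀ᵐ ϑ ∂(tabT S t), Represents (B (κ.union ϑ)) (deriv κ v) (f ϑ))
    {c : Triple S → H} (hc : StronglyMeasurable c) (hc2 : gnorm S (1 / ξm) κ.cre κ.gau c < ⊤) :
    ∫ q, inner ℂ (c q) (multFun t f q) ∂(vecM S κ.cre κ.gau) =
      ∫ x, pairFun κ c f x ∂(thetaM S κ.cre κ.gau t) := by
  rw [thetaM, integral_bind_kernel (hG.integrable_pairFun hA hv h hf hr hc hc2)]
  refine integral_congr_ae ?_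
  filter_upwards [ae_partM_pull S t κ.cre κ.gau, hG.integrable hA hv h hf hr] with q hq hi
  rw [multFun, ← integral_inner hi, partKerAt_apply]
  refine integral_congr_ae ?_
  filter_upwards [hq] with x hx
  rw [pairFun, hx]

theorem integral_thetaM {κc κg : Ch S} {g : Table S × Triple S → ℂ} (hgm : StronglyMeasurable g)
    (hg : Integrable g (thetaM S κc κg t)) :
    ∫ x, g x ∂(thetaM S κc κg t) =
      ∫ ϑ, ∫ z, g (ϑ, z) ∂(vecM S (κc.union ϑ.cre) (κg.union ϑ.gau)) ∂(tabT S t) := by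
  rw [thetaM_eq] at hg ⊢
  rw [integral_bind_kernel hg]
  refine integral_congr_ae (Filter.Eventually.of_forall fun ϑ => ?_)
  simp only [vecKer_apply]
  rw [integral_map measurable_prodMk_left.aemeasurable hgm.aestronglyMeasurable]

end

variable {X : Type*} [MeasurableSpace X] {S : NoiseSpace X} [MeasurableSingletonClass X]
variable {H : Type*} [NormedAddCommGroup H] [InnerProductSpace ℂ H] [CompleteSpace H]

/-! ### The formal adjoint of the multiple integral -/

section
variable {t : ℝ} {κ : Table S} {B : OpFun S H} {η : Weights} {E : Ch S × Ch S × Ch S → ℝ≥0∞}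
  {ξp ξm : ℝ}

omit [MeasurableSingletonClass X] in
/-- The adjoint, for functions. -/
theorem Represents.inner_adjoint [MeasurableSingletonClass X] {σ ρ σ' ρ' : Ch S}
    {T : L0 S H σ ρ →ₗ.[ℂ] L0 S H σ' ρ'}
    {ηp ηm : ℝ} (hp : 0 < ηp) (hm : 0 < ηm) (hT : opNorm ηp ηm T ≠ ⊤) {a f c g : Triple S → H}
    (h : Represents T a f) (h' : Represents (formalAdjoint T) c g) (ha : gnorm S ηp σ ρ a < ⊤)
    (hc : gnorm S (1 / ηm) σ' ρ' c < ⊤) :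
    ∫ z, (inner ℂ (c z) (f z) : ℂ) ∂(vecM S σ' ρ') =
      (starRingEnd ℂ) (∫ z, (inner ℂ (a z) (g z) : ℂ) ∂(vecM S σ ρ)) := by
  obtain ⟨p, hp', hp1, hp2⟩ := h
  obtain ⟨q, hq, hq1, hq2⟩ := h'
  have h6 := (formalAdjoint_of_mem_graph hp hm hT hq
    ((gnorm_congr hq1).trans_lt hc)).2 p hp' ((gnorm_congr hp1).trans_lt ha)
  rw [← pairing_congr hq1 hp2, ← pairing_congr hp1 hq2, ← pairing_symm]
  exact h6.2.2

/-- The pairing with a multiple integral, as an integral over tables. -/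
theorem Good.pairing_multFun (hG : Good t κ B η E) (hA : Admissible η ξp ξm)
    {v : Triple S → H} (hv : StronglyMeasurable v) (h : gnorm S ξp κ.ann κ.gau v < ⊤)
    {f : Table S → Triple S → H} (hf : StronglyMeasurable (Function.uncurry f))
    (hr : ∀ᵐ ϑ ∂(tabT S t), Represents (B (κ.union ϑ)) (deriv κ v) (f ϑ))
    {c : Triple S → H} (hc : StronglyMeasurable c) (hc2 : gnorm S (1 / ξm) κ.cre κ.gau c < ⊤) :
    ∫ q, (inner ℂ (c q) (multFun t f q) : ℂ) ∂(vecM S κ.cre κ.gau) =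
      ∫ ϑ, ∫ z, (inner ℂ (c (pull S κ.cre κ.gau z)) (f ϑ z) : ℂ)
        ∂(vecM S (κ.cre.union ϑ.cre) (κ.gau.union ϑ.gau)) ∂(tabT S t) := by
  rw [hG.integral_inner_multFun hA hv h hf hr hc hc2, integral_thetaM (stronglyMeasurable_pairFun hc hf)
    (hG.integrable_pairFun hA hv h hf hr hc hc2)]
  rfl

/-- Both pairings are written as integrals over tables by `Good.pairing_multFun`. For each table the
inner integrals are related by the adjoint of `B(ϑ)`, where `ϑ` on one side corresponds to `ϑ*` on
the other. -/
theorem Good.pairing_qsInt (hG : Good t (Table.empty S) B η E)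
    (hB : MapsFields t (1 / η.loMinus) B.adj) (hA : Admissible η ξp ξm)
    {a u c d : L0 S H (Chain.empty S.time) (Chain.empty S.time)}
    (hau : ActsAs t (Table.empty S) B a u) (hcd : ActsAs t (Table.empty S) B.adj c d)
    (ha : InG ξp a) (hc : InG (1 / ξm) c) :
    Paired c u ∧ Paired d a ∧ pairing c u = pairing d a := by
  have hG' := hG.adj hB
  have hA' := hA.adj
  have hu := hG.gnorm_le hA ha hau
  have hd := hG'.gnorm_le hA' hc hcd
  have ha2 : InG (1 / (1 / ξp)) a := by rwa [one_div_one_div]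
  have hu2 : InG ξm u := hu.trans_lt (ENNReal.mul_lt_top hG.finite ha)
  have hd2 : InG (1 / ξp) d := hd.trans_lt (ENNReal.mul_lt_top hG'.finite hc)
  refine ⟨hc.paired hA.pos hu2, hd2.paired hA.up_pos ha, ?_⟩
  obtain ⟨f, hf, hr, hu⟩ := hau.exists_multFun
  obtain ⟨g, hg, hs, hd⟩ := hcd.exists_multFun
  rw [pairing_symm a d, pairing_congr Filter.EventuallyEq.rfl hu, pairing_congr Filter.EventuallyEq.rfl hd,
    hG.pairing_multFun hA a.stronglyMeasurable ha hf hr c.stronglyMeasurable hc,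
    hG'.pairing_multFun hA' c.stronglyMeasurable hc hg hs a.stronglyMeasurable ha2]
  have hm : Measurable (Table.star : Table S → Table S) := by fun_prop
  let st : Table S ≃ᵐ Table S :=
    { toFun := Table.star, invFun := Table.star, left_inv := fun _ => rfl, right_inv := fun _ => rfl
      measurable_toFun := hm
      measurable_invFun := hm }
  have hst : MeasurableEmbedding (Table.star : Table S → Table S) := st.measurableEmbedding
  rw [← integral_conj]
  let J : Table S → ℂ := fun ϑ => ∫ z, (inner ℂ (a (pull S (Chain.empty S.time) (Chain.empty S.time) z))
    (g ϑ z) : ℂ) ∂(vecM S ((Chain.empty S.time).union ϑ.cre) ((Chain.empty S.time).union ϑ.gau))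
  -- The table in the pairing with `Λ(B*)` is replaced by its adjoint, which preserves the measure;
  -- then the integrands can be compared table by table.
  refine Eq.trans ?_ ((measurePreserving_star S t).integral_comp hst
    (fun ϑ => (starRingEnd ℂ) (J ϑ)))
  refine integral_congr_ae ?_
  have hs' := ae_tabT_star S hs
  have ha' := ae_gnorm_deriv_lt_top (κ := Table.empty S) (t := t) hA.up a.stronglyMeasurable ha
  have hc' := ae_tabT_star S
    (ae_gnorm_deriv_lt_top (κ := Table.empty S) (t := t) hA'.up c.stronglyMeasurable hc)
  have hT := hG.opNorm_lt_top
  filter_upwards [hr, hs', hT, ha', hc'] with ϑ h1 h2 h3 h4 h5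
  exact Represents.inner_adjoint (T := B ((Table.empty S).union ϑ)) η.upPlus_pos η.loMinus_pos
    h3.ne h1 h2 h4 h5

end

section
variable {t ξp ξm : ℝ} {B : OpFun S H} {η : Weights}

theorem QSIntegrableUpTo.pairing_qsInt (hB : QSIntegrableUpTo t η B) (hA : Admissible η ξp ξm) :
    ∀ p ∈ (qsInt t B).graph, ∀ q ∈ (qsInt t B.adj).graph, InG ξp p.1 → InG (1 / ξm) q.1 →
      Paired q.1 p.2 ∧ Paired q.2 p.1 ∧ pairing q.1 p.2 = pairing q.2 p.1 := by
  obtain ⟨E, hG, -⟩ := hB.exists_good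
  exact fun p hp q hq h1 h2 =>
    hG.pairing_qsInt hB.2.1 hA (mem_graph_multInt.1 hp) (mem_graph_multInt.1 hq) h1 h2

theorem QSIntegrableUpTo.exists_qsInt (hB : QSIntegrableUpTo t η B) (hA : Admissible η ξp ξm)
    {a : L0 S H (Chain.empty S.time) (Chain.empty S.time)} (ha : InG ξp a) :
    ∃ u, (a, u) ∈ (qsInt t B).graph ∧ ActsAs t (Table.empty S) B a u := by
  obtain ⟨E, hG, -⟩ := hB.exists_good
  obtain ⟨u, hu⟩ := hG.exists_actsAs hA ha
  exact ⟨u, mem_graph_multInt.2 hu, hu⟩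

theorem QSIntegrableUpTo.opNorm_qsInt_le (hB : QSIntegrableUpTo t η B) (hA : Admissible η ξp ξm) :
    opNorm ξp ξm (qsInt t B) ≤ qsNorm t η B := by
  obtain ⟨E, hG, h⟩ := hB.exists_good
  exact (hG.opNorm_le hA).trans_eq h

theorem QSIntegrableUpTo.exists_qsInt_adj (hB : QSIntegrableUpTo t η B) (hA : Admissible η ξp ξm)
    {c : L0 S H (Chain.empty S.time) (Chain.empty S.time)} (hc : InG (1 / ξm) c) :
    ∃ d, (c, d) ∈ (qsInt t B.adj).graph := by
  obtain ⟨E, hG, -⟩ := hB.exists_good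
  obtain ⟨d, hd⟩ := (hG.adj hB.2.1).exists_actsAs hA.adj hc
  exact ⟨d, mem_graph_multInt.2 hd⟩

theorem QSIntegrableUpTo.opNorm_qsInt_adj_ne_top (hB : QSIntegrableUpTo t η B)
    (hA : Admissible η ξp ξm) : opNorm (1 / ξm) (1 / ξp) (qsInt t B.adj) ≠ ⊤ := by
  obtain ⟨E, hG, -⟩ := hB.exists_good
  have hG' := hG.adj hB.2.1
  exact ((hG'.opNorm_le hA.adj).trans_lt hG'.finite).ne

theorem QSIntegrableUpTo.agreeOn_adj (hB : QSIntegrableUpTo t η B) (hA : Admissible η ξp ξm) :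
    AgreeOn (1 / ξm) (formalAdjoint (qsInt t B)) (qsInt t B.adj) := by
  intro c hc
  obtain ⟨d, hd⟩ := hB.exists_qsInt_adj hA hc
  refine ⟨d, (formalAdjoint_graph hA.up_pos
    ((hB.opNorm_qsInt_le hA).trans_lt hB.2.2.2).ne).2 fun p hp hp2 => ?_, hd⟩
  exact hB.pairing_qsInt hA p hp (c, d) hd (hp2 _ hA.up_pos) hc

/-- Each of the two operators is adjoint to the other on the full weighted spaces, so
`opNorm_le_of_pairing` applies in both directions; inverting the parameters twice restores them. -/
theorem QSIntegrableUpTo.opNorm_adj (hB : QSIntegrableUpTo t η B) (hA : Admissible η ξp ξm) :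
    opNorm (1 / ξm) (1 / ξp) (qsInt t B.adj) = opNorm ξp ξm (qsInt t B) := by
  refine le_antisymm ?_ ?_
  · exact opNorm_le_of_pairing hA.up_pos hA.pos ((hB.opNorm_qsInt_le hA).trans_lt hB.2.2.2).ne
      (fun c hc => hB.exists_qsInt_adj hA hc) (hB.pairing_qsInt hA)
  · have h := opNorm_le_of_pairing (T := qsInt t B.adj) (T' := qsInt t B)
      (one_div_pos.2 hA.pos) (one_div_pos.2 hA.up_pos) (hB.opNorm_qsInt_adj_ne_top hA)
      (fun a ha => ?_) (fun q hq p hp h1 h2 => ?_)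
    · rwa [one_div_one_div, one_div_one_div] at h
    · rw [one_div_one_div] at ha
      obtain ⟨u, hu, -⟩ := hB.exists_qsInt hA ha
      exact ⟨u, hu⟩
    · rw [one_div_one_div] at h2
      obtain ⟨h3, h4, h5⟩ := hB.pairing_qsInt hA p hp q hq h2 h1
      refine ⟨paired_symm h4, paired_symm h3, ?_⟩
      rw [pairing_symm q.2 p.1, pairing_symm q.1 p.2, h5]

end

variable {X : Type*} [MeasurableSpace X] {S : NoiseSpace X}
variable {H : Type*} [NormedAddCommGroup H] [InnerProductSpace ℂ H]

/-! ### The last point of a chain -/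

theorem chT_mono {s t : ℝ} (h : s ≤ t) : chT S s ≤ chT S t :=
  Measure.restrict_mono (Chain.below_mono h) le_rfl

theorem tabT_mono {s t : ℝ} (h : s ≤ t) : tabT S s ≤ tabT S t := by
  have hs : Table.below S s ⊆ Table.below S t := fun _ hϑ => ⟨Chain.below_mono h hϑ.1,
    Chain.below_mono h hϑ.2.1, Chain.below_mono h hϑ.2.2.1, Chain.below_mono h hϑ.2.2.2⟩
  exact Measure.restrict_mono hs le_rfl

theorem measurable_lintegral_chT {Ω : Type*} [MeasurableSpace Ω] {F : Ω × Ch S → ℝ≥0∞}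
    (hF : Measurable F) {s : Ω → ℝ} (hs : Measurable s) :
    Measurable fun ω => ∫⁻ τ, F (ω, τ) ∂(chT S (s ω)) := by
  have hm : MeasurableSet {p : Ω × Ch S | p.2 ∈ Chain.below S.time (s p.1)} :=
    (Chain.measurableSet_below_prod S.measurable_time).preimage
      ((hs.comp measurable_fst).prodMk measurable_snd)
  have h : (fun ω => ∫⁻ τ, F (ω, τ) ∂(chT S (s ω))) = fun ω => ∫⁻ τ,
      {p : Ω × Ch S | p.2 ∈ Chain.below S.time (s p.1)}.indicator F (ω, τ) ∂(chM S) := by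
    funext ω
    exact (lintegral_indicator (measurableSet_below_ch S (s ω)) _).symm
  rw [h]
  exact (hF.indicator hm).lintegral_prod_right'

theorem lintegral_chT_rec (t : ℝ) {F : Ch S → ℝ≥0∞} (hF : Measurable F) :
    ∫⁻ κ, F κ ∂(chT S t) = F (Chain.empty S.time) +
      ∫⁻ x in S.before t, ∫⁻ κ, F ((Chain.single S.time x).union κ) ∂(chT S (S.time x)) ∂S.μ := by
  have : SFinite (Chain.measure S.time S.μ) := inferInstanceAs (SFinite (chM S))
  let g := Chain.growth S.measurable_time
  have hm : MeasurableSet {p : X × Ch S | S.time p.1 < t} :=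
    measurableSet_lt (S.measurable_time.comp measurable_fst) measurable_const
  have hF' : Measurable fun p : X × Ch S => F ((Chain.single S.time p.1).union p.2) := by fun_prop
  have h := (Chain.growth_rec S.measurable_time S.μ).restrict S.measurable_time hF t
  rw [Finset.univ_unique, Finset.sum_singleton] at h
  refine h.trans (congrArg (F (Chain.empty S.time) + ·) ?_)
  refine (g.setLIntegral_before S.measurable_time (F := {p : X × Ch S | S.time p.1 < t}.indicator
      fun p => F ((Chain.single S.time p.1).union p.2)) (hF'.indicator hm)).trans ?_
  rw [← lintegral_indicator (measurableSet_before S t)]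
  refine lintegral_congr fun x => ?_
  by_cases hx : S.time x < t
  · rw [indicator_of_mem (by exact hx)]
    refine lintegral_congr fun ϑ => ?_
    rw [indicator_of_mem (by exact hx)]
  · rw [indicator_of_notMem (by exact hx)]
    refine (lintegral_congr fun ϑ => ?_).trans lintegral_zero
    rw [indicator_of_notMem (by exact hx)]

theorem lintegral_single_union_le (t : ℝ) {F : Ch S → ℝ≥0∞} (hF : Measurable F) :
    ∫⁻ x in S.before t, ∫⁻ κ, F ((Chain.single S.time x).union κ) ∂(chT S (S.time x)) ∂S.μ ≤
      ∫⁻ κ, F κ ∂(chT S t) := by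
  rw [lintegral_chT_rec t hF]
  exact le_add_self

theorem lintegral_elem_union_le (t : ℝ) (i : Pos) {F : Table S → ℝ≥0∞} (hF : Measurable F) :
    ∫⁻ x in S.before t, ∫⁻ ϑ, F ((Table.elem S i x).union ϑ) ∂(tabT S (S.time x)) ∂S.μ ≤
      ∫⁻ ϑ, F ϑ ∂(tabT S t) := by
  rw [lintegral_tabT_rec S t hF]
  cases i
  · exact le_self_add.trans le_add_self
  · exact (le_self_add.trans le_add_self).trans le_add_self
  · exact ((le_self_add.trans le_add_self).trans le_add_self).trans le_add_self
  · exact ((le_add_self.trans le_add_self).trans le_add_self).trans le_add_self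

theorem measurable_lintegral_tabT {Ω : Type*} [MeasurableSpace Ω] {F : Ω × Table S → ℝ≥0∞}
    (hF : Measurable F) {s : Ω → ℝ} (hs : Measurable s) :
    Measurable fun ω => ∫⁻ ϑ, F (ω, ϑ) ∂(tabT S (s ω)) := by
  have hb : ∀ {f : Ω × Table S → Ch S}, Measurable f →
      MeasurableSet {p : Ω × Table S | f p ∈ Chain.below S.time (s p.1)} := fun hf =>
    (Chain.measurableSet_below_prod S.measurable_time).preimage ((hs.comp measurable_fst).prodMk hf)
  have hm : MeasurableSet {p : Ω × Table S | p.2 ∈ Table.below S (s p.1)} :=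
    (hb (f := fun p => p.2.1) (by fun_prop)).inter ((hb (f := fun p => p.2.2.1) (by fun_prop)).inter
      ((hb (f := fun p => p.2.2.2.1) (by fun_prop)).inter
        (hb (f := fun p => p.2.2.2.2) (by fun_prop))))
  have h : (fun ω => ∫⁻ ϑ, F (ω, ϑ) ∂(tabT S (s ω))) = fun ω => ∫⁻ ϑ,
      {p : Ω × Table S | p.2 ∈ Table.below S (s p.1)}.indicator F (ω, ϑ) ∂(Table.measure S) := by
    funext ω
    exact (lintegral_indicator (measurableSet_below_table S (s ω)) _).symm
  rw [h]
  have : SFinite (Table.measure S) := inferInstanceAs (SFinite ((chM S).prod _))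
  exact (hF.indicator hm).lintegral_prod_right'

/-- By the recursion over the latest point a null set of tables has null sections for almost every
latest point. All properties assumed for almost every table pass to the derivatives in this way. -/
theorem ae_elem_union {t : ℝ} {p : Table S → Prop} (h : ∀ᵐ ϑ ∂(tabT S t), p ϑ) (i : Pos) :
    ∀ᵐ x ∂(S.μ.restrict (S.before t)), ∀ᵐ ϑ ∂(tabT S (S.time x)), p ((Table.elem S i x).union ϑ) := by
  obtain ⟨N, hN, hNm, hN0⟩ := exists_measurable_superset_of_null (ae_iff.1 h)
  have hm : Measurable (N.indicator (1 : Table S → ℝ≥0∞)) := measurable_one.indicator hNm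
  have h1 := lintegral_elem_union_le t i hm
  rw [lintegral_indicator_one hNm, hN0, nonpos_iff_eq_zero, lintegral_eq_zero_iff
    (measurable_lintegral_tabT (F := fun p : X × Table S =>
      N.indicator (1 : Table S → ℝ≥0∞) ((Table.elem S i p.1).union p.2)) (by fun_prop)
      S.measurable_time)] at h1
  filter_upwards [h1] with x hx
  simp only [Pi.zero_apply] at hx
  rw [lintegral_eq_zero_iff (by fun_prop)] at hx
  filter_upwards [hx] with ϑ hϑ
  by_contra hc
  have : (Table.elem S i x).union ϑ ∈ N := hN hc
  simp [this] at hϑ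

/-! ### The bound for a derivative -/

/-- The bound `E` after adding a point. -/
def pointBound (η : Weights) (E : Ch S × Ch S × Ch S → ℝ≥0∞) (i : Pos) (x : X)
    (p : Ch S × Ch S × Ch S) : ℝ≥0∞ :=
  ENNReal.ofReal η.upZero ^ (Table.elem S i x).gau.len /
    ENNReal.ofReal η.loZero ^ (Table.elem S i x).gau.len *
    E ((Table.elem S i x).ann.union p.1, (Table.elem S i x).cre.union p.2.1,
      (Table.elem S i x).tim.union p.2.2)

theorem measurable_pointBound (η : Weights) {E : Ch S × Ch S × Ch S → ℝ≥0∞} (hE : Measurable E)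
    (i : Pos) : Measurable fun p : X × Ch S × Ch S × Ch S => pointBound η E i p.1 p.2 := by
  unfold pointBound; fun_prop

theorem len_elem_gau_union {i : Pos} {x : X} {σ : Ch S} (h : σ ∈ Chain.below S.time (S.time x)) :
    ((Table.elem S i x).gau.union σ).len = (Table.elem S i x).gau.len + σ.len := by
  cases i
  case gau =>
    change ((Chain.single S.time x).union σ).len = 1 + σ.len
    rw [Chain.len_single_union h, add_comm]
  all_goals
    change ((Chain.empty S.time).union σ).len = 0 + σ.len
    rw [Chain.empty_union, zero_add]

/-- Only a gauge point changes the number of points of `ϑ₀⁰`; the prefactor in `pointBound` accounts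
for its weights. -/
theorem bound_elem {t : ℝ} {B : OpFun S H} {η : Weights} {E : Ch S × Ch S × Ch S → ℝ≥0∞}
    (h : ∀ᵐ ϑ ∂(tabT S t), opNorm η.upPlus η.loMinus (B ϑ) ^ 2 ≤
      ENNReal.ofReal η.upZero ^ ϑ.gau.len / ENNReal.ofReal η.loZero ^ ϑ.gau.len *
        E (ϑ.ann, ϑ.cre, ϑ.tim)) (i : Pos) :
    ∀ᵐ x ∂(S.μ.restrict (S.before t)), ∀ᵐ ϑ ∂(tabT S (S.time x)),
      opNorm η.upPlus η.loMinus (B ((Table.elem S i x).union ϑ)) ^ 2 ≤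
      ENNReal.ofReal η.upZero ^ ϑ.gau.len / ENNReal.ofReal η.loZero ^ ϑ.gau.len *
        pointBound η E i x (ϑ.ann, ϑ.cre, ϑ.tim) := by
  filter_upwards [ae_elem_union h i] with x hx
  filter_upwards [hx, ae_restrict_mem (measurableSet_below_table S (S.time x))] with ϑ h1 h2
  refine h1.trans_eq ?_
  rw [pointBound, ← mul_assoc]
  congr 1
  change ENNReal.ofReal η.upZero ^ ((Table.elem S i x).gau.union ϑ.gau).len /
    ENNReal.ofReal η.loZero ^ ((Table.elem S i x).gau.union ϑ.gau).len = _
  rw [len_elem_gau_union h2.2.1, pow_add, pow_add, div_eq_mul_inv, div_eq_mul_inv, div_eq_mul_inv,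
    ← inv_pow_eq η.loZero_pos, ← inv_pow_eq η.loZero_pos, ENNReal.mul_inv (by simp) (by simp),
    ← inv_pow_eq η.loZero_pos, ← inv_pow_eq η.loZero_pos]
  ring

/-- The factor which compares the weights before and after adding a point. -/
def pointFactor (η : Weights) : Pos → ℝ≥0∞
  | .ann => ENNReal.ofReal η.upMinus
  | .gau => ENNReal.ofReal η.upZero / ENNReal.ofReal η.loZero
  | .cre => (ENNReal.ofReal η.loPlus)⁻¹
  | .tim => 1

theorem pointFactor_lt_top (η : Weights) (i : Pos) : pointFactor η i < ⊤ := by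
  cases i
  · exact ENNReal.ofReal_lt_top
  · exact ENNReal.div_lt_top (by finiteness) (by simpa using η.loZero_pos)
  · exact ENNReal.inv_lt_top.2 (by simpa using η.loPlus_pos)
  · exact ENNReal.one_lt_top

/-- The integrand of the norm. -/
def wbnd (η : Weights) (E : Ch S × Ch S × Ch S → ℝ≥0∞) (p : Ch S × Ch S × Ch S) : ℝ≥0∞ :=
  ENNReal.ofReal η.loPlus ^ p.2.1.len / ENNReal.ofReal η.upMinus ^ p.1.len * E p

@[fun_prop]
theorem measurable_wbnd (η : Weights) {E : Ch S × Ch S × Ch S → ℝ≥0∞} (hE : Measurable E) :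
    Measurable (wbnd η E) := by
  unfold wbnd; fun_prop

theorem wbnd_pointBound (η : Weights) (E : Ch S × Ch S × Ch S → ℝ≥0∞) (i : Pos) (x : X)
    {p : Ch S × Ch S × Ch S} (h1 : p.1 ∈ Chain.below S.time (S.time x))
    (h2 : p.2.1 ∈ Chain.below S.time (S.time x)) :
    wbnd η (pointBound η E i x) p = pointFactor η i * wbnd η E
      ((Table.elem S i x).ann.union p.1, (Table.elem S i x).cre.union p.2.1,
      (Table.elem S i x).tim.union p.2.2) := by
  obtain ⟨ann, cre, tim⟩ := p
  simp only [wbnd, pointBound]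
  rw [← mul_assoc, ← mul_assoc]
  congr 1
  have hu0 : ENNReal.ofReal η.upMinus ≠ 0 := by simpa using η.upMinus_pos
  have hl0 : ENNReal.ofReal η.loPlus ≠ 0 := by simpa using η.loPlus_pos
  cases i
  · change _ * (ENNReal.ofReal η.upZero ^ 0 / ENNReal.ofReal η.loZero ^ 0) = ENNReal.ofReal η.upMinus *
      (ENNReal.ofReal η.loPlus ^ ((Chain.empty S.time).union cre).len /
        ENNReal.ofReal η.upMinus ^ ((Chain.single S.time x).union ann).len)
    rw [Chain.empty_union, Chain.len_single_union h1, pow_zero, pow_zero, div_one, mul_one, pow_succ,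
      div_eq_mul_inv, div_eq_mul_inv, ENNReal.mul_inv (by simp) (by simp)]
    rw [show ∀ a b c d : ℝ≥0∞, a * (b * (c * d)) = (a * d) * (b * c) from fun a b c d => by ring,
      ENNReal.mul_inv_cancel hu0 ENNReal.ofReal_ne_top, one_mul]
  · change _ * (ENNReal.ofReal η.upZero ^ 1 / ENNReal.ofReal η.loZero ^ 1) =
      (ENNReal.ofReal η.upZero / ENNReal.ofReal η.loZero) *
      (ENNReal.ofReal η.loPlus ^ ((Chain.empty S.time).union cre).len /
        ENNReal.ofReal η.upMinus ^ ((Chain.empty S.time).union ann).len)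
    rw [Chain.empty_union, Chain.empty_union, pow_one, pow_one, mul_comm]
  · change _ * (ENNReal.ofReal η.upZero ^ 0 / ENNReal.ofReal η.loZero ^ 0) =
      (ENNReal.ofReal η.loPlus)⁻¹ *
      (ENNReal.ofReal η.loPlus ^ ((Chain.single S.time x).union cre).len /
        ENNReal.ofReal η.upMinus ^ ((Chain.empty S.time).union ann).len)
    rw [Chain.empty_union, Chain.len_single_union h2, pow_zero, pow_zero, div_one, mul_one, pow_succ,
      div_eq_mul_inv, div_eq_mul_inv]
    rw [show ∀ a b c d : ℝ≥0∞, a * (b * c * d) = (a * c) * (b * d) from fun a b c d => by ring,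
      ENNReal.inv_mul_cancel hl0 ENNReal.ofReal_ne_top, one_mul]
  · change _ * (ENNReal.ofReal η.upZero ^ 0 / ENNReal.ofReal η.loZero ^ 0) = 1 *
      (ENNReal.ofReal η.loPlus ^ ((Chain.empty S.time).union cre).len /
        ENNReal.ofReal η.upMinus ^ ((Chain.empty S.time).union ann).len)
    rw [Chain.empty_union, Chain.empty_union, pow_zero, pow_zero, div_one, mul_one, one_mul]

theorem bnd_pointBound (η : Weights) {E : Ch S × Ch S × Ch S → ℝ≥0∞} (hE : Measurable E) (i : Pos)
    (x : X) : bnd S (S.time x) η (pointBound η E i x) = pointFactor η i ^ (1 / 2 : ℝ) *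
      ∫⁻ tim, (∫⁻ ann, ∫⁻ cre, wbnd η E
      ((Table.elem S i x).ann.union ann, (Table.elem S i x).cre.union cre,
      (Table.elem S i x).tim.union tim) ∂(chT S (S.time x)) ∂(chT S (S.time x))) ^ (1 / 2 : ℝ)
        ∂(chT S (S.time x)) := by
  rw [bnd, ← lintegral_const_mul _ (by fun_prop)]
  refine lintegral_congr fun tim => ?_
  rw [← ENNReal.mul_rpow_of_nonneg _ _ (by norm_num), ← lintegral_const_mul _ (by fun_prop)]
  congr 1
  refine lintegral_congr_ae ?_
  filter_upwards [ae_restrict_mem (measurableSet_below_ch S (S.time x))] with ann h1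
  rw [← lintegral_const_mul _ (by fun_prop)]
  refine lintegral_congr_ae ?_
  filter_upwards [ae_restrict_mem (measurableSet_below_ch S (S.time x))] with cre h2
  exact wbnd_pointBound η E i x (p := (ann, cre, tim)) h1 h2

theorem measurable_bnd_pointBound (η : Weights) {E : Ch S × Ch S × Ch S → ℝ≥0∞} (hE : Measurable E)
    (i : Pos) : Measurable fun x => bnd S (S.time x) η (pointBound η E i x) := by
  have hP := measurable_pointBound η hE i
  unfold bnd
  refine measurable_lintegral_chT (F := fun p : X × Ch S => (∫⁻ ann, ∫⁻ cre,
    ENNReal.ofReal η.loPlus ^ cre.len / ENNReal.ofReal η.upMinus ^ ann.len *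
    pointBound η E i p.1 (ann, cre, p.2) ∂(chT S (S.time p.1)) ∂(chT S (S.time p.1))) ^ (1 / 2 : ℝ))
    (Measurable.pow_const ?_ _) S.measurable_time
  refine measurable_lintegral_chT (F := fun p : (X × Ch S) × Ch S => ∫⁻ cre,
    ENNReal.ofReal η.loPlus ^ cre.len / ENNReal.ofReal η.upMinus ^ p.2.len *
    pointBound η E i p.1.1 (p.2, cre, p.1.2) ∂(chT S (S.time p.1.1))) ?_
    (S.measurable_time.comp measurable_fst)
  refine measurable_lintegral_chT (F := fun p : ((X × Ch S) × Ch S) × Ch S =>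
    ENNReal.ofReal η.loPlus ^ p.2.len / ENNReal.ofReal η.upMinus ^ p.1.2.len *
    pointBound η E i p.1.1.1 (p.1.2, p.2, p.1.1.2)) ?_
    (S.measurable_time.comp (by fun_prop))
  have := hP.fun_comp (by fun_prop : Measurable fun p : ((X × Ch S) × Ch S) × Ch S =>
    (p.1.1.1, p.1.2, p.2, p.1.1.2))
  fun_prop

/-- Minkowski's integral inequality in `L²`: the square of the inner integral is a double integral
over `y` and `z`, and Cauchy–Schwarz in `x` is applied for each pair. -/
theorem lintegral_sq_lintegral_le {α β : Type*} [MeasurableSpace α] [MeasurableSpace β]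
    {μ : Measure α} {ν : Measure β} [SFinite μ] [SFinite ν] {k : α × β → ℝ≥0∞} (hk : Measurable k) :
    ∫⁻ x, (∫⁻ y, k (x, y) ^ (1 / 2 : ℝ) ∂ν) ^ 2 ∂μ ≤ (∫⁻ y, (∫⁻ x, k (x, y) ∂μ) ^ (1 / 2 : ℝ) ∂ν) ^ 2 := by
  have e : ∀ x, (∫⁻ y, k (x, y) ^ (1 / 2 : ℝ) ∂ν) ^ 2 =
      ∫⁻ y, ∫⁻ z, k (x, y) ^ (1 / 2 : ℝ) * k (x, z) ^ (1 / 2 : ℝ) ∂ν ∂ν := by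
    intro x
    rw [sq, ← lintegral_mul_const _ (by fun_prop)]
    exact lintegral_congr fun y => (lintegral_const_mul _ (by fun_prop)).symm
  simp_rw [e]
  rw [lintegral_lintegral_swap (by fun_prop), sq, ← lintegral_mul_const _ (by fun_prop)]
  refine lintegral_mono fun y => ?_
  rw [lintegral_lintegral_swap (by fun_prop), ← lintegral_const_mul _ (by fun_prop)]
  refine lintegral_mono fun z => ?_
  have h := lintegral_mul_le_weighted (ν := μ) (f := fun x => k (x, y) ^ (1 / 2 : ℝ))
    (g := fun x => k (x, z) ^ (1 / 2 : ℝ)) (v := fun _ => 1) (w := fun _ => 1) (by fun_prop)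
    (by fun_prop) (by fun_prop) (by fun_prop) (fun _ => one_mul 1)
  simpa only [one_mul, rpow_half_sq] using h

theorem lintegral_sq_single_union_le (t : ℝ) {Ψ : Ch S × Ch S → ℝ≥0∞} (hΨ : Measurable Ψ) :
    ∫⁻ x in S.before t, (∫⁻ tim, (∫⁻ a, Ψ ((Chain.single S.time x).union a, tim) ∂(chT S (S.time x)))
      ^ (1 / 2 : ℝ) ∂(chT S t)) ^ 2 ∂S.μ ≤ (∫⁻ tim, (∫⁻ a, Ψ (a, tim) ∂(chT S t)) ^ (1 / 2 : ℝ)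
        ∂(chT S t)) ^ 2 := by
  have hk : Measurable fun p : X × Ch S =>
      ∫⁻ a, Ψ ((Chain.single S.time p.1).union a, p.2) ∂(chT S (S.time p.1)) :=
    measurable_lintegral_chT (F := fun q : (X × Ch S) × Ch S =>
      Ψ ((Chain.single S.time q.1.1).union q.2, q.1.2)) (by fun_prop)
      (S.measurable_time.comp measurable_fst)
  refine (lintegral_sq_lintegral_le hk).trans ?_
  gcongr with tim
  exact lintegral_single_union_le t (F := fun a => Ψ (a, tim)) (by fun_prop)

/-- The place of the new point in the norm of `B` decides the exponent. A time point belongs to the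
outer integral and gives `L¹`. An annihilation or creation point is integrated under the square root
and gives `L²`, by Minkowski's inequality. A gauge point is covered by the essential supremum and
gives `L^∞`. The other chains are restricted to times before `t(x)`, which only decreases the
integrals. -/
theorem eLpNorm_bnd_pointBound_lt_top {t : ℝ} (η : Weights) {E : Ch S × Ch S × Ch S → ℝ≥0∞}
    (hE : Measurable E) (h : bnd S t η E < ⊤) (i : Pos) :
    eLpNorm (fun x => bnd S (S.time x) η (pointBound η E i x)) i.exponent
      (S.μ.restrict (S.before t)) < ⊤ := by
  have hW : bnd S t η E = ∫⁻ tim, (∫⁻ ann, ∫⁻ cre, wbnd η E (ann, cre, tim) ∂(chT S t) ∂(chT S t))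
    ^ (1 / 2 : ℝ) ∂(chT S t) := rfl
  have hc : pointFactor η i ^ (1 / 2 : ℝ) < ⊤ :=
    ENNReal.rpow_lt_top_of_nonneg (by norm_num) (pointFactor_lt_top η i).ne
  have hle : ∀ᵐ x ∂(S.μ.restrict (S.before t)), chT S (S.time x) ≤ chT S t := by
    filter_upwards [ae_restrict_mem (measurableSet_before S t)] with x hx
    exact chT_mono (le_of_lt hx)
  have two : ∀ g : X → ℝ≥0∞, ∫⁻ x in S.before t, g x ^ 2 ∂S.μ < ⊤ →
      eLpNorm g 2 (S.μ.restrict (S.before t)) < ⊤ := by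
    intro g hg
    rw [eLpNorm_eq_lintegral_rpow_enorm_toReal (by norm_num) (by norm_num)]
    refine ENNReal.rpow_lt_top_of_nonneg (by norm_num) (ne_of_lt ?_)
    simpa using hg
  cases i
  · refine two _ ?_
    have h1 := lintegral_sq_single_union_le (S := S) t
      (Ψ := fun p => ∫⁻ cre, wbnd η E (p.1, cre, p.2) ∂(chT S t)) (by fun_prop)
    rw [← hW] at h1
    refine lt_of_le_of_lt (lintegral_mono_ae (hle.mono fun x hx => ?_))
      (lt_of_eq_of_lt (lintegral_const_mul' ((pointFactor η .ann ^ (1 / 2 : ℝ)) ^ 2) _ (by finiteness))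
        (ENNReal.mul_lt_top (by finiteness) (h1.trans_lt (by finiteness))))
    rw [bnd_pointBound η hE, mul_pow]
    gcongr with tim ann cre
    change wbnd η E (_, (Chain.empty S.time).union cre, (Chain.empty S.time).union tim) ≤ _
    rw [Chain.empty_union, Chain.empty_union]
    exact le_rfl
  · change eLpNorm _ ⊤ _ < _
    rw [eLpNorm_exponent_top]
    refine lt_of_le_of_lt (essSup_le_of_ae_le (pointFactor η .gau ^ (1 / 2 : ℝ) * bnd S t η E) ?_)
      (ENNReal.mul_lt_top hc h)
    refine hle.mono fun x hx => ?_
    simp only [enorm_eq_self]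
    rw [bnd_pointBound η hE, hW]
    gcongr with tim ann cre
    change wbnd η E ((Chain.empty S.time).union ann, (Chain.empty S.time).union cre,
      (Chain.empty S.time).union tim) ≤ _
    rw [Chain.empty_union, Chain.empty_union, Chain.empty_union]
  · refine two _ ?_
    have h1 := lintegral_sq_single_union_le (S := S) t
      (Ψ := fun p => ∫⁻ ann, wbnd η E (ann, p.1, p.2) ∂(chT S t)) (by fun_prop)
    have h2 : ∫⁻ tim, (∫⁻ a, ∫⁻ ann, wbnd η E (ann, a, tim) ∂(chT S t) ∂(chT S t)) ^ (1 / 2 : ℝ)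
        ∂(chT S t) = bnd S t η E := by
      rw [hW]
      refine lintegral_congr fun tim => ?_
      rw [lintegral_lintegral_swap (by fun_prop)]
    rw [h2] at h1
    refine lt_of_le_of_lt (lintegral_mono_ae (hle.mono fun x hx => ?_))
      (lt_of_eq_of_lt (lintegral_const_mul' ((pointFactor η .cre ^ (1 / 2 : ℝ)) ^ 2) _ (by finiteness))
        (ENNReal.mul_lt_top (by finiteness) (h1.trans_lt (by finiteness))))
    rw [bnd_pointBound η hE, mul_pow]
    have sw : ∀ tim, ∫⁻ ann, ∫⁻ cre, wbnd η E ((Table.elem S .cre x).ann.union ann,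
        (Table.elem S .cre x).cre.union cre, (Table.elem S .cre x).tim.union tim)
          ∂(chT S (S.time x)) ∂(chT S (S.time x)) =
        ∫⁻ cre, ∫⁻ ann, wbnd η E ((Table.elem S .cre x).ann.union ann,
        (Table.elem S .cre x).cre.union cre, (Table.elem S .cre x).tim.union tim)
          ∂(chT S (S.time x)) ∂(chT S (S.time x)) := fun tim =>
      lintegral_lintegral_swap (by fun_prop)
    simp only [sw]
    gcongr with tim cre ann
    change wbnd η E ((Chain.empty S.time).union ann, _, (Chain.empty S.time).union tim) ≤ _
    rw [Chain.empty_union, Chain.empty_union]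
    exact le_rfl
  · change eLpNorm _ 1 _ < _
    rw [eLpNorm_one_eq_lintegral_enorm]
    simp only [enorm_eq_self]
    have h1 := lintegral_single_union_le (S := S) t (F := fun tim =>
      (∫⁻ ann, ∫⁻ cre, wbnd η E (ann, cre, tim) ∂(chT S t) ∂(chT S t)) ^ (1 / 2 : ℝ)) (by fun_prop)
    rw [← hW] at h1
    refine (lintegral_mono_ae (hle.mono fun x hx => ?_)).trans_lt (h1.trans_lt h)
    rw [bnd_pointBound η hE]
    change (1 : ℝ≥0∞) ^ (1 / 2 : ℝ) * _ ≤ _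
    rw [ENNReal.one_rpow, one_mul]
    gcongr with tim ann cre
    change wbnd η E ((Chain.empty S.time).union ann, (Chain.empty S.time).union cre, _) ≤ _
    rw [Chain.empty_union, Chain.empty_union]
    exact le_rfl

/-! ### The derivatives form good fields -/

variable [MeasurableSingletonClass X] {t : ℝ} {B : OpFun S H} {η : Weights} {ξp ξm : ℝ}

omit [MeasurableSingletonClass X] in
theorem ae_bnd_pointBound_lt_top (η : Weights) {E : Ch S × Ch S × Ch S → ℝ≥0∞}
    (hE : Measurable E) (h : bnd S t η E < ⊤) (i : Pos) :
    ∀ᵐ x ∂(S.μ.restrict (S.before t)), bnd S (S.time x) η (pointBound η E i x) < ⊤ := by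
  have h4 := eLpNorm_bnd_pointBound_lt_top η hE h i
  have h5 := measurable_bnd_pointBound η hE i
  change ∀ᵐ x ∂(S.μ.restrict (S.before t)), (fun x => bnd S (S.time x) η (pointBound η E i x)) x < ⊤
  revert h4 h5
  generalize (fun x => bnd S (S.time x) η (pointBound η E i x)) = g
  intro h4 h5
  cases i
  case gau =>
    change eLpNorm _ ⊤ _ < _ at h4
    rw [eLpNorm_exponent_top] at h4
    filter_upwards [ae_le_eLpNormEssSup (f := g)] with x hx
    rw [enorm_eq_self] at hx
    exact hx.trans_lt h4
  case tim =>
    change eLpNorm _ 1 _ < _ at h4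
    rw [eLpNorm_one_eq_lintegral_enorm] at h4
    simp only [enorm_eq_self] at h4
    exact ae_lt_top h5 h4.ne
  all_goals
    change eLpNorm _ 2 _ < _ at h4
    rw [eLpNorm_eq_lintegral_rpow_enorm_toReal (by norm_num) (by norm_num),
      ENNReal.rpow_lt_top_iff_of_pos (by norm_num)] at h4
    simp only [enorm_eq_self, ENNReal.toReal_ofNat, ENNReal.rpow_two] at h4
    filter_upwards [ae_lt_top (by fun_prop) h4.ne] with x hx
    exact (ENNReal.pow_lt_top_iff.1 hx).resolve_right (by norm_num)

omit [MeasurableSingletonClass X] in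
/-- The data of a QS integrable function, with a bound for the essential supremum. -/
theorem QSIntegrableUpTo.exists_data (hB : QSIntegrableUpTo t η B) :
    ∃ E, Measurable E ∧ bnd S t η E < ⊤ ∧
      (∀ᵐ ϑ ∂(tabT S t), opNorm η.upPlus η.loMinus (B ϑ) ^ 2 ≤
        ENNReal.ofReal η.upZero ^ ϑ.gau.len / ENNReal.ofReal η.loZero ^ ϑ.gau.len *
          E (ϑ.ann, ϑ.cre, ϑ.tim)) ∧
      ∃ N : Set (Table S), (∀ᵐ ϑ ∂(tabT S t), ϑ ∈ N) ∧
        ∀ b : Table S → Triple S → H, StronglyMeasurable (Function.uncurry b) →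
          (∀ ϑ ∈ N, gnorm S η.upPlus ϑ.ann ϑ.gau (b ϑ) < ⊤) →
          ∃ c : Table S → Triple S → H, StronglyMeasurable (Function.uncurry c) ∧
            ∀ ϑ ∈ N, Represents (B ϑ) (b ϑ) (c ϑ) := by
  obtain ⟨E, hE, h1, h2⟩ := exists_bound t η hB.2.2.1
  exact ⟨E, hE, h2.trans_lt hB.2.2.2, h1, hB.1⟩

/-- A bound such that all derivatives and all restrictions in time are good fields. -/
theorem QSIntegrableUpTo.exists_good_elem (hB : QSIntegrableUpTo t η B) :
    ∃ E, Good t (Table.empty S) B η E ∧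
      (∀ i, ∀ᵐ x ∂(S.μ.restrict (S.before t)),
        Good (S.time x) (Table.elem S i x) B η (pointBound η E i x)) ∧
      ∀ s ≤ t, Good s (Table.empty S) B η E := by
  obtain ⟨E, hE, hfin, h1, N, hN, hN2⟩ := hB.exists_data
  have hs : ∀ s ≤ t, Good s (Table.empty S) B η E := by
    intro s hs
    have hN' := ae_mono (tabT_mono hs) hN
    have h1' := ae_mono (tabT_mono hs) h1
    have hN3 : ∀ᵐ ϑ ∂(tabT S s), (Table.empty S).union ϑ ∈ N := by
      filter_upwards [hN'] with ϑ hϑ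
      rwa [empty_table_union]
    refine { measurable := hE, field := ?_, bound := ?_, finite := ?_ }
    · intro v hv hv2
      exact exists_field_of_maps hN2 hN3 hv hv2
    · filter_upwards [h1'] with ϑ hϑ
      rwa [empty_table_union]
    · refine lt_of_le_of_lt ?_ hfin
      unfold bnd
      have := chT_mono (S := S) hs
      gcongr
  refine ⟨E, hs t le_rfl, fun i => ?_, hs⟩
  have h3 := ae_bnd_pointBound_lt_top η hE hfin i
  have h4 := ae_elem_union hN i
  have h5 := bound_elem h1 i
  refine (h3.and (h4.and h5)).mono ?_
  rintro x ⟨h3, h4, h5⟩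
  have hm : Measurable (pointBound η E i x) := by unfold pointBound; fun_prop
  have hf := fun v hv hv2 => exists_field_of_maps (κ := Table.elem S i x) (B := B) (η := η)
    (t := S.time x) hN2 h4 (v := v) hv hv2
  exact Good.mk hm hf h5 h3

theorem QSIntegrableUpTo.singleIntegrable (hB : QSIntegrableUpTo t η B) (hA : Admissible η ξp ξm) :
    SingleIntegrable t ξp ξm fun i x => multInt (S.time x) (Table.elem S i x) B := by
  obtain ⟨E, hG, h, -⟩ := hB.exists_good_elem
  intro i
  refine ⟨_, measurable_bnd_pointBound η hG.measurable i, ?_,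
    eLpNorm_bnd_pointBound_lt_top η hG.measurable hG.finite i⟩
  filter_upwards [h i] with x hx
  exact hx.opNorm_le hA

/-- A countable family of sets which determines the integral of a function. -/
theorem exists_determining_sets {α F : Type*} [MeasurableSpace α] [NormedAddCommGroup F]
    [NormedSpace ℝ F] [CompleteSpace F] {f : α → F} (hf : StronglyMeasurable f) :
    ∃ 𝒜 : Set (Set α), 𝒜.Countable ∧ (∀ A ∈ 𝒜, MeasurableSet A) ∧ ∀ m m' : Measure α,
      (∀ A ∈ 𝒜, m A = m' A) → Integrable f m → Integrable f m' → ∫ x, f x ∂m = ∫ x, f x ∂m' := by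
  borelize F
  have := hf.separableSpace_range_union_singleton (b := (0 : F))
  -- A strongly measurable function has separable range, so its integral is the limit of integrals
  -- of fixed simple functions. Countably many level sets determine all of these, whatever the
  -- measure.
  let φ := fun n => SimpleFunc.approxOn f hf.measurable (range f ∪ {0}) 0 (by simp) n
  refine ⟨⋃ n, (fun y => φ n ⁻¹' {y}) '' (φ n).range, ?_, ?_, ?_⟩
  · exact countable_iUnion fun n => ((φ n).range.countable_toSet).image _
  · intro A hA
    obtain ⟨n, y, -, rfl⟩ := mem_iUnion.1 hA
    exact (φ n).measurableSet_fiber y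
  · intro m m' h hm hm'
    refine tendsto_nhds_unique
      (tendsto_integral_approxOn_of_measurable_of_range_subset hf.measurable hm (range f ∪ {0}) le_rfl)
      ((tendsto_integral_approxOn_of_measurable_of_range_subset hf.measurable hm' (range f ∪ {0})
        le_rfl).congr fun n => ?_)
    rw [SimpleFunc.integral_eq, SimpleFunc.integral_eq]
    refine Finset.sum_congr rfl fun y hy => ?_
    have := h _ (mem_iUnion.2 ⟨n, y, hy, rfl⟩)
    rw [Measure.real, Measure.real, this]

/-! ### One point of a chain -/

namespace Chain
variable {Z : Type*} [MeasurableSpace Z] {τ : Z → ℝ}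

/-- A function of a point, as a function of a chain, which is supported by the one point chains. -/
def onPt {Ω : Type*} (Φ : Ω × Z → ℝ≥0∞) (p : Ω × Chain τ) : ℝ≥0∞ :=
  if h : p.2.len = 1 then Φ (p.1, p.2.pt ⟨0, h ▸ one_pos⟩) else 0

theorem measurable_onPt {Ω : Type*} [MeasurableSpace Ω] {Φ : Ω × Z → ℝ≥0∞} (hΦ : Measurable Φ) :
    Measurable (onPt Φ : Ω × Chain τ → ℝ≥0∞) := by
  refine measurable_prod_pieces fun n => ?_
  by_cases hn : n = 1
  · subst hn
    change Measurable fun p : Ω × Piece τ 1 => Φ (p.1, p.2.1 0)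
    exact hΦ.comp (measurable_fst.prodMk ((measurable_piece_apply 0).comp measurable_snd))
  · have : (fun p : Ω × Piece τ n => onPt Φ (p.1, ofPiece p.2)) = fun _ => 0 := by
      funext p
      exact dif_neg hn
    rw [this]
    exact measurable_const

theorem onPt_single {Ω : Type*} (Φ : Ω × Z → ℝ≥0∞) (ω : Ω) (z : Z) :
    onPt Φ (ω, single τ z) = Φ (ω, z) := dif_pos rfl

theorem onPt_of_len_ne {Ω : Type*} (Φ : Ω × Z → ℝ≥0∞) {ω : Ω} {κ : Chain τ} (h : κ.len ≠ 1) :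
    onPt Φ (ω, κ) = 0 := dif_neg h

theorem sub_singleton (w : Chain τ) (j : Fin w.len) : w.sub {j} = single τ (w.pt j) := by
  refine ext_support ?_
  rw [support_sub, support_single]
  simp

theorem single_union_sub (w : Chain τ) (j : Fin w.len) :
    (single τ (w.pt j)).union (w.sub {j}ᶜ) = w := by
  have h := sub_union_sub w (s := {j}) (s' := ∅) (Finset.disjoint_empty_right _)
  have h0 : w.sub ∅ = empty τ := eq_empty_of_len rfl
  rwa [h0, union_empty, Finset.union_empty, sub_singleton] at h

variable (hτ : Measurable τ)
include hτ

theorem lintegral_measure_of_len_zero (μ : Measure Z) [SigmaFinite μ] {F : Chain τ → ℝ≥0∞}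
    (hF : Measurable F) (h : ∀ κ, κ.len ≠ 0 → F κ = 0) : ∫⁻ κ, F κ ∂(measure τ μ) = F (empty τ) := by
  rw [lintegral_measure_rec hτ μ hF]
  have : ∀ z, ∫⁻ κ in below τ (τ z), F ((single τ z).union κ) ∂(measure τ μ) = 0 := by
    intro z
    refine (setLIntegral_congr_fun (measurableSet_below hτ _) fun κ hκ => ?_).trans lintegral_zero
    exact h _ (by rw [len_single_union hκ]; exact Nat.succ_ne_zero _)
  simp [this]

theorem lintegral_measure_of_len_one (μ : Measure Z) [SigmaFinite μ] {F : Chain τ → ℝ≥0∞}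
    (hF : Measurable F) (h : ∀ κ, κ.len ≠ 1 → F κ = 0) :
    ∫⁻ κ, F κ ∂(measure τ μ) = ∫⁻ z, F (single τ z) ∂μ := by
  rw [lintegral_measure_rec hτ μ hF, h (empty τ) Nat.zero_ne_one, zero_add]
  refine lintegral_congr fun z => ?_
  have hU : Measurable fun κ : Chain τ => F ((single τ z).union κ) :=
    hF.comp ((measurable_union hτ).comp (measurable_const.prodMk measurable_id))
  rw [← lintegral_indicator (measurableSet_below hτ _),
    lintegral_measure_of_len_zero hτ μ (hU.indicator (measurableSet_below hτ _)),
    indicator_of_mem (empty_mem_below _), union_empty]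
  intro κ hκ
  by_cases hb : κ ∈ below τ (τ z)
  · rw [indicator_of_mem hb]
    exact h _ (by rw [len_single_union hb]; omega)
  · exact indicator_of_notMem hb _

end Chain

variable {X : Type*} [MeasurableSpace X] (S : NoiseSpace X)

open Classical in
/-- The sum over the points of a marked chain in `X^t`. -/
def sumPts (t : ℝ) (Φ : MCh S × (X × ℕ) → ℝ≥0∞) (w : MCh S) : ℝ≥0∞ :=
  ∑ j : Fin w.len, if S.time (w.pt j).1 < t then Φ (w.sub {j}ᶜ, w.pt j) else 0

open Classical in
/-- A function of a point and a chain as a function of three chains. -/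
def onParts (Φ : MCh S × (X × ℕ) → ℝ≥0∞) (p : MCh S × MCh S × MCh S) : ℝ≥0∞ :=
  if p.2.1.len = 0 then Chain.onPt Φ (p.2.2, p.1) else 0

theorem measurable_onParts {Φ : MCh S × (X × ℕ) → ℝ≥0∞} (hΦ : Measurable Φ) :
    Measurable (onParts S Φ) := by
  refine Measurable.ite ?_ ?_ measurable_const
  · exact (Chain.measurableSet_len_eq 0).preimage (measurable_fst.comp measurable_snd)
  · exact (Chain.measurable_onPt hΦ).comp
      ((measurable_snd.comp measurable_snd).prodMk measurable_fst)

/-- A sum over single points is a sum over parts in which the first part is a singleton and the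
second is empty; the formulas for sums over parts become applicable. -/
theorem sumPts_eq (t : ℝ) (Φ : MCh S × (X × ℕ) → ℝ≥0∞) (w : MCh S) : sumPts S t Φ w =
    ∑ P ∈ parts S t w, onParts S Φ (w.sub P.1, w.sub P.2, w.sub (P.1 ∪ P.2)ᶜ) := by
  classical
  have e : sumPts S t Φ w = ∑ j ∈ Finset.univ.filter (fun j => S.time (w.pt j).1 < t),
      Φ (w.sub {j}ᶜ, w.pt j) := by
    rw [Finset.sum_filter, sumPts]
  rw [e]
  refine Finset.sum_of_injOn (fun j => (({j} : Finset (Fin w.len)), (∅ : Finset (Fin w.len)))) ?_ ?_ ?_ ?_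
  · intro j _ j' _ h
    exact Finset.singleton_injective (congrArg Prod.fst h)
  · intro j hj
    simp only [Finset.coe_filter, Finset.mem_univ, true_and, mem_ofPred_eq] at hj
    simp only [parts, Finset.coe_filter, Finset.mem_univ, true_and, mem_ofPred_eq]
    refine ⟨Finset.disjoint_empty_right _, fun k hk => ?_⟩
    simp only [Finset.union_empty, Finset.mem_singleton] at hk
    rwa [hk]
  · intro P hP h
    simp only [onParts]
    by_cases h2 : P.2 = ∅
    · by_cases h1 : P.1.card = 1
      · exfalso
        obtain ⟨j, hj⟩ := Finset.card_eq_one.1 h1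
        refine h ⟨j, ?_, Prod.ext hj.symm h2.symm⟩
        simp only [parts, Finset.mem_filter, Finset.mem_univ, true_and] at hP
        simp only [Finset.coe_filter, Finset.mem_univ, true_and, mem_ofPred_eq]
        exact hP.2 j (by rw [hj]; simp)
      · rw [Chain.onPt_of_len_ne _ (by exact h1), ite_self]
    · rw [if_neg]
      rw [Chain.len_sub]
      exact Finset.card_ne_zero.2 (Finset.nonempty_iff_ne_empty.2 h2)
  · intro j _
    simp only [onParts]
    rw [if_pos (by rw [Chain.len_sub]; rfl), Chain.sub_singleton, Chain.onPt_single, Finset.union_empty]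

theorem measurable_sumPts (t : ℝ) {Φ : MCh S × (X × ℕ) → ℝ≥0∞} (hΦ : Measurable Φ) :
    Measurable (sumPts S t Φ) := by
  have h : sumPts S t Φ = _ := funext (sumPts_eq S t Φ)
  rw [h]
  exact measurable_sum_parts S t (measurable_onParts S hΦ)

theorem lintegral_sumPts (t : ℝ) {Φ : MCh S × (X × ℕ) → ℝ≥0∞} (hΦ : Measurable Φ) :
    ∫⁻ w, sumPts S t Φ w ∂(mchM S) =
      ∫⁻ x in S.before t, ∑' m : S.idx x, ∫⁻ w, Φ (w, (x, m)) ∂(mchM S) ∂S.μ := by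
  simp_rw [sumPts_eq]
  rw [lintegral_sum_parts S t (measurable_onParts S hΦ)]
  have hb := measurableSet_below_mch S t
  have hP := measurable_onParts S hΦ
  have hI : Measurable fun p : (X × ℕ) => ∫⁻ w, Φ (w, p) ∂(mchM S) := hΦ.lintegral_prod_left'
  have h1 : ∀ y : MCh S, ∫⁻ z in Chain.below S.markedTime t, ∫⁻ w, onParts S Φ (y, z, w)
      ∂(mchM S) ∂(mchM S) = ∫⁻ w, Chain.onPt Φ (w, y) ∂(mchM S) := by
    intro y
    have hy : Measurable fun z => ∫⁻ w, onParts S Φ (y, z, w) ∂(mchM S) :=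
      Measurable.lintegral_prod_right' (f := fun p : MCh S × MCh S => onParts S Φ (y, p.1, p.2))
        (by fun_prop)
    rw [← lintegral_indicator hb]
    refine (Chain.lintegral_measure_of_len_zero S.measurable_markedTime S.markedMeasure
      (hy.indicator hb) ?_).trans ?_
    · intro z hz
      refine indicator_apply_eq_zero.2 fun _ => ?_
      refine (lintegral_congr fun w => ?_).trans lintegral_zero
      exact if_neg hz
    · rw [indicator_of_mem (Chain.empty_mem_below _)]
      exact lintegral_congr fun w => if_pos rfl
  simp_rw [h1]
  have hO : Measurable fun y : MCh S => ∫⁻ w, Chain.onPt Φ (w, y) ∂(mchM S) :=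
    (Chain.measurable_onPt hΦ).lintegral_prod_left'
  rw [← lintegral_indicator hb]
  refine (Chain.lintegral_measure_of_len_one S.measurable_markedTime S.markedMeasure
      (hO.indicator hb) ?_).trans ?_
  · intro y hy
    refine indicator_apply_eq_zero.2 fun _ => ?_
    refine (lintegral_congr fun w => ?_).trans lintegral_zero
    exact Chain.onPt_of_len_ne _ hy
  · have hs : Measurable fun z : X × ℕ => (Chain.below S.markedTime t).indicator
        (fun y : MCh S => ∫⁻ w, Chain.onPt Φ (w, y) ∂(mchM S)) (Chain.single S.markedTime z) :=
      (hO.indicator hb).comp (Chain.measurable_single S.measurable_markedTime)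
    rw [lintegral_markedMeasure S hs, ← lintegral_indicator (measurableSet_before S t)]
    refine lintegral_congr fun x => ?_
    by_cases hx : S.time x < t
    · rw [indicator_of_mem (by exact hx)]
      refine tsum_congr fun m => ?_
      rw [indicator_of_mem (by intro i; exact hx)]
      exact lintegral_congr fun w => Chain.onPt_single _ _ _
    · rw [indicator_of_notMem (by exact hx)]
      refine ENNReal.tsum_eq_zero.2 fun m => indicator_of_notMem (fun h => hx ?_) _
      exact h ⟨0, one_pos⟩

/-! ### Adding a point -/

open Classical in
/-- The contribution of the point of type `i`. -/
def pointSum (t : ℝ) (i : Pos) (Φ : X × Triple S → ℝ≥0∞) (q : Triple S) : ℝ≥0∞ :=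
  match i with
  | .ann => ∫⁻ x in S.before t, Φ (x, q) ∂S.μ
  | .gau => sumPts S t (fun p => Φ (p.2.1, (Chain.empty S.markedTime,
      Chain.single S.markedTime p.2, p.1))) q.2.2
  | .cre => sumPts S t (fun p => Φ (p.2.1, (Chain.single S.markedTime p.2,
      Chain.empty S.markedTime, p.1))) q.2.2
  | .tim => ∫⁻ x in S.before t, Φ (x, q) ∂S.μ

theorem measurable_pointSum (t : ℝ) (i : Pos) {Φ : X × Triple S → ℝ≥0∞} (hΦ : Measurable Φ) :
    Measurable (pointSum S t i Φ) := by
  cases i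
  · exact hΦ.lintegral_prod_left'
  · exact (measurable_sumPts S t (by fun_prop)).comp (by fun_prop)
  · exact (measurable_sumPts S t (by fun_prop)).comp (by fun_prop)
  · exact hΦ.lintegral_prod_left'

variable [MeasurableSingletonClass X]

theorem lintegral_vecM_empty {F : Triple S → ℝ≥0∞} (hF : Measurable F) :
    ∫⁻ q, F q ∂(vecM S (Chain.empty S.time) (Chain.empty S.time)) =
      ∫⁻ w, F (Chain.empty S.markedTime, Chain.empty S.markedTime, w) ∂(mchM S) := by
  rw [lintegral_vecM S _ _ hF, fibM_empty, lintegral_dirac, lintegral_dirac]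

/-- The one-point case of the sum-integral formula. Annihilation and time points are already
integrated over; gauge and creation points are points of the argument and carry one of its marks. -/
theorem lintegral_pointSum (t : ℝ) (i : Pos) {Φ : X × Triple S → ℝ≥0∞} (hΦ : Measurable Φ) :
    ∫⁻ q, pointSum S t i Φ q ∂(vecM S (Chain.empty S.time) (Chain.empty S.time)) =
      ∫⁻ x in S.before t, ∫⁻ q, Φ (x, q) ∂(vecM S (Table.elem S i x).cre (Table.elem S i x).gau)
        ∂S.μ := by
  have hP := measurable_pointSum S t i hΦ
  cases i
  · exact lintegral_lintegral_swap (f := fun q x => Φ (x, q)) (by fun_prop)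
  · rw [lintegral_vecM_empty S hP]
    refine (lintegral_sumPts S t (Φ := fun p => Φ (p.2.1, (Chain.empty S.markedTime,
      Chain.single S.markedTime p.2, p.1))) (by fun_prop)).trans (lintegral_congr fun x => ?_)
    change _ = ∫⁻ q, Φ (x, q) ∂(vecM S (Chain.empty S.time) (Chain.single S.time x))
    rw [lintegral_vecM S _ _ (F := fun q => Φ (x, q)) (by fun_prop), fibM_empty, lintegral_dirac,
      lintegral_fibM_single S x (Measurable.lintegral_prod_right' (f := fun p : MCh S × MCh S =>
        Φ (x, (Chain.empty S.markedTime, p.1, p.2))) (by fun_prop))]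
  · rw [lintegral_vecM_empty S hP]
    refine (lintegral_sumPts S t (Φ := fun p => Φ (p.2.1, (Chain.single S.markedTime p.2,
      Chain.empty S.markedTime, p.1))) (by fun_prop)).trans (lintegral_congr fun x => ?_)
    change _ = ∫⁻ q, Φ (x, q) ∂(vecM S (Chain.single S.time x) (Chain.empty S.time))
    rw [lintegral_vecM S _ _ (F := fun q => Φ (x, q)) (by fun_prop), fibM_empty]
    simp_rw [lintegral_dirac]
    rw [lintegral_fibM_single S x (Measurable.lintegral_prod_right' (f := fun p : MCh S × MCh S =>
        Φ (x, (p.1, Chain.empty S.markedTime, p.2))) (by fun_prop))]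
  · exact lintegral_lintegral_swap (f := fun q x => Φ (x, q)) (by fun_prop)

theorem ae_pull_empty : ∀ᵐ q ∂(vecM S (Chain.empty S.time) (Chain.empty S.time)),
    q.1 = Chain.empty S.markedTime ∧ q.2.1 = Chain.empty S.markedTime ∧
      pull S (Chain.empty S.time) (Chain.empty S.time) q = q := by
  filter_upwards [ae_vecM S (κ := Chain.empty S.time) (κ' := Chain.empty S.time)] with q hq
  obtain ⟨h1, h2, -⟩ := hq
  rw [fiber_empty, mem_singleton_iff] at h1 h2
  obtain ⟨y, z, w⟩ := q
  simp only at h1 h2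
  subst h1 h2
  refine ⟨rfl, rfl, ?_⟩
  rw [pull_empty]
  simp only [Chain.empty_union]

/-- Putting the selected point back into the argument restores `q`, so a factor `C` of the pulled
argument is constant along the sum. -/
theorem pointSum_mul (t : ℝ) (i : Pos) (C : Triple S → ℝ≥0∞) {Φ : X × Triple S → ℝ≥0∞}
    (hΦ : Measurable Φ) : ∀ᵐ q ∂(vecM S (Chain.empty S.time) (Chain.empty S.time)),
      pointSum S t i (fun p => C (pull S (Chain.empty S.time) (Chain.empty S.time) p.2) * Φ p) q =
        C q * pointSum S t i Φ q := by
  filter_upwards [ae_pull_empty S] with q hq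
  obtain ⟨h1, h2, h3⟩ := hq
  have key : ∀ j : Fin q.2.2.len, ((Chain.empty S.markedTime, Chain.empty S.markedTime,
      (Chain.single S.markedTime (q.2.2.pt j)).union (q.2.2.sub {j}ᶜ)) : Triple S) = q := by
    intro j
    rw [Chain.single_union_sub, ← h1]
    refine Prod.ext rfl (Prod.ext ?_ rfl)
    rw [h1, ← h2]
  cases i
  · simp only [pointSum, h3]
    exact lintegral_const_mul _ (by fun_prop)
  · simp only [pointSum, sumPts, pull_empty, Chain.empty_union, key, Finset.mul_sum, mul_ite, mul_zero]
  · simp only [pointSum, sumPts, pull_empty, Chain.union_empty, key, Finset.mul_sum, mul_ite, mul_zero]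
  · simp only [pointSum, h3]
    exact lintegral_const_mul _ (by fun_prop)

theorem ae_pointSum {t : ℝ} {i : Pos} {p : X × Triple S → Prop} (hp : MeasurableSet {x | p x})
    (h : ∀ᵐ x ∂(S.μ.restrict (S.before t)),
      ∀ᵐ q ∂(vecM S (Table.elem S i x).cre (Table.elem S i x).gau), p (x, q)) :
    ∀ᵐ q ∂(vecM S (Chain.empty S.time) (Chain.empty S.time)),
      pointSum S t i ({x | p x}ᶜ.indicator 1) q = 0 := by
  have hm : Measurable ({x | p x}ᶜ.indicator (1 : X × Triple S → ℝ≥0∞)) :=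
    measurable_one.indicator hp.compl
  refine (lintegral_eq_zero_iff (measurable_pointSum S t i hm)).1 ?_
  rw [lintegral_pointSum S t i hm]
  refine (lintegral_congr_ae (h.mono fun x hx => ?_)).trans lintegral_zero
  refine (lintegral_congr_ae (hx.mono fun q hq => ?_)).trans lintegral_zero
  exact indicator_of_notMem (not_not_intro hq) _

theorem ae_of_pointSum {t : ℝ} {i : Pos} {p : X × Triple S → Prop} (hp : MeasurableSet {x | p x})
    (h : ∀ᵐ q ∂(vecM S (Chain.empty S.time) (Chain.empty S.time)),
      pointSum S t i ({x | p x}ᶜ.indicator 1) q = 0) :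
    ∀ᵐ x ∂(S.μ.restrict (S.before t)),
      ∀ᵐ q ∂(vecM S (Table.elem S i x).cre (Table.elem S i x).gau), p (x, q) := by
  have hm : Measurable ({x | p x}ᶜ.indicator (1 : X × Triple S → ℝ≥0∞)) :=
    measurable_one.indicator hp.compl
  have h1 := (lintegral_eq_zero_iff (measurable_pointSum S t i hm)).2 h
  rw [lintegral_pointSum S t i hm, lintegral_eq_zero_iff (measurable_lintegral_vecM S
    (Ω := X) (G := {x | p x}ᶜ.indicator (1 : X × Triple S → ℝ≥0∞)) hm
    (s := fun x => (Table.elem S i x).cre) (r := fun x => (Table.elem S i x).gau) (by fun_prop)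
    (by fun_prop))] at h1
  filter_upwards [h1] with x hx
  simp only [Pi.zero_apply] at hx
  rw [lintegral_eq_zero_iff (by fun_prop)] at hx
  filter_upwards [hx] with q hq
  by_contra hc
  have : (x, q) ∈ {x | p x}ᶜ := hc
  simp [this] at hq

variable {X : Type*} [MeasurableSpace X] (S : NoiseSpace X)

/-! ### The recursion over the last point of a table -/

/-- Adding a point to a table. -/
def shiftPt (i : Pos) (x : X) (y : Table S × Triple S) : Table S × Triple S :=
  ((Table.elem S i x).union y.1, y.2)

@[fun_prop]
theorem measurable_shiftPt (i : Pos) {Ω : Type*} [MeasurableSpace Ω] {f : Ω → X}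
    {g : Ω → Table S × Triple S} (hf : Measurable f) (hg : Measurable g) :
    Measurable fun ω => shiftPt S i (f ω) (g ω) := by
  unfold shiftPt; fun_prop

/-- The sum over the parts and the pairs of chains before the point `x`, which is added as the last
point. -/
def pointKer (i : Pos) : ProbabilityTheory.Kernel (X × Triple S) (Table S × Triple S) where
  toFun p := (partM S (S.time p.1) p.2).map (shiftPt S i p.1)
  measurable' := by
    refine Measure.measurable_of_measurable_coe _ fun s hs => ?_
    have h := (measurable_lintegral_partM_prod S (Ω := X)
      (G := fun p => s.indicator 1 (shiftPt S i p.1 p.2))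
      ((measurable_one.indicator hs).fun_comp (by fun_prop))).comp
      (f := fun p : X × Triple S => (p.1, (S.time p.1, p.2)))
      (measurable_fst.prodMk ((S.measurable_time.comp measurable_fst).prodMk measurable_snd))
    simp only [Function.comp_def] at h
    have e : (fun p : X × Triple S => (partM S (S.time p.1) p.2).map (shiftPt S i p.1) s) =
        fun p => ∫⁻ y, s.indicator 1 (shiftPt S i p.1 y) ∂(partM S (S.time p.1) p.2) := by
      funext p
      rw [← lintegral_indicator_one hs, lintegral_map (measurable_one.indicator hs) (by fun_prop)]
    rw [e]
    exact h

theorem pointKer_apply (i : Pos) (p : X × Triple S) :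
    pointKer S i p = (partM S (S.time p.1) p.2).map (shiftPt S i p.1) := rfl

theorem lintegral_pointKer (i : Pos) (p : X × Triple S) {G : Table S × Triple S → ℝ≥0∞}
    (hG : Measurable G) : ∫⁻ y, G y ∂(pointKer S i p) =
      ∫⁻ y, G (shiftPt S i p.1 y) ∂(partM S (S.time p.1) p.2) := by
  rw [pointKer_apply, lintegral_map hG (by fun_prop)]

theorem measurable_lintegral_pointKer (i : Pos) {G : Table S × Triple S → ℝ≥0∞}
    (hG : Measurable G) : Measurable fun p => ∫⁻ y, G y ∂(pointKer S i p) :=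
  hG.lintegral_kernel

variable [MeasurableSingletonClass X]

theorem lintegral_mul_partM (t : ℝ) (κc κg : Ch S) {C : Triple S → ℝ≥0∞} (hC : Measurable C)
    {G : Table S × Triple S → ℝ≥0∞} (hG : Measurable G) :
    ∫⁻ q, C q * ∫⁻ x, G x ∂(partM S t q) ∂(vecM S κc κg) =
      ∫⁻ ϑ, ∫⁻ z, C (pull S κc κg z) * G (ϑ, z)
        ∂(vecM S (κc.union ϑ.cre) (κg.union ϑ.gau)) ∂(tabT S t) := by
  rw [← lintegral_partM_vecM S t κc κg (G := fun x => C (pull S κc κg x.2) * G x) (by fun_prop)]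
  refine lintegral_congr_ae ?_
  filter_upwards [ae_partM_pull S t κc κg] with q hq
  rw [← lintegral_const_mul _ hG]
  refine lintegral_congr_ae ?_
  filter_upwards [hq] with x hx
  rw [hx]

theorem pull_empty_pull_of_ae {t : ℝ} (i : Pos) : ∀ᵐ x ∂(S.μ.restrict (S.before t)),
    ∀ᵐ ϑ ∂(tabT S (S.time x)), ∀ᵐ z ∂(vecM S ((Table.elem S i x).cre.union ϑ.cre)
      ((Table.elem S i x).gau.union ϑ.gau)),
      pull S (Chain.empty S.time) (Chain.empty S.time) (pull S (Table.elem S i x).cre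
        (Table.elem S i x).gau z) = pull S (Chain.empty S.time) (Chain.empty S.time) z := by
  have h : ∀ᵐ ϑ ∂(tabT S t), ϑ.cre.Apart ϑ.gau := by
    refine ae_tabT_star S (p := fun ϑ => ϑ.ann.Apart ϑ.gau) ?_
    refine ae_tabT_ann_gau (p := fun x => x.1.Apart x.2)
      (Chain.measurableSet_apart S.measurable_time) ?_
    exact Filter.Eventually.of_forall fun ann => ae_restrict_of_ae (ae_apart_ch S ann)
  filter_upwards [ae_elem_union h i] with x hx
  filter_upwards [hx] with ϑ hϑ
  filter_upwards [ae_vecM S] with z hz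
  have h1 : z.1.Apart z.2.1 := by
    rw [← base_apart, hz.1.1, hz.2.1.1]
    exact hϑ
  refine pull_empty_pull S h1 ?_
  rw [← base_apart, base_union S h1, hz.1.1, hz.2.1.1]
  intro a ha b hb
  rw [Chain.support_union (by exact hϑ)] at ha
  rcases ha with ha | ha
  · exact hz.2.2.1 a ha b hb
  · exact hz.2.2.2 a ha b hb

/-- The sum over the types of the last point. -/
def recSum (t : ℝ) (G : Table S × Triple S → ℝ≥0∞) (q : Triple S) : ℝ≥0∞ :=
  G (Table.empty S, q) +
    (pointSum S t .ann (fun p => ∫⁻ y, G y ∂(pointKer S .ann p)) q +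
    (pointSum S t .gau (fun p => ∫⁻ y, G y ∂(pointKer S .gau p)) q +
    (pointSum S t .cre (fun p => ∫⁻ y, G y ∂(pointKer S .cre p)) q +
    pointSum S t .tim (fun p => ∫⁻ y, G y ∂(pointKer S .tim p)) q)))

/-- The factor `C` is absorbed twice, first through the tables before `x` and then through `x`
itself; by `pull_empty_pull_of_ae` this agrees with a single absorption. -/
theorem lintegral_mul_pointSum (t : ℝ) (i : Pos) {C : Triple S → ℝ≥0∞} (hC : Measurable C)
    {G : Table S × Triple S → ℝ≥0∞} (hG : Measurable G) :
    ∫⁻ q, C q * pointSum S t i (fun p => ∫⁻ y, G y ∂(pointKer S i p)) q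
      ∂(vecM S (Chain.empty S.time) (Chain.empty S.time)) =
    ∫⁻ x in S.before t, ∫⁻ ϑ, ∫⁻ z, C (pull S (Chain.empty S.time) (Chain.empty S.time) z) *
      G ((Table.elem S i x).union ϑ, z) ∂(vecM S ((Table.elem S i x).cre.union ϑ.cre)
        ((Table.elem S i x).gau.union ϑ.gau)) ∂(tabT S (S.time x)) ∂S.μ := by
  have hK := measurable_lintegral_pointKer S i hG
  refine (lintegral_congr_ae ((pointSum_mul S t i C hK).mono fun q hq => hq.symm)).trans ?_
  rw [lintegral_pointSum S t i (by fun_prop)]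
  refine lintegral_congr_ae ?_
  filter_upwards [pull_empty_pull_of_ae S i] with x hx
  simp_rw [lintegral_pointKer S i _ hG]
  rw [lintegral_mul_partM S (S.time x) _ _ (C := fun q => C (pull S (Chain.empty S.time)
    (Chain.empty S.time) q)) (by fun_prop) (G := fun y => G (shiftPt S i x y)) (by fun_prop)]
  refine lintegral_congr_ae ?_
  filter_upwards [hx] with ϑ hϑ
  refine lintegral_congr_ae ?_
  filter_upwards [hϑ] with z hz
  rw [hz]
  rfl

/-- Both sides have the same integral against every indicator `C`: after the change of variables to
tables the left side is decomposed by the latest point, and each term is one of the point sums on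
the right. The exceptional null set depends on `G`. -/
theorem lintegral_partM_rec (t : ℝ) {G : Table S × Triple S → ℝ≥0∞} (hG : Measurable G) :
    ∀ᵐ q ∂(vecM S (Chain.empty S.time) (Chain.empty S.time)),
      ∫⁻ y, G y ∂(partM S t q) = recSum S t G q := by
  have hm : ∀ i, Measurable (pointSum S t i (fun p => ∫⁻ y, G y ∂(pointKer S i p))) := fun i =>
    measurable_pointSum S t i (measurable_lintegral_pointKer S i hG)
  have m1 := hm .ann
  have m2 := hm .gau
  have m3 := hm .cre
  have m4 := hm .tim
  have hR : Measurable (recSum S t G) := by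
    have : Measurable fun q => G (Table.empty S, q) := by fun_prop
    exact this.add (m1.add (m2.add (m3.add m4)))
  refine ae_eq_of_forall_setLIntegral_eq_of_sigmaFinite (measurable_lintegral_partM_at S t hG) hR
    fun s hs _ => ?_
  let C : Triple S → ℝ≥0∞ := s.indicator 1
  have hC : Measurable C := measurable_one.indicator hs
  have e : ∀ F : Triple S → ℝ≥0∞, ∫⁻ q in s, F q ∂(vecM S (Chain.empty S.time) (Chain.empty S.time)) =
      ∫⁻ q, C q * F q ∂(vecM S (Chain.empty S.time) (Chain.empty S.time)) := by
    intro F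
    rw [← lintegral_indicator hs]
    refine lintegral_congr fun q => ?_
    by_cases hq : q ∈ s
    · simp [C, hq]
    · simp [C, hq]
  rw [e, e, lintegral_mul_partM S t _ _ hC hG]
  have hV : Measurable fun ϑ : Table S => ∫⁻ z, C (pull S (Chain.empty S.time) (Chain.empty S.time) z) *
      G (ϑ, z) ∂(vecM S ϑ.cre ϑ.gau) := measurable_lintegral_vecM S (Ω := Table S)
        (G := fun x => C (pull S (Chain.empty S.time) (Chain.empty S.time) x.2) * G x)
        (by fun_prop) (by fun_prop) (by fun_prop)
  simp only [Chain.empty_union]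
  rw [lintegral_tabT_rec S t hV]
  simp only [recSum, mul_add]
  rw [lintegral_add_left (by fun_prop), lintegral_add_left (by fun_prop),
    lintegral_add_left (by fun_prop), lintegral_add_left (by fun_prop),
    lintegral_mul_pointSum S t .ann hC hG, lintegral_mul_pointSum S t .gau hC hG,
    lintegral_mul_pointSum S t .cre hC hG, lintegral_mul_pointSum S t .tim hC hG]
  congr 1
  refine lintegral_congr_ae ?_
  filter_upwards [ae_pull_empty S] with q hq
  rw [hq.2.2]

open Classical in
/-- The measure for the recursion. -/
def recM (t : ℝ) (q : Triple S) : Measure (Table S × Triple S) :=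
  Measure.dirac (Table.empty S, q) +
    ((∑ j : Fin q.2.2.len, if S.time (q.2.2.pt j).1 < t then
      pointKer S .gau ((q.2.2.pt j).1, (Chain.empty S.markedTime, Chain.single S.markedTime (q.2.2.pt j),
        q.2.2.sub {j}ᶜ)) +
      pointKer S .cre ((q.2.2.pt j).1, (Chain.single S.markedTime (q.2.2.pt j),
        Chain.empty S.markedTime, q.2.2.sub {j}ᶜ)) else 0) +
    ((S.μ.restrict (S.before t)).bind (fun x => pointKer S .ann (x, q)) +
    (S.μ.restrict (S.before t)).bind (fun x => pointKer S .tim (x, q))))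

omit [MeasurableSingletonClass X] in
theorem measurable_pointKer_left (i : Pos) (q : Triple S) : Measurable fun x => pointKer S i (x, q) :=
  (pointKer S i).measurable.comp measurable_prodMk_right

omit [MeasurableSingletonClass X] in
theorem lintegral_recM (t : ℝ) (q : Triple S) {G : Table S × Triple S → ℝ≥0∞} (hG : Measurable G) :
    ∫⁻ y, G y ∂(recM S t q) = recSum S t G q := by
  classical
  rw [recM, lintegral_add_measure, lintegral_add_measure, lintegral_add_measure,
    lintegral_dirac' _ hG, lintegral_finsetSum_measure,
    Measure.lintegral_bind (measurable_pointKer_left S .ann q).aemeasurable hG.aemeasurable,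
    Measure.lintegral_bind (measurable_pointKer_left S .tim q).aemeasurable hG.aemeasurable]
  have e : ∑ j : Fin q.2.2.len, ∫⁻ y, G y ∂(if S.time (q.2.2.pt j).1 < t then
      pointKer S .gau ((q.2.2.pt j).1, (Chain.empty S.markedTime, Chain.single S.markedTime (q.2.2.pt j),
        q.2.2.sub {j}ᶜ)) +
      pointKer S .cre ((q.2.2.pt j).1, (Chain.single S.markedTime (q.2.2.pt j),
        Chain.empty S.markedTime, q.2.2.sub {j}ᶜ)) else 0) =
      pointSum S t .gau (fun p => ∫⁻ y, G y ∂(pointKer S .gau p)) q +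
      pointSum S t .cre (fun p => ∫⁻ y, G y ∂(pointKer S .cre p)) q := by
    simp only [pointSum, sumPts]
    rw [← Finset.sum_add_distrib]
    refine Finset.sum_congr rfl fun j _ => ?_
    by_cases h : S.time (q.2.2.pt j).1 < t
    · simp only [if_pos h]
      rw [lintegral_add_measure]
    · simp only [if_neg h]
      rw [lintegral_zero_measure, add_zero]
  rw [e, recSum]
  simp only [pointSum]
  ring

section
variable {S} {H : Type*} [NormedAddCommGroup H] [InnerProductSpace ℂ H]

/-- The integral before the point `x`, which is added as the last point. -/
def pointFun (i : Pos) (f : Table S → Triple S → H) (x : X) (q : Triple S) : H :=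
  ∫ y, Function.uncurry f y ∂(pointKer S i (x, q))

omit [MeasurableSingletonClass X] in
theorem stronglyMeasurable_pointFun (i : Pos) {f : Table S → Triple S → H}
    (hf : StronglyMeasurable (Function.uncurry f)) :
    StronglyMeasurable (Function.uncurry (pointFun i f)) :=
  hf.integral_kernel (κ := pointKer S i)

omit [MeasurableSingletonClass X] in
theorem pointFun_eq (i : Pos) {f : Table S → Triple S → H}
    (hf : StronglyMeasurable (Function.uncurry f)) (x : X) (q : Triple S) :
    pointFun i f x q = multFun (S.time x) (fun ϑ => f ((Table.elem S i x).union ϑ)) q := by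
  rw [pointFun, pointKer_apply, integral_map (by fun_prop) hf.aestronglyMeasurable]
  rfl

open Classical in
-- `lintegral_partM_rec` gives equality of the two measures for one set at a time, with a null set
-- depending on that set. For a fixed `f` countably many sets determine the integral, so outside one
-- null set the integrals over `partM` and `recM` agree. Applied to the norm of `f`, it also carries
-- over integrability; the parts of `recM` are then integrated separately.
theorem multFun_rec [CompleteSpace H] {t : ℝ} {f : Table S → Triple S → H}
    (hf : StronglyMeasurable (Function.uncurry f))
    (hi : ∀ᵐ q ∂(vecM S (Chain.empty S.time) (Chain.empty S.time)),
      Integrable (Function.uncurry f) (partM S t q)) :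
    ∀ᵐ q ∂(vecM S (Chain.empty S.time) (Chain.empty S.time)),
      Integrable (Function.uncurry f) (recM S t q) ∧
      IntegrableOn (fun x => pointFun .ann f x q) (S.before t) S.μ ∧
      IntegrableOn (fun x => pointFun .tim f x q) (S.before t) S.μ ∧
      multFun t f q = f (Table.empty S) q + ((∑ j : Fin q.2.2.len,
        if S.time (q.2.2.pt j).1 < t then
            pointFun .gau f (q.2.2.pt j).1
              (Chain.empty S.markedTime, Chain.single S.markedTime (q.2.2.pt j), q.2.2.sub {j}ᶜ) +
            pointFun .cre f (q.2.2.pt j).1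
              (Chain.single S.markedTime (q.2.2.pt j), Chain.empty S.markedTime, q.2.2.sub {j}ᶜ)
          else 0) + (∫ x in S.before t, pointFun .ann f x q ∂S.μ) +
        ∫ x in S.before t, pointFun .tim f x q ∂S.μ) := by
  obtain ⟨𝒜, hc, hA, hd⟩ := exists_determining_sets hf
  have h1 : ∀ᵐ q ∂(vecM S (Chain.empty S.time) (Chain.empty S.time)), ∀ A ∈ 𝒜,
      partM S t q A = recM S t q A := by
    rw [ae_ball_iff hc]
    intro A hA'
    have hm : Measurable (A.indicator (1 : Table S × Triple S → ℝ≥0∞)) :=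
      measurable_one.indicator (hA A hA')
    filter_upwards [lintegral_partM_rec S t hm] with q hq
    rw [← lintegral_recM S t q hm, lintegral_indicator_one (hA A hA'),
      lintegral_indicator_one (hA A hA')] at hq
    exact hq
  filter_upwards [h1, hi, lintegral_partM_rec S t hf.enorm] with q h1 h2 h3
  have h4 : Integrable (Function.uncurry f) (recM S t q) := by
    refine ⟨hf.aestronglyMeasurable, ?_⟩
    rw [HasFiniteIntegral, lintegral_recM S t q hf.enorm, ← h3]
    exact h2.2
  have h5 := hd _ _ h1 h2 h4
  have h6 := h4
  rw [recM, integrable_add_measure, integrable_add_measure, integrable_add_measure,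
    integrable_finsetSum_measure] at h6
  obtain ⟨i0, i1, i2, i3⟩ := h6
  let ka : ProbabilityTheory.Kernel X (Table S × Triple S) :=
    ⟨fun x => pointKer S .ann (x, q), measurable_pointKer_left S .ann q⟩
  let kt : ProbabilityTheory.Kernel X (Table S × Triple S) :=
    ⟨fun x => pointKer S .tim (x, q), measurable_pointKer_left S .tim q⟩
  have j2 : Integrable (Function.uncurry f) ((S.μ.restrict (S.before t)).bind ka) := i2
  have j3 : Integrable (Function.uncurry f) ((S.μ.restrict (S.before t)).bind kt) := i3
  have b2 : IntegrableOn (fun x => pointFun .ann f x q) (S.before t) S.μ := by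
    rw [Measure.comp_eq_comp_const_apply] at j2
    have := j2.integral_comp
    simp only [ProbabilityTheory.Kernel.const_apply] at this
    exact this
  have b3 : IntegrableOn (fun x => pointFun .tim f x q) (S.before t) S.μ := by
    rw [Measure.comp_eq_comp_const_apply] at j3
    have := j3.integral_comp
    simp only [ProbabilityTheory.Kernel.const_apply] at this
    exact this
  refine ⟨h4, b2, b3, ?_⟩
  have e2 := integral_bind_kernel j2
  have e3 := integral_bind_kernel j3
  rw [multFun, h5, recM, integral_add_measure i0 (by
      rw [integrable_add_measure, integrable_add_measure, integrable_finsetSum_measure]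
      exact ⟨i1, i2, i3⟩),
    integral_add_measure (by rw [integrable_finsetSum_measure]; exact i1) (by
      rw [integrable_add_measure]; exact ⟨i2, i3⟩), integral_add_measure i2 i3,
    integral_finsetSum_measure i1, integral_dirac' _ _ hf, add_assoc (Finset.sum _ _)]
  refine congrArg (f (Table.empty S) q + ·) (congrArg₂ (· + ·) ?_ (congrArg₂ (· + ·) e2 e3))
  refine Finset.sum_congr rfl fun j hj => ?_
  have i1' := i1 j hj
  by_cases h : S.time (q.2.2.pt j).1 < t
  · simp only [if_pos h] at i1' ⊢
    rw [integrable_add_measure] at i1'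
    exact integral_add_measure i1'.1 i1'.2
  · simp only [if_neg h]
    exact integral_zero_measure _

end

variable {X : Type*} [MeasurableSpace X] {S : NoiseSpace X}

theorem table_union_empty (ϑ : Table S) : ϑ.union (Table.empty S) = ϑ := by
  change (ϑ.1.union (Chain.empty S.time), ϑ.2.1.union (Chain.empty S.time),
    ϑ.2.2.1.union (Chain.empty S.time), ϑ.2.2.2.union (Chain.empty S.time)) = ϑ
  simp only [Chain.union_empty]

/-- The empty table is an atom. -/
theorem ae_tabT_empty {t : ℝ} {p : Table S → Prop} (h : ∀ᵐ ϑ ∂(tabT S t), p ϑ) :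
    p (Table.empty S) := by
  obtain ⟨N, hN, hNm, hN0⟩ := exists_measurable_superset_of_null (ae_iff.1 h)
  have hm : Measurable (N.indicator (1 : Table S → ℝ≥0∞)) := measurable_one.indicator hNm
  rw [← lintegral_indicator_one hNm, lintegral_tabT_rec S t hm] at hN0
  by_contra hc
  have : Table.empty S ∈ N := hN hc
  simp [this] at hN0

theorem ae_elem {t : ℝ} {p : Table S → Prop} (h : ∀ᵐ ϑ ∂(tabT S t), p ϑ) (i : Pos) :
    ∀ᵐ x ∂(S.μ.restrict (S.before t)), p (Table.elem S i x) := by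
  filter_upwards [ae_elem_union h i] with x hx
  have := ae_tabT_empty hx
  rwa [table_union_empty] at this

variable [MeasurableSingletonClass X]
variable {H : Type*} [NormedAddCommGroup H] [InnerProductSpace ℂ H]

/-! ### Single integrals -/

omit [InnerProductSpace ℂ H] in
theorem deriv_elem_congr {t : ℝ} {a b : Triple S → H}
    (h : a =ᵐ[vecM S (Chain.empty S.time) (Chain.empty S.time)] b) (i : Pos) :
    ∀ᵐ x ∂(S.μ.restrict (S.before t)), deriv (Table.empty S) a
      =ᵐ[vecM S (Table.elem S i x).ann (Table.elem S i x).gau] deriv (Table.empty S) b := by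
  have h1 := deriv_congr (κ := Table.empty S) (t := t) h
  have h2 : ∀ᵐ ϑ ∂(tabT S t), deriv (Table.empty S) a =ᵐ[vecM S ϑ.ann ϑ.gau]
      deriv (Table.empty S) b := by
    filter_upwards [h1] with ϑ hϑ
    rwa [empty_table_union] at hϑ
  exact ae_elem (p := fun ϑ => deriv (Table.empty S) a =ᵐ[vecM S ϑ.ann ϑ.gau]
      deriv (Table.empty S) b) h2 i

omit [InnerProductSpace ℂ H] in
theorem deriv_empty (a : Triple S → H) :
    deriv (Table.empty S) a =ᵐ[vecM S (Chain.empty S.time) (Chain.empty S.time)] a := by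
  filter_upwards [ae_pull_empty S] with q hq
  rw [deriv_eq]
  exact congrArg a hq.2.2

section
variable {t : ℝ} {D : ∀ (i : Pos) (x : X), Op S H (Table.elem S i x)}
  {a b u v : L0 S H (Chain.empty S.time) (Chain.empty S.time)}

theorem singleActsAs_zero : SingleActsAs t D 0 0 := by
  refine ⟨fun _ _ _ => 0, fun i => stronglyMeasurable_const, fun i => ?_, ?_⟩
  · filter_upwards [deriv_elem_congr (t := t) (AEEqFun.coeFn_zero
      (μ := vecM S (Chain.empty S.time) (Chain.empty S.time)) (β := H)) i] with x hx
    exact represents_zero.congr (Filter.EventuallyEq.symm hx) Filter.EventuallyEq.rfl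
  · filter_upwards [AEEqFun.coeFn_zero (μ := vecM S (Chain.empty S.time) (Chain.empty S.time)) (β := H)]
      with q hq
    refine ⟨integrableOn_zero, integrableOn_zero, ?_⟩
    rw [hq]
    simp

theorem SingleActsAs.add (h : SingleActsAs t D a u) (h' : SingleActsAs t D b v) :
    SingleActsAs t D (a + b) (u + v) := by
  obtain ⟨f, hf, h1, h2⟩ := h
  obtain ⟨g, hg, h1', h2'⟩ := h'
  refine ⟨fun i x q => f i x q + g i x q, fun i => (hf i).add (hg i), fun i => ?_, ?_⟩
  · filter_upwards [h1 i, h1' i, deriv_elem_congr (t := t) (AEEqFun.coeFn_add a b) i] with x hx hx' e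
    exact (hx.add hx').congr (Filter.EventuallyEq.symm e) Filter.EventuallyEq.rfl
  · filter_upwards [h2, h2', AEEqFun.coeFn_add u v] with q hq hq' e
    refine ⟨hq.1.add hq'.1, hq.2.1.add hq'.2.1, ?_⟩
    rw [e, Pi.add_apply, hq.2.2, hq'.2.2, integral_add hq.1 hq'.1, integral_add hq.2.1 hq'.2.1]
    have : ∀ s s' i i' j j' : H, s + i + j + (s' + i' + j') = s + s' + (i + i') + (j + j') :=
      fun _ _ _ _ _ _ => by abel
    rw [this, ← Finset.sum_add_distrib]
    congr 2
    refine Finset.sum_congr rfl fun j _ => ?_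
    by_cases hj : S.time (q.2.2.pt j).1 < t
    · simp only [if_pos hj]; abel
    · simp only [if_neg hj, add_zero]

theorem SingleActsAs.smul (k : ℂ) (h : SingleActsAs t D a u) : SingleActsAs t D (k • a) (k • u) := by
  obtain ⟨f, hf, h1, h2⟩ := h
  refine ⟨fun i x q => k • f i x q, fun i => (hf i).const_smul k, fun i => ?_, ?_⟩
  · filter_upwards [h1 i, deriv_elem_congr (t := t) (AEEqFun.coeFn_smul k a) i] with x hx e
    exact (hx.smul k).congr (Filter.EventuallyEq.symm e) Filter.EventuallyEq.rfl
  · filter_upwards [h2, AEEqFun.coeFn_smul k u] with q hq e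
    refine ⟨hq.1.smul k, hq.2.1.smul k, ?_⟩
    rw [e, Pi.smul_apply, hq.2.2, integral_smul, integral_smul, smul_add, smul_add, Finset.smul_sum]
    congr 2
    refine Finset.sum_congr rfl fun j _ => ?_
    by_cases hj : S.time (q.2.2.pt j).1 < t
    · simp only [if_pos hj, smul_add]
    · simp only [if_neg hj, smul_zero]

theorem SingleActsAs.unique (h : SingleActsAs t D 0 u) : u = 0 := by
  obtain ⟨f, hf, h1, h2⟩ := h
  have h3 : ∀ i, MeasurableSet {x : X × Triple S | f i x.1 x.2 = 0} := fun i =>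
    (hf i).measurableSet_eq_fun stronglyMeasurable_const
  have h4 : ∀ i, ∀ᵐ q ∂(vecM S (Chain.empty S.time) (Chain.empty S.time)),
      pointSum S t i ({x : X × Triple S | f i x.1 x.2 = 0}ᶜ.indicator 1) q = 0 := by
    intro i
    refine ae_pointSum S (h3 i) ?_
    filter_upwards [h1 i, deriv_elem_congr (t := t) (AEEqFun.coeFn_zero
      (μ := vecM S (Chain.empty S.time) (Chain.empty S.time)) (β := H)) i] with x hx e
    exact hx.eq_zero e
  have hint : ∀ i, ∀ q, ∫⁻ x in S.before t, {x : X × Triple S | f i x.1 x.2 = 0}ᶜ.indicator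
      (1 : X × Triple S → ℝ≥0∞) (x, q) ∂S.μ = 0 → ∫ x in S.before t, f i x q ∂S.μ = 0 := by
    intro i q h
    have hm : Measurable ({x : X × Triple S | f i x.1 x.2 = 0}ᶜ.indicator
      (1 : X × Triple S → ℝ≥0∞)) := measurable_one.indicator (h3 i).compl
    rw [lintegral_eq_zero_iff (by fun_prop)] at h
    refine integral_eq_zero_of_ae ?_
    filter_upwards [h] with x hx
    by_contra hc
    have : (x, q) ∈ {x : X × Triple S | f i x.1 x.2 = 0}ᶜ := hc
    simp [this] at hx
  have hz : ∀ i (p : X × Triple S), {x : X × Triple S | f i x.1 x.2 = 0}ᶜ.indicator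
      (1 : X × Triple S → ℝ≥0∞) p = 0 → f i p.1 p.2 = 0 := by
    intro i p h
    by_contra hc
    have : p ∈ {x : X × Triple S | f i x.1 x.2 = 0}ᶜ := hc
    simp [this] at h
  refine AEEqFun.ext (Filter.EventuallyEq.trans ?_ AEEqFun.coeFn_zero.symm)
  filter_upwards [h2, h4 .ann, h4 .gau, h4 .cre, h4 .tim] with q hq q1 q2 q3 q4
  simp only [pointSum, sumPts, Finset.sum_eq_zero_iff, Finset.mem_univ, true_implies] at q1 q2 q3 q4
  rw [hq.2.2, hint .ann q q1, hint .tim q q4, add_zero, add_zero]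
  refine Finset.sum_eq_zero fun j _ => ?_
  have q2' := q2 j
  have q3' := q3 j
  by_cases hj : S.time (q.2.2.pt j).1 < t
  · simp only [if_pos hj] at q2' q3' ⊢
    rw [hz _ _ q2', hz _ _ q3', add_zero]
  · simp only [if_neg hj]

theorem mem_graph_singleInt : (a, u) ∈ (singleInt t D).graph ↔ SingleActsAs t D a u :=
  mem_graph_ofRel (r := SingleActsAs t D) singleActsAs_zero
    (fun _ _ _ _ h h' => SingleActsAs.add h h')
    (fun k _ _ h => SingleActsAs.smul k h) fun _ h => SingleActsAs.unique h

end

/-! ### The differential of a multiple integral -/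

theorem mem_graph_add {E F : Type*} [AddCommGroup E] [Module ℂ E] [AddCommGroup F] [Module ℂ F]
    {T T' : E →ₗ.[ℂ] F} {a : E} {b c : F} (h : (a, b) ∈ T.graph) (h' : (a, c) ∈ T'.graph) :
    (a, b + c) ∈ (T + T').graph := by
  rw [LinearPMap.mem_graph_iff] at h h' ⊢
  obtain ⟨x, hx, rfl⟩ := h
  obtain ⟨y, hy, rfl⟩ := h'
  simp only at hx hy
  refine ⟨⟨a, ?_, ?_⟩, rfl, ?_⟩
  · rw [← hx]; exact x.2
  · rw [← hy]; exact y.2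
  · rw [LinearPMap.add_apply]
    congr 2
    · exact Subtype.ext hx.symm
    · exact Subtype.ext hy.symm

/-- Finiteness of a point sum confines the infinite values of `Φ` to a set invisible for that sum.
With `ae_of_pointSum` this becomes finiteness for almost every point and argument. -/
theorem pointSum_top_eq_zero {t : ℝ} (i : Pos) {Φ : X × Triple S → ℝ≥0∞} (hΦ : Measurable Φ)
    {q : Triple S} (h : pointSum S t i Φ q ≠ ⊤) :
    pointSum S t i ({x | Φ x < ⊤}ᶜ.indicator 1) q = 0 := by
  have hz : ∀ p, Φ p ≠ ⊤ → {x | Φ x < ⊤}ᶜ.indicator (1 : X × Triple S → ℝ≥0∞) p = 0 := fun p hp =>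
    indicator_of_notMem (not_not_intro (lt_top_iff_ne_top.2 hp)) _
  have hint : ∫⁻ x in S.before t, Φ (x, q) ∂S.μ ≠ ⊤ →
      ∫⁻ x in S.before t, {x | Φ x < ⊤}ᶜ.indicator (1 : X × Triple S → ℝ≥0∞) (x, q) ∂S.μ = 0 := by
    intro h
    refine (lintegral_congr_ae ?_).trans lintegral_zero
    filter_upwards [ae_lt_top (by fun_prop) h] with x hx
    exact hz _ hx.ne
  cases i
  · exact hint h
  · simp only [pointSum, sumPts, ne_eq, ENNReal.sum_eq_top, not_exists, not_and, Finset.mem_univ,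
      true_implies] at h
    simp only [pointSum, sumPts]
    refine Finset.sum_eq_zero fun j _ => ?_
    have hj := h j
    split_ifs at hj ⊢ with h1
    · exact hz _ hj
    · rfl
  · simp only [pointSum, sumPts, ne_eq, ENNReal.sum_eq_top, not_exists, not_and, Finset.mem_univ,
      true_implies] at h
    simp only [pointSum, sumPts]
    refine Finset.sum_eq_zero fun j _ => ?_
    have hj := h j
    split_ifs at hj ⊢ with h1
    · exact hz _ hj
    · rfl
  · exact hint h

section
variable [CompleteSpace H] {t : ℝ} {B : OpFun S H} {η : Weights} {ξp ξm : ℝ}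

/-- The convergence of the integrals before `x` is taken from the convergence of the whole integral,
not from a norm of `ȧ(x)`, which may be infinite for the parameter `ξ⁺`. -/
theorem ae_integrable_pointKer {f : Table S → Triple S → H}
    (hf : StronglyMeasurable (Function.uncurry f))
    (hi : ∀ᵐ q ∂(vecM S (Chain.empty S.time) (Chain.empty S.time)),
      Integrable (Function.uncurry f) (recM S t q)) (i : Pos) :
    ∀ᵐ x ∂(S.μ.restrict (S.before t)),
      ∀ᵐ q ∂(vecM S (Table.elem S i x).cre (Table.elem S i x).gau),
        Integrable (Function.uncurry fun ϑ => f ((Table.elem S i x).union ϑ))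
          (partM S (S.time x) q) := by
  have hK := measurable_lintegral_pointKer S i hf.enorm
  have h1 : ∀ᵐ x ∂(S.μ.restrict (S.before t)),
      ∀ᵐ q ∂(vecM S (Table.elem S i x).cre (Table.elem S i x).gau),
        (x, q) ∈ {p | ∫⁻ y, ‖Function.uncurry f y‖ₑ ∂(pointKer S i p) < ⊤} := by
    refine ae_of_pointSum S (measurableSet_lt hK measurable_const) ?_
    filter_upwards [hi] with q hq
    refine pointSum_top_eq_zero i hK ?_
    have h2 := hq.2
    rw [HasFiniteIntegral, lintegral_recM S t q hf.enorm, recSum] at h2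
    simp only [ENNReal.add_lt_top] at h2
    cases i
    · exact h2.2.1.ne
    · exact h2.2.2.1.ne
    · exact h2.2.2.2.1.ne
    · exact h2.2.2.2.2.ne
  filter_upwards [h1] with x hx
  filter_upwards [hx] with q hq
  change ∫⁻ y, ‖Function.uncurry f y‖ₑ ∂(pointKer S i (x, q)) < ⊤ at hq
  rw [lintegral_pointKer S i _ hf.enorm] at hq
  refine ⟨(hf.comp_measurable (g := fun y => shiftPt S i x y) (by fun_prop)).aestronglyMeasurable, hq⟩

omit [CompleteSpace H] [InnerProductSpace ℂ H] in
-- Absorbing first the points of the table `ϑ` and then `x` is the same as absorbing all of them at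
-- once, as soon as the chains involved are apart.
theorem deriv_deriv (a : Triple S → H) (i : Pos) : ∀ᵐ x ∂(S.μ.restrict (S.before t)),
    ∀ᵐ ϑ ∂(tabT S (S.time x)), deriv (Table.elem S i x) (deriv (Table.empty S) a)
      =ᵐ[vecM S ((Table.elem S i x).union ϑ).ann ((Table.elem S i x).union ϑ).gau]
        deriv (Table.empty S) a := by
  have h : ∀ᵐ ϑ ∂(tabT S t), ϑ.ann.Apart ϑ.gau := by
    refine ae_tabT_ann_gau (p := fun x => x.1.Apart x.2)
      (Chain.measurableSet_apart S.measurable_time) ?_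
    exact Filter.Eventually.of_forall fun ann => ae_restrict_of_ae (ae_apart_ch S ann)
  filter_upwards [ae_elem_union h i] with x hx
  filter_upwards [hx] with ϑ hϑ
  filter_upwards [ae_vecM S] with z hz
  have h1 : z.1.Apart z.2.1 := by
    rw [← base_apart, hz.1.1, hz.2.1.1]
    exact hϑ
  rw [deriv_eq, deriv_eq]
  refine congrArg a (pull_empty_pull S h1 ?_)
  rw [← base_apart, base_union S h1, hz.1.1, hz.2.1.1]
  intro a ha b hb
  rw [Chain.support_union hϑ] at ha
  rcases ha with ha | ha
  · exact hz.2.2.1 a ha b hb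
  · exact hz.2.2.2 a ha b hb

omit [CompleteSpace H] in
theorem represents_elem_union {a : Triple S → H} {f : Table S → Triple S → H}
    (hr : ∀ᵐ ϑ ∂(tabT S t), Represents (B ((Table.empty S).union ϑ)) (deriv (Table.empty S) a) (f ϑ))
    (i : Pos) : ∀ᵐ x ∂(S.μ.restrict (S.before t)), ∀ᵐ ϑ ∂(tabT S (S.time x)),
      Represents (B ((Table.elem S i x).union ϑ)) (deriv (Table.empty S) a)
        (f ((Table.elem S i x).union ϑ)) := by
  have h : ∀ᵐ ϑ ∂(tabT S t), Represents (B ϑ) (deriv (Table.empty S) a) (f ϑ) := by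
    filter_upwards [hr] with ϑ hϑ
    rwa [empty_table_union] at hϑ
  exact ae_elem_union (p := fun ϑ => Represents (B ϑ) (deriv (Table.empty S) a) (f ϑ)) h i

/-- The multiple integral has its maximal domain, so measurability of the vector and integrability
for almost every argument suffice; no finite norm of `v` is required. -/
theorem represents_multInt {s : ℝ} {κ : Table S} {v : Triple S → H} (hv : StronglyMeasurable v)
    {f : Table S → Triple S → H} (hf : StronglyMeasurable (Function.uncurry f))
    (hr : ∀ᵐ ϑ ∂(tabT S s), Represents (B (κ.union ϑ)) (deriv κ v) (f ϑ))
    (hi : ∀ᵐ q ∂(vecM S κ.cre κ.gau), Integrable (Function.uncurry f) (partM S s q)) :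
    Represents (multInt s κ B) v (multFun s f) := by
  have hu := stronglyMeasurable_multFun s hf
  have ev := AEEqFun.coeFn_mk _ (hv.aestronglyMeasurable (μ := vecM S κ.ann κ.gau))
  have eu := AEEqFun.coeFn_mk _ (hu.aestronglyMeasurable (μ := vecM S κ.cre κ.gau))
  refine ⟨(AEEqFun.mk _ hv.aestronglyMeasurable, AEEqFun.mk _ hu.aestronglyMeasurable), ?_, ev, eu⟩
  rw [mem_graph_multInt]
  refine ⟨f, hf, ?_, ?_⟩
  · have h4 := deriv_congr (t := s) ev
    filter_upwards [hr, h4] with ϑ g1 g4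
    exact g1.congr g4.symm Filter.EventuallyEq.rfl
  · filter_upwards [hi, eu] with q hq e
    refine ⟨(integrable_partM hf).1 hq, ?_⟩
    rw [e, multFun, integral_partM hf hq]

omit [CompleteSpace H] [InnerProductSpace ℂ H] in
theorem stronglyMeasurable_deriv {κ : Table S} {a : Triple S → H} (ha : StronglyMeasurable a) :
    StronglyMeasurable (deriv κ a) := by
  rw [deriv_eq]
  exact ha.comp_measurable (measurable_pull S _ _ measurable_id)

theorem represents_multInt_elem {a : Triple S → H} (ha : StronglyMeasurable a)
    {f : Table S → Triple S → H} (hf : StronglyMeasurable (Function.uncurry f))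
    (hr : ∀ᵐ ϑ ∂(tabT S t), Represents (B ((Table.empty S).union ϑ)) (deriv (Table.empty S) a) (f ϑ))
    (hi : ∀ᵐ q ∂(vecM S (Chain.empty S.time) (Chain.empty S.time)),
      Integrable (Function.uncurry f) (recM S t q)) (i : Pos) :
    ∀ᵐ x ∂(S.μ.restrict (S.before t)), Represents (multInt (S.time x) (Table.elem S i x) B)
      (deriv (Table.empty S) a) (pointFun i f x) := by
  filter_upwards [represents_elem_union hr i, ae_integrable_pointKer hf hi i,
    deriv_deriv (t := t) a i] with x h1 h2 h3
  have hfx : StronglyMeasurable (Function.uncurry fun ϑ => f ((Table.elem S i x).union ϑ)) :=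
    hf.comp_measurable (g := fun y => shiftPt S i x y) (by fun_prop)
  rw [show pointFun i f x = multFun (S.time x) fun ϑ => f ((Table.elem S i x).union ϑ) from
    funext fun q => pointFun_eq i hf x q]
  refine represents_multInt (stronglyMeasurable_deriv ha) hfx ?_ h2
  filter_upwards [h1, h3] with ϑ g1 g3
  exact g1.congr g3.symm Filter.EventuallyEq.rfl

/-- One field `f` serves for the multiple integral, for its value at the empty table (an atom of the
measure) and for all inner integrals. The conclusion is stated for any `D` that reproduces the inner
integrals, so that it applies to the derivatives of `B` as well as to `L ⊙ U`. -/
theorem Good.exists_differential {E : Ch S × Ch S × Ch S → ℝ≥0∞}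
    (hG : Good t (Table.empty S) B η E) (hA : Admissible η ξp ξm)
    {a : L0 S H (Chain.empty S.time) (Chain.empty S.time)} (ha : InG ξp a) :
    ∃ (f : Table S → Triple S → H) (b u : L0 S H (Chain.empty S.time) (Chain.empty S.time)),
      StronglyMeasurable (Function.uncurry f) ∧
      (∀ᵐ ϑ ∂(tabT S t), Represents (B ((Table.empty S).union ϑ)) (deriv (Table.empty S) a) (f ϑ)) ∧
      (a, u) ∈ (qsInt t B).graph ∧ (a, b) ∈ (B (Table.empty S)).graph ∧
      (∀ᵐ q ∂(vecM S (Chain.empty S.time) (Chain.empty S.time)),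
        Integrable (Function.uncurry f) (recM S t q)) ∧
      ∀ D : ∀ (i : Pos) (x : X), Op S H (Table.elem S i x),
        (∀ i, ∀ᵐ x ∂(S.μ.restrict (S.before t)),
          Represents (D i x) (deriv (Table.empty S) a) (pointFun i f x)) →
        (a, u - b) ∈ (singleInt t D).graph := by
  obtain ⟨f, hf, hr⟩ := hG.exists_field hA a.stronglyMeasurable ha
  have hi := multFun_rec hf (hG.integrable hA a.stronglyMeasurable ha hf hr)
  have hmu := (stronglyMeasurable_multFun t hf).aestronglyMeasurable
    (μ := vecM S (Chain.empty S.time) (Chain.empty S.time))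
  have eu := AEEqFun.coeFn_mk _ hmu
  have h0 := ae_tabT_empty hr
  rw [empty_table_union] at h0
  obtain ⟨p, hp, e1, e2⟩ := h0
  have ep : p.1 = a := AEEqFun.ext (e1.trans (deriv_empty a))
  refine ⟨f, p.2, AEEqFun.mk _ hmu, hf, hr, mem_graph_multInt.2 (hG.actsAs hA ha hf hr eu), ?_,
    hi.mono fun q hq => hq.1, fun D hD => ?_⟩
  · rw [← ep]; exact hp
  · refine mem_graph_singleInt.2 ⟨fun i => pointFun i f, fun i => stronglyMeasurable_pointFun i hf, hD, ?_⟩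
    filter_upwards [hi, eu, e2, AEEqFun.coeFn_sub (AEEqFun.mk _ hmu) p.2] with q hq eu e2 es
    refine ⟨hq.2.1, hq.2.2.1, ?_⟩
    rw [es, Pi.sub_apply, eu, e2, hq.2.2.2, add_sub_cancel_left]

theorem Good.differential {E : Ch S × Ch S × Ch S → ℝ≥0∞}
    (hG : Good t (Table.empty S) B η E) (hA : Admissible η ξp ξm) :
    AgreeOn ξp (qsInt t B) (B (Table.empty S) +
      singleInt t fun i x => multInt (S.time x) (Table.elem S i x) B) := by
  intro a ha
  obtain ⟨f, b, u, hf, hr, hu, hb, hi, h⟩ := hG.exists_differential hA ha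
  refine ⟨u, hu, ?_⟩
  have h1 := mem_graph_add hb (h _ fun i => represents_multInt_elem a.stronglyMeasurable hf hr hi i)
  rwa [add_sub_cancel] at h1

end

/-! ### Square integrable functions over a sum of Dirac measures -/

section
variable {β ι : Type*} [MeasurableSpace β] [MeasurableSingletonClass β]
  {e : ι → β} {ν : Measure β}
  {H : Type*} [NormedAddCommGroup H] [InnerProductSpace ℂ H]

theorem lintegral_sum_dirac (hν : ν = Measure.sum fun k => Measure.dirac (e k)) (F : β → ℝ≥0∞) :
    ∫⁻ p, F p ∂ν = ∑' k, F (e k) := by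
  rw [hν, lintegral_sum_measure]
  simp only [lintegral_dirac]

variable [Countable ι]

theorem ae_sum_dirac_iff (hν : ν = Measure.sum fun k => Measure.dirac (e k)) {P : β → Prop} :
    (∀ᵐ p ∂ν, P p) ↔ ∀ k, P (e k) := by
  rw [hν, Measure.ae_sum_iff]
  simp [ae_dirac_eq]

omit [InnerProductSpace ℂ H] in
theorem eLpNorm_sum_dirac (hν : ν = Measure.sum fun k => Measure.dirac (e k)) (c : β → H) :
    eLpNorm c 2 ν = (∑' k, ‖c (e k)‖ₑ ^ 2) ^ (1 / 2 : ℝ) := by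
  rw [eLpNorm_two_eq, lintegral_sum_dirac hν]

omit [InnerProductSpace ℂ H] in
theorem aestronglyMeasurable_sum_dirac (hν : ν = Measure.sum fun k => Measure.dirac (e k))
    (c : β → H) : AEStronglyMeasurable c ν := by
  rw [hν]
  exact aestronglyMeasurable_sum_measure_iff.2 fun k => aestronglyMeasurable_dirac

omit [InnerProductSpace ℂ H] in
theorem memLp_sum_dirac (hν : ν = Measure.sum fun k => Measure.dirac (e k)) {c : β → H}
    (h : ∑' k, ‖c (e k)‖ₑ ^ 2 < ⊤) : MemLp c 2 ν := by
  refine ⟨aestronglyMeasurable_sum_dirac hν c, ?_⟩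
  rw [eLpNorm_sum_dirac hν]
  exact ENNReal.rpow_lt_top_of_nonneg (by norm_num) h.ne

open Classical in
/-- The element of `L²` given by a function, if it is square integrable. -/
def famLp (ν : Measure β) (c : β → H) : Lp H 2 ν := if h : MemLp c 2 ν then h.toLp c else 0

omit [MeasurableSingletonClass β] [InnerProductSpace ℂ H] in
theorem coeFn_famLp {c : β → H} (h : MemLp c 2 ν) : famLp ν c =ᵐ[ν] c := by
  rw [famLp, dif_pos h]
  exact h.coeFn_toLp

omit [MeasurableSingletonClass β] [InnerProductSpace ℂ H] in
theorem famLp_of_not {c : β → H} (h : ¬MemLp c 2 ν) : famLp ν c = 0 := dif_neg h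

omit [MeasurableSingletonClass β] [InnerProductSpace ℂ H] in
theorem eq_famLp {c : β → H} {α : Lp H 2 ν} (h : α =ᵐ[ν] c) : α = famLp ν c := by
  have hc : MemLp c 2 ν := (memLp_congr_ae h).1 (Lp.memLp α)
  exact Lp.ext (h.trans (coeFn_famLp hc).symm)

/-- The value at an atom, as a continuous linear map. -/
def evalAt (hν : ν = Measure.sum fun k => Measure.dirac (e k)) (k : ι) : Lp H 2 ν →L[ℂ] H :=
  LinearMap.mkContinuous
    { toFun := fun α => α (e k)
      map_add' := fun α β => (ae_sum_dirac_iff hν).1 (Lp.coeFn_add α β) k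
      map_smul' := fun s α => (ae_sum_dirac_iff hν).1 (Lp.coeFn_smul s α) k } 1 fun α => by
    have h1 : ‖α (e k)‖ₑ ≤ eLpNorm α 2 ν := by
      rw [eLpNorm_sum_dirac hν, ← sq_rpow_half ‖α (e k)‖ₑ]
      exact ENNReal.rpow_le_rpow (ENNReal.le_tsum k) (by norm_num)
    rw [one_mul, Lp.norm_def]
    simpa using ENNReal.toReal_mono (Lp.eLpNorm_ne_top α) h1

theorem evalAt_apply (hν : ν = Measure.sum fun k => Measure.dirac (e k)) (k : ι) (α : Lp H 2 ν) :
    evalAt hν k α = α (e k) := rfl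

omit [InnerProductSpace ℂ H] [Countable ι] in
theorem measure_dirac_atom_ne_top (hν : ν = Measure.sum fun k => Measure.dirac (e k))
    (he : Function.Injective e) (k : ι) : ν {e k} ≠ ⊤ := by
  rw [← lintegral_indicator_one (measurableSet_singleton _), lintegral_sum_dirac hν,
    tsum_eq_single k]
  · simp
  · intro j hj
    simp [he.ne hj]

/-- A family of vectors which depends measurably on a parameter is a measurable function with values
in `L²`. -/
theorem stronglyMeasurable_famLp {Y : Type*} [MeasurableSpace Y]
    (hν : ν = Measure.sum fun k => Measure.dirac (e k)) (he : Function.Injective e)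
    {c : β → Y → H} (hc : ∀ k, StronglyMeasurable (c (e k))) :
    StronglyMeasurable fun y => famLp ν fun p => c p y := by
  classical
  let D : Set Y := {y | ∑' k, ‖c (e k) y‖ₑ ^ 2 < ⊤}
  have hD : MeasurableSet D := measurableSet_lt
    (Measurable.tsum fun k => (hc k).enorm.pow_const 2) measurable_const
  -- The vector `v` at one atom and zero elsewhere. Finite sums of such functions depend measurably
  -- on the parameter and converge in `L²` wherever the family is square summable; `H` need not be
  -- separable.
  let single : ι → H → Lp H 2 ν := fun k v =>
    indicatorConstLp 2 (measurableSet_singleton (e k)) (measure_dirac_atom_ne_top hν he k) v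
  have hsub : ∀ k v w, single k v - single k w = single k (v - w) := fun k v w =>
    (indicatorConstLp_sub (p := 2) (hs := measurableSet_singleton (e k))
      (hμs := measure_dirac_atom_ne_top hν he k) (c := v) (c' := w))
  have hzero : ∀ k, single k 0 = 0 := fun k => by simpa using (hsub k 0 0).symm
  have heval : ∀ j k v, evalAt hν j (single k v) = if j = k then v else 0 := by
    intro j k v
    rw [evalAt_apply, (ae_sum_dirac_iff hν).1 (indicatorConstLp_coeFn (p := 2)
      (hs := measurableSet_singleton (e k)) (hμs := measure_dirac_atom_ne_top hν he k) (c := v)) j]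
    by_cases h : j = k
    · simp [h]
    · simp [h, he.ne h]
  have hcont : ∀ k, Continuous (single k) := by
    intro k
    refine (LipschitzWith.of_dist_le_mul (K := (ν.real {e k} ^ (1 / (2 : ℝ≥0∞).toReal)).toNNReal)
      fun v w => ?_).continuous
    rw [dist_eq_norm, dist_eq_norm, hsub, norm_indicatorConstLp (by norm_num) (by norm_num), mul_comm]
    gcongr
    exact Real.le_coe_toNNReal _
  let s : Finset ι → Y → Lp H 2 ν := fun K y => ∑ k ∈ K, single k (D.indicator (c (e k)) y)
  have hs : ∀ K, StronglyMeasurable (s K) := fun K =>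
    Finset.stronglyMeasurable_fun_sum K fun k _ =>
      (hcont k).comp_stronglyMeasurable ((hc k).indicator hD)
  refine stronglyMeasurable_of_tendsto (f := s) Filter.atTop hs (tendsto_pi_nhds.2 fun y => ?_)
  by_cases hy : y ∈ D
  · have hm : MemLp (fun p => c p y) 2 ν := memLp_sum_dirac hν hy
    rw [tendsto_iff_edist_tendsto_0]
    have e1 : ∀ K, edist (s K y) (famLp ν fun p => c p y) =
        (∑' k : {k // k ∉ K}, ‖c (e k) y‖ₑ ^ 2) ^ (1 / 2 : ℝ) := by
      intro K
      rw [Lp.edist_def, eLpNorm_sum_dirac hν]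
      congr 1
      refine Eq.trans (tsum_congr fun j => ?_)
        (tsum_subtype {k | k ∉ K} fun k => ‖c (e k) y‖ₑ ^ 2).symm
      have h1 : (famLp ν fun p => c p y) (e j) = c (e j) y :=
        (ae_sum_dirac_iff hν).1 (coeFn_famLp hm) j
      have h2 : (s K y) (e j) = if j ∈ K then c (e j) y else 0 := by
        rw [← evalAt_apply hν, map_sum]
        simp only [heval, indicator_of_mem hy, Finset.sum_ite_eq]
      rw [Pi.sub_apply, h1, h2]
      by_cases hj : j ∈ K
      · simp [hj]
      · simp [hj]
    have h1 := ENNReal.tendsto_tsum_compl_atTop_zero hy.ne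
    simp_rw [e1]
    have h2 := (ENNReal.continuous_rpow_const (y := 1 / 2)).tendsto 0 |>.comp h1
    simpa [Function.comp_def] using h2
  · have hm : ¬ MemLp (fun p => c p y) 2 ν := by
      intro hm
      refine hy ?_
      have := hm.2
      rw [eLpNorm_sum_dirac hν, ENNReal.rpow_lt_top_iff_of_pos (by norm_num)] at this
      exact this
    rw [famLp_of_not hm]
    have : ∀ K, s K y = 0 := fun K => Finset.sum_eq_zero fun k _ => by
      rw [indicator_of_notMem hy]
      exact hzero k
    simp_rw [this]
    exact tendsto_const_nhds

/-- A bounded operator between spaces of square integrable families commutes with integration. -/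
theorem exists_integral_famLp {β' ι' : Type*} [MeasurableSpace β'] [MeasurableSingletonClass β']
    [Countable ι'] {e' : ι' → β'} {ν' : Measure β'} [CompleteSpace H]
    (hν : ν = Measure.sum fun k => Measure.dirac (e k)) (he : Function.Injective e)
    (hν' : ν' = Measure.sum fun k => Measure.dirac (e' k)) (L : Lp H 2 ν →L[ℂ] Lp H 2 ν')
    {Y : Type*} [MeasurableSpace Y] {m : Measure Y} {c : β → Y → H} {h : β' → Y → H}
    (hc : ∀ k, StronglyMeasurable (c (e k)))
    (hF : ∫⁻ y, (∑' k, ‖c (e k) y‖ₑ ^ 2) ^ (1 / 2 : ℝ) ∂m < ⊤)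
    (hh : ∀ᵐ y ∂m, L (famLp ν fun p => c p y) =ᵐ[ν'] fun q => h q y) :
    ∃ α : Lp H 2 ν, (α =ᵐ[ν] fun p => ∫ y, c p y ∂m) ∧ L α =ᵐ[ν'] fun q => ∫ y, h q y ∂m := by
  have hm := stronglyMeasurable_famLp hν he hc
  have hmem : ∀ᵐ y ∂m, MemLp (fun p => c p y) 2 ν := by
    have h1 : Measurable fun y => (∑' k, ‖c (e k) y‖ₑ ^ 2) ^ (1 / 2 : ℝ) :=
      (Measurable.tsum fun k => (hc k).enorm.pow_const 2).pow_const _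
    filter_upwards [ae_lt_top h1 hF.ne] with y hy
    rw [ENNReal.rpow_lt_top_iff_of_pos (by norm_num)] at hy
    exact memLp_sum_dirac hν hy
  have hi : Integrable (fun y => famLp ν fun p => c p y) m := by
    refine ⟨hm.aestronglyMeasurable, lt_of_le_of_lt (lintegral_mono_ae ?_) hF⟩
    filter_upwards [hmem] with y hy
    rw [← eLpNorm_sum_dirac hν fun p => c p y, ← eLpNorm_congr_ae (coeFn_famLp hy), Lp.enorm_def]
  -- The Bochner integral in `L²` commutes with `L` and with the evaluation at an atom; both are
  -- bounded.
  refine ⟨∫ y, famLp ν (fun p => c p y) ∂m, (ae_sum_dirac_iff hν).2 fun k => ?_,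
    (ae_sum_dirac_iff hν').2 fun k => ?_⟩
  · rw [← evalAt_apply hν, ← ContinuousLinearMap.integral_comp_comm _ hi]
    refine integral_congr_ae ?_
    filter_upwards [hmem] with y hy
    exact (ae_sum_dirac_iff hν).1 (coeFn_famLp hy) k
  · rw [← evalAt_apply hν', ← ContinuousLinearMap.integral_comp_comm _ hi,
      ← ContinuousLinearMap.integral_comp_comm _ (L.integrable_comp hi)]
    refine integral_congr_ae ?_
    filter_upwards [hh] with y hy
    exact (ae_sum_dirac_iff hν').1 hy k

end

/-! ### The frame of a fiber -/

section
variable {X : Type*} [MeasurableSpace X] [MeasurableSingletonClass X] {S : NoiseSpace X}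

instance (σ : Ch S) : Countable (fiber S σ) := (fiberEquiv S σ).symm.injective.countable

theorem fibM_prod_eq (σ ρ : Ch S) : (fibM S σ).prod (fibM S ρ) =
    Measure.sum fun k : fiber S σ × fiber S ρ => Measure.dirac ((k.1 : MCh S), (k.2 : MCh S)) := by
  refine Measure.ext fun s hs => ?_
  have hm : Measurable (s.indicator (1 : MCh S × MCh S → ℝ≥0∞)) := measurable_one.indicator hs
  rw [← lintegral_indicator_one hs, ← lintegral_indicator_one hs, lintegral_prod _ hm.aemeasurable,
    lintegral_fibM S _ (Measurable.lintegral_prod_right' hm), lintegral_sum_dirac rfl]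
  refine Eq.trans (tsum_congr fun y => ?_) (ENNReal.tsum_prod (f := fun (y : fiber S σ)
    (z : fiber S ρ) => s.indicator (1 : MCh S × MCh S → ℝ≥0∞) ((y : MCh S), (z : MCh S)))).symm
  exact lintegral_fibM S ρ (hm.comp measurable_prodMk_left)

theorem frame_injective (σ ρ : Ch S) : Function.Injective fun k : fiber S σ × fiber S ρ =>
    ((k.1 : MCh S), (k.2 : MCh S)) := fun k j h => by
  simp only [Prod.mk.injEq] at h
  exact Prod.ext (Subtype.ext h.1) (Subtype.ext h.2)

end

/-! ### The semitensor product -/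

section
variable {X : Type*} [MeasurableSpace X] [MeasurableSingletonClass X] {S : NoiseSpace X}
variable {H : Type*} [NormedAddCommGroup H] [InnerProductSpace ℂ H]

theorem lintegral_vecM_union_frame {κ σ κ' σ' : Ch S} (h : κ.Apart σ) (h' : κ'.Apart σ')
    {F : Triple S → ℝ≥0∞} (hF : Measurable F) :
    ∫⁻ z, F z ∂(vecM S (κ.union σ) (κ'.union σ')) = ∑' k : fiber S κ × fiber S κ',
      ∫⁻ z, F ((k.1 : MCh S).union z.1, (k.2 : MCh S).union z.2.1, z.2.2) ∂(vecM S σ σ') := by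
  have hm : Measurable fun p : MCh S × MCh S =>
      ∫⁻ z, F (p.1.union z.1, p.2.union z.2.1, z.2.2) ∂(vecM S σ σ') :=
    Measurable.lintegral_prod_right' (f := fun p : (MCh S × MCh S) × Triple S =>
      F (p.1.1.union p.2.1, p.1.2.union p.2.2.1, p.2.2.2)) (by fun_prop)
  rw [lintegral_vecM_union S h h' hF,
    ← lintegral_sum_dirac (fibM_prod_eq κ κ') fun p : MCh S × MCh S =>
      ∫⁻ z, F (p.1.union z.1, p.2.union z.2.1, z.2.2) ∂(vecM S σ σ'), lintegral_prod _ hm.aemeasurable]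

theorem ae_vecM_union {κ σ κ' σ' : Ch S} (h : κ.Apart σ) (h' : κ'.Apart σ') {P : Triple S → Prop}
    (hP : ∀ᵐ y ∂(vecM S (κ.union σ) (κ'.union σ')), P y) (k : fiber S κ × fiber S κ') :
    ∀ᵐ z ∂(vecM S σ σ'), P ((k.1 : MCh S).union z.1, (k.2 : MCh S).union z.2.1, z.2.2) := by
  obtain ⟨N, hN, hNm, hN0⟩ := exists_measurable_superset_of_null (ae_iff.1 hP)
  rw [← lintegral_indicator_one hNm,
    lintegral_vecM_union_frame h h' (measurable_one.indicator hNm), ENNReal.tsum_eq_zero] at hN0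
  have h1 := hN0 k
  have hm : Measurable (N.indicator (1 : Triple S → ℝ≥0∞)) := measurable_one.indicator hNm
  rw [lintegral_eq_zero_iff (by fun_prop)] at h1
  filter_upwards [h1] with z hz
  by_contra hc
  have : ((k.1 : MCh S).union z.1, (k.2 : MCh S).union z.2.1, z.2.2) ∈ N := hN hc
  simp [this] at hz

theorem ae_vecM_of_union {κ σ κ' σ' : Ch S} (h : κ.Apart σ) (h' : κ'.Apart σ') {P : Triple S → Prop}
    (hm : MeasurableSet {y | P y})
    (hP : ∀ k : fiber S κ × fiber S κ', ∀ᵐ z ∂(vecM S σ σ'),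
      P ((k.1 : MCh S).union z.1, (k.2 : MCh S).union z.2.1, z.2.2)) :
    ∀ᵐ y ∂(vecM S (κ.union σ) (κ'.union σ')), P y := by
  rw [ae_iff]
  change vecM S (κ.union σ) (κ'.union σ') {y | P y}ᶜ = 0
  rw [← lintegral_indicator_one hm.compl,
    lintegral_vecM_union_frame h h' (measurable_one.indicator hm.compl), ENNReal.tsum_eq_zero]
  intro k
  refine (lintegral_congr_ae ?_).trans lintegral_zero
  filter_upwards [hP k] with z hz
  exact indicator_of_notMem (not_not_intro hz) _

/-- The action of the semitensor product. -/
def OdotActs (κ ϑ χ : Table S) (L : Fib S H κ.ann κ.gau →L[ℂ] Fib S H κ.cre κ.gau) (T : Op S H ϑ)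
    (v : L0 S H χ.ann χ.gau) (out : L0 S H χ.cre χ.gau) : Prop :=
  ∃ u : MCh S × MCh S → Triple S → H,
    (∀ᵐ p ∂((fibM S κ.ann).prod (fibM S κ.gau)),
      Represents T (fun z => v (p.1.union z.1, p.2.union z.2.1, z.2.2)) (u p)) ∧
    ∀ᵐ z ∂(vecM S ϑ.cre ϑ.gau), ∃ α : Fib S H κ.ann κ.gau,
      (α =ᵐ[(fibM S κ.ann).prod (fibM S κ.gau)] fun p => u p z) ∧
      (L α =ᵐ[(fibM S κ.cre).prod (fibM S κ.gau)]
        fun q => out (q.1.union z.1, q.2.union z.2.1, z.2.2))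

variable {κ ϑ : Table S} {L : Fib S H κ.ann κ.gau →L[ℂ] Fib S H κ.cre κ.gau} {T : Op S H ϑ}

/-- As the chains are apart, a vector over `κ ⊔ ϑ` is determined, up to null sets, by its slices
over the countable frame of `κ`. For the zero vector all slices of `u` vanish, hence `α = 0` and `L
α = 0`, so the relation is single-valued. -/
theorem mem_graph_odot (h1 : κ.ann.Apart ϑ.ann) (h2 : κ.gau.Apart ϑ.gau) (h3 : κ.cre.Apart ϑ.cre)
    {v : L0 S H (κ.union ϑ).ann (κ.union ϑ).gau} {out : L0 S H (κ.union ϑ).cre (κ.union ϑ).gau} :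
    (v, out) ∈ (odot κ ϑ (κ.union ϑ) L T).graph ↔ OdotActs κ ϑ (κ.union ϑ) L T v out := by
  have hv : ∀ {v v' : Triple S → H}, v =ᵐ[vecM S (κ.union ϑ).ann (κ.union ϑ).gau] v' →
      ∀ᵐ p ∂((fibM S κ.ann).prod (fibM S κ.gau)),
        (fun z : Triple S => v (p.1.union z.1, p.2.union z.2.1, z.2.2)) =ᵐ[vecM S ϑ.ann ϑ.gau]
          fun z => v' (p.1.union z.1, p.2.union z.2.1, z.2.2) := fun h =>
    (ae_sum_dirac_iff (fibM_prod_eq κ.ann κ.gau)).2 fun k => ae_vecM_union h1 h2 h k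
  have ho : ∀ {v v' : Triple S → H}, v =ᵐ[vecM S (κ.union ϑ).cre (κ.union ϑ).gau] v' →
      ∀ᵐ z ∂(vecM S ϑ.cre ϑ.gau),
        (fun q : MCh S × MCh S => v (q.1.union z.1, q.2.union z.2.1, z.2.2))
          =ᵐ[(fibM S κ.cre).prod (fibM S κ.gau)]
            fun q => v' (q.1.union z.1, q.2.union z.2.1, z.2.2) := fun h => by
    filter_upwards [ae_all_iff.2 fun k => ae_vecM_union h3 h2 h k] with z hz
    exact (ae_sum_dirac_iff (fibM_prod_eq κ.cre κ.gau)).2 hz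
  refine mem_graph_ofRel (r := OdotActs κ ϑ (κ.union ϑ) L T) ?_ ?_ ?_ ?_
  · refine ⟨fun _ => 0, ?_, ?_⟩
    · filter_upwards [hv (AEEqFun.coeFn_zero (β := H))] with p hp
      exact represents_zero.congr hp.symm Filter.EventuallyEq.rfl
    · filter_upwards [ho (AEEqFun.coeFn_zero (β := H))] with z hz
      refine ⟨0, Lp.coeFn_zero .., ?_⟩
      rw [map_zero]
      exact (Lp.coeFn_zero ..).trans hz.symm
  · rintro a u b w ⟨f, f1, f2⟩ ⟨g, g1, g2⟩
    refine ⟨fun p => f p + g p, ?_, ?_⟩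
    · filter_upwards [f1, g1, hv (AEEqFun.coeFn_add a b)] with p hp hp' e
      exact (hp.add hp').congr (Filter.EventuallyEq.symm e) Filter.EventuallyEq.rfl
    · filter_upwards [f2, g2, ho (AEEqFun.coeFn_add u w)] with z ⟨α, α1, α2⟩ ⟨β, β1, β2⟩ e
      refine ⟨α + β, (Lp.coeFn_add _ _).trans (α1.add β1), ?_⟩
      rw [map_add]
      exact ((Lp.coeFn_add _ _).trans (α2.add β2)).trans e.symm
  · rintro k a u ⟨f, f1, f2⟩
    refine ⟨fun p => k • f p, ?_, ?_⟩
    · filter_upwards [f1, hv (AEEqFun.coeFn_smul k a)] with p hp e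
      exact (hp.smul k).congr (Filter.EventuallyEq.symm e) Filter.EventuallyEq.rfl
    · filter_upwards [f2, ho (AEEqFun.coeFn_smul k u)] with z ⟨α, α1, α2⟩ e
      refine ⟨k • α, (Lp.coeFn_smul _ _).trans (α1.const_smul k), ?_⟩
      rw [map_smul]
      exact ((Lp.coeFn_smul _ _).trans (α2.const_smul k)).trans e.symm
  · rintro out ⟨f, f1, f2⟩
    have e1 : ∀ᵐ z ∂(vecM S ϑ.cre ϑ.gau), ∀ k : fiber S κ.ann × fiber S κ.gau,
        f ((k.1 : MCh S), (k.2 : MCh S)) z = 0 := by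
      have h4 : ∀ᵐ p ∂((fibM S κ.ann).prod (fibM S κ.gau)), f p =ᵐ[vecM S ϑ.cre ϑ.gau] 0 := by
        filter_upwards [f1, hv (AEEqFun.coeFn_zero (β := H))] with p hp e
        exact hp.eq_zero e
      exact ae_all_iff.2 fun k => (ae_sum_dirac_iff (fibM_prod_eq κ.ann κ.gau)).1 h4 k
    have e2 : ∀ᵐ z ∂(vecM S ϑ.cre ϑ.gau), ∀ k : fiber S κ.cre × fiber S κ.gau,
        out ((k.1 : MCh S).union z.1, (k.2 : MCh S).union z.2.1, z.2.2) = 0 := by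
      filter_upwards [f2, e1] with z ⟨α, α1, α2⟩ hz k
      have : α = 0 := by
        refine Lp.ext (α1.trans (Filter.EventuallyEq.trans ?_ (Lp.coeFn_zero ..).symm))
        exact (ae_sum_dirac_iff (fibM_prod_eq κ.ann κ.gau)).2 hz
      rw [this, map_zero] at α2
      exact ((ae_sum_dirac_iff (fibM_prod_eq κ.cre κ.gau)).1
        ((Lp.coeFn_zero ..).symm.trans α2) k).symm
    refine AEEqFun.ext (Filter.EventuallyEq.trans ?_ AEEqFun.coeFn_zero.symm)
    exact ae_vecM_of_union h3 h2 (out.stronglyMeasurable.measurableSet_eq_fun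
      stronglyMeasurable_const) (ae_all_iff.1 e2)

theorem mem_graph_odot_empty {L : Fib S H κ.ann κ.gau →L[ℂ] Fib S H κ.cre κ.gau}
    {T : Op S H (Table.empty S)} {v : L0 S H κ.ann κ.gau} {out : L0 S H κ.cre κ.gau} :
    (v, out) ∈ (odot κ (Table.empty S) κ L T).graph ↔ OdotActs κ (Table.empty S) κ L T v out := by
  -- `κ ⊔ ∅` equals `κ` only by a theorem, and the types of the vectors depend on the table;
  -- generalising to `χ` allows substitution.
  have h : ∀ {χ : Table S} {v : L0 S H χ.ann χ.gau} {out : L0 S H χ.cre χ.gau},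
      κ.union (Table.empty S) = χ → ((v, out) ∈ (odot κ (Table.empty S) χ L T).graph ↔
        OdotActs κ (Table.empty S) χ L T v out) := by
    rintro χ v out rfl
    exact mem_graph_odot (Chain.apart_empty _) (Chain.apart_empty _) (Chain.apart_empty _)
  exact h (table_union_empty κ)

end

section
variable {X : Type*} [MeasurableSpace X] [MeasurableSingletonClass X] {S : NoiseSpace X}

/-! ### Point derivatives of vectors of finite norm -/

/-- The empty chain has mass one. Variables on which a statement does not depend can therefore be
removed from an iterated almost everywhere statement. -/
instance (t : ℝ) : (ae (chT S t)).NeBot := by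
  rw [ae_neBot]
  intro h
  have h1 := lintegral_chT_rec (S := S) t (F := fun _ => 1) measurable_const
  rw [h, lintegral_zero_measure] at h1
  exact one_ne_zero (le_antisymm (le_self_add.trans_eq h1.symm) zero_le)

theorem ae_ann_gau_of_tabT {t : ℝ} {p : Ch S → Ch S → Prop} (h : ∀ᵐ ϑ ∂(tabT S t), p ϑ.ann ϑ.gau) :
    ∀ᵐ ann ∂(chT S t), ∀ᵐ gau ∂(chT S t), p ann gau := by
  obtain ⟨tim, h1⟩ := (ae_tabT_iterated (p := fun ϑ => p ϑ.ann ϑ.gau) h).exists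
  filter_upwards [h1] with ann h2
  exact h2.exists.choose_spec

theorem lintegral_weighted_swap (s : ℝ) {W : Ch S × Ch S → ℝ≥0∞} (hW : Measurable W) (b c : ℝ≥0∞) :
    ∫⁻ σ, b ^ σ.len * ∫⁻ ρ, c ^ ρ.len * W (σ, ρ) ∂(chT S s) ∂(chT S s) =
      ∫⁻ ρ, c ^ ρ.len * ∫⁻ σ, b ^ σ.len * W (σ, ρ) ∂(chT S s) ∂(chT S s) := by
  have e1 : ∀ σ, b ^ σ.len * ∫⁻ ρ, c ^ ρ.len * W (σ, ρ) ∂(chT S s) =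
      ∫⁻ ρ, b ^ σ.len * (c ^ ρ.len * W (σ, ρ)) ∂(chT S s) := fun σ =>
    (lintegral_const_mul _ (by fun_prop)).symm
  have e2 : ∀ ρ, c ^ ρ.len * ∫⁻ σ, b ^ σ.len * W (σ, ρ) ∂(chT S s) =
      ∫⁻ σ, c ^ ρ.len * (b ^ σ.len * W (σ, ρ)) ∂(chT S s) := fun ρ =>
    (lintegral_const_mul _ (by fun_prop)).symm
  simp_rw [e1, e2]
  rw [lintegral_lintegral_swap (by fun_prop)]
  refine lintegral_congr fun ρ => lintegral_congr fun σ => by ring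

/-- The point `x` is the latest point of the first chain, so integrating over `x` gives at most the
original integral. The new point costs one factor `b`, and restricting `ρ` to times before `t(x)`
only decreases the integral. -/
theorem ae_lintegral_single_union_lt_top {t : ℝ} {W : Ch S × Ch S → ℝ≥0∞} (hW : Measurable W)
    {b c : ℝ≥0∞} (hb : b ≠ 0)
    (h : ∫⁻ σ, b ^ σ.len * ∫⁻ ρ, c ^ ρ.len * W (σ, ρ) ∂(chT S t) ∂(chT S t) < ⊤) :
    ∀ᵐ x ∂(S.μ.restrict (S.before t)), ∫⁻ σ, b ^ σ.len * ∫⁻ ρ, c ^ ρ.len *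
      W ((Chain.single S.time x).union σ, ρ) ∂(chT S (S.time x)) ∂(chT S (S.time x)) < ⊤ := by
  let G : Ch S → ℝ≥0∞ := fun σ => b ^ σ.len * ∫⁻ ρ, c ^ ρ.len * W (σ, ρ) ∂(chT S t)
  have hG : Measurable G := by fun_prop
  have hm : Measurable fun x => ∫⁻ σ, G ((Chain.single S.time x).union σ) ∂(chT S (S.time x)) :=
    measurable_lintegral_chT (F := fun p : X × Ch S => G ((Chain.single S.time p.1).union p.2))
      (by fun_prop) S.measurable_time
  filter_upwards [ae_lt_top hm ((lintegral_single_union_le t hG).trans_lt h).ne,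
    ae_restrict_mem (measurableSet_before S t)] with x hx hxt
  have h2 : b * ∫⁻ σ, b ^ σ.len * ∫⁻ ρ, c ^ ρ.len *
      W ((Chain.single S.time x).union σ, ρ) ∂(chT S (S.time x)) ∂(chT S (S.time x)) ≤
      ∫⁻ σ, G ((Chain.single S.time x).union σ) ∂(chT S (S.time x)) := by
    refine (lintegral_const_mul_le _ _).trans (lintegral_mono_ae ?_)
    filter_upwards [ae_restrict_of_ae (ae_apart_ch S (Chain.single S.time x))] with σ hσ
    simp only [G]
    rw [Chain.len_union hσ, pow_add, ← mul_assoc]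
    refine mul_le_mul' (le_of_eq ?_) (lintegral_mono' (chT_mono (le_of_lt hxt)) le_rfl)
    rw [show (Chain.single S.time x).len = 1 from rfl, pow_one]
  by_contra hc
  rw [not_lt, top_le_iff] at hc
  rw [hc, ENNReal.mul_top hb] at h2
  exact hx.ne (top_le_iff.1 h2)

variable {H : Type*} [NormedAddCommGroup H] {η : Weights} {t : ℝ}

/-- The substitute for a finite norm of `ȧ(x)`. The norm at time `t(x)` involves only absorbed
points before `x`, so an annihilation or gauge point `x` is the latest point of its chain in the
norm of `a` at time `t`. For creation and time points nothing is absorbed at `x` and monotonicity in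
time is enough. -/
theorem ae_adaptedSq_deriv_lt_top {a : Triple S → H} (ha : StronglyMeasurable a)
    (h : adaptedSq t (Table.empty S) η (fun z => ‖a z‖ₑ) < ⊤) (i : Pos) :
    ∀ᵐ x ∂(S.μ.restrict (S.before t)), adaptedSq (S.time x) (Table.elem S i x) η
      (fun z => ‖deriv (Table.empty S) a z‖ₑ) < ⊤ := by
  let W : Ch S × Ch S → ℝ≥0∞ := fun x => wsq S η.upPlus x.1 x.2
    fun z => ‖deriv (Table.empty S) a z‖ₑ
  have hd : StronglyMeasurable (deriv (Table.empty S) a) := stronglyMeasurable_deriv ha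
  have hW : Measurable W := measurable_lintegral_vecM S (Ω := Ch S × Ch S)
    (G := fun x => ENNReal.ofReal η.upPlus ^ x.2.2.2.len * ‖deriv (Table.empty S) a x.2‖ₑ ^ 2)
    (by have := hd.enorm; fun_prop) (by fun_prop) (by fun_prop)
  have hW0 : ∫⁻ σ, ENNReal.ofReal η.upMinus ^ σ.len * ∫⁻ ρ, ENNReal.ofReal η.upZero ^ ρ.len *
      W ((Chain.empty S.time).union σ, (Chain.empty S.time).union ρ) ∂(chT S t) ∂(chT S t) < ⊤ := h
  simp only [Chain.empty_union] at hW0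
  have key : ∀ᵐ x ∂(S.μ.restrict (S.before t)), ∫⁻ σ, ENNReal.ofReal η.upMinus ^ σ.len *
      ∫⁻ ρ, ENNReal.ofReal η.upZero ^ ρ.len * W ((Table.elem S i x).ann.union σ,
        (Table.elem S i x).gau.union ρ) ∂(chT S (S.time x)) ∂(chT S (S.time x)) < ⊤ := by
    have hmono : ∀ᵐ x ∂(S.μ.restrict (S.before t)), ∫⁻ σ, ENNReal.ofReal η.upMinus ^ σ.len *
        ∫⁻ ρ, ENNReal.ofReal η.upZero ^ ρ.len * W ((Chain.empty S.time).union σ,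
          (Chain.empty S.time).union ρ) ∂(chT S (S.time x)) ∂(chT S (S.time x)) < ⊤ := by
      filter_upwards [ae_restrict_mem (measurableSet_before S t)] with x hx
      have hx' := chT_mono (S := S) (le_of_lt hx)
      simp only [Chain.empty_union]
      refine (lintegral_mono' hx' fun σ => ?_).trans_lt hW0
      exact mul_le_mul_right (lintegral_mono' hx' le_rfl) _
    cases i
    · have h1 := ae_lintegral_single_union_lt_top hW
        (by simpa using η.upMinus_pos) hW0
      filter_upwards [h1] with x hx
      change ∫⁻ σ, ENNReal.ofReal η.upMinus ^ σ.len * ∫⁻ ρ, ENNReal.ofReal η.upZero ^ ρ.len *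
        W ((Chain.single S.time x).union σ, (Chain.empty S.time).union ρ)
          ∂(chT S (S.time x)) ∂(chT S (S.time x)) < ⊤
      simpa only [Chain.empty_union] using hx
    -- For a gauge point the two integrals are exchanged, so that the chain receiving the point is
    -- the outer one.
    · rw [lintegral_weighted_swap t hW] at hW0
      have hW' : Measurable fun x : Ch S × Ch S => W (x.2, x.1) := hW.comp measurable_swap
      have h1 := ae_lintegral_single_union_lt_top hW'
        (by simpa using η.upZero_pos) hW0
      filter_upwards [h1] with x hx
      rw [lintegral_weighted_swap (S.time x) (W := fun p => W ((Table.elem S .gau x).ann.union p.1,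
        (Table.elem S .gau x).gau.union p.2)) (by fun_prop)]
      change ∫⁻ ρ, ENNReal.ofReal η.upZero ^ ρ.len * ∫⁻ σ, ENNReal.ofReal η.upMinus ^ σ.len *
        W ((Chain.empty S.time).union σ, (Chain.single S.time x).union ρ)
          ∂(chT S (S.time x)) ∂(chT S (S.time x)) < ⊤
      simpa only [Chain.empty_union] using hx
    · exact hmono
    · exact hmono
  filter_upwards [key, deriv_deriv (t := t) a i] with x hx hd2
  refine lt_of_eq_of_lt ?_ hx
  have h2 := ae_ann_gau_of_tabT (p := fun σ ρ => deriv (Table.elem S i x) (deriv (Table.empty S) a)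
      =ᵐ[vecM S ((Table.elem S i x).ann.union σ) ((Table.elem S i x).gau.union ρ)]
        deriv (Table.empty S) a) hd2
  refine lintegral_congr_ae ?_
  filter_upwards [h2] with σ h3
  congr 1
  refine lintegral_congr_ae ?_
  filter_upwards [h3] with ρ h4
  congr 1
  exact wsq_congr (h4.mono fun z hz => congrArg (fun y : H => ‖y‖ₑ) hz)

end

section
variable {X : Type*} [MeasurableSpace X] [MeasurableSingletonClass X] {S : NoiseSpace X}
variable {H : Type*} [NormedAddCommGroup H]

/-! ### Components of vectors in a frame -/

/-- The component of `d` at the frame vector `p`. -/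
def component (d : Triple S → H) (p : MCh S × MCh S) : Triple S → H := fun z =>
  d (p.1.union z.1, p.2.union z.2.1, z.2.2)

theorem stronglyMeasurable_component {d : Triple S → H} (hd : StronglyMeasurable d)
    (p : MCh S × MCh S) : StronglyMeasurable (component d p) :=
  hd.comp_measurable (by fun_prop)

theorem wsq_tsum {ι : Type*} [Countable ι] (ξ : ℝ) (σ ρ : Ch S) {c : ι → Triple S → ℝ≥0∞}
    (hc : ∀ k, Measurable (c k)) :
    wsq S ξ σ ρ (fun z => (∑' k, c k z ^ 2) ^ (1 / 2 : ℝ)) = ∑' k, wsq S ξ σ ρ (c k) := by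
  simp only [wsq, rpow_half_sq]
  rw [← lintegral_tsum fun k => by have := hc k; fun_prop]
  simp only [ENNReal.tsum_mul_left]

theorem deriv_component {κ : Table S} {σ ρ : Ch S} (h1 : κ.ann.Apart σ) (h2 : κ.gau.Apart ρ)
    (d : Triple S → H) (k : fiber S κ.ann × fiber S κ.gau) :
    component (deriv κ d) ((k.1 : MCh S), (k.2 : MCh S)) =ᵐ[vecM S σ ρ]
      deriv (Table.empty S) (component d ((k.1 : MCh S), (k.2 : MCh S))) := by
  filter_upwards [ae_vecM S] with z hz
  obtain ⟨a1, a2⟩ := inCh_union S h1 k.1.2 hz.1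
  obtain ⟨b1, b2⟩ := inCh_union S h2 k.2.2 hz.2.1
  change d (pull S κ.ann κ.gau _) =
    component d _ (pull S (Chain.empty S.time) (Chain.empty S.time) z)
  rw [pull_empty]
  simp only [component, pull, a1, a2, b1, b2, Chain.union_empty]

/-- The norm of all components. -/
def frameNorm (σ ρ : Ch S) (d : Triple S → H) (z : Triple S) : ℝ≥0∞ :=
  (∑' k : fiber S σ × fiber S ρ, ‖component d ((k.1 : MCh S), (k.2 : MCh S)) z‖ₑ ^ 2) ^ (1 / 2 : ℝ)

theorem measurable_frameNorm (σ ρ : Ch S) {d : Triple S → H} (hd : StronglyMeasurable d) :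
    Measurable (frameNorm σ ρ d) :=
  (Measurable.tsum fun _ => (stronglyMeasurable_component hd _).enorm.pow_const 2).pow_const _

theorem wsq_deriv_frameNorm {κ : Table S} {σ ρ : Ch S} (h1 : κ.ann.Apart σ) (h2 : κ.gau.Apart ρ)
    {d : Triple S → H} (hd : StronglyMeasurable d) (ξ : ℝ) :
    wsq S ξ (κ.ann.union σ) (κ.gau.union ρ) (fun z => ‖d (pull S κ.ann κ.gau z)‖ₑ) =
      wsq S ξ σ ρ (fun z => frameNorm κ.ann κ.gau d
        (pull S (Chain.empty S.time) (Chain.empty S.time) z)) := by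
  have hm : Measurable fun z => ENNReal.ofReal ξ ^ z.2.2.len * ‖deriv κ d z‖ₑ ^ 2 := by
    have := (stronglyMeasurable_deriv (κ := κ) hd).enorm
    fun_prop
  simp only [frameNorm]
  rw [wsq_tsum ξ σ ρ (c := fun (k : fiber S κ.ann × fiber S κ.gau) z =>
    ‖component d ((k.1 : MCh S), (k.2 : MCh S))
      (pull S (Chain.empty S.time) (Chain.empty S.time) z)‖ₑ) fun k =>
    (stronglyMeasurable_deriv (κ := Table.empty S) (stronglyMeasurable_component hd _)).enorm]
  refine (lintegral_vecM_union_frame h1 h2 hm).trans (tsum_congr fun k => ?_)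
  refine lintegral_congr_ae ?_
  filter_upwards [deriv_component h1 h2 d k] with z hz
  have hz' : ‖deriv κ d ((k.1 : MCh S).union z.1, (k.2 : MCh S).union z.2.1, z.2.2)‖ₑ =
    ‖component d ((k.1 : MCh S), (k.2 : MCh S))
      (pull S (Chain.empty S.time) (Chain.empty S.time) z)‖ₑ := congrArg (fun y : H => ‖y‖ₑ) hz
  simp only [hz']

/-- Parseval over the frame of `κ`: a vector over `κ` can be replaced by the `ℓ²` norm of its
components, a function over the empty table, to which the estimate for `B` itself applies. -/
theorem adaptedSq_frameNorm {s : ℝ} {κ : Table S} {η : Weights} {d : Triple S → H}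
    (hd : StronglyMeasurable d) : adaptedSq s (Table.empty S) η (frameNorm κ.ann κ.gau d) =
      adaptedSq s κ η (fun z => ‖d z‖ₑ) := by
  unfold adaptedSq
  refine lintegral_congr_ae ?_
  filter_upwards [ae_restrict_of_ae (ae_apart_ch S κ.ann)] with σ h1
  congr 1
  refine lintegral_congr_ae ?_
  filter_upwards [ae_restrict_of_ae (ae_apart_ch S κ.gau)] with ρ h2
  have e : ∀ τ : Ch S, (Chain.empty S.time).union τ = τ := Chain.empty_union
  rw [wsq_deriv_frameNorm h1 h2 hd]
  change _ * wsq S _ ((Chain.empty S.time).union σ) ((Chain.empty S.time).union ρ) _ = _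
  rw [e, e]

theorem ae_tabT_apart (s : ℝ) (κ : Table S) : ∀ᵐ ϑ ∂(tabT S s),
    κ.ann.Apart ϑ.ann ∧ κ.gau.Apart ϑ.gau ∧ κ.cre.Apart ϑ.cre := by
  have hm : ∀ σ : Ch S, Measurable fun τ : Ch S => (σ, τ) := fun σ => by fun_prop
  have ha : ∀ σ : Ch S, MeasurableSet {τ : Ch S | σ.Apart τ} := fun σ =>
    (Chain.measurableSet_apart S.measurable_time).preimage (hm σ)
  have m1 : Measurable fun ϑ : Table S => ϑ.ann := by fun_prop
  have m2 : Measurable fun ϑ : Table S => ϑ.gau := by fun_prop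
  have m3 : Measurable fun ϑ : Table S => ϑ.cre := by fun_prop
  refine ae_tabT_of_iterated (((ha κ.ann).preimage m1).inter
    (((ha κ.gau).preimage m2).inter ((ha κ.cre).preimage m3))) ?_
  refine Filter.Eventually.of_forall fun tim => ?_
  filter_upwards [ae_restrict_of_ae (ae_apart_ch S κ.ann)] with ann h1
  filter_upwards [ae_restrict_of_ae (ae_apart_ch S κ.cre)] with cre h2
  filter_upwards [ae_restrict_of_ae (ae_apart_ch S κ.gau)] with gau h3
  exact ⟨h1, h3, h2⟩

/-- The table and the argument with the components `p` added. -/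
def shiftComp (p : MCh S × MCh S) (y : Table S × Triple S) : Table S × Triple S :=
  (y.1, (p.1.union y.2.1, p.2.union y.2.2.1, y.2.2.2))

theorem measurable_shiftComp (p : MCh S × MCh S) : Measurable (shiftComp (S := S) p) := by
  unfold shiftComp; fun_prop

variable [InnerProductSpace ℂ H]

theorem multFun_union (s : ℝ) {f : Table S → Triple S → H}
    (hf : StronglyMeasurable (Function.uncurry f)) (p : MCh S × MCh S) {z : Triple S}
    (h1 : z.1 = Chain.empty S.markedTime) (h2 : z.2.1 = Chain.empty S.markedTime) :
    multFun s f (p.1.union z.1, p.2.union z.2.1, z.2.2) =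
      ∫ y, Function.uncurry f (shiftComp p y) ∂(partM S s z) := by
  have e : partM S s (p.1.union z.1, p.2.union z.2.1, z.2.2) =
      (partM S s z).map (shiftComp p) := by
    refine Measure.ext_of_lintegral _ fun G hG => ?_
    rw [lintegral_map hG (measurable_shiftComp p), lintegral_partM S s _ hG]
    refine Eq.trans ?_ (lintegral_partM S s z (hG.comp (measurable_shiftComp p))).symm
    refine Finset.sum_congr rfl fun P _ => lintegral_congr fun r => ?_
    simp only [splitPt, shiftComp, Function.comp_apply, h1, h2, Chain.empty_union, Chain.union_empty]
  rw [multFun, e, integral_map (measurable_shiftComp p).aemeasurable hf.aestronglyMeasurable]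

/-! ### The semitensor product of a bounded operator and a multiple integral -/

variable [CompleteSpace H] {s : ℝ} {κ : Table S} {B : OpFun S H} {η : Weights} {ξp ξm : ℝ}
  {E : Ch S × Ch S × Ch S → ℝ≥0∞}

/-- The operators `B(ϑ)` are applied to each component separately. Their bounds are uniform in the
component, so the squares add up and the basic estimate gives integrability of the `ℓ²` norm of the
whole family, as needed for a Bochner integral in `L²`. -/
theorem Good.exists_components (hG : Good s (Table.empty S) B η E) (hA : Admissible η ξp ξm)
    {d : Triple S → H} (hd : StronglyMeasurable d)
    (hfin : adaptedSq s κ η (fun z => ‖d z‖ₑ) < ⊤) :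
    ∃ g : fiber S κ.ann × fiber S κ.gau → Table S → Triple S → H,
      (∀ k, StronglyMeasurable (Function.uncurry (g k))) ∧
      (∀ k, ∀ᵐ ϑ ∂(tabT S s), Represents (B ((Table.empty S).union ϑ))
        (deriv (Table.empty S) (component d ((k.1 : MCh S), (k.2 : MCh S)))) (g k ϑ)) ∧
      ∀ᵐ q ∂(vecM S (Chain.empty S.time) (Chain.empty S.time)),
        ∫⁻ y, (∑' k, ‖Function.uncurry (g k) y‖ₑ ^ 2) ^ (1 / 2 : ℝ) ∂(partM S s q) < ⊤ := by
  have hfr := measurable_frameNorm κ.ann κ.gau hd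
  have hfin' : adaptedSq s (Table.empty S) η (frameNorm κ.ann κ.gau d) < ⊤ := by
    rwa [adaptedSq_frameNorm hd]
  have hw : ∀ ϑ : Table S, wsq S η.upPlus ((Table.empty S).union ϑ).ann ((Table.empty S).union ϑ).gau
      (fun z => frameNorm κ.ann κ.gau d (pull S (Table.empty S).ann (Table.empty S).gau z)) =
      ∑' k : fiber S κ.ann × fiber S κ.gau,
        gnorm S η.upPlus ((Table.empty S).union ϑ).ann ((Table.empty S).union ϑ).gau
          (deriv (Table.empty S) (component d ((k.1 : MCh S), (k.2 : MCh S)))) ^ 2 := by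
    intro ϑ
    simp only [frameNorm, gnorm_sq]
    exact wsq_tsum _ _ _ (c := fun (k : fiber S κ.ann × fiber S κ.gau) z =>
      ‖component d ((k.1 : MCh S), (k.2 : MCh S))
        (pull S (Chain.empty S.time) (Chain.empty S.time) z)‖ₑ) fun k =>
      (stronglyMeasurable_deriv (κ := Table.empty S) (stronglyMeasurable_component hd _)).enorm
  have hlt : ∀ᵐ ϑ ∂(tabT S s), ∀ k : fiber S κ.ann × fiber S κ.gau,
      gnorm S η.upPlus ((Table.empty S).union ϑ).ann ((Table.empty S).union ϑ).gau
        (deriv (Table.empty S) (component d ((k.1 : MCh S), (k.2 : MCh S)))) < ⊤ := by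
    filter_upwards [ae_wsq_pull_lt_top hfr hfin'] with ϑ hϑ k
    rw [hw] at hϑ
    exact (ENNReal.pow_lt_top_iff (n := 2)).1 ((ENNReal.le_tsum k).trans_lt hϑ) |>.resolve_right
      (by norm_num)
  have hex := fun k : fiber S κ.ann × fiber S κ.gau =>
    hG.field (component d ((k.1 : MCh S), (k.2 : MCh S))) (stronglyMeasurable_component hd _)
      (hlt.mono fun ϑ h => h k)
  choose g hg hgr using hex
  refine ⟨g, hg, hgr, ?_⟩
  have hF : Measurable fun y : Table S × Triple S =>
      (∑' k, ‖Function.uncurry (g k) y‖ₑ ^ 2) ^ (1 / 2 : ℝ) :=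
    (Measurable.tsum fun k => (hg k).enorm.pow_const 2).pow_const _
  refine lintegral_partM_lt_top S (κ := Table.empty S) hA.pos hF ?_
  -- The estimate is applied once to the `ℓ²` norm of all components; applied to single components
  -- it would not give integrability of the sum.
  have h1 := wsq_partM_le_adaptedSq S (κ := Table.empty S) (t := s) hA.pos hA.lo hG.measurable hfr hF ?_
  · have h2 : (bnd S s η E * adaptedSq s (Table.empty S) η (frameNorm κ.ann κ.gau d) ^ (1 / 2 : ℝ)) < ⊤ :=
      ENNReal.mul_lt_top hG.finite (ENNReal.rpow_lt_top_of_nonneg (by norm_num) hfin'.ne)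
    exact (ENNReal.rpow_lt_top_iff_of_pos (by norm_num)).1 (h1.trans_lt h2)
  · filter_upwards [hG.bound, hlt, ae_all_iff.2 hgr] with ϑ h1 h2 h3
    have h4 : wsq S η.loMinus ((Table.empty S).cre.union ϑ.cre) ((Table.empty S).gau.union ϑ.gau)
        (fun z => (∑' k, ‖g k ϑ z‖ₑ ^ 2) ^ (1 / 2 : ℝ)) = ∑' k,
          gnorm S η.loMinus ((Table.empty S).union ϑ).cre ((Table.empty S).union ϑ).gau (g k ϑ) ^ 2 := by
      simp only [gnorm_sq]
      exact wsq_tsum _ _ _ (c := fun k z => ‖g k ϑ z‖ₑ) fun k =>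
        ((hg k).comp_measurable measurable_prodMk_left).enorm
    refine h4.trans_le ?_
    refine le_trans ?_ (mul_le_mul' h1 (hw ϑ).ge)
    rw [← ENNReal.tsum_mul_left]
    refine ENNReal.tsum_le_tsum fun k => ?_
    rw [← mul_pow]
    exact pow_le_pow_left₀ zero_le ((h3 k).gnorm_le η.upPlus_pos (h2 k)) 2

end

section
variable {X : Type*} [MeasurableSpace X] [MeasurableSingletonClass X] {S : NoiseSpace X}
variable {H : Type*} [NormedAddCommGroup H] [InnerProductSpace ℂ H] [CompleteSpace H]
variable {s t : ℝ} {κ : Table S} {B : OpFun S H} {η : Weights} {ξp ξm : ℝ}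
  {E : Ch S × Ch S × Ch S → ℝ≥0∞}

/-- The components of the value of a field which solves the recurrence. -/
theorem ae_components_eq {ϑ : Table S} {L : Fib S H κ.ann κ.gau →L[ℂ] Fib S H κ.cre κ.gau}
    (hap : κ.ann.Apart ϑ.ann ∧ κ.gau.Apart ϑ.gau ∧ κ.cre.Apart ϑ.cre)
    (hrec : AgreeOn η.upPlus (B (κ.union ϑ)) (odot κ ϑ (κ.union ϑ) L (B ϑ)))
    {d : Triple S → H} (hd : StronglyMeasurable d)
    (hfin : gnorm S η.upPlus (κ.union ϑ).ann (κ.union ϑ).gau (deriv κ d) < ⊤) {f : Triple S → H}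
    (hf : Represents (B (κ.union ϑ)) (deriv κ d) f)
    {g : fiber S κ.ann × fiber S κ.gau → Triple S → H}
    (hg : ∀ k, Represents (B ϑ)
      (deriv (Table.empty S) (component d ((k.1 : MCh S), (k.2 : MCh S)))) (g k))
    {c : MCh S × MCh S → Triple S → H} (hc : ∀ k : fiber S κ.ann × fiber S κ.gau,
      c ((k.1 : MCh S), (k.2 : MCh S)) = g k) :
    ∀ᵐ z ∂(vecM S ϑ.cre ϑ.gau), ∀ j : fiber S κ.cre × fiber S κ.gau,
      evalAt (fibM_prod_eq κ.cre κ.gau) j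
        (L (famLp ((fibM S κ.ann).prod (fibM S κ.gau)) fun p => c p z)) =
          f ((j.1 : MCh S).union z.1, (j.2 : MCh S).union z.2.1, z.2.2) := by
  obtain ⟨a1, a2, a3⟩ := hap
  have hd' := stronglyMeasurable_deriv (κ := κ) hd
  have ev := AEEqFun.coeFn_mk _ (hd'.aestronglyMeasurable
    (μ := vecM S (κ.union ϑ).ann (κ.union ϑ).gau))
  obtain ⟨out, ho, ho2⟩ := hrec (AEEqFun.mk _ hd'.aestronglyMeasurable) (by
    rw [InG, gnorm_congr ev]; exact hfin)
  have eo : out =ᵐ[vecM S (κ.union ϑ).cre (κ.union ϑ).gau] f :=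
    (represents_coe.2 ho).unique hf ev
  obtain ⟨u, hu1, hu2⟩ := (mem_graph_odot a1 a2 a3).1 ho2
  have h1 : ∀ k : fiber S κ.ann × fiber S κ.gau,
      u ((k.1 : MCh S), (k.2 : MCh S)) =ᵐ[vecM S ϑ.cre ϑ.gau] g k := by
    intro k
    refine ((ae_sum_dirac_iff (fibM_prod_eq κ.ann κ.gau)).1 hu1 k).unique (hg k) ?_
    exact Filter.EventuallyEq.trans (ae_vecM_union a1 a2 ev k) (deriv_component a1 a2 d k)
  filter_upwards [hu2, ae_all_iff.2 h1, ae_all_iff.2 fun k => ae_vecM_union a3 a2 eo k]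
    with z ⟨α, α1, α2⟩ h2 h3 j
  have h4 : α = famLp ((fibM S κ.ann).prod (fibM S κ.gau)) fun p => c p z := by
    refine eq_famLp (α1.trans ((ae_sum_dirac_iff (fibM_prod_eq κ.ann κ.gau)).2 fun k => ?_))
    exact (h2 k).trans (congrFun (hc k) z).symm
  rw [← h4, evalAt_apply, (ae_sum_dirac_iff (fibM_prod_eq κ.cre κ.gau)).1 α2 j]
  exact h3 j

theorem ae_component_congr {σ ρ : Ch S} {v v' : Triple S → H} (h : v =ᵐ[vecM S σ ρ] v')
    (k : fiber S σ × fiber S ρ) : component v ((k.1 : MCh S), (k.2 : MCh S))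
      =ᵐ[vecM S (Chain.empty S.time) (Chain.empty S.time)]
        component v' ((k.1 : MCh S), (k.2 : MCh S)) := by
  refine ae_vecM_union (P := fun z => v z = v' z) (Chain.apart_empty σ) (Chain.apart_empty ρ) ?_ k
  rwa [Chain.union_empty, Chain.union_empty]

/-- The recurrence says that, for almost every table and argument, `L` maps the family of components
of the fields for `B(ϑ)` to the components of the field for `B(κ ⊔ ϑ)`. Integrating these families
over `partM` and commuting `L` with the integral shows that `L`, applied to the components of `U` on
`d`, gives the multiple integral of `f`. -/
theorem Good.represents_odot (hG : Good s (Table.empty S) B η E) (hA : Admissible η ξp ξm)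
    {L : Fib S H κ.ann κ.gau →L[ℂ] Fib S H κ.cre κ.gau}
    (hrec : ∀ᵐ ϑ ∂(tabT S s), AgreeOn η.upPlus (B (κ.union ϑ)) (odot κ ϑ (κ.union ϑ) L (B ϑ)))
    {d : Triple S → H} (hd : StronglyMeasurable d)
    (hfin : adaptedSq s κ η (fun z => ‖d z‖ₑ) < ⊤)
    {f : Table S → Triple S → H} (hf : StronglyMeasurable (Function.uncurry f))
    (hr : ∀ᵐ ϑ ∂(tabT S s), Represents (B (κ.union ϑ)) (deriv κ d) (f ϑ)) :
    Represents (odot κ (Table.empty S) κ L (qsInt s B)) d (multFun s f) := by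
  obtain ⟨g, hg, hgr, hint⟩ := hG.exists_components hA hd hfin
  let fr : fiber S κ.ann × fiber S κ.gau → MCh S × MCh S := fun k => ((k.1 : MCh S), (k.2 : MCh S))
  -- The components are indexed by the frame, whereas elements of `Fib` are functions of arbitrary
  -- pairs of marked chains; off the frame, a null set, the value is zero.
  let c : MCh S × MCh S → Table S × Triple S → H :=
    Function.extend fr (fun k => Function.uncurry (g k)) 0
  have hc : ∀ k, c (fr k) = Function.uncurry (g k) := fun k =>
    (frame_injective κ.ann κ.gau).extend_apply _ _ k
  let ν := (fibM S κ.ann).prod (fibM S κ.gau)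
  have hcm : ∀ k, StronglyMeasurable (c (fr k)) := fun k => by rw [hc]; exact hg k
  have hLm : StronglyMeasurable fun y => L (famLp ν fun p => c p y) :=
    L.continuous.comp_stronglyMeasurable
      (stronglyMeasurable_famLp (fibM_prod_eq κ.ann κ.gau) (frame_injective κ.ann κ.gau) hcm)
  -- The recurrence holds for almost every table and then almost every argument; `thetaM` converts
  -- this into almost every `q` and almost every point under the sum over its parts. Measurability
  -- of the condition comes from `famLp` depending measurably on the point.
  have hcond : ∀ᵐ q ∂(vecM S (Chain.empty S.time) (Chain.empty S.time)),
      ∀ᵐ y ∂(partM S s q), ∀ j : fiber S κ.cre × fiber S κ.gau,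
        evalAt (fibM_prod_eq κ.cre κ.gau) j (L (famLp ν fun p => c p y)) =
          Function.uncurry f (shiftComp ((j.1 : MCh S), (j.2 : MCh S)) y) := by
    refine ae_thetaM_partM S (ae_thetaM_of_vecM S ?_ ?_)
    · rw [ofPred_forall]
      refine MeasurableSet.iInter fun j => StronglyMeasurable.measurableSet_eq_fun
        ((evalAt (fibM_prod_eq κ.cre κ.gau) j).continuous.comp_stronglyMeasurable hLm)
        (hf.comp_measurable (measurable_shiftComp _))
    · simp only [Chain.empty_union]
      filter_upwards [ae_tabT_apart s κ, hrec, hr, ae_all_iff.2 hgr,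
        ae_wsq_pull_lt_top (t := s) hd.enorm hfin] with ϑ h1 h2 h3 h4 h5
      have h4' : ∀ k, Represents (B ϑ) (deriv (Table.empty S) (component d (fr k))) (g k ϑ) :=
        fun k => by
          have h6 := h4 k
          rwa [empty_table_union] at h6
      exact ae_components_eq h1 h2 hd (gnorm_lt_top_iff.2 h5) h3 h4' (c := fun p z => c p (ϑ, z))
        fun k => by
          funext z
          exact congrFun (hc k) (ϑ, z)
  have hu := stronglyMeasurable_multFun s hf
  have ev := AEEqFun.coeFn_mk _ (hd.aestronglyMeasurable (μ := vecM S κ.ann κ.gau))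
  have eu := AEEqFun.coeFn_mk _ (hu.aestronglyMeasurable (μ := vecM S κ.cre κ.gau))
  refine ⟨(AEEqFun.mk _ hd.aestronglyMeasurable, AEEqFun.mk _ hu.aestronglyMeasurable),
    mem_graph_odot_empty.2 ⟨fun p q => ∫ y, c p y ∂(partM S s q), ?_, ?_⟩, ev, eu⟩
  · refine (ae_sum_dirac_iff (fibM_prod_eq κ.ann κ.gau)).2 fun k => ?_
    have h1 : Represents (qsInt s B) (component d (fr k)) (multFun s (g k)) := by
      refine represents_multInt (stronglyMeasurable_component hd _) (hg k) (hgr k) ?_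
      filter_upwards [hint] with q hq
      refine ⟨(hg k).aestronglyMeasurable, lt_of_le_of_lt (lintegral_mono fun y => ?_) hq⟩
      rw [← sq_rpow_half ‖Function.uncurry (g k) y‖ₑ]
      exact ENNReal.rpow_le_rpow (ENNReal.le_tsum k) (by norm_num)
    refine h1.congr (ae_component_congr ev k).symm (Filter.EventuallyEq.of_eq (funext fun q => ?_))
    exact congrArg (fun w : Table S × Triple S → H => ∫ y, w y ∂(partM S s q)) (hc k).symm
  · filter_upwards [hint, hcond, ae_pull_empty S, ae_all_iff.2 fun k => ae_component_congr eu k]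
      with q h1 h2 h3 h4
    obtain ⟨α, α1, α2⟩ := exists_integral_famLp (fibM_prod_eq κ.ann κ.gau)
      (frame_injective κ.ann κ.gau) (fibM_prod_eq κ.cre κ.gau) L (c := c)
      (h := fun p y => Function.uncurry f (shiftComp p y)) (m := partM S s q) hcm (by
        refine lt_of_eq_of_lt (lintegral_congr fun y => ?_) h1
        exact congrArg (· ^ (1 / 2 : ℝ)) (tsum_congr fun k =>
          congrArg (fun w : Table S × Triple S → H => ‖w y‖ₑ ^ 2) (hc k)))
      (h2.mono fun y hy => (ae_sum_dirac_iff (fibM_prod_eq κ.cre κ.gau)).2 hy)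
    refine ⟨α, α1, α2.trans ((ae_sum_dirac_iff (fibM_prod_eq κ.cre κ.gau)).2 fun j => ?_)⟩
    refine Eq.trans ?_ (h4 j).symm
    exact (multFun_union s hf _ h3.1 h3.2.1).symm

/-! ### The recurrence -/

theorem eq_zero_of_mem_graph_singleInt {D : ∀ (i : Pos) (x : X), Op S H (Table.elem S i x)}
    {a c : L0 S H (Chain.empty S.time) (Chain.empty S.time)}
    (h : (a, c) ∈ (singleInt 0 D).graph) : c = 0 := by
  obtain ⟨f, hf, -, h2⟩ := mem_graph_singleInt.1 h
  have hb : S.before 0 = ∅ := eq_empty_of_forall_notMem fun x hx => (S.time_nonneg x).not_gt hx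
  refine AEEqFun.ext (Filter.EventuallyEq.trans ?_ AEEqFun.coeFn_zero.symm)
  filter_upwards [h2] with q hq
  rw [hq.2.2, hb, Measure.restrict_empty, integral_zero_measure, integral_zero_measure, add_zero,
    add_zero]
  exact Finset.sum_eq_zero fun j _ => if_neg (S.time_nonneg _).not_gt

/-- Times are nonnegative, so `X^0` is empty and the single integral in the differential at time
zero vanishes; only the term with `B(∅)` is left. -/
theorem Good.mem_graph_qsInt_zero (hG : Good 0 (Table.empty S) B η E) (hA : Admissible η ξp ξm)
    {a b : L0 S H (Chain.empty S.time) (Chain.empty S.time)} (ha : InG ξp a)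
    (hb : (a, b) ∈ (B (Table.empty S)).graph) : (a, b) ∈ (qsInt 0 B).graph := by
  obtain ⟨f, b', u, hf, hr, hu, hb', hi, h⟩ := hG.exists_differential hA ha
  have h1 := eq_zero_of_mem_graph_singleInt (h _ fun i => represents_multInt_elem a.stronglyMeasurable hf hr hi i)
  have h2 : b = b' := LinearPMap.mem_graph_snd_inj (B (Table.empty S)) hb hb' rfl
  rw [h2, ← sub_eq_zero.1 h1]
  exact hu

/-- The decomposition by the latest point is applied with `D = L ⊙ U`, which reproduces the inner
integrals by `Good.represents_odot`. The initial term `B(∅)` agrees with the multiple integral at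
time zero. The agreement with `T⁰ ⊗ 1̂`, assumed for the parameter `η⁺`, covers `ξ⁺` because `η⁺ ≤
ξ⁺`. -/
theorem QSIntegrableUpTo.recurrence (hB : QSIntegrableUpTo t η B) (hA : Admissible η ξp ξm)
    (ht : 0 ≤ t) {T0 : H →L[ℂ] H}
    {L : ∀ (i : Pos) (x : X), Fib S H (Table.elem S i x).ann (Table.elem S i x).gau →L[ℂ]
      Fib S H (Table.elem S i x).cre (Table.elem S i x).gau}
    (hR : Recurrence t η.upPlus B T0 L) :
    AgreeOn ξp (qsInt 0 B) (ampliation T0) ∧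
      AgreeOn ξp (qsInt t B) (qsInt 0 B + singleInt t fun i x =>
        odot (Table.elem S i x) (Table.empty S) (Table.elem S i x) (L i x) (qsInt (S.time x) B)) := by
  obtain ⟨E, hG, -, hs⟩ := hB.exists_good_elem
  refine ⟨fun a ha => ?_, fun a ha => ?_⟩
  · obtain ⟨b, hb, hb2⟩ := hR.1 a (ha.mono hA.upPlus_le)
    exact ⟨b, (hs 0 ht).mem_graph_qsInt_zero hA ha hb, hb2⟩
  · obtain ⟨f, b, u, hf, hr, hu, hb, hi, h⟩ := hG.exists_differential hA ha
    refine ⟨u, hu, ?_⟩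
    have h0 := (hs 0 ht).mem_graph_qsInt_zero hA ha hb
    have hD : ∀ i, ∀ᵐ x ∂(S.μ.restrict (S.before t)), Represents
        (odot (Table.elem S i x) (Table.empty S) (Table.elem S i x) (L i x) (qsInt (S.time x) B))
          (deriv (Table.empty S) a) (pointFun i f x) := by
      intro i
      have hfin := ae_adaptedSq_deriv_lt_top (t := t) (η := η) a.stronglyMeasurable
        ((adaptedSq_le S hA.up a.stronglyMeasurable.enorm).trans_lt (gnorm_lt_top_iff.1 ha)) i
      have hrep := represents_elem_union hr i
      have hdd := deriv_deriv (S := S) (t := t) a i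
      filter_upwards [hfin, hrep, hdd, hR.2 i, ae_restrict_mem (measurableSet_before S t)]
        with x h1 h2 h3 h4 h5
      have hfx : StronglyMeasurable (Function.uncurry fun ϑ => f ((Table.elem S i x).union ϑ)) :=
        hf.comp_measurable (g := fun y => shiftPt S i x y) (by fun_prop)
      rw [show pointFun i f x = multFun (S.time x) fun ϑ => f ((Table.elem S i x).union ϑ) from
        funext fun q => pointFun_eq i hf x q]
      refine (hs (S.time x) (le_of_lt h5)).represents_odot hA h4
        (stronglyMeasurable_deriv a.stronglyMeasurable) h1 hfx ?_
      filter_upwards [h2, h3] with ϑ g1 g3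
      exact g1.congr g3.symm Filter.EventuallyEq.rfl
    have h1 := mem_graph_add h0 (h _ hD)
    rwa [add_sub_cancel] at h1

end

end QS

end

theorem theorem1 {X : Type*} [MeasurableSpace X] [MeasurableSingletonClass X]
    (S : QS.NoiseSpace X)
    {H : Type*} [NormedAddCommGroup H] [InnerProductSpace ℂ H] [CompleteSpace H]
    (B : QS.OpFun S H) (t : ℝ) (ht : 0 ≤ t) (η : QS.Weights) (hB : QS.QSIntegrableUpTo t η B)
    (ξp ξm : ℝ) (hξp : 0 < ξp) (hξm : 0 < ξm)
    (hp : η.upMinus + η.upZero + η.upPlus ≤ ξp)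
    (hm : η.loMinus⁻¹ + η.loZero⁻¹ + η.loPlus⁻¹ ≤ ξm⁻¹) :
    -- the multiple integral acts on `G(ξ⁺)` and is continuous
    (∀ a, QS.InG ξp a → ∃ u, (a, u) ∈ (QS.qsInt t B).graph ∧
      QS.ActsAs t (QS.Table.empty S) B a u) ∧
    QS.opNorm ξp ξm (QS.qsInt t B) ≤ QS.qsNorm t η B ∧
    -- the formally conjugated operator
    QS.AgreeOn (1 / ξm) (QS.formalAdjoint (QS.qsInt t B)) (QS.qsInt t B.adj) ∧
    (∀ p ∈ (QS.qsInt t B).graph, ∀ q ∈ (QS.qsInt t B.adj).graph,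
      QS.InG ξp p.1 → QS.InG (1 / ξm) q.1 →
        QS.Paired q.1 p.2 ∧ QS.Paired q.2 p.1 ∧ QS.pairing q.1 p.2 = QS.pairing q.2 p.1) ∧
    QS.opNorm (1 / ξm) (1 / ξp) (QS.qsInt t B.adj) = QS.opNorm ξp ξm (QS.qsInt t B) ∧
    -- the QS differential, with QS integrable derivatives
    QS.AgreeOn ξp (QS.qsInt t B)
      (B (QS.Table.empty S) +
        QS.singleInt t fun i x => QS.multInt (S.time x) (QS.Table.elem S i x) B) ∧
    QS.SingleIntegrable t ξp ξm
      (fun i x => QS.multInt (S.time x) (QS.Table.elem S i x) B) ∧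
    -- the QS equation
    ∀ (T0 : H →L[ℂ] H)
      (L : ∀ (i : QS.Pos) (x : X),
        QS.Fib S H (QS.Table.elem S i x).ann (QS.Table.elem S i x).gau →L[ℂ]
          QS.Fib S H (QS.Table.elem S i x).cre (QS.Table.elem S i x).gau),
      QS.Recurrence t η.upPlus B T0 L →
        QS.AgreeOn ξp (QS.qsInt 0 B) (QS.ampliation T0) ∧
        QS.AgreeOn ξp (QS.qsInt t B)
          (QS.qsInt 0 B + QS.singleInt t fun i x =>
            QS.odot (QS.Table.elem S i x) (QS.Table.empty S) (QS.Table.elem S i x) (L i x)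
              (QS.qsInt (S.time x) B)) := by
  have hA : QS.Admissible η ξp ξm := ⟨hξm, hp, hm⟩
  obtain ⟨E, hG, -⟩ := hB.exists_good
  exact ⟨fun a ha => hB.exists_qsInt hA ha, hB.opNorm_qsInt_le hA, hB.agreeOn_adj hA,
    hB.pairing_qsInt hA, hB.opNorm_adj hA, hG.differential hA, hB.singleIntegrable hA,
    fun _ _ hR => hB.recurrence hA ht hR⟩
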